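/- **Setting.** Let $d\ge 1$, $s>0$, $L>0$, $\sigma>0$, $b\ge a>0$. For real $t>0$, the norm of $H^t(\mathbb R^d)$ is $\|g\|_{H^t(\mathbb R^d)}^2=\int(1+|\xi|^2)^t|\mathcal F g(\xi)|^2d\xi$, with the unitary Fourier transform $\mathcal Fg(\xi)=(2\pi)^{-d/2}\int g(x)e^{-i\langle x,\xi\rangle}dx$; $H^t([0,1]^d)$ is the space of restrictions to $[0,1]^d$, with the quotient norm $\|f\|_{H^t([0,1]^d)}=\inf\{\|g\|_{H^t(\mathbb R^d)}: g=f \text{ a.e. on }[0,1]^d\}$, and $\mathcal H^s(L)=\{f:\|f\|_{H^s([0,1]^d)}\le L\}$ (real functions). Let $f_X$ be a probability density on $[0,1]^d$ with $a\le f_X\le b$, and let $\nu$ be a centred $\sigma$-sub-Gaussian law on $\mathbb R$, i.e. $\int e^{\lambda t}\,d\nu(t)\le e^{\lambda^2\sigma^2/2}$ for all $\lambda\in\mathbb R$. One observes $\mathcal D_n=(X_i,Y_i)_{i\le n}$, $Y_i=f^*(X_i)+\xi_i$, where $X_i\sim f_X$ and $\xi_i\sim\nu$ are all independent. An estimator is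 a (jointly measurable) real function $\hat f(\mathcal D_n)(x)$ of the data and the point. Its adversarial risk with perturbation radius $r$ is $$R_A(\hat f,f^*)=\mathbb E_{\mathcal D_n,X}\Big[\sup_{x'\in[0,1]^d,\ |x'-X|\le r}|\hat f(\mathcal D_n)(x')-f^*(X)|^2\Big],$$ where $X\sim f_X$ is independent of $\mathcal D_n$. Put $\rho_{n,r}=r^{2\min(1,s)}+n^{-2s/(2s+d)}$. **Theorem.** (i) There are constants $c,C>0$ depending only on $d,s,L,\sigma,a,b$ such that for every such $f_X$, every $n\ge 1$ and every $r\in[0,1]$, $$c\,\rho_{n,r}\ \le\ \inf_{\hat f}\ \sup_{\nu}\ \sup_{f^*\in\mathcal H^s(L)}R_A(\hat f,f^*)\ \le\ C\,\rho_{n,r},$$ where $\nu$ ranges over the centred $\sigma$-sub-Gaussian laws. The lower bound $c\,\rho_{n,r}\le\inf_{\hat f}\sup_{f^*}R_A(\hat f,f^*)$ holds already when $\nu$ is fixed to be $N(0,\sigma^2)$. (ii) The upper bound is attained by projected and truncated kernel ridge regression. Let $t=s$ if $s>d/2$ and $t=d$ if $s\le d/2$, let $$\tilde f\in\operatorname*{arg\,min}_{g\in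 H^t([0,1]^d)}\ \frac1n\sum_{i=1}^n(Y_i-g(X_i))^2+\lambda\|g\|_{H^t([0,1]^d)}^2$$ (with $g$ evaluated through its continuous version), and let $\bar f$ be the $L^2([0,1]^d)$-projection of $\tilde f$ onto $\mathcal H^s(L)$. If $s>d/2$, let $\hat f$ be the continuous version of $\bar f$. If $s\le d/2$, let $\hat f$ be the restriction to $[0,1]^d$ of $\mathcal F^{-1}(\mathcal F(G)\,\chi(r\,\cdot))$, where $G\in H^s(\mathbb R^d)$ is a real extension of $\bar f$ with $\|G\|_{H^s(\mathbb R^d)}\le A\|\bar f\|_{H^s([0,1]^d)}$ (taking the continuous version if $r>0$), and $\chi(\xi)=1-\theta\big((4|\xi|^2-1)/3\big)$, $\theta(u)=e(u)/(e(u)+e(1-u))$, $e(u)=e^{-1/u}$ for $u>0$ and $e(u)=0$ for $u\le0$. Then for all $0<\kappa_1\le\kappa_2$ and $A\ge 1$ there is $C>0$, depending only on $d,s,L,\sigma,a,b,\kappa_1,\kappa_2,A$, such that for all $n\ge1$, $r\in[0,1]$ and $\kappa_1n^{-2t/(2s+d)}\le\lambda\le\kappa_2n^{-2t/(2s+d)}$,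 estimators of this form (jointly measurable) exist, and every one of them satisfies $$\sup_\nu\ \sup_{f^*\in\mathcal H^s(L)}R_A(\hat f,f^*)\le C\,\rho_{n,r}$$ for every such $f_X$. -/

import Mathlib

open MeasureTheory ProbabilityTheory Set
open scoped ENNReal NNReal FourierTransform

noncomputable section

namespace AdvReg

/-- The space `ℝ^d` with its Euclidean norm. -/
abbrev E (d : ℕ) : Type := EuclideanSpace ℝ (Fin d)

/-- The cube `[0,1]^d`. -/
def cube (d : ℕ) : Set (E d) := {x | ∀ i, x i ∈ Icc (0 : ℝ) 1}

/-! ### Sobolev spaces -/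

/-- The norm of `H^s(ℝ^d)`, with value `∞` on the functions in `L²(ℝ^d)` outside `H^s(ℝ^d)`:
`‖G‖² = ∫ (1 + |ξ|²)^s |Ĝ(ξ)|² dξ`, where `Ĝ(ξ) = (2π)^{-d/2} ∫ G(x) e^{-i⟨x,ξ⟩} dx`.
Mathlib's unitary Fourier transform `𝓕` on `L²` has the kernel `e^{-2πi⟨x,η⟩}`, so that
`Ĝ(2πη) = (2π)^{-d/2} 𝓕 G η`; the integral is written in the variable `η = ξ / (2π)`. -/
def sobolevNorm {d : ℕ} (s : ℝ) (G : Lp ℂ 2 (volume : Measure (E d))) : ℝ≥0∞ :=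
  (∫⁻ η : E d, ENNReal.ofReal ((1 + (2 * Real.pi * ‖η‖) ^ 2) ^ s) *
    ‖(𝓕 G : Lp ℂ 2 (volume : Measure (E d))) η‖ₑ ^ 2) ^ (1 / 2 : ℝ)

/-- `G ∈ L²(ℝ^d)` extends the real function `f` given on the cube (almost everywhere). -/
def Extends {d : ℕ} (G : Lp ℂ 2 (volume : Measure (E d))) (f : E d → ℝ) : Prop :=
  ∀ᵐ x ∂(volume.restrict (cube d)), G x = (f x : ℂ)

/-- The quotient norm of `H^s([0,1]^d)`: the infimum of the norms of the extensions of `f` to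
`ℝ^d`. It is `∞` when `f` is not the restriction of an element of `H^s(ℝ^d)`.
Only the values of `f` on the cube, up to null sets, matter. -/
def cubeNorm {d : ℕ} (s : ℝ) (f : E d → ℝ) : ℝ≥0∞ :=
  ⨅ (G : Lp ℂ 2 (volume : Measure (E d))) (_ : Extends G f), sobolevNorm s G

/-- The Sobolev ball of radius `L` in `H^s([0,1]^d)`. -/
def sobolevBall (d : ℕ) (s L : ℝ) : Set (E d → ℝ) :=
  {f | cubeNorm s f ≤ ENNReal.ofReal L}

/-! ### The regression model and the adversarial risk -/

/-- `p` is a probability density on the cube with `a ≤ p ≤ b` there. -/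
structure IsCovariateDensity {d : ℕ} (a b : ℝ) (p : E d → ℝ) : Prop where
  measurable : Measurable p
  lower : ∀ x ∈ cube d, a ≤ p x
  upper : ∀ x ∈ cube d, p x ≤ b
  total : ∫⁻ x in cube d, ENNReal.ofReal (p x) = 1

/-- The law on the cube with density `p`. -/
def covariateLaw {d : ℕ} (p : E d → ℝ) : Measure (E d) :=
  (volume.restrict (cube d)).withDensity (fun x => ENNReal.ofReal (p x))

/-- The centred `σ`-sub-Gaussian laws on `ℝ`. -/
def subGaussianLaws (σ : ℝ≥0) : Set (Measure ℝ) :=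
  {ν | IsProbabilityMeasure ν ∧ ∫ t, t ∂ν = 0 ∧ HasSubgaussianMGF (fun t : ℝ => t) (σ ^ 2) ν}

/-- A data set: `n` pairs `(X_i, Y_i)`. -/
abbrev Data (d n : ℕ) : Type := Fin n → E d × ℝ

/-- The data set produced by the regression function `f` from the covariates and noise terms
`ω i = (X_i, ξ_i)`, that is, `Y_i = f (X_i) + ξ_i`. -/
def dataOf {d n : ℕ} (f : E d → ℝ) (ω : Fin n → E d × ℝ) : Data d n :=
  fun i => ((ω i).1, f (ω i).1 + (ω i).2)

/-- The adversarial risk of the estimator `fhat` at the regression function `f`: the expectation,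
over independent pairs `(X_i, ξ_i)` with law `covariateLaw p ⊗ ν` and an independent test point `X`
with law `covariateLaw p`, of the supremum of `|fhat(x') - f(X)|²` over the points `x'` of the cube
at distance at most `r` from `X`. -/
def advRisk {d n : ℕ} (p : E d → ℝ) (ν : Measure ℝ) (r : ℝ)
    (fhat : Data d n → E d → ℝ) (f : E d → ℝ) : ℝ≥0∞ :=
  ∫⁻ z : (Fin n → E d × ℝ) × E d,
    ⨆ x' ∈ cube d ∩ Metric.closedBall z.2 r,
      ENNReal.ofReal (|fhat (dataOf f z.1) x' - f z.2| ^ 2)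
    ∂((Measure.pi fun _ : Fin n => (covariateLaw p).prod ν).prod (covariateLaw p))

/-- The worst adversarial risk of an estimator over the Sobolev ball and a class of noise laws. -/
def worstRisk {d n : ℕ} (s L : ℝ) (p : E d → ℝ) (noise : Set (Measure ℝ)) (r : ℝ)
    (fhat : Data d n → E d → ℝ) : ℝ≥0∞ :=
  ⨆ ν ∈ noise, ⨆ f ∈ sobolevBall d s L, advRisk p ν r fhat f

/-- The minimax adversarial risk with `n` observations: the infimum of the worst risk over all
estimators. An estimator is a real function of the data and of the point at which it is evaluated,
jointly measurable in both. -/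
def minimaxRisk {d : ℕ} (n : ℕ) (s L : ℝ) (p : E d → ℝ) (noise : Set (Measure ℝ)) (r : ℝ) : ℝ≥0∞ :=
  ⨅ (fhat : Data d n → E d → ℝ) (_ : Measurable (Function.uncurry fhat)),
    worstRisk s L p noise r fhat

/-- The rate `r^{2 min(1,s)} + n^{-2s/(2s+d)}`. -/
def rate (d n : ℕ) (s r : ℝ) : ℝ :=
  r ^ (2 * min 1 s) + (n : ℝ) ^ (-(2 * s / (2 * s + d)))

/-! ### Projected and truncated kernel ridge regression -/

/-- The regularized empirical risk `(1/n) ∑ (Y_i - g(X_i))² + lam ‖g‖²_{H^t([0,1]^d)}`. -/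
def ridgeObjective {d n : ℕ} (t lam : ℝ) (D : Data d n) (g : E d → ℝ) : ℝ≥0∞ :=
  ENNReal.ofReal ((1 / n : ℝ) * ∑ i, ((D i).2 - g (D i).1) ^ 2) +
    ENNReal.ofReal lam * cubeNorm t g ^ 2

/-- `g` is a continuous function on the cube that belongs to `H^t([0,1]^d)`. For `t > d/2` every
element of `H^t([0,1]^d)` has exactly one such representative, through which it is evaluated. -/
def ContinuousSobolev {d : ℕ} (t : ℝ) (g : E d → ℝ) : Prop :=
  ContinuousOn g (cube d) ∧ cubeNorm t g < ∞

/-- `g` is the kernel ridge regression estimator in `H^t([0,1]^d)` for the data `D`. -/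
def IsRidge {d n : ℕ} (t lam : ℝ) (D : Data d n) (g : E d → ℝ) : Prop :=
  ContinuousSobolev t g ∧
    ∀ h : E d → ℝ, ContinuousSobolev t h → ridgeObjective t lam D g ≤ ridgeObjective t lam D h

/-- `h` is the `L²([0,1]^d)`-projection of `g` onto the Sobolev ball. -/
def IsBallProjection {d : ℕ} (s L : ℝ) (g h : E d → ℝ) : Prop :=
  h ∈ sobolevBall d s L ∧ ∀ u ∈ sobolevBall d s L,
    eLpNorm (h - g) 2 (volume.restrict (cube d)) ≤ eLpNorm (u - g) 2 (volume.restrict (cube d))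

/-- The radial cut-off `χ` as a function of `ρ = |ξ|`; it is `1` for `ρ ≤ 1/2` and `0` for `ρ ≥ 1`.
Here `Real.smoothTransition t = e(t) / (e(t) + e(1 - t))` with `e(t) = exp(-1/t)` for `t > 0` and
`e(t) = 0` for `t ≤ 0`. -/
def cutoff (ρ : ℝ) : ℝ := 1 - Real.smoothTransition ((4 * ρ ^ 2 - 1) / 3)

/-- `u` is, on the cube, the frequency truncation `F⁻¹(F(G) χ(r ·))` of an extension `G` of `h` to a
real element of `H^s(ℝ^d)` whose norm is at most `A ‖h‖_{H^s([0,1]^d)}`. In the variable `η` of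
`𝓕` the multiplier is `χ(2πrη)`. When `r > 0` the truncated function is smooth, and `u` is its
continuous version. -/
def IsTruncation {d : ℕ} (s r A : ℝ) (h u : E d → ℝ) : Prop :=
  ∃ G U : Lp ℂ 2 (volume : Measure (E d)),
    Extends G h ∧ (∀ᵐ x, (G x).im = 0) ∧ sobolevNorm s G ≤ ENNReal.ofReal A * cubeNorm s h ∧
    (∀ᵐ η : E d, (𝓕 U : Lp ℂ 2 (volume : Measure (E d))) η =
      (cutoff (r * (2 * Real.pi * ‖η‖)) : ℂ) * (𝓕 G : Lp ℂ 2 (volume : Measure (E d))) η) ∧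
    Extends U u ∧ (0 < r → ContinuousOn u (cube d))

/-- The smoothness of the ridge penalty: `s` if `s > d/2`, and `d` if `s ≤ d/2`. -/
def penaltyOrder (d : ℕ) (s : ℝ) : ℝ := if (d : ℝ) / 2 < s then s else d

/-- `fhat` is a projected and truncated kernel ridge regression estimator, with regularization
parameter `lam` and extensions bounded by the factor `A`: for all data with covariates in the cube,
the ridge estimator is projected onto the Sobolev ball; when `s > d/2` the continuous version of
the projection is taken, and when `s ≤ d/2` the projection is truncated in frequency. -/
def IsPTKRR {d n : ℕ} (s L r lam A : ℝ) (fhat : Data d n → E d → ℝ) : Prop :=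
  ∀ D : Data d n, (∀ i, (D i).1 ∈ cube d) →
    ∃ ftilde : E d → ℝ, IsRidge (penaltyOrder d s) lam D ftilde ∧
      (((d : ℝ) / 2 < s ∧ IsBallProjection s L ftilde (fhat D) ∧ ContinuousOn (fhat D) (cube d)) ∨
        (s ≤ (d : ℝ) / 2 ∧ ∃ fbar : E d → ℝ,
          IsBallProjection s L ftilde fbar ∧ IsTruncation s r A fbar (fhat D)))

end AdvReg

end

/-! Put N = n^{1/(2s+d)}, so that n = N^{2s+d} and the rate is r^{2 min(1,s)} + N^{-2s}. The first
term is the price of the perturbation, the second that of estimation. Both bounds treat the two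
effects separately.

Upper bound, perturbation. The adversarial error at x is controlled by the squared oscillation of
the estimator over the r-ball around x plus its squared error at x. For s > d/2 the estimator lies
in the Sobolev ball; for s ≤ d/2 it is band-limited at a frequency of order 1/r with bounded
H^s-norm. In both cases its oscillation over r-balls is of order r^{min(1,s)} in L², with the
supremum taken inside the integral (`exists_local_approx`, `exists_low_approx`). Low frequencies are
expanded in a Taylor series. High frequencies are split into dyadic bands: on balls of radius h a
band at frequency R costs a factor (hR)^d in the maximal inequality `exists_sup_bound`, and the
bands are summable exactly because the smoothness exceeds d/2. The truncation itself moves the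
function by order r^s. All this is collected in `exists_adversarial_bound`.

Upper bound, estimation. Sobolev spaces on the cube are images of L²(ℝ^d); for t > d/2 point
evaluations are inner products, and ridge regression is regularized least squares in a Hilbert
space. Its variance is governed by the leverage, the largest ratio of g(X_i)² to λ‖g‖² + (1/n) ∑
g(X_j)². Cut the cube into M^d cells with M of order N. If every subcell holds its share of the
sample, local polynomial approximation and norm equivalence for polynomials
(`exists_sampling_bound`) bound the squared L²-norm of g, and its squared supremum up to a factor
M^d, by the same quadratic form, since M^{-2t} ≲ λ. Hence the leverage is of order N^d and the
variance of order N^d / n = N^{-2s}. For the bias, f is only in H^s and is compared with its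
low-frequency part f₀ in H^t: the penalty costs N^{-2t} N^{2(t-s)} = N^{-2s}, and f - f₀ enters
through an empirical mean square whose expectation is of order N^{-2s}. The only concentration
needed is a Chernoff bound for the occupation numbers; on the exceptional event the projection onto
the ball keeps the error bounded.

Lower bound, perturbation. The value of the estimator at x + v has to serve for both f(x) and f(x +
v), so the risk dominates ∫ (f(x) - f(x + v))² (`lintegral_shift_le_advRisk`). A single wave is
used, of frequency 1 if s ≥ 1 and of order 1/r if s ≤ 1.

Lower bound, estimation. Assouad's lemma is applied to about N^d cosine waves with integer
frequencies, multiplied by a window whose Fourier transform is the indicator of a small ball. The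
transforms of different waves have disjoint supports, so squared Sobolev norms add up; the window is
bounded below on the cube, and after division by it the waves are orthogonal there, so that Bessel's
inequality turns L²-error into error of the coefficients. -/

noncomputable section

namespace AdvReg

/-! ### The Fourier transform on `L²` -/

theorem continuous_neg_innerl (d : ℕ) :
    Continuous fun p : E d × E d => (-innerₗ (E d)) p.1 p.2 := by
  have : (fun p : E d × E d => (-innerₗ (E d)) p.1 p.2) = fun p => -(inner ℝ p.1 p.2) := by
    ext p; simp
  rw [this]
  exact (continuous_fst.inner continuous_snd).neg

open scoped SchwartzMap in
/-- On `L¹ ∩ L²` the inverse Fourier transform of `L²` is given by the Fourier integral. -/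
theorem fourierInv_coeFn_ae {d : ℕ} (γ : Lp ℂ 2 (volume : Measure (E d)))
    (hγ : Integrable (γ : E d → ℂ)) :
    ((𝓕⁻ γ : Lp ℂ 2 (volume : Measure (E d))) : E d → ℂ) =ᵐ[volume] 𝓕⁻ (γ : E d → ℂ) := by
  have hcont : Continuous (𝓕⁻ (γ : E d → ℂ)) :=
    VectorFourier.fourierIntegral_continuous Real.continuous_fourierChar
      (L := -innerₗ (E d)) (continuous_neg_innerl d) hγ
  -- It suffices to pair both sides with test functions. The transform on L² agrees with that of
  -- tempered distributions, which moves it onto the test function; the Fubini identity for Fourier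
  -- integrals then moves it back onto `γ`, now as an integral.
  apply ae_eq_of_integral_contDiff_smul_eq
  · exact (Lp.memLp _).locallyIntegrable one_le_two
  · exact hcont.locallyIntegrable
  · intro g g_smooth g_cpt
    have hg₁ : HasCompactSupport (Complex.ofRealCLM ∘ g) := g_cpt.comp_left rfl
    have hg₂ : ContDiff ℝ (⊤ : ℕ∞) (Complex.ofRealCLM ∘ g) := by fun_prop
    set S : 𝓢(E d, ℂ) := hg₁.toSchwartzMap hg₂ with hS
    have hSx : ∀ x, S x = (g x : ℂ) := fun x => by simp [hS]
    have h1 : ∫ x, g x • (𝓕⁻ γ : Lp ℂ 2 (volume : Measure (E d))) x =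
        Lp.toTemperedDistribution (𝓕⁻ γ) S := by
      rw [Lp.toTemperedDistribution_apply]
      simp [hSx]
    have h2 : Lp.toTemperedDistribution (𝓕⁻ γ) S = ∫ η, (𝓕⁻ S) η • γ η := by
      rw [← Lp.fourierInv_toTemperedDistribution_eq, TemperedDistribution.fourierInv_apply,
        Lp.toTemperedDistribution_apply]
    rw [h1, h2]
    have h3 := VectorFourier.integral_fourierIntegral_smul_eq_flip (μ := volume) (ν := volume)
      (L := -innerₗ (E d)) (f := (S : E d → ℂ)) (g := (γ : E d → ℂ))
      Real.continuous_fourierChar (continuous_neg_innerl d) S.integrable hγ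
    have h4 : ∀ η, (𝓕⁻ S) η =
        VectorFourier.fourierIntegral 𝐞 volume (-innerₗ (E d)) (S : E d → ℂ) η := by
      intro η
      rw [SchwartzMap.fourierInv_coe]
      rfl
    simp_rw [h4]
    rw [h3]
    apply integral_congr_ae
    filter_upwards with x
    rw [hSx, Complex.coe_smul]
    congr 1
    change VectorFourier.fourierIntegral 𝐞 volume _ _ _ =
      VectorFourier.fourierIntegral 𝐞 volume _ _ _
    congr 1
    ext a b
    simp [real_inner_comm]

theorem continuous_fourierInv {d : ℕ} {γ : E d → ℂ} (hγ : Integrable γ) : Continuous (𝓕⁻ γ) :=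
  VectorFourier.fourierIntegral_continuous Real.continuous_fourierChar
      (L := -innerₗ (E d)) (continuous_neg_innerl d) hγ

theorem fourierInv_congr {d : ℕ} {γ δ : E d → ℂ} (h : γ =ᵐ[volume] δ) : 𝓕⁻ γ = 𝓕⁻ δ := by
  funext x
  rw [Real.fourierInv_eq, Real.fourierInv_eq]
  exact integral_congr_ae (by filter_upwards [h] with η hη; rw [hη])

theorem enorm_sq_Lp {α : Type*} {mα : MeasurableSpace α} {μ : Measure α} {F : Type*}
    [NormedAddCommGroup F] (f : Lp F 2 μ) : ‖f‖ₑ ^ 2 = ∫⁻ x, ‖f x‖ₑ ^ 2 ∂μ := by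
  rw [Lp.enorm_def, eLpNorm_eq_lintegral_rpow_enorm_toReal (by norm_num) (by norm_num)]
  simp only [ENNReal.toReal_ofNat, one_div, ENNReal.rpow_ofNat]
  rw [← ENNReal.rpow_natCast, ← ENNReal.rpow_mul]
  norm_num

/-- Plancherel's theorem for functions in `L¹ ∩ L²`. -/
theorem lintegral_enorm_fourierInv_sq {d : ℕ} {γ : E d → ℂ} (h1 : Integrable γ)
    (h2 : MemLp γ 2) : ∫⁻ x, ‖𝓕⁻ γ x‖ₑ ^ 2 = ∫⁻ η, ‖γ η‖ₑ ^ 2 := by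
  have hc := h2.coeFn_toLp
  have h1' : Integrable (h2.toLp γ : E d → ℂ) := h1.congr hc.symm
  have hae := fourierInv_coeFn_ae (h2.toLp γ) h1'
  rw [fourierInv_congr hc] at hae
  have : ‖(𝓕⁻ (h2.toLp γ) : Lp ℂ 2 (volume : Measure (E d)))‖ₑ = ‖h2.toLp γ‖ₑ := by
    have := Lp.norm_fourier_eq (𝓕⁻ (h2.toLp γ) : Lp ℂ 2 (volume : Measure (E d)))
    rw [FourierTransform.fourier_fourierInv_eq] at this
    rw [← ofReal_norm, ← ofReal_norm, this]
  calc ∫⁻ x, ‖𝓕⁻ γ x‖ₑ ^ 2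
      = ∫⁻ x, ‖(𝓕⁻ (h2.toLp γ) : Lp ℂ 2 (volume : Measure (E d))) x‖ₑ ^ 2 := by
        apply lintegral_congr_ae
        filter_upwards [hae] with x hx
        rw [hx]
    _ = ‖h2.toLp γ‖ₑ ^ 2 := by rw [← enorm_sq_Lp, this]
    _ = _ := by
        rw [enorm_sq_Lp]
        apply lintegral_congr_ae
        filter_upwards [hc] with x hx
        rw [hx]

/-! ### Real parts -/

/-- The map `φ ↦ conj φ(-·)` on `L²`. -/
def conjReflect {d : ℕ} (φ : Lp ℂ 2 (volume : Measure (E d))) : Lp ℂ 2 (volume : Measure (E d)) :=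
  star (Lp.compMeasurePreserving (fun x : E d => -x)
    (Measure.measurePreserving_neg (volume : Measure (E d))) φ)

theorem conjReflect_coeFn {d : ℕ} (φ : Lp ℂ 2 (volume : Measure (E d))) :
    conjReflect φ =ᵐ[volume] fun x => star (φ (-x)) := by
  unfold conjReflect
  filter_upwards [Lp.coeFn_star (Lp.compMeasurePreserving (fun x : E d => -x)
    (Measure.measurePreserving_neg (volume : Measure (E d))) φ), Lp.coeFn_compMeasurePreserving φ
    (Measure.measurePreserving_neg (volume : Measure (E d)))] with x h1 h2
  rw [h1, Pi.star_apply, h2]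
  rfl

theorem continuous_star_Lp {d : ℕ} :
    Continuous (star : Lp ℂ 2 (volume : Measure (E d)) → Lp ℂ 2 (volume : Measure (E d))) := by
  refine LipschitzWith.continuous (K := 1) (LipschitzWith.mk_one fun f g => le_of_eq ?_)
  rw [dist_eq_norm, dist_eq_norm, Lp.norm_def, Lp.norm_def]
  congr 1
  apply eLpNorm_congr_norm_ae
  filter_upwards [Lp.coeFn_sub (star f) (star g), Lp.coeFn_star f, Lp.coeFn_star g,
    Lp.coeFn_sub f g] with x h1 h2 h3 h4
  rw [h1, Pi.sub_apply, h2, h3, h4, Pi.star_apply, Pi.star_apply, Pi.sub_apply, ← star_sub,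
    norm_star]

theorem continuous_conjReflect {d : ℕ} : Continuous (conjReflect (d := d)) := by
  unfold conjReflect
  exact continuous_star_Lp.comp
    (Lp.compMeasurePreservingₗᵢ ℂ _ (Measure.measurePreserving_neg (volume : Measure (E d)))).continuous

theorem star_fourierInv {d : ℕ} (γ : E d → ℂ) (x : E d) :
    star (𝓕⁻ γ x) = 𝓕⁻ (fun η => star (γ (-η))) x := by
  rw [Real.fourierInv_eq', Real.fourierInv_eq', ← integral_neg_eq_self]
  change (starRingEnd ℂ) _ = _
  rw [← integral_conj]
  congr 1
  ext η
  simp [← Complex.exp_conj, Complex.conj_ofNat]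

-- On Schwartz functions this is conjugation under the integral sign, and both sides are continuous
-- on L². It makes real-valuedness of a function equivalent to Hermitian symmetry of its transform.
open scoped SchwartzMap in
theorem star_fourierInv_Lp {d : ℕ} (φ : Lp ℂ 2 (volume : Measure (E d))) :
    star (𝓕⁻ φ : Lp ℂ 2 (volume : Measure (E d))) = 𝓕⁻ (conjReflect φ) := by
  apply DenseRange.induction_on (p := fun φ : Lp ℂ 2 (volume : Measure (E d)) =>
    star (𝓕⁻ φ : Lp ℂ 2 (volume : Measure (E d))) = 𝓕⁻ (conjReflect φ))
    (SchwartzMap.denseRange_toLpCLM (p := 2) ENNReal.ofNat_ne_top) φ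
  · apply isClosed_eq
    · exact continuous_star_Lp.comp (Lp.fourierTransformₗᵢ (E d) ℂ).symm.continuous
    · exact (Lp.fourierTransformₗᵢ (E d) ℂ).symm.continuous.comp continuous_conjReflect
  intro f
  have hf : Integrable (SchwartzMap.toLpCLM ℂ (E := E d) ℂ 2 volume f : E d → ℂ) :=
    f.integrable.congr (f.coeFn_toLp 2 volume).symm
  set F := SchwartzMap.toLpCLM ℂ (E := E d) ℂ 2 volume f
  have hF : Integrable (conjReflect F : E d → ℂ) := by
    refine Integrable.congr ?_ (conjReflect_coeFn F).symm
    have h := hf.comp_neg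
    exact (Complex.conjCLE.toContinuousLinearMap).integrable_comp h
  change star (𝓕⁻ F : Lp ℂ 2 (volume : Measure (E d))) = 𝓕⁻ (conjReflect F)
  apply Lp.ext
  filter_upwards [Lp.coeFn_star (𝓕⁻ F), fourierInv_coeFn_ae F hf, fourierInv_coeFn_ae _ hF]
    with x h1 h2 h3
  rw [h1, Pi.star_apply, h2, h3, star_fourierInv, fourierInv_congr (conjReflect_coeFn F)]

/-- Taking real parts does not increase Sobolev norms. -/
theorem exists_re_sobolevNorm_le {d : ℕ} (G : Lp ℂ 2 (volume : Measure (E d))) :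
    ∃ G' : Lp ℂ 2 (volume : Measure (E d)), (∀ᵐ x, G' x = ((G x).re : ℂ)) ∧
      ∀ s, sobolevNorm s G' ≤ sobolevNorm s G := by
  -- The real part is the average of G and its conjugate, whose transform is the reflected conjugate
  -- of that of G. The weight is even, so both have the same norm, and convexity of the square
  -- bounds the average.
  refine ⟨(2 : ℂ)⁻¹ • (G + star G), ?_, fun s => ?_⟩
  · filter_upwards [Lp.coeFn_smul (2 : ℂ)⁻¹ (G + star G), Lp.coeFn_add G (star G),
      Lp.coeFn_star G] with x h1 h2 h3
    rw [h1, Pi.smul_apply, h2, Pi.add_apply, h3, Pi.star_apply, smul_eq_mul]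
    change _ * (G x + (starRingEnd ℂ) (G x)) = _
    rw [Complex.add_conj]
    push_cast
    ring
  · set γ : Lp ℂ 2 (volume : Measure (E d)) := 𝓕 G with hγ
    have hG : G = 𝓕⁻ γ := by rw [hγ, FourierTransform.fourierInv_fourier_eq]
    have hstar : star G = 𝓕⁻ (conjReflect γ) := by
      conv_lhs => rw [hG]
      exact star_fourierInv_Lp γ
    have hF : (𝓕 ((2 : ℂ)⁻¹ • (G + star G)) : Lp ℂ 2 (volume : Measure (E d))) =
        (2 : ℂ)⁻¹ • (γ + conjReflect γ) := by
      rw [FourierTransform.fourier_smul, FourierTransform.fourier_add, hstar,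
        FourierTransform.fourier_fourierInv_eq]
    unfold sobolevNorm
    rw [hF, ← hγ]
    gcongr ?_ ^ (1 / 2 : ℝ)
    set W : E d → ℝ≥0∞ := fun η => ENNReal.ofReal ((1 + (2 * Real.pi * ‖η‖) ^ 2) ^ s)
    have hW : Measurable W := by fun_prop
    have hm : Measurable fun η => ‖γ η‖ₑ ^ 2 :=
      ((Lp.stronglyMeasurable γ).measurable.enorm.pow_const 2)
    have e1 : ∫⁻ η, W η * ‖γ (-η)‖ₑ ^ 2 = ∫⁻ η, W η * ‖γ η‖ₑ ^ 2 := by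
      rw [← (Measure.measurePreserving_neg (volume : Measure (E d))).lintegral_comp
        (f := fun η => W η * ‖γ η‖ₑ ^ 2) (by fun_prop)]
      simp [W]
    calc ∫⁻ η, W η * ‖((2 : ℂ)⁻¹ • (γ + conjReflect γ) : Lp ℂ 2 (volume : Measure (E d))) η‖ₑ ^ 2
        ≤ ∫⁻ η, 2⁻¹ * (W η * ‖γ η‖ₑ ^ 2 + W η * ‖γ (-η)‖ₑ ^ 2) := by
          apply lintegral_mono_ae
          filter_upwards [Lp.coeFn_smul (2 : ℂ)⁻¹ (γ + conjReflect γ),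
            Lp.coeFn_add γ (conjReflect γ), conjReflect_coeFn γ] with η h1 h2 h3
          rw [h1, Pi.smul_apply, h2, Pi.add_apply, h3, ← mul_add, mul_left_comm]
          gcongr
          set u := γ η
          set v := γ (-η)
          have hv : ‖v‖ₑ = ‖star v‖ₑ := by simp [← ofReal_norm]
          rw [hv]
          set v' := star v
          have : ‖(2 : ℂ)⁻¹ • (u + v')‖ ^ 2 ≤ 2⁻¹ * (‖u‖ ^ 2 + ‖v'‖ ^ 2) := by
            rw [norm_smul]
            have := norm_add_le u v'
            have h2 : ‖(2 : ℂ)⁻¹‖ = 2⁻¹ := by simp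
            rw [h2]
            nlinarith [norm_nonneg (u + v'), sq_nonneg (‖u‖ - ‖v'‖), norm_nonneg u, norm_nonneg v']
          have := ENNReal.ofReal_le_ofReal this
          rw [ENNReal.ofReal_mul (by norm_num), ENNReal.ofReal_add (by positivity) (by positivity),
            ENNReal.ofReal_pow (norm_nonneg _), ENNReal.ofReal_pow (norm_nonneg _),
            ENNReal.ofReal_pow (norm_nonneg _), ofReal_norm, ofReal_norm, ofReal_norm,
            ENNReal.ofReal_inv_of_pos (by norm_num)] at this
          simpa using this
      _ = ∫⁻ η, W η * ‖γ η‖ₑ ^ 2 := by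
          rw [lintegral_const_mul' _ _ (by simp), lintegral_add_left (by fun_prop), e1, ← two_mul,
            ← mul_assoc, ENNReal.inv_mul_cancel (by simp) (by simp), one_mul]

/-! ### Local Taylor approximation of band-limited functions -/

/-- Cauchy–Schwarz for the measure with weights `u`. It replaces the square of a series by a series
of squares, which can be integrated term by term; both maximal functions below are built this way.
-/
theorem tsum_mul_sq_le (u c : ℕ → ℝ≥0∞) :
    (∑' k, u k * c k) ^ 2 ≤ (∑' k, u k) * ∑' k, u k * c k ^ 2 := by
  have h := ENNReal.lintegral_mul_le_Lp_mul_Lq (μ := Measure.count (α := ℕ))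
    (Real.HolderConjugate.two_two) (f := fun k => u k ^ (1 / 2 : ℝ))
    (g := fun k => u k ^ (1 / 2 : ℝ) * c k) (by fun_prop) (by fun_prop)
  simp only [lintegral_count, Pi.mul_apply] at h
  have e1 : ∀ k, u k ^ (1 / 2 : ℝ) * (u k ^ (1 / 2 : ℝ) * c k) = u k * c k := by
    intro k
    rw [← mul_assoc, ← ENNReal.rpow_add_of_nonneg _ _ (by norm_num) (by norm_num)]
    norm_num
  have e2 : ∀ k, (u k ^ (1 / 2 : ℝ)) ^ (2 : ℝ) = u k := by
    intro k
    rw [← ENNReal.rpow_mul]; norm_num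
  have e3 : ∀ k, (u k ^ (1 / 2 : ℝ) * c k) ^ (2 : ℝ) = u k * c k ^ 2 := by
    intro k
    rw [ENNReal.mul_rpow_of_nonneg _ _ (by norm_num), e2, ENNReal.rpow_two]
  simp only [e1, e2, e3] at h
  calc (∑' k, u k * c k) ^ 2 ≤ ((∑' k, u k) ^ (1 / 2 : ℝ) * (∑' k, u k * c k ^ 2) ^ (1 / 2 : ℝ)) ^ 2 := by
        gcongr
    _ = _ := by
        rw [mul_pow, ← ENNReal.rpow_natCast, ← ENNReal.rpow_natCast, ← ENNReal.rpow_mul,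
          ← ENNReal.rpow_mul]
        norm_num

/-- The product of the coordinates of `v` listed by `α`. -/
def mono {d k : ℕ} (α : Fin k → Fin d) (v : E d) : ℝ := ∏ j, v (α j)

theorem continuous_mono {d k : ℕ} (α : Fin k → Fin d) : Continuous (mono α) := by
  unfold mono; fun_prop

theorem abs_coord_le {d : ℕ} (v : E d) (i : Fin d) : |v i| ≤ ‖v‖ := by
  simpa using PiLp.norm_apply_le v i

theorem abs_mono_le {d k : ℕ} (α : Fin k → Fin d) (v : E d) : |mono α v| ≤ ‖v‖ ^ k := by
  unfold mono
  rw [Finset.abs_prod]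
  calc ∏ j, |v (α j)| ≤ ∏ _j : Fin k, ‖v‖ :=
        Finset.prod_le_prod (fun _ _ => abs_nonneg _) fun j _ => abs_coord_le v _
    _ = _ := by simp

/-- Indexing monomials by words instead of multi-indices absorbs the multinomial coefficients. -/
theorem inner_pow_eq {d : ℕ} (k : ℕ) (η v : E d) :
    (inner ℝ η v) ^ k = ∑ α : Fin k → Fin d, mono α η * mono α v := by
  have : inner ℝ η v = ∑ i, η i * v i := by
    simp [PiLp.inner_apply, mul_comm]
  rw [this, Fintype.sum_pow]
  simp [mono, Finset.prod_mul_distrib]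

theorem sum_mono_sq {d : ℕ} (k : ℕ) (η : E d) :
    ∑ α : Fin k → Fin d, mono α η ^ 2 = ‖η‖ ^ (2 * k) := by
  have := inner_pow_eq k η η
  rw [real_inner_self_eq_norm_sq, ← pow_mul] at this
  rw [this]
  simp [sq]

/-- `γ` is square integrable and vanishes at the frequencies `‖η‖ > R`. -/
structure BandLimited {d : ℕ} (R : ℝ) (γ : E d → ℂ) : Prop where
  memLp : MemLp γ 2
  supp : ∀ η, R < ‖η‖ → γ η = 0

theorem BandLimited.mono_mul {d k : ℕ} {R : ℝ} {γ : E d → ℂ} (h : BandLimited R γ)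
    (α : Fin k → Fin d) : BandLimited R (fun η => (mono α η : ℂ) * γ η) := by
  refine ⟨?_, fun η hη => by rw [h.supp η hη, mul_zero]⟩
  refine MemLp.of_le_mul (c := max R 0 ^ k) h.memLp ?_ ?_
  · exact (Complex.continuous_ofReal.comp (continuous_mono α)).aestronglyMeasurable.mul
      h.memLp.1
  · filter_upwards with η
    rw [norm_mul, Complex.norm_real]
    by_cases hη : R < ‖η‖
    · simp [h.supp η hη]
    · gcongr
      exact (abs_mono_le α η).trans (pow_le_pow_left₀ (norm_nonneg _)
        ((not_lt.1 hη).trans (le_max_left _ _)) _)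

theorem BandLimited.integrable {d : ℕ} {R : ℝ} {γ : E d → ℂ} (h : BandLimited R γ) :
    Integrable γ := by
  have : γ = (Metric.closedBall 0 R).indicator γ := by
    ext η
    by_cases hη : R < ‖η‖
    · rw [h.supp η hη]; simp [indicator, hη]
    · rw [indicator_of_mem]; simpa using hη
  rw [this, integrable_indicator_iff measurableSet_closedBall]
  have : IsFiniteMeasure (volume.restrict (Metric.closedBall (0 : E d) R)) :=
    ⟨by simpa using measure_closedBall_lt_top⟩
  exact (h.memLp.restrict _).integrable one_le_two

/-- The Fourier integral of `mono α · γ`; up to the factor `(2πi)^k` it is a partial derivative of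
the function with Fourier transform `γ`. -/
def fourierDeriv {d k : ℕ} (γ : E d → ℂ) (α : Fin k → Fin d) (x : E d) : ℂ :=
  𝓕⁻ (fun η => (mono α η : ℂ) * γ η) x

/-- The term of order `k` of the Taylor expansion at `x` of the function with Fourier transform
`γ`. -/
def taylorTerm {d : ℕ} (γ : E d → ℂ) (k : ℕ) (x v : E d) : ℂ :=
  (2 * Real.pi * Complex.I) ^ k / (k.factorial : ℂ) *
    ∑ α : Fin k → Fin d, (mono α v : ℂ) * fourierDeriv γ α x

theorem fourierInv_eq_mul {d : ℕ} (γ : E d → ℂ) (x : E d) :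
    𝓕⁻ γ x = ∫ η, Complex.exp (2 * Real.pi * Complex.I * inner ℝ η x) * γ η := by
  rw [Real.fourierInv_eq']
  congr 1
  ext η
  rw [smul_eq_mul]
  congr 2
  push_cast
  ring

theorem norm_cexp_inner {d : ℕ} (η x : E d) :
    ‖Complex.exp (2 * Real.pi * Complex.I * inner ℝ η x)‖ = 1 := by
  rw [show (2 * Real.pi * Complex.I * inner ℝ η x : ℂ) =
    ((2 * Real.pi * inner ℝ η x : ℝ) : ℂ) * Complex.I by push_cast; ring]
  exact Complex.norm_exp_ofReal_mul_I _

theorem continuous_cexp_inner {d : ℕ} (x : E d) :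
    Continuous fun η : E d => Complex.exp (2 * Real.pi * Complex.I * inner ℝ η x) := by
  fun_prop

theorem integrable_cexp_mul {d : ℕ} {γ : E d → ℂ} (h : Integrable γ) (x : E d) :
    Integrable fun η => Complex.exp (2 * Real.pi * Complex.I * inner ℝ η x) * γ η := by
  refine h.bdd_mul (c := 1) (continuous_cexp_inner x).aestronglyMeasurable ?_
  filter_upwards with η using (norm_cexp_inner η x).le

/-- Expand exp(2πi⟨η, v⟩) in its power series and integrate term by term. On the bounded support of
`γ` the L¹-norms of the terms are dominated by an exponential series, so the Taylor series converges
for every v. -/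
theorem hasSum_taylorTerm {d : ℕ} {R : ℝ} {γ : E d → ℂ} (h : BandLimited R γ) (x v : E d) :
    HasSum (fun k => taylorTerm γ k x v) (𝓕⁻ γ (x + v)) := by
  set e : E d → E d → ℂ := fun x η => Complex.exp (2 * Real.pi * Complex.I * inner ℝ η x)
  set Fk : ℕ → E d → ℂ := fun k η =>
    e x η * ((2 * Real.pi * Complex.I * inner ℝ η v) ^ k / (k.factorial : ℂ) * γ η) with hFk
  have hterm : ∀ k, Fk k = fun η => (2 * Real.pi * Complex.I) ^ k / (k.factorial : ℂ) *
      ∑ α : Fin k → Fin d, (mono α v : ℂ) * (e x η * ((mono α η : ℂ) * γ η)) := by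
    intro k
    ext η
    have := congrArg (fun r : ℝ => (r : ℂ)) (inner_pow_eq k η v)
    push_cast at this
    simp only [hFk]
    rw [mul_pow (2 * Real.pi * Complex.I), this, Finset.mul_sum, Finset.mul_sum, Finset.sum_div,
      Finset.sum_mul, Finset.mul_sum]
    refine Finset.sum_congr rfl fun α _ => ?_
    ring
  have hint : ∀ k, Integrable (Fk k) := by
    intro k
    rw [hterm]
    refine Integrable.const_mul (integrable_finsetSum _ fun α _ => Integrable.const_mul ?_ _) _
    exact integrable_cexp_mul (h.mono_mul α).integrable x
  have hintegral : ∀ k, ∫ η, Fk k η = taylorTerm γ k x v := by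
    intro k
    rw [hterm, integral_const_mul, integral_finsetSum]
    · unfold taylorTerm
      congr 1
      refine Finset.sum_congr rfl fun α _ => ?_
      rw [integral_const_mul, fourierDeriv, fourierInv_eq_mul]
    · exact fun α _ => (integrable_cexp_mul (h.mono_mul α).integrable x).const_mul _
  have hbound : ∀ k η, ‖Fk k η‖ ≤ (2 * Real.pi * (max R 0 * ‖v‖)) ^ k / k.factorial * ‖γ η‖ := by
    intro k η
    simp only [hFk, e]
    rw [norm_mul, norm_cexp_inner, one_mul, norm_mul, norm_div, norm_pow]
    by_cases hη : R < ‖η‖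
    · simp [h.supp η hη]
    · have h2 : ‖(2 * Real.pi * Complex.I * inner ℝ η v : ℂ)‖ ≤ 2 * Real.pi * (max R 0 * ‖v‖) := by
        rw [norm_mul, norm_mul, norm_mul, Complex.norm_I, Complex.norm_real, Complex.norm_real,
          Complex.norm_ofNat, mul_one, Real.norm_of_nonneg Real.pi_pos.le]
        gcongr
        exact (norm_inner_le_norm η v).trans (by gcongr; exact (not_lt.1 hη).trans (le_max_left _ _))
      have h3 : ‖(k.factorial : ℂ)‖ = k.factorial := by simp
      rw [h3]
      gcongr
  have hsum : Summable fun k => ∫ η, ‖Fk k η‖ := by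
    refine Summable.of_nonneg_of_le (fun k => integral_nonneg fun η => norm_nonneg _)
      (fun k => (integral_mono (hint k).norm (h.integrable.norm.const_mul _) (hbound k)).trans_eq
        (integral_const_mul _ _)) ?_
    exact (Real.summable_pow_div_factorial _).mul_right _
  have hmain := hasSum_integral_of_summable_integral_norm hint hsum
  simp only [hintegral] at hmain
  suffices key : 𝓕⁻ γ (x + v) = ∫ η, ∑' k, Fk k η by rw [key]; exact hmain
  rw [fourierInv_eq_mul]
  congr 1
  ext η
  have h1 : HasSum (fun k : ℕ => (2 * Real.pi * Complex.I * inner ℝ η v : ℂ) ^ k / (k.factorial : ℂ))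
      (Complex.exp (2 * Real.pi * Complex.I * inner ℝ η v)) := by
    rw [Complex.exp_eq_exp_ℂ]
    exact NormedSpace.expSeries_div_hasSum_exp _
  have h2 := (h1.mul_right (γ η)).mul_left (e x η)
  rw [h2.tsum_eq, inner_add_right]
  push_cast
  rw [mul_add, Complex.exp_add, mul_assoc]

/-- The Taylor polynomial of degree less than `m` at `x` of the function with Fourier transform
`γ`. -/
def taylorPoly {d : ℕ} (γ : E d → ℂ) (m : ℕ) (x v : E d) : ℂ :=
  ∑ k ∈ Finset.range m, taylorTerm γ k x v

/-- The sum of the absolute values of the derivatives of order `k`. -/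
def derivSum {d : ℕ} (γ : E d → ℂ) (k : ℕ) (x : E d) : ℝ≥0∞ :=
  ∑ α : Fin k → Fin d, ‖fourierDeriv γ α x‖ₑ

theorem measurable_derivSum {d : ℕ} {R : ℝ} {γ : E d → ℂ} (h : BandLimited R γ) (k : ℕ) :
    Measurable (derivSum γ k) :=
  Finset.measurable_sum _ fun α _ => (continuous_fourierInv (h.mono_mul α).integrable).measurable.enorm

theorem enorm_taylorTerm_le {d : ℕ} (γ : E d → ℂ) (k : ℕ) (x v : E d) {h : ℝ} (hv : ‖v‖ ≤ h) :
    ‖taylorTerm γ k x v‖ₑ ≤ ENNReal.ofReal ((2 * Real.pi * h) ^ k / k.factorial) *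
      derivSum γ k x := by
  have hh : 0 ≤ h := (norm_nonneg v).trans hv
  unfold taylorTerm derivSum
  rw [enorm_mul]
  have e1 : ‖((2 * Real.pi * Complex.I) ^ k / (k.factorial : ℂ))‖ₑ =
      ENNReal.ofReal ((2 * Real.pi) ^ k / k.factorial) := by
    rw [← ofReal_norm]
    congr 1
    rw [norm_div, norm_pow, norm_mul, norm_mul, Complex.norm_I, Complex.norm_real,
      Complex.norm_ofNat, Real.norm_of_nonneg Real.pi_pos.le, mul_one]
    simp
  have e2 : ‖∑ α : Fin k → Fin d, (mono α v : ℂ) * fourierDeriv γ α x‖ₑ ≤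
      ENNReal.ofReal (h ^ k) * ∑ α : Fin k → Fin d, ‖fourierDeriv γ α x‖ₑ := by
    refine (enorm_sum_le _ _).trans ?_
    rw [Finset.mul_sum]
    refine Finset.sum_le_sum fun α _ => ?_
    rw [enorm_mul]
    gcongr
    rw [← ofReal_norm, Complex.norm_real]
    exact ENNReal.ofReal_le_ofReal ((abs_mono_le α v).trans (by gcongr))
  rw [e1]
  refine (mul_le_mul_right e2 _).trans_eq ?_
  rw [← mul_assoc, ← ENNReal.ofReal_mul (by positivity)]
  congr 2
  rw [mul_pow]; ring

/-- Plancherel for each derivative, after Cauchy–Schwarz over the d^k words; `sum_mono_sq`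
recombines the squared monomials into a power of ‖η‖. -/
theorem lintegral_derivSum_sq_le {d : ℕ} {R : ℝ} {γ : E d → ℂ} (h : BandLimited R γ) (k : ℕ) :
    ∫⁻ x, derivSum γ k x ^ 2 ≤ (d : ℝ≥0∞) ^ k * ∫⁻ η, ‖η‖ₑ ^ (2 * k) * ‖γ η‖ₑ ^ 2 := by
  have hm : ∀ α : Fin k → Fin d, Measurable (fourierDeriv γ α) := fun α =>
    (continuous_fourierInv (h.mono_mul α).integrable).measurable
  calc ∫⁻ x, derivSum γ k x ^ 2
      ≤ ∫⁻ x, (d : ℝ≥0∞) ^ k * ∑ α : Fin k → Fin d, ‖fourierDeriv γ α x‖ₑ ^ 2 := by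
        refine lintegral_mono fun x => ?_
        have := ENNReal.rpow_sum_le_const_mul_sum_rpow (p := 2)
          (s := (Finset.univ : Finset (Fin k → Fin d)))
          (fun α => ‖fourierDeriv γ α x‖ₑ) (by norm_num)
        unfold derivSum
        norm_num at this
        exact this
    _ = (d : ℝ≥0∞) ^ k * ∑ α : Fin k → Fin d, ∫⁻ x, ‖fourierDeriv γ α x‖ₑ ^ 2 := by
        rw [lintegral_const_mul _ (Finset.measurable_sum _ fun α _ => (hm α).enorm.pow_const 2),
          lintegral_finsetSum _ fun α _ => (hm α).enorm.pow_const 2]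
    _ = (d : ℝ≥0∞) ^ k * ∑ α : Fin k → Fin d, ∫⁻ η, ‖mono α η‖ₑ ^ 2 * ‖γ η‖ₑ ^ 2 := by
        congr 1
        refine Finset.sum_congr rfl fun α _ => ?_
        unfold fourierDeriv
        rw [lintegral_enorm_fourierInv_sq (h.mono_mul α).integrable (h.mono_mul α).memLp]
        refine lintegral_congr fun η => ?_
        rw [enorm_mul, mul_pow]
        congr 2
        rw [← ofReal_norm, Complex.norm_real, ofReal_norm]
    _ = (d : ℝ≥0∞) ^ k * ∫⁻ η, ‖η‖ₑ ^ (2 * k) * ‖γ η‖ₑ ^ 2 := by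
        rw [← lintegral_finsetSum']
        · congr 1
          refine lintegral_congr fun η => ?_
          rw [← Finset.sum_mul]
          congr 1
          have := congrArg ENNReal.ofReal (sum_mono_sq k η)
          rw [ENNReal.ofReal_sum_of_nonneg fun _ _ => sq_nonneg _,
            ENNReal.ofReal_pow (norm_nonneg _), ofReal_norm] at this
          rw [← this]
          refine Finset.sum_congr rfl fun α _ => ?_
          rw [← sq_abs, ENNReal.ofReal_pow (abs_nonneg _), ← Real.norm_eq_abs, ofReal_norm]
        · exact fun α _ => ((continuous_mono α).measurable.enorm.pow_const 2).aemeasurable.mul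
            (h.memLp.1.enorm.pow_const 2)

/-- Taylor approximation of a band-limited function, uniformly over balls, in `L²`. -/
theorem exists_taylor_bound {d : ℕ} (hd : 1 ≤ d) (m : ℕ) {h R : ℝ} (hh : 0 < h) (hR : 0 < R)
    {γ : E d → ℂ} (hγ : BandLimited R γ) :
    ∃ F : E d → ℝ≥0∞, Measurable F ∧
      ∫⁻ x, F x ≤ ENNReal.ofReal ((2 * Real.pi * h) ^ (2 * m) * d ^ m *
        Real.exp (2 * Real.pi * h * (Real.sqrt d * R)) ^ 2) *
          ∫⁻ η, ‖η‖ₑ ^ (2 * m) * ‖γ η‖ₑ ^ 2 ∧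
      ∀ x v, ‖v‖ ≤ h → ‖𝓕⁻ γ (x + v) - taylorPoly γ m x v‖ₑ ^ 2 ≤ F x := by
  have hd' : (0 : ℝ) < d := by exact_mod_cast hd
  -- By Bernstein's inequality every derivative beyond order m costs at most a factor √d · R in L².
  -- Dividing by q^k makes the square integrals of `c k` bounded uniformly in k, and the Taylor
  -- coefficients that remain sum to exp z.
  set q : ℝ := Real.sqrt d * R with hq
  have hq0 : 0 < q := by positivity
  set z : ℝ := 2 * Real.pi * h * q with hz
  have hz0 : 0 < z := by positivity
  set u : ℕ → ℝ≥0∞ := fun k => ENNReal.ofReal (z ^ k / k.factorial) with hu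
  set c : ℕ → E d → ℝ≥0∞ := fun k x => ENNReal.ofReal ((q ^ k)⁻¹) * derivSum γ (k + m) x with hc
  have hcm : ∀ k, Measurable (c k) := fun k => (measurable_derivSum hγ _).const_mul _
  have husum : ∑' k, u k = ENNReal.ofReal (Real.exp z) := by
    rw [← ENNReal.ofReal_tsum_of_nonneg (fun k => by positivity) (Real.summable_pow_div_factorial z),
      Real.exp_eq_exp_ℝ, NormedSpace.exp_eq_tsum_div]
  set K : ℝ≥0∞ := ENNReal.ofReal ((2 * Real.pi * h) ^ (2 * m)) with hK
  -- This majorant involves derivatives at x only and not v; this is how the supremum over the ball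
  -- gets inside the integral.
  refine ⟨fun x => K * (ENNReal.ofReal (Real.exp z) * ∑' k, u k * c k x ^ 2), ?_, ?_, ?_⟩
  · exact ((Measurable.tsum fun k => ((hcm k).pow_const 2).const_mul _).const_mul _).const_mul _
  · set I := ∫⁻ η, ‖η‖ₑ ^ (2 * m) * ‖γ η‖ₑ ^ 2
    have hck : ∀ k, ∫⁻ x, c k x ^ 2 ≤ ENNReal.ofReal (d ^ m) * I := by
      intro k
      simp only [hc, mul_pow]
      rw [lintegral_const_mul _ ((measurable_derivSum hγ _).pow_const 2)]
      have h1 := lintegral_derivSum_sq_le hγ (k + m)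
      have h2 : ∫⁻ η, ‖η‖ₑ ^ (2 * (k + m)) * ‖γ η‖ₑ ^ 2 ≤ ENNReal.ofReal (R ^ (2 * k)) * I := by
        rw [← lintegral_const_mul' _ _ ENNReal.ofReal_ne_top]
        refine lintegral_mono fun η => ?_
        by_cases hη : R < ‖η‖
        · simp [hγ.supp η hη]
        · rw [← mul_assoc, mul_add, pow_add]
          gcongr
          rw [← ofReal_norm, ← ENNReal.ofReal_pow (norm_nonneg _)]
          exact ENNReal.ofReal_le_ofReal (pow_le_pow_left₀ (norm_nonneg _) (not_lt.1 hη) _)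
      refine (mul_le_mul_right (h1.trans (mul_le_mul_right h2 _)) _).trans_eq ?_
      rw [← mul_assoc, ← mul_assoc]
      congr 1
      rw [← ENNReal.ofReal_pow (by positivity), show (d : ℝ≥0∞) = ENNReal.ofReal d by simp,
        ← ENNReal.ofReal_pow (by positivity), ← ENNReal.ofReal_mul (by positivity),
        ← ENNReal.ofReal_mul (by positivity)]
      congr 1
      have : (q ^ k) ^ 2 = d ^ k * R ^ (2 * k) := by
        rw [← pow_mul, mul_comm k, pow_mul, hq, mul_pow, Real.sq_sqrt hd'.le, mul_pow, pow_mul]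
      rw [inv_pow, this, pow_add]
      field_simp
    rw [lintegral_const_mul _ ((Measurable.tsum fun k =>
      ((hcm k).pow_const 2).const_mul _).const_mul _), lintegral_const_mul _ (Measurable.tsum fun k =>
      ((hcm k).pow_const 2).const_mul _), lintegral_tsum fun k =>
      (((hcm k).pow_const 2).const_mul _).aemeasurable]
    calc K * (ENNReal.ofReal (Real.exp z) * ∑' k, ∫⁻ x, u k * c k x ^ 2)
        ≤ K * (ENNReal.ofReal (Real.exp z) * ∑' k, u k * (ENNReal.ofReal (d ^ m) * I)) := by
          gcongr with k
          rw [lintegral_const_mul _ ((hcm k).pow_const 2)]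
          gcongr
          exact hck k
      _ = _ := by
          rw [ENNReal.tsum_mul_right, husum, hK, ← mul_assoc, ← mul_assoc, ← mul_assoc,
            ← ENNReal.ofReal_mul (by positivity), ← ENNReal.ofReal_mul (by positivity),
            ← ENNReal.ofReal_mul (by positivity)]
          congr 2
          ring
  · intro x v hv
    have hs := (hasSum_nat_add_iff' m).2 (hasSum_taylorTerm hγ x v)
    rw [taylorPoly, ← hs.tsum_eq]
    have h1 : ‖∑' k, taylorTerm γ (k + m) x v‖ₑ ≤
        ENNReal.ofReal ((2 * Real.pi * h) ^ m) * ∑' k, u k * c k x := by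
      refine (enorm_tsum_le_tsum_enorm).trans ?_
      rw [← ENNReal.tsum_mul_left]
      refine ENNReal.tsum_le_tsum fun k => ?_
      refine (enorm_taylorTerm_le γ (k + m) x v hv).trans ?_
      simp only [hc, hu]
      rw [← mul_assoc, ← mul_assoc, ← ENNReal.ofReal_mul (by positivity),
        ← ENNReal.ofReal_mul (by positivity)]
      gcongr
      have : (2 * Real.pi * h) ^ m * (z ^ k / k.factorial) * (q ^ k)⁻¹ =
          (2 * Real.pi * h) ^ (k + m) / k.factorial := by
        rw [hz, mul_pow _ q, pow_add]; field_simp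
      rw [this]
      gcongr
      omega
    calc ‖∑' k, taylorTerm γ (k + m) x v‖ₑ ^ 2
        ≤ (ENNReal.ofReal ((2 * Real.pi * h) ^ m) * ∑' k, u k * c k x) ^ 2 := by gcongr
      _ = K * (∑' k, u k * c k x) ^ 2 := by
          rw [mul_pow, ← ENNReal.ofReal_pow (by positivity), ← pow_mul, mul_comm m]
      _ ≤ _ := by
          rw [← husum]
          exact mul_le_mul_right (tsum_mul_sq_le _ _) _

/-! ### Local approximation of Sobolev functions -/

/-- The square of the `H^t`-norm of the function with Fourier transform `γ`. -/
def energy {d : ℕ} (t : ℝ) (γ : E d → ℂ) : ℝ≥0∞ :=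
  ∫⁻ η : E d, ENNReal.ofReal ((1 + (2 * Real.pi * ‖η‖) ^ 2) ^ t) * ‖γ η‖ₑ ^ 2

theorem sobolevNorm_sq {d : ℕ} (s : ℝ) (G : Lp ℂ 2 (volume : Measure (E d))) :
    sobolevNorm s G ^ 2 = energy s (𝓕 G : Lp ℂ 2 (volume : Measure (E d))) := by
  unfold sobolevNorm energy
  rw [← ENNReal.rpow_natCast, ← ENNReal.rpow_mul]
  norm_num

theorem energy_congr {d : ℕ} {t : ℝ} {γ δ : E d → ℂ} (h : γ =ᵐ[volume] δ) :
    energy t γ = energy t δ :=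
  lintegral_congr_ae (by filter_upwards [h] with η hη; rw [hη])

theorem energy_mono {d : ℕ} {t : ℝ} {γ δ : E d → ℂ} (h : ∀ η, ‖γ η‖ ≤ ‖δ η‖) :
    energy t γ ≤ energy t δ := by
  refine lintegral_mono fun η => ?_
  gcongr
  exact enorm_le_iff_norm_le.2 (h η)

theorem one_le_weight {d : ℕ} {t : ℝ} (ht : 0 ≤ t) (η : E d) :
    1 ≤ (1 + (2 * Real.pi * ‖η‖) ^ 2) ^ t :=
  Real.one_le_rpow (by nlinarith [sq_nonneg (2 * Real.pi * ‖η‖)]) ht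

theorem norm_rpow_le_weight {d : ℕ} {t : ℝ} (ht : 0 ≤ t) (η : E d) :
    ‖η‖ ^ (2 * t) ≤ (1 + (2 * Real.pi * ‖η‖) ^ 2) ^ t := by
  rw [Real.rpow_mul (norm_nonneg _), Real.rpow_two]
  refine Real.rpow_le_rpow (sq_nonneg _) ?_ ht
  nlinarith [Real.pi_gt_three, sq_nonneg ‖η‖, mul_nonneg (sq_nonneg ‖η‖) (sq_nonneg Real.pi),
    mul_le_mul_of_nonneg_left (show (1 : ℝ) ≤ 4 * Real.pi ^ 2 by nlinarith [Real.pi_gt_three])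
      (sq_nonneg ‖η‖)]

theorem lintegral_sq_le_energy {d : ℕ} {t : ℝ} (ht : 0 ≤ t) (γ : E d → ℂ) :
    ∫⁻ η, ‖γ η‖ₑ ^ 2 ≤ energy t γ := by
  refine lintegral_mono fun η => ?_
  conv_lhs => rw [← one_mul (‖γ η‖ₑ ^ 2)]
  gcongr
  rw [← ENNReal.ofReal_one]
  exact ENNReal.ofReal_le_ofReal (one_le_weight ht η)

theorem memLp_two_of_lintegral_lt_top {α : Type*} {mα : MeasurableSpace α} {μ : Measure α}
    {F : Type*} [NormedAddCommGroup F] {f : α → F} (hf : AEStronglyMeasurable f μ)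
    (h : ∫⁻ x, ‖f x‖ₑ ^ 2 ∂μ < ∞) : MemLp f 2 μ := by
  refine ⟨hf, ?_⟩
  rw [eLpNorm_lt_top_iff_lintegral_rpow_enorm_lt_top (by norm_num) (by norm_num)]
  simpa using h

theorem memLp_of_energy {d : ℕ} {t : ℝ} (ht : 0 ≤ t) {γ : E d → ℂ}
    (hm : AEStronglyMeasurable γ) (h : energy t γ < ∞) : MemLp γ 2 :=
  memLp_two_of_lintegral_lt_top hm ((lintegral_sq_le_energy ht γ).trans_lt h)

theorem lintegral_weight_inv_lt_top {d : ℕ} {t : ℝ} (ht : (d : ℝ) / 2 < t) :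
    ∫⁻ η : E d, ENNReal.ofReal ((1 + (2 * Real.pi * ‖η‖) ^ 2) ^ (-t)) < ∞ := by
  have ht0 : 0 < t := lt_of_le_of_lt (by positivity) ht
  have h := integrable_rpow_neg_one_add_norm_sq (E := E d) (μ := volume) (r := 2 * t)
    (by rw [finrank_euclideanSpace_fin]; linarith)
  refine lt_of_le_of_lt (lintegral_mono fun η => ?_) h.lintegral_lt_top
  apply ENNReal.ofReal_le_ofReal
  rw [show -(2 * t) / 2 = -t by ring]
  rw [Real.rpow_neg (by positivity), Real.rpow_neg (by positivity)]
  gcongr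
  nlinarith [Real.pi_gt_three, norm_nonneg η]

/-- Cauchy–Schwarz against the inverse square root of the weight, which is square integrable because
t > d/2. -/
theorem integrable_of_energy {d : ℕ} {t : ℝ} (ht : (d : ℝ) / 2 < t) {γ : E d → ℂ}
    (hm : AEStronglyMeasurable γ) (h : energy t γ < ∞) : Integrable γ := by
  have ht0 : 0 < t := lt_of_le_of_lt (by positivity) ht
  set w : E d → ℝ := fun η => (1 + (2 * Real.pi * ‖η‖) ^ 2) ^ (t / 2) with hw
  have hwpos : ∀ η, 0 < w η := fun η => by positivity
  have hwc : Measurable w := by fun_prop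
  have h1 : MemLp (fun η => (w η)⁻¹) 2 (volume : Measure (E d)) := by
    refine memLp_two_of_lintegral_lt_top hwc.inv.aestronglyMeasurable ?_
    refine lt_of_le_of_lt (lintegral_mono fun η => le_of_eq ?_) (lintegral_weight_inv_lt_top ht)
    rw [← ofReal_norm, ← ENNReal.ofReal_pow (norm_nonneg _), Real.norm_of_nonneg (by positivity)]
    congr 1
    rw [hw, inv_pow, ← Real.rpow_natCast, ← Real.rpow_mul (by positivity), Real.rpow_neg (by positivity)]
    norm_num
  have h2 : MemLp (fun η => (w η : ℂ) * γ η) 2 (volume : Measure (E d)) := by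
    refine memLp_two_of_lintegral_lt_top
      ((Complex.measurable_ofReal.comp hwc).aestronglyMeasurable.mul hm) ?_
    refine lt_of_le_of_lt (lintegral_mono fun η => le_of_eq ?_) h
    rw [enorm_mul, mul_pow]
    congr 1
    rw [← ofReal_norm, Complex.norm_real, ← ENNReal.ofReal_pow (norm_nonneg _),
      Real.norm_of_nonneg (hwpos η).le]
    congr 1
    rw [hw, ← Real.rpow_natCast, ← Real.rpow_mul (by positivity)]
    norm_num
  have h3 := h2.smul (p := 2) (q := 2) (r := 1) h1
  rw [memLp_one_iff_integrable] at h3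
  refine h3.congr ?_
  filter_upwards with η
  simp only [Pi.smul_apply', Complex.real_smul]
  rw [← mul_assoc, ← Complex.ofReal_mul, inv_mul_cancel₀ (hwpos η).ne']
  simp

/-- Maximal inequality for a band-limited function over balls of radius at least `1 / R`. -/
theorem exists_sup_bound {d : ℕ} (hd : 1 ≤ d) : ∃ C : ℝ, 0 < C ∧
    ∀ (h R : ℝ), 0 < R → 1 ≤ h * R → ∀ γ : E d → ℂ, BandLimited R γ →
    ∃ F : E d → ℝ≥0∞, Measurable F ∧
      ∫⁻ x, F x ≤ ENNReal.ofReal (C * (h * R) ^ d) * ∫⁻ η, ‖γ η‖ₑ ^ 2 ∧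
      ∀ x v, ‖v‖ ≤ h → ‖𝓕⁻ γ (x + v)‖ₑ ^ 2 ≤ F x := by
  have hd' : (1 : ℝ) ≤ d := by exact_mod_cast hd
  have hsd : 1 ≤ Real.sqrt d := Real.one_le_sqrt.2 hd'
  set C₀ : ℝ := Real.exp (2 * Real.pi * Real.sqrt d) ^ 2
  refine ⟨(5 * Real.sqrt d) ^ d * C₀, by positivity, fun h R hR hhR γ hγ => ?_⟩
  obtain ⟨F, hFm, hFi, hF⟩ := exists_taylor_bound hd 0 (h := 1 / R) (by positivity) hR hγ
  -- The Taylor bound with m = 0 already controls balls of radius 1/R. A larger ball is covered by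
  -- such balls around grid points of mesh δ, since cells of the grid have diameter 1/R. About
  -- (hR)^d translates of the same majorant are summed, all with the same integral.
  set δ : ℝ := 1 / (R * Real.sqrt d) with hδ
  have hδ0 : 0 < δ := by positivity
  set N : ℕ := ⌈h / δ⌉₊ with hN
  set S : Finset (Fin d → ℤ) := Fintype.piFinset fun _ => Finset.Icc (-(N : ℤ)) N
  set p : (Fin d → ℤ) → E d := fun k => WithLp.toLp 2 fun i => δ * k i with hp
  refine ⟨fun x => ∑ k ∈ S, F (x + p k), ?_, ?_, ?_⟩
  · exact Finset.measurable_sum _ fun k _ => hFm.comp (measurable_id.add_const _)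
  · rw [lintegral_finsetSum S (f := fun k x => F (x + p k))
      fun k _ => hFm.comp (measurable_id.add_const _)]
    simp only [lintegral_add_right_eq_self F, Finset.sum_const, nsmul_eq_mul]
    have hcard : (S.card : ℝ) ≤ (5 * Real.sqrt d) ^ d * (h * R) ^ d := by
      have : S.card = (2 * N + 1) ^ d := by
        simp only [S, Fintype.card_piFinset, Int.card_Icc, Finset.prod_const, Finset.card_univ,
          Fintype.card_fin]
        congr 1
        omega
      rw [this, ← mul_pow]
      push_cast
      gcongr
      have h1 : (N : ℝ) < h / δ + 1 := Nat.ceil_lt_add_one (by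
        have : 0 < h := by by_contra hc; nlinarith
        positivity)
      have h2 : h / δ = h * R * Real.sqrt d := by rw [hδ]; field_simp
      have h3 : 1 ≤ h * R * Real.sqrt d := by nlinarith
      nlinarith
    have hFi' : ∫⁻ x, F x ≤ ENNReal.ofReal C₀ * ∫⁻ η, ‖γ η‖ₑ ^ 2 := by
      refine hFi.trans (le_of_eq ?_)
      simp only [mul_zero, pow_zero, one_mul]
      rw [show 2 * Real.pi * (1 / R) * (Real.sqrt d * R) = 2 * Real.pi * Real.sqrt d by field_simp]
    calc (S.card : ℝ≥0∞) * ∫⁻ x, F x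
        ≤ ENNReal.ofReal ((5 * Real.sqrt d) ^ d * (h * R) ^ d) *
          (ENNReal.ofReal C₀ * ∫⁻ η, ‖γ η‖ₑ ^ 2) := by
          gcongr
          rw [← ENNReal.ofReal_natCast]
          exact ENNReal.ofReal_le_ofReal hcard
      _ = _ := by
          rw [← mul_assoc, ← ENNReal.ofReal_mul (by positivity)]
          congr 2
          ring
  · intro x v hv
    set k : Fin d → ℤ := fun i => ⌊v i / δ⌋ with hk
    have hkS : k ∈ S := by
      simp only [S, Fintype.mem_piFinset, Finset.mem_Icc]
      intro i
      have h1 := (abs_coord_le v i).trans hv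
      have h2 : |v i / δ| ≤ N := by
        rw [abs_div, abs_of_pos hδ0]
        exact (div_le_div_of_nonneg_right h1 hδ0.le).trans (Nat.le_ceil _)
      rw [abs_le] at h2
      constructor
      · rw [hk, Int.le_floor]; push_cast; exact h2.1
      · have := (Int.floor_le (v i / δ)).trans h2.2
        exact Int.cast_le.1 (this.trans_eq (Int.cast_natCast N).symm)
    have hw : ‖v - p k‖ ≤ 1 / R := by
      have hc : ∀ i, |(v - p k) i| ≤ δ := by
        intro i
        have h1 := Int.floor_le (v i / δ)
        have h2 := Int.lt_floor_add_one (v i / δ)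
        have e : (v - p k) i = δ * (v i / δ - ⌊v i / δ⌋) := by
          simp only [hp, hk, PiLp.sub_apply]
          field_simp
        rw [e, abs_of_nonneg (by nlinarith)]
        nlinarith
      rw [EuclideanSpace.norm_eq]
      have : ∑ i, ‖(v - p k) i‖ ^ 2 ≤ (1 / R) ^ 2 := by
        calc ∑ i, ‖(v - p k) i‖ ^ 2 ≤ ∑ _i : Fin d, δ ^ 2 := by
              gcongr with i; exact hc i
          _ = (1 / R) ^ 2 := by
              simp only [Finset.sum_const, Finset.card_univ, Fintype.card_fin, nsmul_eq_mul, hδ]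
              rw [div_pow, mul_pow, Real.sq_sqrt (by linarith)]
              field_simp
      exact Real.sqrt_le_iff.2 ⟨by positivity, this⟩
    have := hF (x + p k) (v - p k) hw
    simp only [taylorPoly, Finset.range_zero, Finset.sum_empty, sub_zero] at this
    rw [show x + p k + (v - p k) = x + v by abel] at this
    exact this.trans (Finset.single_le_sum (f := fun k => F (x + p k)) (fun _ _ => zero_le) hkS)

/-- The part of `γ` at the frequencies `a < ‖η‖ ≤ b`. -/
def band {d : ℕ} (a b : ℝ) (γ : E d → ℂ) : E d → ℂ := {η | a < ‖η‖ ∧ ‖η‖ ≤ b}.indicator γ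

theorem measurableSet_band {d : ℕ} (a b : ℝ) : MeasurableSet {η : E d | a < ‖η‖ ∧ ‖η‖ ≤ b} :=
  (measurableSet_lt measurable_const measurable_norm).inter
    (measurableSet_le measurable_norm measurable_const)

theorem BandLimited.band {d : ℕ} {a b : ℝ} {γ : E d → ℂ} (h : MemLp γ 2) :
    BandLimited b (band a b γ) := by
  refine ⟨h.indicator (measurableSet_band a b), fun η hη => ?_⟩
  rw [AdvReg.band, indicator_of_notMem]
  simp only [mem_ofPred_eq, not_and, not_le]
  exact fun _ => hη

theorem lintegral_band_sq_le {d : ℕ} {t a b : ℝ} (ht : 0 ≤ t) (ha : 0 < a) (γ : E d → ℂ) :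
    ∫⁻ η, ‖band a b γ η‖ₑ ^ 2 ≤ ENNReal.ofReal (a ^ (-(2 * t))) * energy t γ := by
  unfold energy
  rw [← lintegral_const_mul' _ _ ENNReal.ofReal_ne_top]
  refine lintegral_mono fun η => ?_
  unfold band
  by_cases hη : η ∈ {η : E d | a < ‖η‖ ∧ ‖η‖ ≤ b}
  · rw [indicator_of_mem hη, ← mul_assoc, ← ENNReal.ofReal_mul (by positivity)]
    conv_lhs => rw [← one_mul (‖γ η‖ₑ ^ 2)]
    gcongr
    rw [← ENNReal.ofReal_one]
    apply ENNReal.ofReal_le_ofReal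
    have h1 : a ^ (2 * t) ≤ ‖η‖ ^ (2 * t) := Real.rpow_le_rpow ha.le hη.1.le (by linarith)
    rw [Real.rpow_neg ha.le, ← div_eq_inv_mul, le_div_iff₀ (by positivity), one_mul]
    exact h1.trans (norm_rpow_le_weight ht η)
  · rw [indicator_of_notMem hη]; simp

/-- Maximal inequality for the high-frequency part of a function in `H^t`, `t > d/2`. -/
theorem exists_high_bound {d : ℕ} (hd : 1 ≤ d) {t A : ℝ} (ht : (d : ℝ) / 2 < t) (hA : 1 ≤ A) :
    ∃ C : ℝ, 0 < C ∧ ∀ h : ℝ, 0 < h → ∀ γ : E d → ℂ, AEStronglyMeasurable γ →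
    energy t γ < ∞ → (∀ η, ‖η‖ ≤ 1 / h → γ η = 0) →
    ∃ F : E d → ℝ≥0∞, Measurable F ∧
      ∫⁻ x, F x ≤ ENNReal.ofReal (C * h ^ (2 * t)) * energy t γ ∧
      ∀ x v, ‖v‖ ≤ A * h → ‖𝓕⁻ γ (x + v)‖ₑ ^ 2 ≤ F x := by
  have ht0 : 0 < t := lt_of_le_of_lt (by positivity) ht
  obtain ⟨C₀, hC₀, hsup⟩ := exists_sup_bound hd
  -- On the band at frequency 2^j / h the maximal inequality costs 2^{jd} and the energy gains
  -- 2^{-2tj}; the product is θ^{2j}, and θ < 1 because t > d/2. Cauchy–Schwarz with weights θ^j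
  -- spends one factor θ^j and leaves the other for summation.
  set θ : ℝ := (2 : ℝ) ^ (-(t - d / 2)) with hθ
  have hθ0 : 0 < θ := by positivity
  have hθ1 : θ < 1 := Real.rpow_lt_one_of_one_lt_of_neg (by norm_num) (by linarith)
  set T : ℝ := (1 - θ)⁻¹ with hT
  have hT0 : 0 < T := inv_pos.2 (by linarith)
  refine ⟨T ^ 2 * (C₀ * (2 * A) ^ d), by positivity, fun h hh γ hm hE hsupp => ?_⟩
  have hL2 := memLp_of_energy ht0.le hm hE
  have hL1 := integrable_of_energy ht hm hE
  set a : ℕ → ℝ := fun j => 2 ^ j / h with ha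
  have ha0 : ∀ j, 0 < a j := fun j => by positivity
  have hband : ∀ j, BandLimited (a (j + 1)) (band (a j) (a (j + 1)) γ) :=
    fun j => BandLimited.band hL2
  have hhR : ∀ j, 1 ≤ A * h * a (j + 1) := by
    intro j
    have : A * h * a (j + 1) = A * 2 ^ (j + 1) := by simp only [ha]; field_simp
    rw [this]
    exact one_le_mul_of_one_le_of_one_le hA (one_le_pow₀ (by norm_num))
  choose F hFm hFi hF using fun j =>
    hsup (A * h) (a (j + 1)) (ha0 _) (hhR j) _ (hband j)
  have hFi' : ∀ j, ∫⁻ x, F j x ≤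
      ENNReal.ofReal (C₀ * (2 * A) ^ d * h ^ (2 * t)) * ENNReal.ofReal (θ ^ (2 * j)) * energy t γ := by
    intro j
    refine (hFi j).trans ((mul_le_mul_right (lintegral_band_sq_le ht0.le (ha0 j) γ) _).trans_eq ?_)
    rw [← mul_assoc, ← ENNReal.ofReal_mul (by positivity), ← ENNReal.ofReal_mul (by positivity)]
    congr 2
    have e1 : A * h * a (j + 1) = 2 * A * 2 ^ j := by
      simp only [ha]; field_simp; ring
    have e2 : a j ^ (-(2 * t)) = (2 : ℝ) ^ (-(2 * t) * j) * h ^ (2 * t) := by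
      simp only [ha]
      rw [Real.div_rpow (by positivity) hh.le, Real.rpow_neg hh.le, div_inv_eq_mul,
        ← Real.rpow_natCast 2 j, ← Real.rpow_mul (by norm_num)]
      congr 2
      ring
    have e3 : θ ^ (2 * j) = (2 ^ j) ^ d * (2 : ℝ) ^ (-(2 * t) * j) := by
      rw [hθ, ← Real.rpow_natCast (2 ^ j : ℝ), ← Real.rpow_natCast 2 j, ← Real.rpow_natCast,
        ← Real.rpow_mul (by norm_num), ← Real.rpow_mul (by norm_num), ← Real.rpow_add (by norm_num)]
      congr 1
      push_cast
      ring
    rw [e1, e2, e3, mul_pow (2 * A)]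
    ring
  have hθsum : ∑' j, ENNReal.ofReal (θ ^ j) = ENNReal.ofReal T := by
    rw [← ENNReal.ofReal_tsum_of_nonneg (fun j => by positivity)
      (summable_geometric_of_lt_one hθ0.le hθ1), tsum_geometric_of_lt_one hθ0.le hθ1]
  have hθpos : ∀ j, ENNReal.ofReal (θ ^ j) ≠ 0 := fun j => by
    simp only [ne_eq, ENNReal.ofReal_eq_zero, not_le]; positivity
  refine ⟨fun x => ENNReal.ofReal T * ∑' j, (ENNReal.ofReal (θ ^ j))⁻¹ * F j x, ?_, ?_, ?_⟩
  · exact (Measurable.tsum fun j => (hFm j).const_mul _).const_mul _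
  · rw [lintegral_const_mul _ (Measurable.tsum fun j => (hFm j).const_mul _),
      lintegral_tsum fun j => ((hFm j).const_mul _).aemeasurable]
    calc ENNReal.ofReal T * ∑' j, ∫⁻ x, (ENNReal.ofReal (θ ^ j))⁻¹ * F j x
        ≤ ENNReal.ofReal T * ∑' j, ENNReal.ofReal (θ ^ j) *
          (ENNReal.ofReal (C₀ * (2 * A) ^ d * h ^ (2 * t)) * energy t γ) := by
          gcongr with j
          rw [lintegral_const_mul _ (hFm j)]
          refine (mul_le_mul_right (hFi' j) _).trans_eq ?_
          have : ENNReal.ofReal (θ ^ (2 * j)) = ENNReal.ofReal (θ ^ j) * ENNReal.ofReal (θ ^ j) := by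
            rw [← ENNReal.ofReal_mul (by positivity), two_mul, pow_add]
          rw [this, mul_comm (ENNReal.ofReal (C₀ * (2 * A) ^ d * h ^ (2 * t))), ← mul_assoc,
            ← mul_assoc, ← mul_assoc, ENNReal.inv_mul_cancel (hθpos j) ENNReal.ofReal_ne_top,
            one_mul, mul_assoc]
      _ = _ := by
          rw [ENNReal.tsum_mul_right, hθsum, ← mul_assoc, ← mul_assoc,
            ← ENNReal.ofReal_mul (by positivity), ← ENNReal.ofReal_mul (by positivity)]
          congr 2
          ring
  · intro x v hv
    have hdisj : Pairwise (Function.onFun Disjoint fun j => {η : E d | a j < ‖η‖ ∧ ‖η‖ ≤ a (j + 1)}) := by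
      have hmono : Monotone a := fun i j hij => by
        simp only [ha]; gcongr; norm_num
      intro i j hij
      rw [Function.onFun, Set.disjoint_left]
      intro η h1 h2
      simp only [mem_ofPred_eq] at h1 h2
      rcases lt_or_gt_of_ne hij with h | h
      · have := hmono (Nat.succ_le_of_lt h)
        simp only [Nat.succ_eq_add_one] at this
        linarith [h1.2, h2.1]
      · have := hmono (Nat.succ_le_of_lt h)
        simp only [Nat.succ_eq_add_one] at this
        linarith [h2.2, h1.1]
    set f : E d → ℂ := fun η => Complex.exp (2 * Real.pi * Complex.I * inner ℝ η (x + v)) * γ η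
      with hf
    have hfint : Integrable f := integrable_cexp_mul hL1 _
    have hsum := hasSum_integral_iUnion (μ := volume) (f := f)
      (fun j => measurableSet_band (d := d) (a j) (a (j + 1))) hdisj hfint.integrableOn
    -- Frequencies up to `a 0` = 1/h are excluded by hypothesis; any other lies in the band that
    -- ends at the first `a j` not below its norm.
    have hU : ∀ η, η ∉ ⋃ j, {η : E d | a j < ‖η‖ ∧ ‖η‖ ≤ a (j + 1)} → f η = 0 := by
      intro η hη
      have : γ η = 0 := by
        by_contra hne
        have h1 : 1 / h < ‖η‖ := by
          by_contra hc; exact hne (hsupp η (not_lt.1 hc))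
        have hex : ∃ j, ‖η‖ ≤ a j := by
          obtain ⟨j, hj⟩ := pow_unbounded_of_one_lt (‖η‖ * h) (one_lt_two)
          refine ⟨j, ?_⟩
          simp only [ha]
          rw [le_div_iff₀ hh]
          exact hj.le
        classical
        have hj := Nat.find_spec hex
        have hj0 : Nat.find hex ≠ 0 := by
          intro h0
          rw [h0] at hj
          simp only [ha, pow_zero] at hj
          linarith
        obtain ⟨j, hjj⟩ := Nat.exists_eq_succ_of_ne_zero hj0
        have hlt := Nat.find_min hex (m := j) (by omega)
        apply hη
        simp only [mem_iUnion, mem_ofPred_eq]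
        exact ⟨j, not_le.1 hlt, by rw [hjj] at hj; exact hj⟩
      simp [hf, this]
    rw [setIntegral_eq_integral_of_forall_compl_eq_zero hU] at hsum
    have hterm : ∀ j, ∫ η in {η : E d | a j < ‖η‖ ∧ ‖η‖ ≤ a (j + 1)}, f η =
        𝓕⁻ (band (a j) (a (j + 1)) γ) (x + v) := by
      intro j
      rw [fourierInv_eq_mul, ← integral_indicator (measurableSet_band _ _)]
      congr 1
      ext η
      unfold band
      by_cases hη : η ∈ {η : E d | a j < ‖η‖ ∧ ‖η‖ ≤ a (j + 1)}
      · rw [indicator_of_mem hη, indicator_of_mem hη]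
      · rw [indicator_of_notMem hη, indicator_of_notMem hη, mul_zero]
    simp only [hterm] at hsum
    rw [fourierInv_eq_mul, ← hf, ← hsum.tsum_eq]
    set c : ℕ → ℝ≥0∞ := fun j => ‖𝓕⁻ (band (a j) (a (j + 1)) γ) (x + v)‖ₑ with hc
    calc ‖∑' j, 𝓕⁻ (band (a j) (a (j + 1)) γ) (x + v)‖ₑ ^ 2
        ≤ (∑' j, ENNReal.ofReal (θ ^ j) * ((ENNReal.ofReal (θ ^ j))⁻¹ * c j)) ^ 2 := by
          gcongr
          refine enorm_tsum_le_tsum_enorm.trans (ENNReal.tsum_le_tsum fun j => le_of_eq ?_)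
          rw [← mul_assoc, ENNReal.mul_inv_cancel (hθpos j) ENNReal.ofReal_ne_top, one_mul]
      _ ≤ (∑' j, ENNReal.ofReal (θ ^ j)) *
          ∑' j, ENNReal.ofReal (θ ^ j) * ((ENNReal.ofReal (θ ^ j))⁻¹ * c j) ^ 2 :=
        tsum_mul_sq_le _ _
      _ ≤ ENNReal.ofReal T * ∑' j, (ENNReal.ofReal (θ ^ j))⁻¹ * F j x := by
          rw [hθsum]
          refine mul_le_mul_right (ENNReal.tsum_le_tsum fun j => ?_) _
          rw [mul_pow, sq (ENNReal.ofReal (θ ^ j))⁻¹, ← mul_assoc, ← mul_assoc,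
            ENNReal.mul_inv_cancel (hθpos j) ENNReal.ofReal_ne_top, one_mul]
          gcongr
          exact hF j x v hv

/-- Taylor approximation of a band-limited function in terms of its `H^t`-norm. -/
theorem exists_low_approx {d : ℕ} (hd : 1 ≤ d) (m : ℕ) {t A : ℝ} (ht : 0 ≤ t) (hA : 1 ≤ A) :
    ∃ C : ℝ, 0 < C ∧ ∀ h : ℝ, 0 < h → ∀ γ : E d → ℂ, BandLimited (1 / h) γ →
    ∃ F : E d → ℝ≥0∞, Measurable F ∧
      ∫⁻ x, F x ≤ ENNReal.ofReal (C * h ^ (2 * min (m : ℝ) t)) * energy t γ ∧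
      ∀ x v, ‖v‖ ≤ A * h → ‖𝓕⁻ γ (x + v) - taylorPoly γ m x v‖ₑ ^ 2 ≤ F x := by
  have hd' : (1 : ℝ) ≤ d := by exact_mod_cast hd
  refine ⟨(2 * Real.pi * A) ^ (2 * m) * d ^ m * Real.exp (2 * Real.pi * A * Real.sqrt d) ^ 2,
    by positivity, fun h hh γ hγ => ?_⟩
  obtain ⟨F, hFm, hFi, hF⟩ := exists_taylor_bound hd m (h := A * h) (R := 1 / h) (by positivity)
    (by positivity) hγ
  refine ⟨F, hFm, hFi.trans ?_, hF⟩
  have hu : 0 ≤ min (m : ℝ) t := le_min (by positivity) ht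
  -- On the support h‖η‖ ≤ 1, so the exponent 2m may be lowered to 2 min(m, t), and then ‖η‖ to that
  -- exponent is dominated by the weight.
  have key : ∫⁻ η, ‖η‖ₑ ^ (2 * m) * ‖γ η‖ₑ ^ 2 ≤
      ENNReal.ofReal ((h ^ (2 * m))⁻¹ * h ^ (2 * min (m : ℝ) t)) * energy t γ := by
    unfold energy
    rw [← lintegral_const_mul' _ _ ENNReal.ofReal_ne_top]
    refine lintegral_mono fun η => ?_
    by_cases hη : 1 / h < ‖η‖
    · simp [hγ.supp η hη]
    rw [← mul_assoc, ← ENNReal.ofReal_mul (by positivity), ← ofReal_norm,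
      ← ENNReal.ofReal_pow (norm_nonneg _)]
    gcongr
    rw [mul_assoc, ← div_eq_inv_mul, le_div_iff₀ (by positivity), mul_comm, ← mul_pow]
    have h1 : h * ‖η‖ ≤ 1 := by
      rw [not_lt, le_div_iff₀ hh] at hη; linarith
    have h0 : 0 ≤ h * ‖η‖ := by positivity
    calc (h * ‖η‖) ^ (2 * m) = (h * ‖η‖) ^ (2 * (m : ℝ)) := by
          rw [← Real.rpow_natCast]; push_cast; rfl
      _ ≤ (h * ‖η‖) ^ (2 * min (m : ℝ) t) := by
          rcases h0.eq_or_lt with h0 | h0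
          · rw [← h0]
            rcases Nat.eq_zero_or_pos m with hm | hm
            · simp [hm, ht]
            · rw [Real.zero_rpow (by positivity)]
              positivity
          · exact Real.rpow_le_rpow_of_exponent_ge h0 h1 (by linarith [min_le_left (m : ℝ) t])
      _ = h ^ (2 * min (m : ℝ) t) * ‖η‖ ^ (2 * min (m : ℝ) t) :=
          Real.mul_rpow hh.le (norm_nonneg _)
      _ ≤ h ^ (2 * min (m : ℝ) t) * (1 + (2 * Real.pi * ‖η‖) ^ 2) ^ t := by
          gcongr
          refine (norm_rpow_le_weight hu η).trans ?_
          exact Real.rpow_le_rpow_of_exponent_le (by nlinarith [sq_nonneg (2 * Real.pi * ‖η‖)])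
            (min_le_right _ _)
  refine (mul_le_mul_right key _).trans_eq ?_
  rw [← mul_assoc, ← ENNReal.ofReal_mul (by positivity)]
  congr 2
  have e : 2 * Real.pi * (A * h) * (Real.sqrt d * (1 / h)) = 2 * Real.pi * A * Real.sqrt d := by
    field_simp
  rw [e, ← mul_assoc (2 * Real.pi) A h, mul_pow _ h]
  field_simp

theorem enorm_add_sq_le {F : Type*} [SeminormedAddCommGroup F] (a b : F) :
    ‖a + b‖ₑ ^ 2 ≤ 2 * ‖a‖ₑ ^ 2 + 2 * ‖b‖ₑ ^ 2 := by
  have h1 : ‖a + b‖ ^ 2 ≤ 2 * ‖a‖ ^ 2 + 2 * ‖b‖ ^ 2 := by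
    have := norm_add_le a b
    nlinarith [norm_nonneg (a + b), norm_nonneg a, norm_nonneg b, sq_nonneg (‖a‖ - ‖b‖)]
  have := ENNReal.ofReal_le_ofReal h1
  rw [ENNReal.ofReal_add (by positivity) (by positivity), ENNReal.ofReal_mul (by norm_num),
    ENNReal.ofReal_mul (by norm_num), ENNReal.ofReal_pow (norm_nonneg _),
    ENNReal.ofReal_pow (norm_nonneg _), ENNReal.ofReal_pow (norm_nonneg _), ofReal_norm,
    ofReal_norm, ofReal_norm] at this
  simpa using this

/-- Local polynomial approximation of a function in `H^t`, `t > d/2`, uniformly over balls, in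
`L²`. -/
theorem exists_local_approx {d : ℕ} (hd : 1 ≤ d) (m : ℕ) {t A : ℝ} (ht : (d : ℝ) / 2 < t)
    (hA : 1 ≤ A) :
    ∃ C : ℝ, 0 < C ∧ ∀ h : ℝ, 0 < h → h ≤ 1 → ∀ γ : E d → ℂ, AEStronglyMeasurable γ →
    energy t γ < ∞ →
    ∃ F : E d → ℝ≥0∞, Measurable F ∧
      ∫⁻ x, F x ≤ ENNReal.ofReal (C * h ^ (2 * min (m : ℝ) t)) * energy t γ ∧
      ∀ x v, ‖v‖ ≤ A * h → ‖𝓕⁻ γ (x + v) - taylorPoly (band (-1) (1 / h) γ) m x v‖ₑ ^ 2 ≤ F x := by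
  have ht0 : 0 < t := lt_of_le_of_lt (by positivity) ht
  obtain ⟨C₁, hC₁, hlow⟩ := exists_low_approx hd m (t := t) ht0.le hA
  obtain ⟨C₂, hC₂, hhigh⟩ := exists_high_bound hd (t := t) ht hA
  refine ⟨2 * C₁ + 2 * C₂, by positivity, fun h hh h1 γ hm hE => ?_⟩
  have hL2 := memLp_of_energy ht0.le hm hE
  -- The lower limit -1 keeps the frequency 0 in the band, which is thus a closed ball.
  set S : Set (E d) := {η | -1 < ‖η‖ ∧ ‖η‖ ≤ 1 / h} with hS
  have hSm : MeasurableSet S := measurableSet_band _ _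
  set γ₂ : E d → ℂ := Sᶜ.indicator γ with hγ₂
  have hE₁ : energy t (band (-1) (1 / h) γ) ≤ energy t γ :=
    energy_mono fun η => norm_indicator_le_norm_self _ _
  have hE₂ : energy t γ₂ ≤ energy t γ := energy_mono fun η => norm_indicator_le_norm_self _ _
  have hlowB : BandLimited (1 / h) (band (-1) (1 / h) γ) := BandLimited.band hL2
  obtain ⟨F₁, hF₁m, hF₁i, hF₁⟩ := hlow h hh _ hlowB
  have hm₂ : AEStronglyMeasurable γ₂ := hm.indicator hSm.compl
  obtain ⟨F₂, hF₂m, hF₂i, hF₂⟩ := hhigh h hh γ₂ hm₂ (hE₂.trans_lt hE) (by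
    intro η hη
    rw [hγ₂, indicator_of_notMem]
    simp only [hS, mem_compl_iff, mem_ofPred_eq, not_not]
    exact ⟨by linarith [norm_nonneg η], hη⟩)
  refine ⟨fun x => 2 * F₁ x + 2 * F₂ x, (hF₁m.const_mul _).add (hF₂m.const_mul _), ?_, ?_⟩
  · rw [lintegral_add_left (hF₁m.const_mul _), lintegral_const_mul _ hF₁m,
      lintegral_const_mul _ hF₂m]
    calc 2 * (∫⁻ x, F₁ x) + 2 * ∫⁻ x, F₂ x
        ≤ 2 * (ENNReal.ofReal (C₁ * h ^ (2 * min (m : ℝ) t)) * energy t γ) +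
          2 * (ENNReal.ofReal (C₂ * h ^ (2 * min (m : ℝ) t)) * energy t γ) := by
          refine add_le_add (mul_le_mul_right ?_ _) (mul_le_mul_right ?_ _)
          · exact hF₁i.trans (mul_le_mul_right hE₁ _)
          · refine hF₂i.trans (mul_le_mul' (ENNReal.ofReal_le_ofReal ?_) hE₂)
            exact mul_le_mul_of_nonneg_left (Real.rpow_le_rpow_of_exponent_ge hh h1
              (by linarith [min_le_right (m : ℝ) t])) hC₂.le
      _ = _ := by
          rw [add_mul, ENNReal.ofReal_add (by positivity) (by positivity), add_mul, mul_assoc 2 C₁,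
            mul_assoc 2 C₂, ENNReal.ofReal_mul zero_le_two, ENNReal.ofReal_mul zero_le_two,
            ENNReal.ofReal_ofNat, mul_assoc, mul_assoc]
  · intro x v hv
    have hsplit : 𝓕⁻ γ (x + v) = 𝓕⁻ (band (-1) (1 / h) γ) (x + v) + 𝓕⁻ γ₂ (x + v) := by
      rw [fourierInv_eq_mul, fourierInv_eq_mul, fourierInv_eq_mul, ← integral_add]
      · congr 1
        ext η
        rw [← mul_add]
        congr 1
        exact (congrFun (indicator_self_add_compl S γ) η).symm
      · exact integrable_cexp_mul hlowB.integrable _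
      · exact integrable_cexp_mul (integrable_of_energy ht hm₂ (hE₂.trans_lt hE)) _
    rw [hsplit, add_sub_right_comm]
    refine (enorm_add_sq_le _ _).trans
      (add_le_add (mul_le_mul_right (hF₁ x v hv) _) (mul_le_mul_right (hF₂ x v hv) _))

/-! ### Polynomials on the cube -/

/-- The monomial with exponents `β`. -/
def monomial {d m : ℕ} (β : Fin d → Fin m) (v : E d) : ℝ := ∏ i, v i ^ (β i : ℕ)

/-- The polynomials of degree less than `m` in each variable. -/
def polySpace (d m : ℕ) : Submodule ℝ (E d → ℝ) :=
  Submodule.span ℝ (range (monomial : (Fin d → Fin m) → E d → ℝ))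

theorem continuous_monomial {d m : ℕ} (β : Fin d → Fin m) : Continuous (monomial β) := by
  unfold monomial; fun_prop

theorem continuous_of_mem_polySpace {d m : ℕ} {q : E d → ℝ} (hq : q ∈ polySpace d m) :
    Continuous q := by
  induction hq using Submodule.span_induction with
  | mem x h => obtain ⟨β, rfl⟩ := h; exact continuous_monomial β
  | zero => exact continuous_zero
  | add x y _ _ hx hy => exact hx.add hy
  | smul a x _ hx => exact continuous_const.mul hx

theorem mono_mem_polySpace {d m k : ℕ} (hk : k < m) (α : Fin k → Fin d) :
    mono α ∈ polySpace d m := by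
  have hcard : ∀ i, (Finset.univ.filter fun j => α j = i).card < m := fun i =>
    ((Finset.card_le_univ _).trans_eq (Fintype.card_fin k)).trans_lt hk
  apply Submodule.subset_span
  refine ⟨fun i => ⟨_, hcard i⟩, ?_⟩
  ext v
  unfold mono monomial
  rw [← Finset.prod_fiberwise Finset.univ α]
  refine Finset.prod_congr rfl fun i _ => ?_
  rw [Finset.prod_congr rfl (g := fun _ => v i) fun j hj => by rw [(Finset.mem_filter.1 hj).2]]
  simp

theorem re_taylorPoly_mem {d : ℕ} (γ : E d → ℂ) (m : ℕ) (x : E d) :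
    (fun v => (taylorPoly γ m x v).re) ∈ polySpace d m := by
  have : (fun v => (taylorPoly γ m x v).re) = ∑ k ∈ Finset.range m, ∑ α : Fin k → Fin d,
      ((2 * Real.pi * Complex.I) ^ k / (k.factorial : ℂ) * fourierDeriv γ α x).re • mono α := by
    ext v
    simp only [taylorPoly, taylorTerm, Finset.sum_apply, Complex.re_sum, Finset.mul_sum]
    refine Finset.sum_congr rfl fun k _ => Finset.sum_congr rfl fun α _ => ?_
    rw [Pi.smul_apply, smul_eq_mul, mul_left_comm, Complex.re_ofReal_mul, mul_comm]
  rw [this]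
  exact Submodule.sum_mem _ fun k hk => Submodule.sum_mem _ fun α _ =>
    Submodule.smul_mem _ _ (mono_mem_polySpace (Finset.mem_range.1 hk) α)

/-- This allows a cell to be rescaled to the unit cube. Dilations and translations act on each
coordinate separately, so the binomial theorem keeps every degree below m. -/
theorem comp_affine_mem_polySpace {d m : ℕ} {q : E d → ℝ} (hq : q ∈ polySpace d m) (a : ℝ)
    (b : E d) : (fun v => q (a • v + b)) ∈ polySpace d m := by
  induction hq using Submodule.span_induction with
  | mem x h =>
    obtain ⟨β, rfl⟩ := h
    have key : ∀ (i : Fin d) (y : ℝ), (a * y + b i) ^ (β i : ℕ) =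
        ∑ e : Fin m, (a ^ (e : ℕ) * b i ^ ((β i : ℕ) - e) * ((β i : ℕ).choose e)) * y ^ (e : ℕ) := by
      intro i y
      rw [add_pow, Fin.sum_univ_eq_sum_range
        (fun e => (a ^ e * b i ^ ((β i : ℕ) - e) * ((β i : ℕ).choose e)) * y ^ e) m]
      rw [← Finset.sum_subset (Finset.range_subset_range.2 (Nat.succ_le_of_lt (β i).2))]
      · refine Finset.sum_congr rfl fun e _ => ?_
        rw [mul_pow]; ring
      · intro e _ he
        rw [Finset.mem_range, not_lt] at he
        rw [Nat.choose_eq_zero_of_lt (by omega)]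
        simp
    have : (fun v => monomial β (a • v + b)) = ∑ ε : Fin d → Fin m,
        (∏ i, (a ^ (ε i : ℕ) * b i ^ ((β i : ℕ) - ε i) * ((β i : ℕ).choose (ε i)))) •
          monomial ε := by
      ext v
      simp only [monomial, PiLp.add_apply, PiLp.smul_apply, smul_eq_mul, key, Finset.sum_apply,
        Pi.smul_apply]
      rw [Finset.prod_univ_sum]
      simp only [Fintype.piFinset_univ, Finset.prod_mul_distrib]
    rw [this]
    exact Submodule.sum_mem _ fun ε _ => Submodule.smul_mem _ _ (Submodule.subset_span ⟨ε, rfl⟩)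
  | zero => exact Submodule.zero_mem _
  | add x y _ _ hx hy => exact Submodule.add_mem _ hx hy
  | smul c x _ hx => exact Submodule.smul_mem _ c hx

/-! ### The cube -/

theorem isClosed_cube (d : ℕ) : IsClosed (cube d) := by
  have : cube d = ⋂ i, {x : E d | x i ∈ Icc (0 : ℝ) 1} := by
    ext x; simp [cube]
  rw [this]
  exact isClosed_iInter fun i => isClosed_Icc.preimage (by fun_prop)

theorem measurableSet_cube (d : ℕ) : MeasurableSet (cube d) := (isClosed_cube d).measurableSet

theorem isCompact_cube (d : ℕ) : IsCompact (cube d) := by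
  refine Metric.isCompact_of_isClosed_isBounded (isClosed_cube d)
    ((Metric.isBounded_iff_subset_closedBall 0).2 ⟨Real.sqrt d, fun x hx => ?_⟩)
  rw [mem_closedBall_zero_iff, EuclideanSpace.norm_eq]
  apply Real.sqrt_le_sqrt
  calc ∑ i, ‖x i‖ ^ 2 ≤ ∑ _i : Fin d, (1 : ℝ) := by
        refine Finset.sum_le_sum fun i _ => ?_
        have := hx i
        rw [Real.norm_of_nonneg this.1]
        exact pow_le_one₀ this.1 this.2
    _ = d := by simp

theorem volume_box {d : ℕ} (s : Fin d → Set ℝ) :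
    volume {x : E d | ∀ i, x i ∈ s i} = ∏ i, volume (s i) := by
  have h := (EuclideanSpace.volume_preserving_symm_measurableEquiv_toLp (Fin d)).symm
  have e : {x : E d | ∀ i, x i ∈ s i} =
      (MeasurableEquiv.toLp 2 (Fin d → ℝ)).symm ⁻¹' (Set.univ.pi s) := by
    ext x; simp [Set.mem_pi]
  rw [e, (EuclideanSpace.volume_preserving_symm_measurableEquiv_toLp
    (Fin d)).measure_preimage_equiv, volume_pi_pi]

theorem volume_cube (d : ℕ) : volume (cube d) = 1 := by
  unfold cube
  rw [volume_box fun _ => Icc (0 : ℝ) 1]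
  simp

instance isProbabilityMeasure_cube (d : ℕ) :
    IsProbabilityMeasure ((volume : Measure (E d)).restrict (cube d)) :=
  ⟨by rw [Measure.restrict_apply_univ, volume_cube]⟩

theorem cube_subset_closure_interior (d : ℕ) : cube d ⊆ closure (interior (cube d)) := by
  have hconv : Convex ℝ (cube d) := by
    intro x hx y hy a b ha hb hab i
    have h1 := hx i
    have h2 := hy i
    simp only [PiLp.add_apply, PiLp.smul_apply, smul_eq_mul, mem_Icc] at *
    constructor
    · nlinarith
    · nlinarith
  have hne : (interior (cube d)).Nonempty := by
    refine ⟨WithLp.toLp 2 fun _ => (1 / 2 : ℝ), ?_⟩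
    rw [mem_interior]
    refine ⟨⋂ i, {x : E d | x i ∈ Ioo (0 : ℝ) 1}, ?_, ?_, ?_⟩
    · intro x hx i
      exact Ioo_subset_Icc_self (mem_iInter.1 hx i)
    · exact isOpen_iInter_of_finite fun i => isOpen_Ioo.preimage (by fun_prop)
    · simp only [mem_iInter, mem_ofPred_eq]
      intro i
      constructor <;> norm_num
  rw [hconv.closure_interior_eq_closure_of_nonempty_interior hne]
  exact subset_closure

/-- The cube lies in the closure of its interior, so a null set cannot contain a nonempty relatively
open part of it. This makes continuous versions unique, boundary included. -/
theorem eqOn_cube_of_ae {d : ℕ} {Y : Type*} [TopologicalSpace Y] [T2Space Y] {f g : E d → Y}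
    (h : f =ᵐ[volume.restrict (cube d)] g)
    (hf : ContinuousOn f (cube d)) (hg : ContinuousOn g (cube d)) : EqOn f g (cube d) :=
  Measure.eqOn_of_ae_eq h hf hg (cube_subset_closure_interior d)

/-! ### Norm equivalence for polynomials on the cube -/

theorem memLp_of_continuous_cube {d : ℕ} {q : E d → ℝ} (hq : ContinuousOn q (cube d)) :
    MemLp q 2 (volume.restrict (cube d)) := by
  obtain ⟨C, hC⟩ := (isCompact_cube d).exists_bound_of_continuousOn hq
  refine MemLp.of_bound (hq.aestronglyMeasurable (measurableSet_cube d)) C ?_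
  filter_upwards [ae_restrict_mem (measurableSet_cube d)] with x hx using hC x hx

/-- Every polynomial can be written on the cube with coefficients controlled by its `L²`-norm. -/
theorem exists_coeff_bound (d m : ℕ) : ∃ C : ℝ, 0 ≤ C ∧ ∀ q ∈ polySpace d m,
    ∃ c : (Fin d → Fin m) → ℝ, (∀ x ∈ cube d, q x = ∑ β, c β * monomial β x) ∧
      ∀ β, |c β| ≤ C * Real.sqrt (∫ x in cube d, q x ^ 2) := by
  have hmem : ∀ β : Fin d → Fin m, MemLp (monomial β) 2 (volume.restrict (cube d)) := fun β =>
    memLp_of_continuous_cube (continuous_monomial β).continuousOn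
  let Λ : ((Fin d → Fin m) → ℝ) →ₗ[ℝ] Lp ℝ 2 ((volume : Measure (E d)).restrict (cube d)) :=
    Fintype.linearCombination ℝ fun β => (hmem β).toLp
  -- A linear right inverse on the finite-dimensional range is automatically bounded, and its norm
  -- is the constant sought. Linear independence of the monomials is not needed.
  obtain ⟨s, hs⟩ := Λ.rangeRestrict.exists_rightInverse_of_surjective
    (LinearMap.range_eq_top.2 Λ.surjective_rangeRestrict)
  have hΛ : ∀ c, Λ c =ᵐ[volume.restrict (cube d)] fun x => ∑ β, c β * monomial β x := by
    intro c
    have h1 : Λ c = ∑ β, c β • (hmem β).toLp := by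
      simp [Λ, Fintype.linearCombination_apply]
    rw [h1]
    have h2 : ∀ β, (c β • (hmem β).toLp : Lp ℝ 2 ((volume : Measure (E d)).restrict (cube d)))
        =ᵐ[volume.restrict (cube d)] fun x => c β * monomial β x := by
      intro β
      filter_upwards [Lp.coeFn_smul (c β) (hmem β).toLp, (hmem β).coeFn_toLp] with x h1 h2
      rw [h1, Pi.smul_apply, h2, smul_eq_mul]
    filter_upwards [Lp.coeFn_finsetSum Finset.univ (fun β => c β • (hmem β).toLp),
      ae_all_iff.2 h2] with x hx hx2
    rw [hx, Finset.sum_apply]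
    exact Finset.sum_congr rfl fun β _ => hx2 β
  have hcont : ∀ c : (Fin d → Fin m) → ℝ, Continuous fun x => ∑ β, c β * monomial β x := fun c =>
    continuous_finsetSum _ fun β _ => continuous_const.mul (continuous_monomial β)
  set S := LinearMap.toContinuousLinearMap s
  refine ⟨‖S‖, ContinuousLinearMap.opNorm_nonneg S, fun q hq => ?_⟩
  have hq' : ∃ c : (Fin d → Fin m) → ℝ, q = fun x => ∑ β, c β * monomial β x := by
    obtain ⟨c, hc⟩ := (Submodule.mem_span_range_iff_exists_fun ℝ).1 hq
    refine ⟨c, ?_⟩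
    rw [← hc]
    ext x
    simp
  obtain ⟨c₀, hc₀⟩ := hq'
  set w := Λ.rangeRestrict c₀ with hw
  have hws : Λ (S w) = Λ c₀ := by
    have := congrArg (fun f => (f w : Lp ℝ 2 ((volume : Measure (E d)).restrict (cube d)))) hs
    simpa [hw, S] using this
  refine ⟨S w, ?_, ?_⟩
  · rw [hc₀]
    refine eqOn_cube_of_ae ?_ (hcont c₀).continuousOn (hcont (S w)).continuousOn
    filter_upwards [hΛ c₀, hΛ (S w)] with x h1 h2
    rw [← h1, ← h2, hws]
  · intro β
    have h1 : |S w β| ≤ ‖S w‖ := norm_le_pi_norm (S w) β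
    refine h1.trans ((S.le_opNorm w).trans_eq ?_)
    congr 1
    have h2 : ‖w‖ = ‖Λ c₀‖ := rfl
    rw [h2, ← Real.sqrt_sq (norm_nonneg (Λ c₀)), ← real_inner_self_eq_norm_sq, L2.inner_def]
    congr 1
    refine integral_congr_ae ?_
    filter_upwards [hΛ c₀] with x hx
    rw [hx, hc₀]
    simp [sq]

theorem exists_poly_sup_bound (d m : ℕ) : ∃ C : ℝ, 0 < C ∧ ∀ q ∈ polySpace d m,
    ∀ x ∈ cube d, q x ^ 2 ≤ C * ∫ x in cube d, q x ^ 2 := by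
  obtain ⟨C, hC, h⟩ := exists_coeff_bound d m
  set N : ℝ := (Fintype.card (Fin d → Fin m) : ℝ)
  refine ⟨(N * C) ^ 2 + 1, by positivity, fun q hq x hx => ?_⟩
  obtain ⟨c, hc, hb⟩ := h q hq
  have hI : 0 ≤ ∫ x in cube d, q x ^ 2 := integral_nonneg fun x => sq_nonneg _
  have h1 : |q x| ≤ N * C * Real.sqrt (∫ x in cube d, q x ^ 2) := by
    rw [hc x hx]
    refine (Finset.abs_sum_le_sum_abs _ _).trans ?_
    calc ∑ β, |c β * monomial β x| ≤ ∑ _β : Fin d → Fin m, C * Real.sqrt (∫ x in cube d, q x ^ 2) := by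
          refine Finset.sum_le_sum fun β _ => ?_
          rw [abs_mul]
          have : |monomial β x| ≤ 1 := by
            unfold monomial
            rw [Finset.abs_prod]
            refine Finset.prod_le_one (fun _ _ => abs_nonneg _) fun i _ => ?_
            rw [abs_pow, abs_of_nonneg (hx i).1]
            exact pow_le_one₀ (hx i).1 (hx i).2
          calc |c β| * |monomial β x| ≤ |c β| * 1 := by gcongr
            _ ≤ _ := by rw [mul_one]; exact hb β
      _ = _ := by simp [N, mul_assoc]
  calc q x ^ 2 = |q x| ^ 2 := (sq_abs _).symm
    _ ≤ (N * C * Real.sqrt (∫ x in cube d, q x ^ 2)) ^ 2 := by gcongr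
    _ = (N * C) ^ 2 * ∫ x in cube d, q x ^ 2 := by rw [mul_pow, Real.sq_sqrt hI]
    _ ≤ _ := by nlinarith

/-- The finitely many monomials are uniformly continuous on the cube and the coefficients are
controlled by the L²-norm. This fixes the refinement K in terms of d and m alone; the factor 1/4 is
small enough to be absorbed in `integral_poly_sq_le`. -/
theorem exists_poly_osc_bound (d m : ℕ) : ∃ K : ℕ, 1 ≤ K ∧ ∀ q ∈ polySpace d m,
    ∀ x ∈ cube d, ∀ y ∈ cube d, (∀ i, |x i - y i| ≤ 1 / K) →
      (q x - q y) ^ 2 ≤ 1 / 4 * ∫ x in cube d, q x ^ 2 := by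
  obtain ⟨C, hC, h⟩ := exists_coeff_bound d m
  set N : ℝ := (Fintype.card (Fin d → Fin m) : ℝ)
  set ε : ℝ := 1 / (2 * (N * C + 1)) with hε
  have hNC : 0 ≤ N * C := by positivity
  have hε0 : 0 < ε := by positivity
  have hu : ∀ β : Fin d → Fin m, ∃ δ > 0, ∀ x ∈ cube d, ∀ y ∈ cube d, dist x y < δ →
      |monomial β x - monomial β y| < ε := by
    intro β
    have := (isCompact_cube d).uniformContinuousOn_of_continuous
      (continuous_monomial β).continuousOn
    rw [Metric.uniformContinuousOn_iff] at this
    exact this ε hε0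
  choose δ hδ hδε using hu
  obtain ⟨δ₀, hδ₀, hδle⟩ : ∃ δ₀ : ℝ, 0 < δ₀ ∧ ∀ β, δ₀ ≤ δ β := by
    rcases isEmpty_or_nonempty (Fin d → Fin m) with he | he
    · exact ⟨1, one_pos, fun β => he.elim β⟩
    · obtain ⟨β₀, hβ₀⟩ := Finite.exists_min δ
      exact ⟨δ β₀, hδ β₀, hβ₀⟩
  obtain ⟨K, hK⟩ := exists_nat_gt (Real.sqrt d / δ₀)
  have hK0 : (0 : ℝ) < K := lt_of_le_of_lt (by positivity) hK
  refine ⟨K, by exact_mod_cast hK0, fun q hq x hx y hy hxy => ?_⟩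
  obtain ⟨c, hc, hb⟩ := h q hq
  set I := ∫ x in cube d, q x ^ 2 with hI'
  have hI : 0 ≤ I := integral_nonneg fun x => sq_nonneg _
  have hdist : dist x y < δ₀ := by
    rw [EuclideanSpace.dist_eq]
    have : ∑ i, dist (x i) (y i) ^ 2 ≤ d * (1 / K : ℝ) ^ 2 := by
      calc ∑ i, dist (x i) (y i) ^ 2 ≤ ∑ _i : Fin d, (1 / K : ℝ) ^ 2 := by
            gcongr with i
            exact hxy i
        _ = _ := by simp
    refine (Real.sqrt_le_sqrt this).trans_lt ?_
    rw [Real.sqrt_mul (by positivity), Real.sqrt_sq (by positivity), mul_one_div,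
      div_lt_iff₀ hK0, mul_comm, ← div_lt_iff₀ hδ₀]
    exact hK
  have h1 : |q x - q y| ≤ 1 / 2 * Real.sqrt I := by
    rw [hc x hx, hc y hy, ← Finset.sum_sub_distrib]
    refine (Finset.abs_sum_le_sum_abs _ _).trans ?_
    calc ∑ β, |c β * monomial β x - c β * monomial β y|
        ≤ ∑ _β : Fin d → Fin m, C * Real.sqrt I * ε := by
          refine Finset.sum_le_sum fun β _ => ?_
          rw [← mul_sub, abs_mul]
          exact mul_le_mul (hb β) (hδε β x hx y hy (hdist.trans_le (hδle β))).le (abs_nonneg _)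
            (by positivity)
      _ = N * C * ε * Real.sqrt I := by simp [N]; ring
      _ ≤ _ := by
          gcongr
          rw [hε, mul_one_div, div_le_div_iff₀ (by positivity) (by norm_num)]
          linarith
  calc (q x - q y) ^ 2 = |q x - q y| ^ 2 := (sq_abs _).symm
    _ ≤ (1 / 2 * Real.sqrt I) ^ 2 := by gcongr
    _ = _ := by rw [mul_pow, Real.sq_sqrt hI]; norm_num

/-! ### Sampling inequalities -/

/-- The cell with index `k` of the grid of mesh `1 / M`. -/
def cell {d : ℕ} (M : ℕ) (k : Fin d → Fin M) : Set (E d) :=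
  {x | ∀ i, x i ∈ Ico ((k i : ℝ) / M) (((k i : ℝ) + 1) / M)}

/-- The closure of `cell M k`. -/
def closedCell {d : ℕ} (M : ℕ) (k : Fin d → Fin M) : Set (E d) :=
  {x | ∀ i, x i ∈ Icc ((k i : ℝ) / M) (((k i : ℝ) + 1) / M)}

/-- The subcell with index `l` of `cell M k`, of side `1 / (M K)`. -/
def fineCell {d : ℕ} (M K : ℕ) (k : Fin d → Fin M) (l : Fin d → Fin K) : Set (E d) :=
  {x | ∀ i, M * x i - k i ∈ Ico ((l i : ℝ) / K) (((l i : ℝ) + 1) / K)}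

theorem measurableSet_coord {d : ℕ} {s : Fin d → Set ℝ} (hs : ∀ i, MeasurableSet (s i)) :
    MeasurableSet {x : E d | ∀ i, x i ∈ s i} := by
  have : {x : E d | ∀ i, x i ∈ s i} = ⋂ i, (fun x : E d => x i) ⁻¹' s i := by ext x; simp
  rw [this]
  exact MeasurableSet.iInter fun i => (hs i).preimage (by fun_prop)

theorem volume_cell {d M : ℕ} (hM : 1 ≤ M) (k : Fin d → Fin M) :
    volume (cell M k) = ENNReal.ofReal ((M : ℝ)⁻¹ ^ d) := by
  unfold cell
  rw [volume_box fun i => Ico ((k i : ℝ) / M) (((k i : ℝ) + 1) / M)]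
  have : ∀ i, ((k i : ℝ) + 1) / M - (k i : ℝ) / M = (M : ℝ)⁻¹ := fun i => by ring
  simp only [Real.volume_Ico, this]
  rw [Finset.prod_const, ENNReal.ofReal_pow (by positivity)]
  simp

theorem volume_closedCell {d M : ℕ} (hM : 1 ≤ M) (k : Fin d → Fin M) :
    volume (closedCell M k) = ENNReal.ofReal ((M : ℝ)⁻¹ ^ d) := by
  unfold closedCell
  rw [volume_box fun i => Icc ((k i : ℝ) / M) (((k i : ℝ) + 1) / M)]
  have : ∀ i, ((k i : ℝ) + 1) / M - (k i : ℝ) / M = (M : ℝ)⁻¹ := fun i => by ring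
  simp only [Real.volume_Icc, this]
  rw [Finset.prod_const, ENNReal.ofReal_pow (by positivity)]
  simp

theorem closedCell_subset_cube {d M : ℕ} (k : Fin d → Fin M) : closedCell M k ⊆ cube d := by
  intro x hx i
  have hM : (0 : ℝ) < M := by
    have := (k i).2
    exact_mod_cast (Nat.zero_le _).trans_lt this
  have h1 : (k i : ℝ) + 1 ≤ M := by exact_mod_cast (k i).2
  refine ⟨le_trans (by positivity) (hx i).1, (hx i).2.trans ?_⟩
  rw [div_le_one hM]; exact h1

theorem exists_mem_closedCell {d M : ℕ} (hM : 1 ≤ M) {x : E d} (hx : x ∈ cube d) :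
    ∃ k, x ∈ closedCell M k := by
  have hM' : (0 : ℝ) < M := by exact_mod_cast hM
  have : ∀ i, ∃ k : Fin M, x i ∈ Icc ((k : ℝ) / M) (((k : ℝ) + 1) / M) := by
    intro i
    have h0 := (hx i).1
    have h1 := (hx i).2
    by_cases hlt : ⌊M * x i⌋₊ < M
    · refine ⟨⟨_, hlt⟩, ?_, ?_⟩
      · rw [div_le_iff₀ hM', mul_comm (x i)]; exact Nat.floor_le (by positivity)
      · rw [le_div_iff₀ hM', mul_comm (x i)]; exact (Nat.lt_floor_add_one _).le
    · have hge : (M : ℝ) ≤ M * x i :=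
        (Nat.cast_le.2 (not_lt.1 hlt)).trans (Nat.floor_le (by positivity))
      have hx1 : x i = 1 := by nlinarith
      refine ⟨⟨M - 1, by omega⟩, ?_⟩
      have e : ((M - 1 : ℕ) : ℝ) = M - 1 := by push_cast [hM]; ring
      simp only [e, hx1]
      constructor
      · rw [div_le_one hM']; linarith
      · rw [le_div_iff₀ hM']; linarith
  choose k hk using this
  exact ⟨k, hk⟩

theorem cube_subset_iUnion_closedCell {d M : ℕ} (hM : 1 ≤ M) :
    cube d ⊆ ⋃ k, closedCell M k := fun _ hx => mem_iUnion.2 (exists_mem_closedCell hM hx)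

theorem mem_closedCell_of_mem_fineCell {d M K : ℕ} (hM : 1 ≤ M) {k : Fin d → Fin M}
    {l : Fin d → Fin K} {x : E d} (hx : x ∈ fineCell M K k l) : x ∈ closedCell M k := by
  have hM' : (0 : ℝ) < M := by exact_mod_cast hM
  intro i
  obtain ⟨h1, h2⟩ := hx i
  have hK' : (0 : ℝ) < K := by
    have := (l i).2
    exact_mod_cast (Nat.zero_le _).trans_lt this
  have h3 : ((l i : ℝ) + 1) / K ≤ 1 := by
    rw [div_le_one hK']; exact_mod_cast (l i).2
  have h4 : 0 ≤ (l i : ℝ) / K := by positivity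
  constructor
  · rw [div_le_iff₀ hM']; linarith
  · rw [le_div_iff₀ hM']; linarith

theorem div_floor_unique {K : ℕ} {a b : Fin K} {y : ℝ}
    (ha : y ∈ Ico ((a : ℝ) / K) (((a : ℝ) + 1) / K))
    (hb : y ∈ Ico ((b : ℝ) / K) (((b : ℝ) + 1) / K)) : a = b := by
  have hK : (0 : ℝ) < K := by
    have := a.2
    exact_mod_cast (Nat.zero_le _).trans_lt this
  have key : ∀ {a b : Fin K}, y ∈ Ico ((a : ℝ) / K) (((a : ℝ) + 1) / K) →
      y ∈ Ico ((b : ℝ) / K) (((b : ℝ) + 1) / K) → a ≤ b := by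
    intro a b ha hb
    have h := ha.1.trans_lt hb.2
    rw [div_lt_div_iff_of_pos_right hK] at h
    have : (a : ℕ) < b + 1 := by exact_mod_cast h
    exact Fin.le_def.2 (by omega)
  exact le_antisymm (key ha hb) (key hb ha)

theorem cell_unique {d M : ℕ} {k k' : Fin d → Fin M} {x : E d} (h : x ∈ cell M k)
    (h' : x ∈ cell M k') : k = k' :=
  funext fun i => div_floor_unique (h i) (h' i)

theorem fineCell_unique {d M K : ℕ} (hM : 1 ≤ M) {k k' : Fin d → Fin M} {l l' : Fin d → Fin K}
    {x : E d} (h : x ∈ fineCell M K k l) (h' : x ∈ fineCell M K k' l') : (k, l) = (k', l') := by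
  have hM' : (0 : ℝ) < M := by exact_mod_cast hM
  have hcell : ∀ {k : Fin d → Fin M} {l : Fin d → Fin K}, x ∈ fineCell M K k l → x ∈ cell M k := by
    intro k l h i
    obtain ⟨h1, h2⟩ := h i
    have hK' : (0 : ℝ) < K := by
      have := (l i).2
      exact_mod_cast (Nat.zero_le _).trans_lt this
    have h3 : ((l i : ℝ) + 1) / K ≤ 1 := by
      rw [div_le_one hK']; exact_mod_cast (l i).2
    have h4 : 0 ≤ (l i : ℝ) / K := by positivity
    constructor
    · rw [div_le_iff₀ hM']; linarith
    · rw [lt_div_iff₀ hM']; linarith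
  have hk := cell_unique (hcell h) (hcell h')
  subst hk
  exact Prod.ext rfl (funext fun i => div_floor_unique (h i) (h' i))

/-- One value per subcell determines the L²-norm: q(x)² ≤ 2 q(u)² + 2 (q(x) - q(u))² on each
subcell, and the oscillation terms add up to at most half of the integral, which is moved to the
left. -/
theorem integral_poly_sq_le {d m K : ℕ} (hK : 1 ≤ K) {q : E d → ℝ} (hq : q ∈ polySpace d m)
    (hosc : ∀ x ∈ cube d, ∀ y ∈ cube d, (∀ i, |x i - y i| ≤ 1 / K) →
      (q x - q y) ^ 2 ≤ 1 / 4 * ∫ x in cube d, q x ^ 2)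
    (u : (Fin d → Fin K) → E d) (hu : ∀ l, u l ∈ closedCell K l) :
    ∫ x in cube d, q x ^ 2 ≤ 4 * ∑ l, (K : ℝ)⁻¹ ^ d * q (u l) ^ 2 := by
  have hK' : (0 : ℝ) < K := by exact_mod_cast hK
  set I := ∫ x in cube d, q x ^ 2 with hI
  have hI0 : 0 ≤ I := integral_nonneg fun x => sq_nonneg _
  have hint : Integrable (fun x => q x ^ 2) (volume.restrict (cube d)) :=
    (memLp_of_continuous_cube (continuous_of_mem_polySpace hq).continuousOn).integrable_sq
  have h1 : ENNReal.ofReal I ≤ ∑ l : Fin d → Fin K,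
      ENNReal.ofReal ((K : ℝ)⁻¹ ^ d * (2 * q (u l) ^ 2 + 1 / 2 * I)) := by
    rw [hI, ofReal_integral_eq_lintegral_ofReal hint (ae_of_all _ fun x => sq_nonneg _)]
    calc ∫⁻ x in cube d, ENNReal.ofReal (q x ^ 2)
        ≤ ∫⁻ x in ⋃ l, closedCell K l, ENNReal.ofReal (q x ^ 2) :=
          lintegral_mono_set (cube_subset_iUnion_closedCell hK)
      _ ≤ ∑' l, ∫⁻ x in closedCell K l, ENNReal.ofReal (q x ^ 2) := lintegral_iUnion_le _ _
      _ = ∑ l, ∫⁻ x in closedCell K l, ENNReal.ofReal (q x ^ 2) := tsum_fintype _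
      _ ≤ _ := by
          refine Finset.sum_le_sum fun l _ => ?_
          calc ∫⁻ x in closedCell K l, ENNReal.ofReal (q x ^ 2)
              ≤ ∫⁻ x in closedCell K l, ENNReal.ofReal (2 * q (u l) ^ 2 + 1 / 2 * I) := by
                refine setLIntegral_mono measurable_const fun x hx => ENNReal.ofReal_le_ofReal ?_
                have := hosc x (closedCell_subset_cube l hx) (u l)
                  (closedCell_subset_cube l (hu l)) (fun i => by
                    have h1 := hx i
                    have h2 := hu l i
                    rw [mem_Icc, add_div] at h1 h2
                    rw [abs_le]; constructor <;> linarith)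
                nlinarith [sq_nonneg (q x - 2 * q (u l))]
            _ = _ := by
                rw [setLIntegral_const, volume_closedCell hK, mul_comm,
                  ← ENNReal.ofReal_mul (by positivity)]
  rw [← ENNReal.ofReal_sum_of_nonneg fun l _ => by positivity] at h1
  rw [ENNReal.ofReal_le_ofReal_iff (Finset.sum_nonneg fun l _ => by positivity)] at h1
  have h2 : ∑ l : Fin d → Fin K, (K : ℝ)⁻¹ ^ d * (2 * q (u l) ^ 2 + 1 / 2 * I) =
      2 * ∑ l : Fin d → Fin K, (K : ℝ)⁻¹ ^ d * q (u l) ^ 2 + 1 / 2 * I := by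
    simp only [mul_add, Finset.sum_add_distrib, Finset.mul_sum, Finset.sum_const,
      Finset.card_univ, Fintype.card_fun, Fintype.card_fin, nsmul_eq_mul]
    congr 1
    · exact Finset.sum_congr rfl fun l _ => by ring
    · push_cast
      rw [inv_pow]
      field_simp
  rw [h2] at h1
  linarith

/-- The function on `ℝ^d` with Fourier transform `γ`, or rather its real part. -/
def realSynth {d : ℕ} (γ : E d → ℂ) (x : E d) : ℝ := (𝓕⁻ γ x).re

/-- If every subcell contains its share of the sample points, then the values of a function in
`H^t` on each cell are controlled by its values at the sample points and its norm. -/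
theorem exists_sampling_bound {d : ℕ} (hd : 1 ≤ d) {m : ℕ} {t c₀ : ℝ} (ht : (d : ℝ) / 2 < t)
    (hm : t ≤ m) (hc₀ : 0 < c₀) : ∃ K : ℕ, 1 ≤ K ∧ ∃ C : ℝ, 0 < C ∧
    ∀ M : ℕ, 1 ≤ M → ∀ γ : E d → ℂ, AEStronglyMeasurable γ → energy t γ < ∞ →
    ∀ n : ℕ, 1 ≤ n → ∀ X : Fin n → E d,
    (∀ k : Fin d → Fin M, ∀ l : Fin d → Fin K, c₀ * n / ((M : ℝ) * K) ^ d ≤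
      Nat.card {i // X i ∈ fineCell M K k l}) →
    ∃ b : (Fin d → Fin M) → ℝ≥0∞,
      (∀ k, ∀ x ∈ closedCell M k, ENNReal.ofReal (realSynth γ x ^ 2) ≤ b k) ∧
      ENNReal.ofReal ((M : ℝ)⁻¹ ^ d) * ∑ k, b k ≤
        ENNReal.ofReal C * (ENNReal.ofReal (1 / n * ∑ i, realSynth γ (X i) ^ 2) +
          ENNReal.ofReal ((M : ℝ) ^ (-(2 * t))) * energy t γ) := by
  classical
  have hd' : (1 : ℝ) ≤ d := by exact_mod_cast hd
  have hsd : 1 ≤ Real.sqrt d := Real.one_le_sqrt.2 hd'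
  have ht0 : 0 < t := lt_of_le_of_lt (by positivity) ht
  -- The dilation factor √d is the diameter of the unit cube: an expansion around any point of a
  -- cell of side 1/M is valid on the whole cell.
  obtain ⟨C₁, hC₁, hloc⟩ := exists_local_approx hd m ht hsd
  obtain ⟨C₂, hC₂, hsup⟩ := exists_poly_sup_bound d m
  obtain ⟨K, hK, hosc⟩ := exists_poly_osc_bound d m
  have hK' : (0 : ℝ) < K := by exact_mod_cast hK
  set C₃ : ℝ := 16 * C₂ with hC₃
  set C₄ : ℝ := 16 * C₂ + 2 with hC₄
  refine ⟨K, hK, C₃ / c₀ + C₄ * C₁, by positivity,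
    fun M hM γ hγ hE n hn X hX => ?_⟩
  have hM' : (0 : ℝ) < M := by exact_mod_cast hM
  have hM1 : (1 : ℝ) ≤ M := by exact_mod_cast hM
  have hn' : (0 : ℝ) < n := by exact_mod_cast hn
  obtain ⟨F, hFm, hFi, hF⟩ := hloc (1 / M) (by positivity) (by
    rw [div_le_one hM']; exact hM1) γ hγ hE
  have hFfin : ∫⁻ x, F x < ∞ := hFi.trans_lt (ENNReal.mul_lt_top ENNReal.ofReal_lt_top hE)
  set P : E d → E d → ℂ := taylorPoly (band (-1) (1 / (1 / (M : ℝ))) γ) m with hP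
  set g := realSynth γ with hg
  -- a good expansion point in every cell
  have hpt : ∀ k : Fin d → Fin M, ∃ x ∈ cell M k,
      ENNReal.ofReal ((M : ℝ)⁻¹ ^ d) * F x ≤ ∫⁻ x in cell M k, F x := by
    intro k
    by_contra hcon
    push Not at hcon
    have hvol := volume_cell (d := d) hM k
    have hpos : 0 < ENNReal.ofReal ((M : ℝ)⁻¹ ^ d) := by
      rw [ENNReal.ofReal_pos]; positivity
    have hmeas : MeasurableSet (cell M k) := measurableSet_coord fun _ => measurableSet_Ico
    have hne : (cell M k).Nonempty := by
      by_contra h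
      rw [not_nonempty_iff_eq_empty] at h
      rw [h, measure_empty] at hvol
      exact hpos.ne hvol
    obtain ⟨x, hx, hle⟩ := exists_le_setLAverage (μ := volume) (s := cell M k) (f := F)
      (by rw [hvol]; exact hpos.ne') (by rw [hvol]; exact ENNReal.ofReal_ne_top)
      hFm.aemeasurable
    have := hcon x hx
    rw [setLAverage_eq, hvol] at hle
    have h2 := mul_le_mul_right hle (ENNReal.ofReal ((M : ℝ)⁻¹ ^ d))
    rw [ENNReal.mul_div_cancel hpos.ne' ENNReal.ofReal_ne_top] at h2
    exact absurd this (not_lt.2 h2)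
  choose z hz hzF using hpt
  have hFz : ∀ k, F (z k) < ∞ := by
    intro k
    have h1 : ENNReal.ofReal ((M : ℝ)⁻¹ ^ d) * F (z k) < ∞ :=
      ((hzF k).trans (setLIntegral_le_lintegral _ _)).trans_lt hFfin
    refine ENNReal.lt_top_of_mul_ne_top_right h1.ne ?_
    simp only [ne_eq, ENNReal.ofReal_eq_zero, not_le]
    positivity
  set f : (Fin d → Fin M) → ℝ := fun k => (F (z k)).toReal with hf
  -- the polynomial on the cell
  set p : (Fin d → Fin M) → E d → ℝ := fun k x => (P (z k) (x - z k)).re with hp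
  have happrox : ∀ k, ∀ x ∈ closedCell M k, (g x - p k x) ^ 2 ≤ f k := by
    intro k x hx
    have hdist : ‖x - z k‖ ≤ Real.sqrt d * (1 / M) := by
      rw [EuclideanSpace.norm_eq]
      have : ∑ i, ‖(x - z k) i‖ ^ 2 ≤ d * (1 / M : ℝ) ^ 2 := by
        calc ∑ i, ‖(x - z k) i‖ ^ 2 ≤ ∑ _i : Fin d, (1 / M : ℝ) ^ 2 := by
              gcongr with i
              have h1 := hx i
              have h2 := hz k i
              rw [mem_Icc, add_div] at h1
              rw [mem_Ico, add_div] at h2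
              rw [PiLp.sub_apply, Real.norm_eq_abs, abs_le]
              constructor <;> linarith
          _ = _ := by simp
      refine (Real.sqrt_le_sqrt this).trans_eq ?_
      rw [Real.sqrt_mul (by positivity), Real.sqrt_sq (by positivity)]
    have h1 := hF (z k) (x - z k) hdist
    rw [add_sub_cancel] at h1
    have h2 : (g x - p k x) ^ 2 ≤ ‖𝓕⁻ γ x - P (z k) (x - z k)‖ ^ 2 := by
      rw [← sq_abs]
      gcongr
      simp only [hg, hp, realSynth]
      rw [← Complex.sub_re]
      exact Complex.abs_re_le_norm _
    refine h2.trans ?_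
    rw [hf, ← ENNReal.ofReal_le_iff_le_toReal (hFz k).ne, ENNReal.ofReal_pow (norm_nonneg _),
      ofReal_norm]
    exact h1
  have hkv : ∀ k : Fin d → Fin M, ∃ b : E d, ∀ i, b i = k i :=
    fun k => ⟨WithLp.toLp 2 fun i => (k i : ℝ), fun i => rfl⟩
  choose kv hkv using hkv
  -- The cell polynomial in the coordinates of the unit cube, where the constants of norm
  -- equivalence do not depend on M or on the cell.
  set q : (Fin d → Fin M) → E d → ℝ := fun k u => p k ((1 / M : ℝ) • u + (1 / M : ℝ) • kv k) with hq
  have hqmem : ∀ k, q k ∈ polySpace d m := by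
    intro k
    have := comp_affine_mem_polySpace (re_taylorPoly_mem (band (-1) (1 / (1 / (M : ℝ))) γ) m (z k))
      (1 / M : ℝ) ((1 / M : ℝ) • kv k - z k)
    convert this using 1
    ext u
    simp only [hq, hp, hP]
    rw [add_sub_assoc]
  have hqp : ∀ k x, p k x = q k ((M : ℝ) • x - kv k) := by
    intro k x
    simp only [hq]
    congr 1
    rw [smul_sub, smul_smul]
    field_simp
    simp
  set I : (Fin d → Fin M) → ℝ := fun k => ∫ u in cube d, q k u ^ 2 with hI
  -- In each subcell take the sample point with the smallest g². The minimum is at most the average,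
  -- and the lower bound on the number of points turns the average into the empirical sum with the
  -- right normalization.
  have hcount : ∀ k l, ∃ i, X i ∈ fineCell M K k l ∧
      g (X i) ^ 2 ≤ (M * K : ℝ) ^ d / (c₀ * n) *
        ∑ j with X j ∈ fineCell M K k l, g (X j) ^ 2 := by
    intro k l
    have hcard : (Nat.card {i // X i ∈ fineCell M K k l} : ℝ) =
        ((Finset.univ.filter fun i => X i ∈ fineCell M K k l).card : ℝ) := by
      rw [Nat.card_eq_fintype_card, Fintype.card_subtype]
    have h1 := hX k l
    rw [hcard] at h1
    have hpos : 0 < c₀ * n / ((M : ℝ) * K) ^ d := by positivity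
    have hne : (Finset.univ.filter fun i => X i ∈ fineCell M K k l).Nonempty := by
      rw [← Finset.card_pos]
      have := hpos.trans_le h1
      exact_mod_cast this
    obtain ⟨i, hi, hmin⟩ := Finset.exists_min_image _ (fun i => g (X i) ^ 2) hne
    refine ⟨i, (Finset.mem_filter.1 hi).2, ?_⟩
    have h2 : c₀ * n / ((M : ℝ) * K) ^ d * g (X i) ^ 2 ≤
        ∑ j with X j ∈ fineCell M K k l, g (X j) ^ 2 := by
      calc c₀ * n / ((M : ℝ) * K) ^ d * g (X i) ^ 2
          ≤ (Finset.univ.filter fun i => X i ∈ fineCell M K k l).card * g (X i) ^ 2 := by gcongr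
        _ = ∑ j with X j ∈ fineCell M K k l, g (X i) ^ 2 := by
            rw [Finset.sum_const, nsmul_eq_mul]
        _ ≤ _ := Finset.sum_le_sum fun j hj => hmin j hj
    calc g (X i) ^ 2 = (M * K : ℝ) ^ d / (c₀ * n) * (c₀ * n / ((M : ℝ) * K) ^ d * g (X i) ^ 2) := by
          field_simp
      _ ≤ _ := by gcongr
  choose ι hι hιle using hcount
  set Sk : (Fin d → Fin M) → ℝ := fun k => ∑ l : Fin d → Fin K,
    ∑ j with X j ∈ fineCell M K k l, g (X j) ^ 2 with hSk
  have hIle : ∀ k, I k ≤ 8 * ((M : ℝ) ^ d / (c₀ * n)) * Sk k + 8 * f k := by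
    intro k
    have h1 := integral_poly_sq_le hK (hqmem k) (hosc _ (hqmem k))
      (fun l => (M : ℝ) • X (ι k l) - kv k) (fun l i => by
        have := hι k l i
        rw [PiLp.sub_apply, PiLp.smul_apply, hkv, smul_eq_mul]
        exact Ico_subset_Icc_self this)
    refine h1.trans ?_
    have h2 : ∀ l, q k ((M : ℝ) • X (ι k l) - kv k) ^ 2 ≤
        2 * ((M * K : ℝ) ^ d / (c₀ * n) * ∑ j with X j ∈ fineCell M K k l, g (X j) ^ 2) +
          2 * f k := by
      intro l
      rw [← hqp]
      have e1 := happrox k _ (mem_closedCell_of_mem_fineCell hM (hι k l))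
      have e2 := hιle k l
      nlinarith [sq_nonneg (2 * g (X (ι k l)) - p k (X (ι k l)))]
    calc 4 * ∑ l, (K : ℝ)⁻¹ ^ d * q k ((M : ℝ) • X (ι k l) - kv k) ^ 2
        ≤ 4 * ∑ l : Fin d → Fin K, (K : ℝ)⁻¹ ^ d * (2 * ((M * K : ℝ) ^ d / (c₀ * n) *
          ∑ j with X j ∈ fineCell M K k l, g (X j) ^ 2) + 2 * f k) := by
          gcongr with l
          exact h2 l
      _ = _ := by
          simp only [mul_add, Finset.sum_add_distrib, Finset.sum_const, Finset.card_univ,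
            Fintype.card_fun, Fintype.card_fin, nsmul_eq_mul, hSk, Finset.mul_sum]
          congr 1
          · refine Finset.sum_congr rfl fun l _ => Finset.sum_congr rfl fun j _ => ?_
            rw [mul_pow, inv_pow]; field_simp; ring
          · push_cast
            rw [inv_pow]; field_simp; ring
  have hgle : ∀ k, ∀ x ∈ closedCell M k,
      g x ^ 2 ≤ C₃ * ((M : ℝ) ^ d / (c₀ * n)) * Sk k + C₄ * f k := by
    intro k x hx
    have e1 := happrox k x hx
    have hcube : (M : ℝ) • x - kv k ∈ cube d := by
      intro i
      have := hx i
      rw [PiLp.sub_apply, PiLp.smul_apply, hkv, smul_eq_mul]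
      rw [mem_Icc, div_le_iff₀ hM', le_div_iff₀ hM'] at this
      constructor <;> linarith
    have e2 : p k x ^ 2 ≤ C₂ * I k := by
      rw [hqp]
      exact hsup _ (hqmem k) _ hcube
    have e3 := mul_le_mul_of_nonneg_left (hIle k) hC₂.le
    have e4 : g x ^ 2 ≤ 2 * p k x ^ 2 + 2 * f k := by nlinarith [sq_nonneg (g x - 2 * p k x)]
    rw [hC₃, hC₄]
    nlinarith
  have hSk0 : ∀ k, 0 ≤ Sk k := fun k =>
    Finset.sum_nonneg fun l _ => Finset.sum_nonneg fun j _ => sq_nonneg _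
  have hf0 : ∀ k, 0 ≤ f k := fun k => ENNReal.toReal_nonneg
  refine ⟨fun k => ENNReal.ofReal (C₃ * ((M : ℝ) ^ d / (c₀ * n)) * Sk k + C₄ * f k),
    fun k x hx => ENNReal.ofReal_le_ofReal (hgle k x hx), ?_⟩
  -- The half-open subcells are disjoint, so each sample point is counted at most once.
  have hsumS : ∑ k, Sk k ≤ ∑ i, g (X i) ^ 2 := by
    simp only [hSk]
    rw [← Fintype.sum_prod_type' (f := fun (k : Fin d → Fin M) (l : Fin d → Fin K) =>
      ∑ j with X j ∈ fineCell M K k l, g (X j) ^ 2)]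
    simp only [Finset.sum_filter]
    rw [Finset.sum_comm]
    refine Finset.sum_le_sum fun j _ => ?_
    by_cases hj : ∃ kl : (Fin d → Fin M) × (Fin d → Fin K), X j ∈ fineCell M K kl.1 kl.2
    · obtain ⟨kl, hkl⟩ := hj
      rw [Finset.sum_eq_single kl]
      · rw [if_pos hkl]
      · intro kl' _ hne
        rw [if_neg]
        exact fun h => hne (fineCell_unique hM h hkl)
      · simp
    · push Not at hj
      rw [Finset.sum_eq_zero fun kl _ => if_neg (hj kl)]
      positivity
  have hsumf : ENNReal.ofReal ((M : ℝ)⁻¹ ^ d * ∑ k, f k) ≤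
      ENNReal.ofReal (C₁ * (M : ℝ) ^ (-(2 * t))) * energy t γ := by
    rw [ENNReal.ofReal_mul (by positivity), ENNReal.ofReal_sum_of_nonneg fun k _ => hf0 k,
      Finset.mul_sum]
    calc ∑ k, ENNReal.ofReal ((M : ℝ)⁻¹ ^ d) * ENNReal.ofReal (f k)
        ≤ ∑ k, ∫⁻ x in cell M k, F x := by
          refine Finset.sum_le_sum fun k _ => ?_
          rw [hf, ENNReal.ofReal_toReal (hFz k).ne]
          exact hzF k
      _ = ∫⁻ x in ⋃ k, cell M k, F x := by
          rw [lintegral_iUnion, tsum_fintype]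
          · exact fun k => measurableSet_coord fun _ => measurableSet_Ico
          · intro k k' hne
            rw [Function.onFun, Set.disjoint_left]
            exact fun x h h' => hne (cell_unique h h')
      _ ≤ ∫⁻ x, F x := setLIntegral_le_lintegral _ _
      _ ≤ _ := by
          refine hFi.trans_eq ?_
          rw [min_eq_right hm, one_div, Real.inv_rpow hM'.le, Real.rpow_neg hM'.le]
  have hnn : ∀ k ∈ (Finset.univ : Finset (Fin d → Fin M)),
      0 ≤ C₃ * ((M : ℝ) ^ d / (c₀ * n)) * Sk k + C₄ * f k := fun k _ => by
    have := hSk0 k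
    have := hf0 k
    positivity
  rw [← ENNReal.ofReal_sum_of_nonneg hnn, ← ENNReal.ofReal_mul (by positivity)]
  have e : (M : ℝ)⁻¹ ^ d * ∑ k, (C₃ * ((M : ℝ) ^ d / (c₀ * n)) * Sk k + C₄ * f k) =
      C₃ / c₀ * (1 / n * ∑ k, Sk k) + C₄ * ((M : ℝ)⁻¹ ^ d * ∑ k, f k) := by
    rw [Finset.sum_add_distrib, ← Finset.mul_sum, ← Finset.mul_sum, inv_pow]
    field_simp
  have hS0 : 0 ≤ ∑ k, Sk k := Finset.sum_nonneg fun k _ => hSk0 k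
  have hf0' : 0 ≤ ∑ k, f k := Finset.sum_nonneg fun k _ => hf0 k
  rw [e, ENNReal.ofReal_add (by positivity) (by positivity), mul_add]
  refine add_le_add ?_ ?_
  · rw [← ENNReal.ofReal_mul (by positivity)]
    apply ENNReal.ofReal_le_ofReal
    have h1 : 1 / (n : ℝ) * ∑ k, Sk k ≤ 1 / n * ∑ i, g (X i) ^ 2 := by gcongr
    have h2 : 0 ≤ 1 / (n : ℝ) * ∑ k, Sk k := by positivity
    calc C₃ / c₀ * (1 / n * ∑ k, Sk k) ≤ C₃ / c₀ * (1 / n * ∑ i, g (X i) ^ 2) := by gcongr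
      _ ≤ _ := by
        gcongr
        have : 0 ≤ C₄ * C₁ := by positivity
        linarith
  · rw [ENNReal.ofReal_mul (by positivity)]
    refine (mul_le_mul_right hsumf _).trans ?_
    rw [ENNReal.ofReal_mul hC₁.le, ← mul_assoc, ← mul_assoc, ← mul_assoc,
      ← ENNReal.ofReal_mul (by positivity)]
    gcongr
    have : 0 ≤ C₃ / c₀ := by positivity
    linarith

/-! ### Regularized least squares in a Hilbert space -/

section Hilbert

variable {H V : Type*} [NormedAddCommGroup H] [InnerProductSpace ℝ H] [CompleteSpace H]
  [NormedAddCommGroup V] [InnerProductSpace ℝ V]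

/-- The regularized empirical risk of `φ` for the functionals `⟪ℓ i, ·⟫` and the responses `y`. -/
def hilbertRidge {n : ℕ} (lam : ℝ) (l : Fin n → H) (y : Fin n → ℝ) (φ : H) : ℝ :=
  (1 / n : ℝ) * ∑ i, (y i - inner ℝ (l i) φ) ^ 2 + lam * ‖φ‖ ^ 2

/-- Lax–Milgram: the penalty makes the form on the left coercive. For w = (1/n) ∑ y_i ℓ_i the
equation is the normal equation of ridge regression. -/
theorem exists_ridge_representer {n : ℕ} {lam : ℝ} (hlam : 0 < lam) (l : Fin n → H) (w : H) :
    ∃ e : H, ∀ φ : H, lam * inner ℝ e φ + (1 / n : ℝ) * ∑ i, inner ℝ (l i) e * inner ℝ (l i) φ =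
      inner ℝ w φ := by
  let B : H →L[ℝ] H →L[ℝ] ℝ := lam • (innerₗ H).mkContinuous₂ 1 (fun x y => by
      rw [one_mul]; exact norm_inner_le_norm x y) +
    (1 / n : ℝ) • ∑ i, (innerSL ℝ (l i)).smulRight (innerSL ℝ (l i))
  have hB : ∀ e φ, B e φ =
      lam * inner ℝ e φ + (1 / n : ℝ) * ∑ i, inner ℝ (l i) e * inner ℝ (l i) φ := by
    intro e φ
    simp [B]
  have hc : IsCoercive B := by
    refine ⟨lam, hlam, fun u => ?_⟩
    rw [hB, real_inner_self_eq_norm_sq]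
    have : 0 ≤ (1 / n : ℝ) * ∑ i, inner ℝ (l i) u * inner ℝ (l i) u :=
      mul_nonneg (by positivity) (Finset.sum_nonneg fun i _ => mul_self_nonneg _)
    nlinarith
  refine ⟨hc.continuousLinearEquivOfBilin.symm w, fun φ => ?_⟩
  rw [← hB, ← hc.continuousLinearEquivOfBilin_apply, ContinuousLinearEquiv.apply_symm_apply]

/-- The solution of the normal equations is the minimizer by convexity of the objective. Its
continuous dependence on design and responses, which coercivity provides, is what makes the
estimator measurable. -/
theorem exists_continuous_ridge (n : ℕ) {lam : ℝ} (hlam : 0 < lam) :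
    ∃ R : (Fin n → H) × (Fin n → ℝ) → H, Continuous R ∧
      ∀ l y ψ, hilbertRidge lam l y (R (l, y)) ≤ hilbertRidge lam l y ψ := by
  choose R hR using fun D : (Fin n → H) × (Fin n → ℝ) =>
    exists_ridge_representer hlam D.1 ((1 / n : ℝ) • ∑ i, D.2 i • D.1 i)
  have hR' : ∀ D φ, lam * inner ℝ (R D) φ + (1 / n : ℝ) * ∑ i, inner ℝ (D.1 i) (R D) *
      inner ℝ (D.1 i) φ = (1 / n : ℝ) * ∑ i, D.2 i * inner ℝ (D.1 i) φ := by
    intro D φ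
    rw [hR, real_inner_smul_left, sum_inner]
    simp_rw [real_inner_smul_left]
  refine ⟨R, ?_, ?_⟩
  · rw [continuous_iff_continuousAt]
    intro D'
    -- The residual that the solution for `D'` leaves in the normal equation for `D`. It is
    -- continuous in `D` and vanishes at `D'`, and coercivity bounds the distance of the two
    -- solutions by its norm.
    let N : (Fin n → H) × (Fin n → ℝ) → H := fun D => (1 / n : ℝ) • ∑ i, D.2 i • D.1 i
      - lam • R D' - (1 / n : ℝ) • ∑ i, (inner ℝ (D.1 i) (R D') : ℝ) • D.1 i
    have hN : Continuous N := by fun_prop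
    have hNi : ∀ D φ, inner ℝ (N D) φ = (1 / n : ℝ) * ∑ i, D.2 i * inner ℝ (D.1 i) φ -
        lam * inner ℝ (R D') φ - (1 / n : ℝ) * ∑ i, inner ℝ (D.1 i) (R D') * inner ℝ (D.1 i) φ := by
      intro D φ
      simp only [N, inner_sub_left, real_inner_smul_left, sum_inner]
    have hN0 : N D' = 0 := by
      refine ext_inner_right ℝ fun φ => ?_
      rw [hNi, inner_zero_left]
      have := hR' D' φ
      linarith
    have key : ∀ D, ‖R D - R D'‖ ≤ lam⁻¹ * ‖N D‖ := by
      intro D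
      set u := R D - R D' with hu
      have h1 : lam * ‖u‖ ^ 2 ≤ inner ℝ (N D) u := by
        have h2 := hR' D u
        have h3 : inner ℝ (R D) u = inner ℝ (R D') u + ‖u‖ ^ 2 := by
          rw [← real_inner_self_eq_norm_sq, ← inner_add_left, hu]; simp
        have h4 : ∀ i, inner ℝ (D.1 i) (R D) = inner ℝ (D.1 i) (R D') + inner ℝ (D.1 i) u := by
          intro i; rw [← inner_add_right, hu]; simp
        rw [hNi, ← h2, h3]
        simp_rw [h4, add_mul, Finset.sum_add_distrib]
        have : 0 ≤ (1 / n : ℝ) * ∑ i, inner ℝ (D.1 i) u * inner ℝ (D.1 i) u :=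
          mul_nonneg (by positivity) (Finset.sum_nonneg fun i _ => mul_self_nonneg _)
        linarith
      have h5 := h1.trans (real_inner_le_norm _ _)
      rcases (norm_nonneg u).eq_or_lt with h0 | h0
      · rw [← h0]; positivity
      · rw [le_inv_mul_iff₀ hlam]
        refine le_of_mul_le_mul_right ?_ h0
        nlinarith
    rw [ContinuousAt, tendsto_iff_norm_sub_tendsto_zero]
    refine squeeze_zero (fun _ => norm_nonneg _) key ?_
    have h0 : Filter.Tendsto (fun D => lam⁻¹ * ‖N D‖) (nhds D') (nhds (lam⁻¹ * ‖N D'‖)) :=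
      (continuous_const.mul hN.norm : Continuous fun D => lam⁻¹ * ‖N D‖).tendsto D'
    simpa [hN0] using h0
  · intro l y ψ
    set φ := R (l, y)
    have h := hR' (l, y) (ψ - φ)
    have h1 : ‖ψ‖ ^ 2 = ‖φ‖ ^ 2 + 2 * inner ℝ φ (ψ - φ) + ‖ψ - φ‖ ^ 2 := by
      rw [← norm_add_sq_real]; simp
    have h2 : ∀ i, (y i - inner ℝ (l i) ψ) ^ 2 = (y i - inner ℝ (l i) φ) ^ 2
        - 2 * (y i * inner ℝ (l i) (ψ - φ)) + 2 * (inner ℝ (l i) φ * inner ℝ (l i) (ψ - φ))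
        + (inner ℝ (l i) (ψ - φ)) ^ 2 := by
      intro i; rw [inner_sub_right]; ring
    simp only at h
    rw [hilbertRidge, hilbertRidge, h1]
    simp_rw [h2, Finset.sum_add_distrib, Finset.sum_sub_distrib, ← Finset.mul_sum]
    have h3 : 0 ≤ (1 / n : ℝ) * ∑ i, (inner ℝ (l i) (ψ - φ)) ^ 2 :=
      mul_nonneg (by positivity) (Finset.sum_nonneg fun i _ => sq_nonneg _)
    have h4 : 0 ≤ lam * ‖ψ - φ‖ ^ 2 := by positivity
    change lam * inner ℝ φ (ψ - φ) + _ * ∑ i, inner ℝ (l i) φ * inner ℝ (l i) (ψ - φ) = _ at h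
    nlinarith

/-- The error of regularized least squares under the leverage bound `Λ`, with the noise entering
through a quadratic form that depends only on the design. -/
theorem exists_ridge_error_bound {n : ℕ} {lam Λ : ℝ} (hlam : 0 < lam) (hΛ : 0 ≤ Λ) (l : Fin n → H)
    (hl : ∀ i φ, (inner ℝ (l i) φ) ^ 2 ≤
      Λ * (lam * ‖φ‖ ^ 2 + (1 / n : ℝ) * ∑ j, (inner ℝ (l j) φ) ^ 2)) :
    ∃ a : Fin n → Fin n → ℝ, (∀ i, a i i ≤ Λ) ∧
      (∀ ξ : Fin n → ℝ, 0 ≤ (1 / n : ℝ) ^ 2 * ∑ i, ∑ j, ξ i * ξ j * a i j) ∧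
      ∀ (φ₀ φ : H) (ρ ξ : Fin n → ℝ),
      hilbertRidge lam l (fun i => inner ℝ (l i) φ₀ + ρ i + ξ i) φ ≤
        hilbertRidge lam l (fun i => inner ℝ (l i) φ₀ + ρ i + ξ i) φ₀ →
      lam * ‖φ - φ₀‖ ^ 2 + (1 / n : ℝ) * ∑ i, (inner ℝ (l i) (φ - φ₀)) ^ 2 ≤
        32 * ((1 / n : ℝ) * ∑ i, ρ i ^ 2) +
        32 * ((1 / n : ℝ) ^ 2 * ∑ i, ∑ j, ξ i * ξ j * a i j) + 8 * (lam * ‖φ₀‖ ^ 2) := by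
  -- The ridge solution is (1/n) ∑ y_j e_j, so the matrix of the products ⟨ℓ_i, e_j⟩, divided by n,
  -- is the hat matrix and its diagonal carries the leverages.
  choose e he using fun i => exists_ridge_representer hlam l (l i)
  have hw' : ∀ ξ : Fin n → ℝ, ∃ w : H, (∀ ψ, lam * inner ℝ w ψ +
      (1 / n : ℝ) * ∑ i, inner ℝ (l i) w * inner ℝ (l i) ψ =
        (1 / n : ℝ) * ∑ j, ξ j * inner ℝ (l j) ψ) ∧
      (1 / n : ℝ) * ∑ j, ξ j * inner ℝ (l j) w =
        (1 / n : ℝ) ^ 2 * ∑ i, ∑ j, ξ i * ξ j * inner ℝ (l i) (e j) := by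
    intro ξ
    set w : H := (1 / n : ℝ) • ∑ j, ξ j • e j with hw
    have hwφ : ∀ ψ, lam * inner ℝ w ψ + (1 / n : ℝ) * ∑ i, inner ℝ (l i) w * inner ℝ (l i) ψ =
        (1 / n : ℝ) * ∑ j, ξ j * inner ℝ (l j) ψ := by
      intro ψ
      simp only [hw, real_inner_smul_left, sum_inner, inner_smul_right, inner_sum]
      have h1 : ∀ j, ξ j * inner ℝ (l j) ψ = ξ j * (lam * inner ℝ (e j) ψ) +
          ξ j * ((1 / n : ℝ) * ∑ i, inner ℝ (l i) (e j) * inner ℝ (l i) ψ) := by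
        intro j; rw [← mul_add, he]
      simp_rw [h1, Finset.sum_add_distrib, mul_add]
      congr 1
      · simp only [Finset.mul_sum]
        exact Finset.sum_congr rfl fun i _ => by ring
      · simp only [Finset.mul_sum, Finset.sum_mul]
        rw [Finset.sum_comm]
        exact Finset.sum_congr rfl fun i _ => Finset.sum_congr rfl fun j _ => by ring
    have hww : (1 / n : ℝ) * ∑ j, ξ j * inner ℝ (l j) w =
        (1 / n : ℝ) ^ 2 * ∑ i, ∑ j, ξ i * ξ j * inner ℝ (l i) (e j) := by
      simp only [hw, inner_smul_right, inner_sum]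
      simp only [Finset.mul_sum]
      exact Finset.sum_congr rfl fun i _ => Finset.sum_congr rfl fun j _ => by ring
    exact ⟨w, hwφ, hww⟩
  refine ⟨fun i j => inner ℝ (l i) (e j), fun i => ?_, ?_, ?_⟩
  · have h1 := hl i (e i)
    have h2 := he i (e i)
    rw [real_inner_self_eq_norm_sq] at h2
    simp_rw [← sq] at h2
    rw [h2] at h1
    by_contra hc
    push Not at hc
    nlinarith
  · intro ξ
    obtain ⟨w, hwφ, hww⟩ := hw' ξ
    rw [← hww, ← hwφ, real_inner_self_eq_norm_sq]
    exact add_nonneg (by positivity)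
      (mul_nonneg (by positivity) (Finset.sum_nonneg fun i _ => mul_self_nonneg _))
  · intro φ₀ φ ρ ξ hJ
    set u := φ - φ₀ with hu
    obtain ⟨w, hwφ, hww⟩ := hw' ξ
    -- Here `w` represents the noise functional in the regularized form. Nonnegativity of the form
    -- at u - 8w is Young's inequality: the noise term is at most 1/16 of the form at u plus four
    -- times the quadratic form of the noise, which does not involve the estimator.
    have h8 : 0 ≤ lam * ‖u - (8 : ℝ) • w‖ ^ 2 +
        (1 / n : ℝ) * ∑ i, (inner ℝ (l i) (u - (8 : ℝ) • w)) ^ 2 :=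
      add_nonneg (by positivity)
        (mul_nonneg (by positivity) (Finset.sum_nonneg fun i _ => sq_nonneg _))
    have hexp : lam * ‖u - (8 : ℝ) • w‖ ^ 2 +
        (1 / n : ℝ) * ∑ i, (inner ℝ (l i) (u - (8 : ℝ) • w)) ^ 2 =
        (lam * ‖u‖ ^ 2 + (1 / n : ℝ) * ∑ i, (inner ℝ (l i) u) ^ 2) -
        16 * (lam * inner ℝ w u + (1 / n : ℝ) * ∑ i, inner ℝ (l i) w * inner ℝ (l i) u) +
        64 * (lam * inner ℝ w w + (1 / n : ℝ) * ∑ i, inner ℝ (l i) w * inner ℝ (l i) w) := by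
      rw [norm_sub_sq_real, norm_smul, inner_smul_right, real_inner_comm w u,
        real_inner_self_eq_norm_sq]
      have : ∀ i, (inner ℝ (l i) (u - (8 : ℝ) • w)) ^ 2 = (inner ℝ (l i) u) ^ 2 -
          16 * (inner ℝ (l i) w * inner ℝ (l i) u) + 64 * (inner ℝ (l i) w * inner ℝ (l i) w) := by
        intro i; rw [inner_sub_right, inner_smul_right]; ring
      simp_rw [this, Finset.sum_add_distrib, Finset.sum_sub_distrib, ← Finset.mul_sum]
      norm_num
      ring
    rw [hexp, hwφ, hwφ, hww] at h8
    have hρ : (1 / n : ℝ) * ∑ i, ρ i * inner ℝ (l i) u ≤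
        (1 / 16) * ((1 / n : ℝ) * ∑ i, (inner ℝ (l i) u) ^ 2) +
          4 * ((1 / n : ℝ) * ∑ i, ρ i ^ 2) := by
      simp only [Finset.mul_sum, ← Finset.sum_add_distrib]
      refine Finset.sum_le_sum fun i _ => ?_
      have h1 : (0 : ℝ) ≤ 1 / n := by positivity
      nlinarith [mul_nonneg h1 (sq_nonneg (inner ℝ (l i) u - 8 * ρ i))]
    have hφ : φ = φ₀ + u := by rw [hu]; simp
    have hul : lam * ‖u‖ ^ 2 ≤ 2 * (lam * ‖φ‖ ^ 2) + 2 * (lam * ‖φ₀‖ ^ 2) := by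
      have h1 := norm_sub_le φ φ₀
      rw [← hu] at h1
      have h2 : ‖u‖ ^ 2 ≤ 2 * ‖φ‖ ^ 2 + 2 * ‖φ₀‖ ^ 2 := by
        have h3 : ‖u‖ ^ 2 ≤ (‖φ‖ + ‖φ₀‖) ^ 2 := by gcongr
        nlinarith [sq_nonneg (‖φ‖ - ‖φ₀‖)]
      nlinarith
    have hJ' : (1 / n : ℝ) * ∑ i, (inner ℝ (l i) u) ^ 2 + lam * ‖φ‖ ^ 2 ≤
        2 * ((1 / n : ℝ) * ∑ i, ρ i * inner ℝ (l i) u) +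
        2 * ((1 / n : ℝ) * ∑ i, ξ i * inner ℝ (l i) u) + lam * ‖φ₀‖ ^ 2 := by
      have h1 : ∀ i, (inner ℝ (l i) φ₀ + ρ i + ξ i - inner ℝ (l i) φ) ^ 2 =
          (inner ℝ (l i) φ₀ + ρ i + ξ i - inner ℝ (l i) φ₀) ^ 2 - 2 * (ρ i * inner ℝ (l i) u) -
          2 * (ξ i * inner ℝ (l i) u) + (inner ℝ (l i) u) ^ 2 := by
        intro i; rw [hu, inner_sub_right]; ring
      unfold hilbertRidge at hJ
      simp_rw [h1, Finset.sum_add_distrib, Finset.sum_sub_distrib, ← Finset.mul_sum] at hJ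
      linarith
    have h0 : 0 ≤ (1 / n : ℝ) * ∑ i, (inner ℝ (l i) u) ^ 2 :=
      mul_nonneg (by positivity) (Finset.sum_nonneg fun i _ => sq_nonneg _)
    have h0' : 0 ≤ lam * ‖u‖ ^ 2 := by positivity
    linarith

/-! ### Minimal preimages under an operator and images of balls -/

/-- The preimage of least norm of `T φ`. -/
def minLift (T : H →L[ℝ] V) (φ : H) : H := (LinearMap.ker T.toLinearMap)ᗮ.starProjection φ

theorem apply_minLift (T : H →L[ℝ] V) (φ : H) : T (minLift T φ) = T φ := by
  have h : φ - minLift T φ ∈ ((LinearMap.ker T.toLinearMap)ᗮ)ᗮ :=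
    Submodule.sub_starProjection_mem_orthogonal φ
  have hc : IsClosed (LinearMap.ker T.toLinearMap : Set H) := T.isClosed_ker
  have : CompleteSpace (LinearMap.ker T.toLinearMap) := hc.completeSpace_coe
  rw [Submodule.orthogonal_orthogonal, LinearMap.mem_ker] at h
  have h2 : T (φ - minLift T φ) = 0 := h
  rw [map_sub, sub_eq_zero] at h2
  exact h2.symm

theorem minLift_mem (T : H →L[ℝ] V) (φ : H) : minLift T φ ∈ (LinearMap.ker T.toLinearMap)ᗮ :=
  Submodule.starProjection_apply_mem _ _

theorem minLift_congr (T : H →L[ℝ] V) {φ ψ : H} (h : T φ = T ψ) : minLift T φ = minLift T ψ := by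
  rw [← sub_eq_zero, minLift, minLift, ← map_sub, Submodule.starProjection_apply_eq_zero_iff]
  apply Submodule.le_orthogonal_orthogonal
  rw [LinearMap.mem_ker]
  change T (φ - ψ) = 0
  rw [map_sub, h, sub_self]

theorem norm_minLift_le (T : H →L[ℝ] V) {φ ψ : H} (h : T φ = T ψ) : ‖minLift T φ‖ ≤ ‖ψ‖ := by
  rw [minLift_congr T h]
  exact Submodule.norm_starProjection_apply_le _ _

/-- The ball of a Hilbert space is weakly compact and T is weakly continuous, so the image is weakly
compact, hence weakly closed and a fortiori closed. The maps `Φ` and `Ψ` realize the weak topologies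
inside a product of lines. -/
theorem isClosed_image_closedBall [CompleteSpace V] (T : H →L[ℝ] V) (L : ℝ) :
    IsClosed (T '' Metric.closedBall 0 L) := by
  let S : Set (WeakDual ℝ H) := WeakDual.toStrongDual ⁻¹' Metric.closedBall 0 L
  have hS : IsCompact S := WeakDual.isCompact_closedBall (𝕜 := ℝ) (E := H) 0 L
  let Φ : WeakDual ℝ H → V → ℝ := fun f ζ => f (T.adjoint ζ)
  have hΦ : Continuous Φ := continuous_pi fun ζ => WeakDual.eval_continuous _
  let Ψ : V → V → ℝ := fun v ζ => inner ℝ v ζ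
  have hΨ : Continuous Ψ := continuous_pi fun ζ => by fun_prop
  have hcl : IsClosed (Ψ ⁻¹' (Φ '' S)) := (hS.image hΦ).isClosed.preimage hΨ
  convert hcl using 1
  ext v
  simp only [mem_image, mem_preimage, Metric.mem_closedBall, dist_zero_right]
  constructor
  · rintro ⟨φ, hφ, rfl⟩
    refine ⟨WeakDual.toStrongDual.symm (InnerProductSpace.toDual ℝ H φ), ?_, ?_⟩
    · simpa [S] using hφ
    · funext ζ
      change inner ℝ φ (T.adjoint ζ) = inner ℝ (T φ) ζ
      rw [ContinuousLinearMap.adjoint_inner_right]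
  · rintro ⟨f, hf, hfv⟩
    refine ⟨(InnerProductSpace.toDual ℝ H).symm (WeakDual.toStrongDual f), ?_, ?_⟩
    · simpa [S] using hf
    · refine ext_inner_right ℝ fun ζ => ?_
      have := congrFun hfv ζ
      rw [← ContinuousLinearMap.adjoint_inner_right, InnerProductSpace.toDual_symm_apply]
      exact this

theorem exists_projection [CompleteSpace V] {K : Set V} (hK : IsClosed K) (hc : Convex ℝ K) (h0 : K.Nonempty) :
    ∃ π : V → V, Continuous π ∧ ∀ v, π v ∈ K ∧ ∀ u ∈ K, ‖π v - v‖ ≤ ‖u - v‖ := by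
  choose π hπ hmin using fun v => exists_norm_eq_iInf_of_complete_convex h0 hK.isComplete hc v
  have hin : ∀ v, ∀ w ∈ K, inner ℝ (v - π v) (w - π v) ≤ 0 := fun v =>
    (norm_eq_iInf_iff_real_inner_le_zero hc (hπ v)).1 (hmin v)
  refine ⟨π, ?_, fun v => ⟨hπ v, fun u hu => ?_⟩⟩
  · have : LipschitzWith 1 π := by
      refine LipschitzWith.of_dist_le_mul fun v w => ?_
      rw [NNReal.coe_one, one_mul, dist_eq_norm, dist_eq_norm]
      have h1 := hin v (π w) (hπ w)
      have h2 := hin w (π v) (hπ v)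
      have h3 : ‖π v - π w‖ ^ 2 ≤ inner ℝ (v - w) (π v - π w) := by
        rw [← real_inner_self_eq_norm_sq]
        simp only [inner_sub_left, inner_sub_right] at h1 h2 ⊢
        linarith
      have h4 := h3.trans (real_inner_le_norm _ _)
      rcases (norm_nonneg (π v - π w)).eq_or_lt with h | h
      · rw [← h]; positivity
      · nlinarith
    exact this.continuous
  · rw [norm_sub_rev, norm_sub_rev u, hmin v]
    have : BddBelow (range fun w : K => ‖v - w‖) := ⟨0, by rintro _ ⟨w, rfl⟩; positivity⟩
    exact ciInf_le this ⟨u, hu⟩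

/-- The nearest-point projection onto the image of a ball, lifted to the domain of the operator,
is weakly continuous. -/
theorem exists_projection_lift [CompleteSpace V] (T : H →L[ℝ] V) {L : ℝ} (hL : 0 ≤ L) :
    ∃ Θ : V → H, (∀ v, ‖Θ v‖ ≤ L) ∧ (∀ v, ∀ φ, ‖φ‖ ≤ L → ‖T (Θ v) - v‖ ≤ ‖T φ - v‖) ∧
      (∀ v, minLift T (Θ v) = Θ v) ∧ ∀ ζ, Continuous fun v => (inner ℝ ζ (Θ v) : ℝ) := by
  obtain ⟨π, hπc, hπ⟩ := exists_projection (isClosed_image_closedBall T L)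
    ((convex_closedBall (0 : H) L).linear_image T.toLinearMap) ⟨T 0, 0, by simpa using hL, rfl⟩
  choose φ hφ hTφ using fun v => (hπ v).1
  have hT : ∀ v, T (minLift T (φ v)) = π v := fun v => (apply_minLift T _).trans (hTφ v)
  have hb : ∀ v, ‖minLift T (φ v)‖ ≤ L := fun v =>
    (norm_minLift_le T rfl).trans (by simpa using hφ v)
  refine ⟨fun v => minLift T (φ v), hb, fun v ψ hψ => ?_, fun v => ?_, ?_⟩
  · rw [hT]
    exact (hπ v).2 _ ⟨ψ, by simpa using hψ, rfl⟩
  · exact minLift_congr T (apply_minLift T _)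
  · have hcl : ∀ ζ ∈ closure (range T.adjoint),
        Continuous fun v => (inner ℝ ζ (minLift T (φ v)) : ℝ) := by
      intro ζ hζ
      rw [mem_closure_iff_seq_limit] at hζ
      obtain ⟨z, hz, hlim⟩ := hζ
      have hu : TendstoUniformly (fun k v => (inner ℝ (z k) (minLift T (φ v)) : ℝ))
          (fun v => (inner ℝ ζ (minLift T (φ v)) : ℝ)) Filter.atTop := by
        rw [Metric.tendstoUniformly_iff]
        intro ε hε
        rw [tendsto_iff_norm_sub_tendsto_zero] at hlim
        have hL1 : 0 < L + 1 := by linarith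
        filter_upwards [hlim.eventually (gt_mem_nhds (div_pos hε hL1))] with k hk v
        rw [dist_comm, Real.dist_eq, ← inner_sub_left]
        refine (abs_real_inner_le_norm _ _).trans_lt ?_
        rw [lt_div_iff₀ hL1] at hk
        refine lt_of_le_of_lt (mul_le_mul_of_nonneg_left ((hb v).trans ?_) (norm_nonneg _)) hk
        linarith
      refine hu.continuous (Filter.Frequently.of_forall fun k => ?_)
      obtain ⟨w, hw⟩ := hz k
      simp_rw [← hw, ContinuousLinearMap.adjoint_inner_left, hT]
      fun_prop
    intro ζ
    -- The lifts lie in the orthogonal complement of the kernel, which is the closure of the range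
    -- of the adjoint, so only the component of ζ there matters.
    have h1 := hcl (minLift T ζ) (by
      have := minLift_mem T ζ
      rw [ContinuousLinearMap.orthogonal_ker] at this
      exact this)
    convert h1 using 2 with v
    rw [← sub_eq_zero, ← inner_sub_left]
    exact Submodule.inner_left_of_mem_orthogonal (minLift_mem T (φ v))
      (Submodule.sub_starProjection_mem_orthogonal ζ)

end Hilbert

/-! ### Sobolev spaces as images of `L²` -/

/-- The weight `(1 + |2πη|²)^{-s/2}`. -/
def wt {d : ℕ} (s : ℝ) (η : E d) : ℝ := (1 + (2 * Real.pi * ‖η‖) ^ 2) ^ (-(s / 2))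

theorem wt_pos {d : ℕ} (s : ℝ) (η : E d) : 0 < wt s η := by unfold wt; positivity

theorem measurable_wt {d : ℕ} (s : ℝ) : Measurable (wt s : E d → ℝ) := by
  unfold wt; fun_prop

theorem abs_wt_le_one {d : ℕ} {s : ℝ} (hs : 0 ≤ s) (η : E d) : |wt s η| ≤ 1 := by
  rw [abs_of_pos (wt_pos s η)]
  exact Real.rpow_le_one_of_one_le_of_nonpos
    (by nlinarith [sq_nonneg (2 * Real.pi * ‖η‖)]) (by linarith)

theorem weight_mul_wt_sq {d : ℕ} (s : ℝ) (η : E d) :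
    (1 + (2 * Real.pi * ‖η‖) ^ 2) ^ s * wt s η ^ 2 = 1 := by
  have h : 0 < 1 + (2 * Real.pi * ‖η‖) ^ 2 := by positivity
  rw [wt, ← Real.rpow_natCast (_ ^ (-(s / 2))), ← Real.rpow_mul h.le, ← Real.rpow_add h]
  norm_num

theorem memLp_wt {d : ℕ} {t : ℝ} (ht : (d : ℝ) / 2 < t) :
    MemLp (wt t : E d → ℝ) 2 := by
  refine memLp_two_of_lintegral_lt_top (measurable_wt t).aestronglyMeasurable ?_
  refine lt_of_le_of_lt (lintegral_mono fun η => le_of_eq ?_) (lintegral_weight_inv_lt_top ht)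
  rw [← ofReal_norm, ← ENNReal.ofReal_pow (norm_nonneg _), Real.norm_eq_abs, sq_abs, wt,
    ← Real.rpow_natCast, ← Real.rpow_mul (by positivity)]
  norm_num

theorem MemLp.real_mul_of_bounded {d : ℕ} {κ : E d → ℝ} (hm : Measurable κ) (hb : ∀ η, |κ η| ≤ 1)
    {φ : E d → ℂ} (hφ : MemLp φ 2) : MemLp (fun η => (κ η : ℂ) * φ η) 2 := by
  refine hφ.mono ((Complex.measurable_ofReal.comp hm).aestronglyMeasurable.mul
    hφ.aestronglyMeasurable) (Filter.Eventually.of_forall fun η => ?_)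
  rw [norm_mul, Complex.norm_real, Real.norm_eq_abs]
  exact mul_le_of_le_one_left (norm_nonneg _) (hb η)

/-- Multiplication by a real function bounded by `1`. -/
def mulOp {d : ℕ} (κ : E d → ℝ) (hm : Measurable κ) (hb : ∀ η, |κ η| ≤ 1) :
    Lp ℂ 2 (volume : Measure (E d)) →L[ℝ] Lp ℂ 2 (volume : Measure (E d)) :=
  LinearMap.mkContinuous
    { toFun := fun φ => (MemLp.real_mul_of_bounded hm hb (Lp.memLp φ)).toLp _
      map_add' := fun φ ψ => by
        refine Lp.ext ?_
        refine (MemLp.coeFn_toLp _).trans ?_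
        filter_upwards [Lp.coeFn_add φ ψ, Lp.coeFn_add
          ((MemLp.real_mul_of_bounded hm hb (Lp.memLp φ)).toLp _)
          ((MemLp.real_mul_of_bounded hm hb (Lp.memLp ψ)).toLp _),
          (MemLp.real_mul_of_bounded hm hb (Lp.memLp φ)).coeFn_toLp,
          (MemLp.real_mul_of_bounded hm hb (Lp.memLp ψ)).coeFn_toLp] with η h1 h2 h3 h4
        rw [h1, h2, Pi.add_apply, Pi.add_apply, h3, h4, mul_add]
      map_smul' := fun c φ => by
        refine Lp.ext ?_
        refine (MemLp.coeFn_toLp _).trans ?_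
        filter_upwards [Lp.coeFn_smul c φ, Lp.coeFn_smul c
          ((MemLp.real_mul_of_bounded hm hb (Lp.memLp φ)).toLp _),
          (MemLp.real_mul_of_bounded hm hb (Lp.memLp φ)).coeFn_toLp] with η h1 h2 h3
        simp only [RingHom.id_apply]
        rw [h1, h2, Pi.smul_apply, Pi.smul_apply, h3, mul_smul_comm] }
    1 fun φ => by
      rw [one_mul]
      refine Lp.norm_le_norm_of_ae_le ?_
      filter_upwards [(MemLp.real_mul_of_bounded hm hb (Lp.memLp φ)).coeFn_toLp] with η h
      refine h.symm ▸ ?_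
      rw [norm_mul, Complex.norm_real, Real.norm_eq_abs]
      exact mul_le_of_le_one_left (norm_nonneg _) (hb η)

theorem mulOp_coeFn {d : ℕ} (κ : E d → ℝ) (hm : Measurable κ) (hb : ∀ η, |κ η| ≤ 1)
    (φ : Lp ℂ 2 (volume : Measure (E d))) : mulOp κ hm hb φ =ᵐ[volume] fun η => (κ η : ℂ) * φ η :=
  (MemLp.real_mul_of_bounded hm hb (Lp.memLp φ)).coeFn_toLp

/-- The Fourier transform `(1 + |2πη|²)^{-s/2} φ(η)` of the element of `H^s` parametrized by `φ`. -/
def amp {d : ℕ} (s : ℝ) (φ : E d → ℂ) (η : E d) : ℂ := (wt s η : ℂ) * φ η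

theorem aestronglyMeasurable_amp {d : ℕ} (s : ℝ) (φ : Lp ℂ 2 (volume : Measure (E d))) :
    AEStronglyMeasurable (amp s φ) :=
  (Complex.measurable_ofReal.comp (measurable_wt s)).aestronglyMeasurable.mul
    (Lp.aestronglyMeasurable φ)

theorem energy_amp {d : ℕ} (s : ℝ) (φ : Lp ℂ 2 (volume : Measure (E d))) :
    energy s (amp s φ) = ‖φ‖ₑ ^ 2 := by
  rw [enorm_sq_Lp]
  refine lintegral_congr fun η => ?_
  rw [amp, enorm_mul, mul_pow (‖(wt s η : ℂ)‖ₑ), ← mul_assoc, ← ofReal_norm (wt s η : ℂ), ← ENNReal.ofReal_pow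
    (norm_nonneg _), ← ENNReal.ofReal_mul (by positivity), Complex.norm_real, Real.norm_eq_abs,
    sq_abs, weight_mul_wt_sq, ENNReal.ofReal_one, one_mul]

/-- The parametrization of `H^s(ℝ^d)` by `L²`. -/
def synthG {d : ℕ} {s : ℝ} (hs : 0 ≤ s) :
    Lp ℂ 2 (volume : Measure (E d)) →L[ℝ] Lp ℂ 2 (volume : Measure (E d)) :=
  ((Lp.fourierTransformₗᵢ (E d) ℂ).symm.toContinuousLinearEquiv.toContinuousLinearMap.restrictScalars
    ℝ) ∘L mulOp (wt s) (measurable_wt s) (abs_wt_le_one hs)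

theorem fourier_synthG {d : ℕ} {s : ℝ} (hs : 0 ≤ s) (φ : Lp ℂ 2 (volume : Measure (E d))) :
    𝓕 (synthG hs φ) = mulOp (wt s) (measurable_wt s) (abs_wt_le_one hs) φ :=
  (Lp.fourierTransformₗᵢ (E d) ℂ).apply_symm_apply _

theorem fourier_synthG_ae {d : ℕ} {s : ℝ} (hs : 0 ≤ s) (φ : Lp ℂ 2 (volume : Measure (E d))) :
    (𝓕 (synthG hs φ) : Lp ℂ 2 (volume : Measure (E d))) =ᵐ[volume] amp s φ := by
  rw [fourier_synthG]
  exact mulOp_coeFn _ _ _ φ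

theorem sobolevNorm_synthG {d : ℕ} {s : ℝ} (hs : 0 ≤ s) (φ : Lp ℂ 2 (volume : Measure (E d))) :
    sobolevNorm s (synthG hs φ) = ‖φ‖ₑ := by
  have h : sobolevNorm s (synthG hs φ) ^ 2 = ‖φ‖ₑ ^ 2 := by
    rw [sobolevNorm_sq, energy_congr (fourier_synthG_ae hs φ), energy_amp]
  exact (ENNReal.pow_right_strictMono two_ne_zero).injective h

theorem exists_synthG_eq {d : ℕ} {s : ℝ} (hs : 0 ≤ s) {G : Lp ℂ 2 (volume : Measure (E d))}
    (hG : sobolevNorm s G < ∞) : ∃ φ, synthG hs φ = G := by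
  set γ : Lp ℂ 2 (volume : Measure (E d)) := 𝓕 G with hγ
  have he : energy s γ < ∞ := by
    rw [hγ, ← sobolevNorm_sq]; exact ENNReal.pow_lt_top hG
  have hm : AEStronglyMeasurable (fun η => ((wt s η)⁻¹ : ℂ) * γ η) volume :=
    (Complex.measurable_ofReal.comp (measurable_wt s)).inv.aestronglyMeasurable.mul
      (Lp.aestronglyMeasurable γ)
  have hL : MemLp (fun η => ((wt s η)⁻¹ : ℂ) * γ η) 2 := by
    refine memLp_two_of_lintegral_lt_top hm (lt_of_le_of_lt (le_of_eq ?_) he)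
    refine lintegral_congr fun η => ?_
    rw [enorm_mul, mul_pow, ← ofReal_norm ((wt s η : ℂ)⁻¹), ← ENNReal.ofReal_pow
      (norm_nonneg _), norm_inv, Complex.norm_real, Real.norm_eq_abs, inv_pow, sq_abs]
    congr 2
    have h1 := weight_mul_wt_sq s η
    have h2 := pow_pos (wt_pos s η) 2
    rw [inv_eq_iff_eq_inv, ← one_div, eq_div_iff (by positivity), mul_comm, h1]
  refine ⟨hL.toLp _, ?_⟩
  have h2 : 𝓕 (synthG hs (hL.toLp _)) = 𝓕 G := by
    rw [← hγ]
    refine Lp.ext ((fourier_synthG_ae hs _).trans ?_)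
    filter_upwards [hL.coeFn_toLp] with η h
    rw [amp, h, mul_inv_cancel_left₀]
    exact_mod_cast (wt_pos s η).ne'
  exact (Lp.fourierTransformₗᵢ (E d) ℂ).injective h2

/-- The real part of the restriction to the cube. -/
def restrictRe (d : ℕ) :
    Lp ℂ 2 (volume : Measure (E d)) →L[ℝ] Lp ℝ 2 (volume.restrict (cube d)) :=
  (Complex.reCLM.compLpL 2 _) ∘L (LpToLpRestrictCLM (E d) ℂ ℝ volume 2 (cube d))

theorem restrictRe_coeFn {d : ℕ} (G : Lp ℂ 2 (volume : Measure (E d))) :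
    restrictRe d G =ᵐ[volume.restrict (cube d)] fun x => (G x).re := by
  refine (Complex.reCLM.coeFn_compLp' _).trans ?_
  filter_upwards [LpToLpRestrictCLM_coeFn ℝ (cube d) G] with x hx
  exact congrArg Complex.re hx

/-- The parametrization of the real space `H^s([0,1]^d)` by `L²(ℝ^d)`. -/
def sobolevOp {d : ℕ} {s : ℝ} (hs : 0 ≤ s) :
    Lp ℂ 2 (volume : Measure (E d)) →L[ℝ] Lp ℝ 2 (volume.restrict (cube d)) :=
  restrictRe d ∘L synthG hs

/-- `Extends` demands real values on the cube. Passing to the real part of an arbitrary complex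
function removes this demand at no cost in the norm. -/
theorem cubeNorm_re_le {d : ℕ} {s : ℝ} {f : E d → ℝ} {G : Lp ℂ 2 (volume : Measure (E d))}
    (h : f =ᵐ[volume.restrict (cube d)] fun x => (G x).re) : cubeNorm s f ≤ sobolevNorm s G := by
  obtain ⟨G', h1, h2⟩ := exists_re_sobolevNorm_le G
  refine (iInf₂_le G' ?_).trans (h2 s)
  filter_upwards [h, ae_restrict_of_ae h1] with x h3 h4
  rw [h4, h3]

theorem cubeNorm_le {d : ℕ} {s : ℝ} (hs : 0 ≤ s) {f : E d → ℝ}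
    {φ : Lp ℂ 2 (volume : Measure (E d))} (h : f =ᵐ[volume.restrict (cube d)] sobolevOp hs φ) :
    cubeNorm s f ≤ ‖φ‖ₑ := by
  rw [← sobolevNorm_synthG hs]
  exact cubeNorm_re_le (h.trans (restrictRe_coeFn _))

theorem sobolevOp_eq_of_extends {d : ℕ} {s : ℝ} (hs : 0 ≤ s) {f : E d → ℝ}
    {φ : Lp ℂ 2 (volume : Measure (E d))} (h : Extends (synthG hs φ) f) :
    sobolevOp hs φ =ᵐ[volume.restrict (cube d)] f := by
  refine (restrictRe_coeFn _).trans ?_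
  filter_upwards [h] with x hx
  exact congrArg Complex.re hx

/-- The infimum in the quotient norm is attained: the parameters of extensions of f form a translate
of the closed kernel, and `minLift` picks its element of least norm. -/
theorem exists_cubeNorm_eq {d : ℕ} {s : ℝ} (hs : 0 ≤ s) {f : E d → ℝ} (hf : cubeNorm s f < ∞) :
    ∃ φ : Lp ℂ 2 (volume : Measure (E d)),
      sobolevOp hs φ =ᵐ[volume.restrict (cube d)] f ∧ ‖φ‖ₑ = cubeNorm s f := by
  have hf' := hf
  unfold cubeNorm at hf'
  simp only [iInf_lt_iff] at hf'
  obtain ⟨G, hG, hGn⟩ := hf'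
  obtain ⟨ψ, rfl⟩ := exists_synthG_eq hs hGn
  have hψ := sobolevOp_eq_of_extends hs hG
  have hmin : sobolevOp hs (minLift (sobolevOp hs) ψ) =ᵐ[volume.restrict (cube d)] f := by
    rw [apply_minLift]; exact hψ
  refine ⟨minLift (sobolevOp hs) ψ, hmin, le_antisymm ?_ (cubeNorm_le hs hmin.symm)⟩
  refine le_iInf₂ fun G' hG' => ?_
  rcases eq_or_ne (sobolevNorm s G') ∞ with h | h
  · rw [h]; exact le_top
  obtain ⟨φ, rfl⟩ := exists_synthG_eq hs (lt_top_iff_ne_top.2 h)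
  rw [sobolevNorm_synthG]
  refine enorm_le_iff_norm_le.2 (norm_minLift_le _ (Lp.ext ?_))
  exact hψ.trans (sobolevOp_eq_of_extends hs hG').symm

/-! ### Evaluation functionals -/

theorem continuous_realSynth {d : ℕ} {γ : E d → ℂ} (hγ : Integrable γ) :
    Continuous (realSynth γ) := Complex.continuous_re.comp (continuous_fourierInv hγ)

theorem integrable_real_mul {d : ℕ} {κ : E d → ℝ} (hκ : MemLp κ 2)
    (φ : Lp ℂ 2 (volume : Measure (E d))) : Integrable (fun η => (κ η : ℂ) * φ η) :=
  MemLp.integrable_mul (p := 2) (q := 2) hκ.ofReal (Lp.memLp φ)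

theorem MemLp.evalVec {d : ℕ} {κ : E d → ℝ} (hκ : MemLp κ 2) (x : E d) :
    MemLp (fun η => (κ η : ℂ) * Complex.exp (-(2 * Real.pi * Complex.I * inner ℝ η x))) 2 := by
  refine (MemLp.ofReal (K := ℂ) hκ).mono ((MemLp.ofReal (K := ℂ) hκ).aestronglyMeasurable.mul
    (Continuous.aestronglyMeasurable (by fun_prop))) (Filter.Eventually.of_forall fun η => ?_)
  have : ‖Complex.exp (-(2 * Real.pi * Complex.I * inner ℝ η x))‖ = 1 := by
    rw [show -(2 * Real.pi * Complex.I * (inner ℝ η x : ℝ) : ℂ) =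
      ((-(2 * Real.pi * inner ℝ η x) : ℝ) : ℂ) * Complex.I by push_cast; ring]
    exact Complex.norm_exp_ofReal_mul_I _
  rw [norm_mul, this, mul_one]
  exact le_rfl

/-- The vector representing the functional `φ ↦ Re 𝓕⁻¹(κ φ)(x)`. -/
def evalVec {d : ℕ} {κ : E d → ℝ} (hκ : MemLp κ 2) (x : E d) : Lp ℂ 2 (volume : Measure (E d)) :=
  (MemLp.evalVec hκ x).toLp _

theorem inner_evalVec {d : ℕ} {κ : E d → ℝ} (hκ : MemLp κ 2) (x : E d)
    (φ : Lp ℂ 2 (volume : Measure (E d))) :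
    inner ℝ (evalVec hκ x) φ = realSynth (fun η => (κ η : ℂ) * φ η) x := by
  rw [L2.inner_def, realSynth, fourierInv_eq_mul]
  change _ = RCLike.re (K := ℂ) _
  rw [← integral_re (integrable_cexp_mul (integrable_real_mul hκ φ) x)]
  refine integral_congr_ae ?_
  filter_upwards [(MemLp.evalVec hκ x).coeFn_toLp] with η h
  rw [evalVec, h, Complex.inner, map_mul, Complex.conj_ofReal, ← Complex.exp_conj]
  simp only [map_neg, map_mul, Complex.conj_ofReal, Complex.conj_I, map_ofNat, RCLike.re_to_complex]
  congr 1
  rw [show -(2 * (Real.pi : ℂ) * -Complex.I * (inner ℝ η x : ℝ)) =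
    2 * Real.pi * Complex.I * (inner ℝ η x : ℝ) by ring]
  ring

theorem norm_evalVec_sq {d : ℕ} {κ : E d → ℝ} (hκ : MemLp κ 2) (x : E d) :
    ‖evalVec hκ x‖ ^ 2 = ‖evalVec hκ 0‖ ^ 2 := by
  have : ‖evalVec hκ x‖ = ‖evalVec hκ 0‖ := by
    rw [Lp.norm_def, Lp.norm_def]
    congr 1
    refine eLpNorm_congr_norm_ae ?_
    filter_upwards [(MemLp.evalVec hκ x).coeFn_toLp, (MemLp.evalVec hκ 0).coeFn_toLp] with η h1 h2
    rw [evalVec, evalVec, h1, h2, norm_mul, norm_mul, Complex.norm_exp, Complex.norm_exp]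
    simp
  rw [this]

/-- The norm does not depend on the point, so the squared distance of the vectors at x and y is
2‖e_y‖² - 2⟨e_x, e_y⟩, and the last product is the value at x of a continuous function. -/
theorem continuous_evalVec {d : ℕ} {κ : E d → ℝ} (hκ : MemLp κ 2) : Continuous (evalVec hκ) := by
  rw [continuous_iff_continuousAt]
  intro y
  rw [ContinuousAt, tendsto_iff_norm_sub_tendsto_zero]
  have h1 : ∀ x, ‖evalVec hκ x - evalVec hκ y‖ ^ 2 = 2 * ‖evalVec hκ y‖ ^ 2 -
      2 * realSynth (fun η => (κ η : ℂ) * evalVec hκ y η) x := by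
    intro x
    rw [norm_sub_sq_real, norm_evalVec_sq hκ x, norm_evalVec_sq hκ y, inner_evalVec]
    ring
  have h2 : Continuous fun x => ‖evalVec hκ x - evalVec hκ y‖ ^ 2 := by
    simp_rw [h1]
    have := continuous_realSynth (integrable_real_mul hκ (evalVec hκ y))
    fun_prop
  have h3 := (h2.sqrt).tendsto y
  simp only [Real.sqrt_sq (norm_nonneg _), sub_self, norm_zero] at h3
  simpa using h3

theorem energy_amp_lt_top {d : ℕ} (s : ℝ) (φ : Lp ℂ 2 (volume : Measure (E d))) :
    energy s (amp s φ) < ∞ := by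
  rw [energy_amp]; exact ENNReal.pow_lt_top enorm_lt_top

theorem integrable_amp {d : ℕ} {t : ℝ} (ht : (d : ℝ) / 2 < t)
    (φ : Lp ℂ 2 (volume : Measure (E d))) : Integrable (amp t φ) :=
  integrable_real_mul (memLp_wt ht) φ

/-- A function whose Fourier transform is integrable is given pointwise by Fourier inversion. -/
theorem re_ae_eq_realSynth {d : ℕ} {G : Lp ℂ 2 (volume : Measure (E d))} {γ : E d → ℂ}
    (h : (𝓕 G : Lp ℂ 2 (volume : Measure (E d))) =ᵐ[volume] γ) (hγ : Integrable γ) :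
    G =ᵐ[volume] 𝓕⁻ γ := by
  have h1 := fourierInv_coeFn_ae (𝓕 G) (hγ.congr h.symm)
  rw [FourierTransform.fourierInv_fourier_eq, fourierInv_congr h] at h1
  exact h1

theorem sobolevOp_ae_eq {d : ℕ} {t : ℝ} (ht0 : 0 ≤ t) (ht : (d : ℝ) / 2 < t)
    (φ : Lp ℂ 2 (volume : Measure (E d))) :
    sobolevOp ht0 φ =ᵐ[volume.restrict (cube d)] realSynth (amp t φ) := by
  refine (restrictRe_coeFn _).trans ?_
  filter_upwards [ae_restrict_of_ae
    (re_ae_eq_realSynth (fourier_synthG_ae ht0 φ) (integrable_amp ht φ))] with x hx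
  exact congrArg Complex.re hx

/-! ### Ridge regression and projections in terms of `L²` -/

theorem half_lt_penaltyOrder {d : ℕ} (hd : 1 ≤ d) (s : ℝ) : (d : ℝ) / 2 < penaltyOrder d s := by
  have : (1 : ℝ) ≤ d := by exact_mod_cast hd
  unfold penaltyOrder
  split_ifs with h
  · exact h
  · linarith

theorem le_penaltyOrder {d : ℕ} (s : ℝ) : s ≤ penaltyOrder d s := by
  unfold penaltyOrder
  split_ifs with h
  · exact le_rfl
  · have : (0 : ℝ) ≤ d := by positivity
    linarith

theorem ContinuousSobolev.exists_amp {d : ℕ} {t : ℝ} (ht : (d : ℝ) / 2 < t) {g : E d → ℝ}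
    (hg : ContinuousSobolev t g) : ∃ φ : Lp ℂ 2 (volume : Measure (E d)),
      EqOn g (realSynth (amp t φ)) (cube d) ∧ ‖φ‖ₑ = cubeNorm t g := by
  have ht0 : 0 ≤ t := le_of_lt (lt_of_le_of_lt (by positivity) ht)
  obtain ⟨φ, h1, h2⟩ := exists_cubeNorm_eq ht0 hg.2
  exact ⟨φ, eqOn_cube_of_ae (h1.symm.trans (sobolevOp_ae_eq ht0 ht φ)) hg.1
    (continuous_realSynth (integrable_amp ht φ)).continuousOn, h2⟩

theorem continuousSobolev_amp {d : ℕ} {t : ℝ} (ht : (d : ℝ) / 2 < t)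
    (φ : Lp ℂ 2 (volume : Measure (E d))) :
    ContinuousSobolev t (realSynth (amp t φ)) ∧ cubeNorm t (realSynth (amp t φ)) ≤ ‖φ‖ₑ := by
  have ht0 : 0 ≤ t := le_of_lt (lt_of_le_of_lt (by positivity) ht)
  have h := cubeNorm_le ht0 (sobolevOp_ae_eq ht0 ht φ).symm
  exact ⟨⟨(continuous_realSynth (integrable_amp ht φ)).continuousOn, h.trans_lt enorm_lt_top⟩, h⟩

theorem ofReal_hilbertRidge {d n : ℕ} {t lam : ℝ} (ht : (d : ℝ) / 2 < t) (hlam : 0 ≤ lam)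
    (D : Data d n) (φ : Lp ℂ 2 (volume : Measure (E d))) :
    ENNReal.ofReal (hilbertRidge lam (fun i => evalVec (memLp_wt ht) (D i).1)
      (fun i => (D i).2) φ) = ENNReal.ofReal ((1 / n : ℝ) *
        ∑ i, ((D i).2 - realSynth (amp t φ) (D i).1) ^ 2) + ENNReal.ofReal lam * ‖φ‖ₑ ^ 2 := by
  unfold hilbertRidge
  rw [ENNReal.ofReal_add (mul_nonneg (by positivity) (Finset.sum_nonneg fun i _ => sq_nonneg _))
    (by positivity), ENNReal.ofReal_mul hlam, ENNReal.ofReal_pow (norm_nonneg _), ofReal_norm]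
  simp_rw [inner_evalVec]
  rfl

/-- Minimizing over functions on the cube and over parameters in L² is the same problem: every
competitor has a parameter whose norm is its quotient norm, and passing from a parameter to its
function can only lower the penalty. The converse below rests on the same two facts. -/
theorem isRidge_amp {d n : ℕ} {t lam : ℝ} (ht : (d : ℝ) / 2 < t) (hlam : 0 ≤ lam)
    {D : Data d n} (hD : ∀ i, (D i).1 ∈ cube d) {φ : Lp ℂ 2 (volume : Measure (E d))}
    (hφ : ∀ ψ, hilbertRidge lam (fun i => evalVec (memLp_wt ht) (D i).1) (fun i => (D i).2) φ ≤
      hilbertRidge lam (fun i => evalVec (memLp_wt ht) (D i).1) (fun i => (D i).2) ψ) :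
    IsRidge t lam D (realSynth (amp t φ)) := by
  refine ⟨(continuousSobolev_amp ht φ).1, fun h hh => ?_⟩
  obtain ⟨ψ, h1, h2⟩ := hh.exists_amp ht
  have h3 := ENNReal.ofReal_le_ofReal (hφ ψ)
  rw [ofReal_hilbertRidge ht hlam, ofReal_hilbertRidge ht hlam] at h3
  unfold ridgeObjective
  rw [← h2]
  simp_rw [fun i => h1 (hD i)]
  refine le_trans ?_ h3
  gcongr
  exact (continuousSobolev_amp ht φ).2

theorem IsRidge.exists_amp {d n : ℕ} {t lam : ℝ} (ht : (d : ℝ) / 2 < t) (hlam : 0 ≤ lam)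
    {D : Data d n} (hD : ∀ i, (D i).1 ∈ cube d) {g : E d → ℝ} (hg : IsRidge t lam D g) :
    ∃ φ : Lp ℂ 2 (volume : Measure (E d)), EqOn g (realSynth (amp t φ)) (cube d) ∧
      ∀ ψ, hilbertRidge lam (fun i => evalVec (memLp_wt ht) (D i).1) (fun i => (D i).2) φ ≤
        hilbertRidge lam (fun i => evalVec (memLp_wt ht) (D i).1) (fun i => (D i).2) ψ := by
  obtain ⟨φ, h1, h2⟩ := hg.1.exists_amp ht
  refine ⟨φ, h1, fun ψ => ?_⟩
  have h3 := hg.2 _ (continuousSobolev_amp ht ψ).1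
  have h0 : 0 ≤ hilbertRidge lam (fun i => evalVec (memLp_wt ht) (D i).1) (fun i => (D i).2) ψ :=
    add_nonneg (mul_nonneg (by positivity) (Finset.sum_nonneg fun i _ => sq_nonneg _))
      (by positivity)
  rw [← ENNReal.ofReal_le_ofReal_iff h0, ofReal_hilbertRidge ht hlam, ofReal_hilbertRidge ht hlam,
    h2]
  simp_rw [← fun i => h1 (hD i)]
  refine h3.trans ?_
  unfold ridgeObjective
  gcongr
  exact (continuousSobolev_amp ht ψ).2

theorem eLpNorm_sub_eq_enorm {α : Type*} {mα : MeasurableSpace α} {μ : Measure α} {f g : α → ℝ}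
    {u v : Lp ℝ 2 μ} (hf : f =ᵐ[μ] u) (hg : g =ᵐ[μ] v) : eLpNorm (f - g) 2 μ = ‖u - v‖ₑ := by
  rw [Lp.enorm_def]
  refine eLpNorm_congr_ae ?_
  filter_upwards [hf, hg, Lp.coeFn_sub u v] with x h1 h2 h3
  rw [Pi.sub_apply, h1, h2, h3, Pi.sub_apply]

theorem isBallProjection_of_forall {d : ℕ} {s L : ℝ} (hs : 0 ≤ s) (hL : 0 ≤ L) {g h : E d → ℝ}
    {v : Lp ℝ 2 (volume.restrict (cube d))} (hg : g =ᵐ[volume.restrict (cube d)] v)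
    {θ : Lp ℂ 2 (volume : Measure (E d))} (hθ : ‖θ‖ ≤ L)
    (hmin : ∀ φ : Lp ℂ 2 (volume : Measure (E d)), ‖φ‖ ≤ L →
      ‖sobolevOp hs θ - v‖ ≤ ‖sobolevOp hs φ - v‖)
    (hh : h =ᵐ[volume.restrict (cube d)] sobolevOp hs θ) : IsBallProjection s L g h := by
  have hle : ∀ φ : Lp ℂ 2 (volume : Measure (E d)), ‖φ‖ₑ ≤ ENNReal.ofReal L ↔ ‖φ‖ ≤ L := by
    intro φ; rw [← ofReal_norm, ENNReal.ofReal_le_ofReal_iff hL]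
  refine ⟨(cubeNorm_le hs hh).trans ((hle θ).2 hθ), fun u hu => ?_⟩
  obtain ⟨φ, h1, h2⟩ := exists_cubeNorm_eq hs (lt_of_le_of_lt hu ENNReal.ofReal_lt_top)
  rw [eLpNorm_sub_eq_enorm hh hg, eLpNorm_sub_eq_enorm h1.symm hg]
  refine enorm_le_iff_norm_le.2 (hmin φ ((hle φ).1 ?_))
  rw [h2]; exact hu

/-! ### Real extensions and frequency truncation -/

theorem conjReflect_fourier_of_real {d : ℕ} {G : Lp ℂ 2 (volume : Measure (E d))}
    (hG : ∀ᵐ x, (G x).im = 0) : conjReflect (𝓕 G) = (𝓕 G : Lp ℂ 2 (volume : Measure (E d))) := by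
  have h1 : star G = G := by
    refine Lp.ext ?_
    filter_upwards [Lp.coeFn_star G, hG] with x h2 h3
    rw [h2, Pi.star_apply]
    exact Complex.conj_eq_iff_im.2 h3
  have h2 := star_fourierInv_Lp (𝓕 G)
  rw [FourierTransform.fourierInv_fourier_eq, h1] at h2
  have h3 := congrArg (fun u : Lp ℂ 2 (volume : Measure (E d)) =>
    (𝓕 u : Lp ℂ 2 (volume : Measure (E d)))) h2
  simp only [FourierTransform.fourier_fourierInv_eq] at h3
  exact h3.symm

theorem im_eq_zero_of_conjReflect {d : ℕ} {γ : Lp ℂ 2 (volume : Measure (E d))}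
    (h : conjReflect γ = γ) :
    ∀ᵐ x, ((𝓕⁻ γ : Lp ℂ 2 (volume : Measure (E d))) x).im = 0 := by
  have h1 := star_fourierInv_Lp γ
  rw [h] at h1
  filter_upwards [Lp.coeFn_star (𝓕⁻ γ : Lp ℂ 2 (volume : Measure (E d)))] with x h2
  rw [h1, Pi.star_apply] at h2
  exact Complex.conj_eq_iff_im.1 h2.symm

theorem conjReflect_mulOp {d : ℕ} {κ : E d → ℝ} (hm : Measurable κ) (hb : ∀ η, |κ η| ≤ 1)
    (heven : ∀ η, κ (-η) = κ η) {γ : Lp ℂ 2 (volume : Measure (E d))} (h : conjReflect γ = γ) :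
    conjReflect (mulOp κ hm hb γ) = mulOp κ hm hb γ := by
  refine Lp.ext ?_
  have h1 := (Measure.measurePreserving_neg
    (volume : Measure (E d))).quasiMeasurePreserving.ae (mulOp_coeFn κ hm hb γ)
  have h2 := conjReflect_coeFn γ
  rw [h] at h2
  filter_upwards [conjReflect_coeFn (mulOp κ hm hb γ), mulOp_coeFn κ hm hb γ, h1, h2]
    with η h3 h4 h5 h6
  rw [h3, h4, h5, h6, heven, star_mul']
  simp

/-- An extension of least norm is real. -/
theorem im_synthG_eq_zero {d : ℕ} {s : ℝ} (hs : 0 ≤ s) {θ : Lp ℂ 2 (volume : Measure (E d))}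
    (hθ : minLift (sobolevOp hs) θ = θ) : ∀ᵐ x, (synthG hs θ x).im = 0 := by
  obtain ⟨G', h1, h2⟩ := exists_re_sobolevNorm_le (synthG hs θ)
  have h3 := h2 s
  rw [sobolevNorm_synthG] at h3
  obtain ⟨φ, rfl⟩ := exists_synthG_eq hs (h3.trans_lt enorm_lt_top)
  rw [sobolevNorm_synthG, enorm_le_iff_norm_le] at h3
  have hT : sobolevOp hs φ = sobolevOp hs θ := by
    refine Lp.ext ((restrictRe_coeFn _).trans (Filter.EventuallyEq.trans ?_
      (restrictRe_coeFn _).symm))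
    filter_upwards [ae_restrict_of_ae h1] with x hx
    exact (congrArg Complex.re hx).trans (Complex.ofReal_re _)
  have hP : minLift (sobolevOp hs) φ = θ := by rw [minLift_congr _ hT, hθ]
  have hφ : φ = θ := by
    -- The real part of the extension restricts to the same function, so its parameter φ projects
    -- onto θ. Since ‖φ‖ ≤ ‖θ‖, Pythagoras forces φ = θ.
    have h4 : inner ℝ θ (φ - θ) = (0 : ℝ) := by
      refine Submodule.inner_right_of_mem_orthogonal (K := (LinearMap.ker
        (sobolevOp hs).toLinearMap)ᗮ) ?_ ?_
      · rw [← hP]; exact minLift_mem _ _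
      · rw [← hP]; exact Submodule.sub_starProjection_mem_orthogonal φ
    have h5 : ‖φ‖ ^ 2 = ‖θ‖ ^ 2 + ‖φ - θ‖ ^ 2 := by
      have := norm_add_sq_real θ (φ - θ)
      rw [h4, add_sub_cancel] at this
      linarith
    have h6 : ‖φ‖ ^ 2 ≤ ‖θ‖ ^ 2 := by gcongr
    have h7 : ‖φ - θ‖ = 0 := by nlinarith [norm_nonneg (φ - θ)]
    exact sub_eq_zero.1 (norm_eq_zero.1 h7)
  rw [hφ] at h1
  filter_upwards [h1] with x hx
  rw [hx, Complex.ofReal_im]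

theorem cutoff_nonneg (ρ : ℝ) : 0 ≤ cutoff ρ := sub_nonneg.2 (Real.smoothTransition.le_one _)

theorem cutoff_le_one (ρ : ℝ) : cutoff ρ ≤ 1 := sub_le_self _ (Real.smoothTransition.nonneg _)

theorem cutoff_eq_one {ρ : ℝ} (h : |ρ| ≤ 1 / 2) : cutoff ρ = 1 := by
  unfold cutoff
  have : ρ ^ 2 ≤ (1 / 2) ^ 2 := by rw [← sq_abs]; gcongr
  rw [Real.smoothTransition.zero_of_nonpos (by linarith), sub_zero]

theorem cutoff_eq_zero {ρ : ℝ} (h : 1 ≤ |ρ|) : cutoff ρ = 0 := by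
  unfold cutoff
  have : (1 : ℝ) ^ 2 ≤ ρ ^ 2 := by rw [← sq_abs ρ]; gcongr
  rw [Real.smoothTransition.one_of_one_le (by linarith), sub_self]

theorem measurable_cutoff : Measurable cutoff := by
  unfold cutoff
  exact (measurable_const.sub (Real.smoothTransition.continuous.measurable.comp (by fun_prop)))

/-- The multiplier `χ(2πrη)`. -/
def cutMul (d : ℕ) (r : ℝ) (η : E d) : ℝ := cutoff (r * (2 * Real.pi * ‖η‖))

theorem measurable_cutMul (d : ℕ) (r : ℝ) : Measurable (cutMul d r) :=
  measurable_cutoff.comp (by fun_prop)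

theorem abs_cutMul_le (d : ℕ) (r : ℝ) (η : E d) : |cutMul d r η| ≤ 1 :=
  abs_le.2 ⟨neg_one_lt_zero.le.trans (cutoff_nonneg _), cutoff_le_one _⟩

theorem cutMul_eq_zero {d : ℕ} {r : ℝ} (hr : 0 < r) {η : E d} (hη : 1 / r < ‖η‖) :
    cutMul d r η = 0 := by
  refine cutoff_eq_zero (le_trans ?_ (le_abs_self _))
  rw [div_lt_iff₀ hr] at hη
  have : 1 ≤ 2 * Real.pi := by linarith [Real.pi_gt_three]
  nlinarith [mul_nonneg (norm_nonneg η) hr.le]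

theorem memLp_of_bounded_support {d : ℕ} {κ : E d → ℝ} (hm : Measurable κ)
    (hb : ∀ η, |κ η| ≤ 1) {R : ℝ} (hR : ∀ η, R < ‖η‖ → κ η = 0) : MemLp κ 2 := by
  have h1 : MemLp ((Metric.closedBall (0 : E d) R).indicator fun _ => (1 : ℝ)) 2 :=
    memLp_indicator_const 2 measurableSet_closedBall 1
      (Or.inr (measure_closedBall_lt_top).ne)
  refine h1.mono hm.aestronglyMeasurable (Filter.Eventually.of_forall fun η => ?_)
  by_cases h : R < ‖η‖
  · rw [hR η h, norm_zero]; positivity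
  · rw [indicator_of_mem (by simpa using h), Real.norm_eq_abs, norm_one]
    exact hb η

/-! ### Existence of the estimator -/

theorem measurable_uncurry_of_separately_continuous {d n : ℕ} {u : E d → Data d n → ℝ}
    (h1 : ∀ D, Continuous fun x => u x D) (h2 : ∀ x, Continuous (u x)) :
    Measurable (Function.uncurry fun D x => u x D) := by
  have h : Measurable (Function.uncurry u) :=
    measurable_uncurry_of_continuous_of_measurable h1 fun x => (h2 x).measurable
  exact h.comp measurable_swap

theorem continuous_inner_evalVec {d : ℕ} {κ : E d → ℝ} (hκ : MemLp κ 2)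
    (w : Lp ℂ 2 (volume : Measure (E d))) :
    Continuous fun x => (inner ℝ (evalVec hκ x) w : ℝ) :=
  (continuous_evalVec hκ).inner continuous_const

/-- Weak continuity of the lift in the data is enough, because each value is a product with a fixed
vector; with continuity in x, separate continuity gives joint measurability. -/
theorem measurable_inner_evalVec {d n : ℕ} {κ : E d → ℝ} (hκ : MemLp κ 2)
    {w : Data d n → Lp ℂ 2 (volume : Measure (E d))}
    (hw : ∀ ζ, Continuous fun D => (inner ℝ ζ (w D) : ℝ)) :
    Measurable (Function.uncurry fun D x => (inner ℝ (evalVec hκ x) (w D) : ℝ)) :=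
  measurable_uncurry_of_separately_continuous
    (u := fun x D => (inner ℝ (evalVec hκ x) (w D) : ℝ))
    (fun D => continuous_inner_evalVec hκ (w D)) (fun x => hw (evalVec hκ x))

theorem enorm_fourier_sub {d : ℕ} (u v : Lp ℂ 2 (volume : Measure (E d))) :
    ‖(𝓕 u : Lp ℂ 2 (volume : Measure (E d))) - 𝓕 v‖ₑ = ‖u - v‖ₑ := by
  rw [← edist_eq_enorm_sub, ← edist_eq_enorm_sub]
  exact (Lp.fourierTransformₗᵢ (E d) ℂ).edist_map u v

theorem lintegral_tail_sq_le {d : ℕ} {s a : ℝ} (hs : 0 ≤ s) (ha : 0 < a) {γ δ : E d → ℂ}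
    (h : ∀ η, ‖δ η‖ ≤ ‖γ η‖) (h0 : ∀ η, ‖η‖ < a → δ η = 0) :
    ∫⁻ η, ‖δ η‖ₑ ^ 2 ≤ ENNReal.ofReal (a ^ (-(2 * s))) * energy s γ := by
  unfold energy
  rw [← lintegral_const_mul' _ _ ENNReal.ofReal_ne_top]
  refine lintegral_mono fun η => ?_
  rcases lt_or_ge ‖η‖ a with h1 | h1
  · simp [h0 η h1]
  · rw [← mul_assoc, ← ENNReal.ofReal_mul (by positivity)]
    have h2 : 1 ≤ a ^ (-(2 * s)) * (1 + (2 * Real.pi * ‖η‖) ^ 2) ^ s := by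
      rw [Real.rpow_neg ha.le, ← div_eq_inv_mul, le_div_iff₀ (by positivity), one_mul]
      exact (Real.rpow_le_rpow ha.le h1 (by positivity)).trans (norm_rpow_le_weight hs η)
    calc ‖δ η‖ₑ ^ 2 ≤ 1 * ‖γ η‖ₑ ^ 2 := by
          rw [one_mul]; gcongr; exact enorm_le_iff_norm_le.2 (h η)
      _ ≤ _ := by gcongr; rw [← ENNReal.ofReal_one]; exact ENNReal.ofReal_le_ofReal h2

/-- The lift of least norm supplies the extension: it is real, and its norm is the quotient norm, so
every A ≥ 1 admits it. The multiplier is real and even, so the truncated function stays real. -/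
theorem isTruncation_of_ae {d : ℕ} {s r A : ℝ} (hs : 0 ≤ s) (hA : 1 ≤ A)
    {θ : Lp ℂ 2 (volume : Measure (E d))} (hθ : minLift (sobolevOp hs) θ = θ)
    {f u : E d → ℝ} (hf : f =ᵐ[volume.restrict (cube d)] sobolevOp hs θ)
    {U : Lp ℂ 2 (volume : Measure (E d))}
    (hU : 𝓕 U = mulOp (cutMul d r) (measurable_cutMul d r) (abs_cutMul_le d r) (𝓕 (synthG hs θ)))
    (hu : u =ᵐ[volume.restrict (cube d)] fun x => (U x).re)
    (hc : 0 < r → ContinuousOn u (cube d)) :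
    IsTruncation s r A f u := by
  have him := im_synthG_eq_zero hs hθ
  refine ⟨synthG hs θ, U, ?_, him, ?_, ?_, ?_, hc⟩
  · filter_upwards [hf, restrictRe_coeFn (synthG hs θ), ae_restrict_of_ae him] with x h1 h2 h3
    refine Complex.ext ?_ h3
    rw [Complex.ofReal_re, h1]
    exact h2.symm
  · rw [sobolevNorm_synthG]
    obtain ⟨φ, h1, h2⟩ := exists_cubeNorm_eq hs
      (lt_of_le_of_lt (cubeNorm_le hs hf) enorm_lt_top)
    have h3 : ‖θ‖ ≤ ‖φ‖ := by
      conv_lhs => rw [← hθ]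
      exact norm_minLift_le _ (Lp.ext (hf.symm.trans h1.symm))
    rw [← h2]
    calc ‖θ‖ₑ ≤ 1 * ‖φ‖ₑ := by rw [one_mul]; exact enorm_le_iff_norm_le.2 h3
      _ ≤ _ := by gcongr; rw [← ENNReal.ofReal_one]; exact ENNReal.ofReal_le_ofReal hA
  · rw [hU]
    exact mulOp_coeFn _ _ _ _
  · have h1 := im_eq_zero_of_conjReflect (conjReflect_mulOp (measurable_cutMul d r)
      (abs_cutMul_le d r) (fun η => by simp [cutMul]) (conjReflect_fourier_of_real him))
    rw [← hU, FourierTransform.fourierInv_fourier_eq] at h1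
    filter_upwards [hu, ae_restrict_of_ae h1] with x h2 h3
    refine Complex.ext ?_ h3
    rw [Complex.ofReal_re, h2]

/-- The weight `wt s` cut off at the frequency `2 ^ j`. -/
def wtTrunc (d : ℕ) (s : ℝ) (j : ℕ) (η : E d) : ℝ :=
  (Metric.closedBall (0 : E d) (2 ^ j)).indicator (wt s) η

theorem measurable_wtTrunc (d : ℕ) (s : ℝ) (j : ℕ) : Measurable (wtTrunc d s j) :=
  (measurable_wt s).indicator measurableSet_closedBall

theorem abs_wtTrunc_le {d : ℕ} {s : ℝ} (hs : 0 ≤ s) (j : ℕ) (η : E d) : |wtTrunc d s j η| ≤ 1 := by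
  unfold wtTrunc indicator
  split_ifs
  · exact abs_wt_le_one hs η
  · simp

theorem memLp_wtTrunc {d : ℕ} {s : ℝ} (hs : 0 ≤ s) (j : ℕ) : MemLp (wtTrunc d s j) 2 :=
  memLp_of_bounded_support (measurable_wtTrunc d s j) (abs_wtTrunc_le hs j) (R := 2 ^ j)
    fun η hη => indicator_of_notMem (by simpa using hη) _

/-- Dyadic frequency truncations converge almost everywhere. -/
theorem ae_tendsto_realSynth_wtTrunc {d : ℕ} {s : ℝ} (hs : 0 < s)
    (θ : Lp ℂ 2 (volume : Measure (E d))) :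
    ∀ᵐ x, Filter.Tendsto (fun j => realSynth (fun η => (wtTrunc d s j η : ℂ) * θ η) x) Filter.atTop
      (nhds (synthG hs.le θ x).re) := by
  let V : ℕ → Lp ℂ 2 (volume : Measure (E d)) := fun j =>
    𝓕⁻ (mulOp (wtTrunc d s j) (measurable_wtTrunc d s j) (abs_wtTrunc_le hs.le j) θ)
  have hVF : ∀ j, 𝓕 (V j) = mulOp (wtTrunc d s j) (measurable_wtTrunc d s j)
      (abs_wtTrunc_le hs.le j) θ := fun j => FourierTransform.fourier_fourierInv_eq _
  have hV : ∀ j, V j =ᵐ[volume] 𝓕⁻ fun η => (wtTrunc d s j η : ℂ) * θ η := fun j =>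
    re_ae_eq_realSynth (by rw [hVF]; exact mulOp_coeFn _ _ _ θ)
      (integrable_real_mul (memLp_wtTrunc hs.le j) θ)
  -- The squared L²-errors decay like 2^{-2sj}. Their sum is finite, hence the sum of the squared
  -- pointwise errors is finite almost everywhere, which gives convergence.
  have hn : ∀ j, ‖synthG hs.le θ - V j‖ₑ ^ 2 ≤
      ENNReal.ofReal ((2 : ℝ) ^ (-(2 * s))) ^ j * ‖θ‖ₑ ^ 2 := by
    intro j
    rw [← enorm_fourier_sub, enorm_sq_Lp, ← energy_amp s θ, ← ENNReal.ofReal_pow (by positivity)]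
    have h2 : ((2 : ℝ) ^ (-(2 * s))) ^ j = ((2 : ℝ) ^ j) ^ (-(2 * s)) := by
      rw [← Real.rpow_natCast, ← Real.rpow_natCast, ← Real.rpow_mul (by norm_num),
        ← Real.rpow_mul (by norm_num), mul_comm]
    rw [h2]
    refine le_trans (le_of_eq (lintegral_congr_ae ?_)) (lintegral_tail_sq_le hs.le (by positivity)
      (δ := fun η => amp s θ η - (wtTrunc d s j η : ℂ) * θ η) ?_ ?_)
    · filter_upwards [Lp.coeFn_sub (𝓕 (synthG hs.le θ) : Lp ℂ 2 (volume : Measure (E d)))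
        (𝓕 (V j)), fourier_synthG_ae hs.le θ, (hVF j).symm ▸ mulOp_coeFn _ _ _ θ] with η h3 h4 h5
      rw [h3, Pi.sub_apply, h4, h5]
    · intro η
      unfold wtTrunc indicator amp
      split_ifs
      · rw [sub_self, norm_zero]; positivity
      · simp only [Complex.ofReal_zero, zero_mul, sub_zero, le_refl]
    · intro η hη
      unfold wtTrunc amp
      rw [indicator_of_mem (by simpa using hη.le), sub_self]
  have hsum : ∑' j, ‖synthG hs.le θ - V j‖ₑ ^ 2 < ∞ := by
    refine lt_of_le_of_lt (ENNReal.tsum_le_tsum hn) ?_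
    rw [ENNReal.tsum_mul_right, ENNReal.tsum_geometric]
    refine ENNReal.mul_lt_top (ENNReal.inv_lt_top.2 (tsub_pos_of_lt ?_))
      (ENNReal.pow_lt_top enorm_lt_top)
    rw [← ENNReal.ofReal_one, ENNReal.ofReal_lt_ofReal_iff one_pos]
    exact Real.rpow_lt_one_of_one_lt_of_neg (by norm_num) (by linarith)
  simp_rw [enorm_sq_Lp] at hsum
  rw [← lintegral_tsum fun j => ((Lp.stronglyMeasurable _).measurable.enorm.pow_const 2).aemeasurable]
    at hsum
  have hfin := ae_lt_top' (AEMeasurable.tsum fun j =>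
    ((Lp.stronglyMeasurable (synthG hs.le θ - V j)).measurable.enorm.pow_const 2).aemeasurable)
    hsum.ne
  filter_upwards [hfin, ae_all_iff.2 hV, ae_all_iff.2 fun j =>
    Lp.coeFn_sub (synthG hs.le θ) (V j)] with x h1 h2 h3
  have h4 := ENNReal.tendsto_atTop_zero_of_tsum_ne_top h1.ne
  simp_rw [h3, Pi.sub_apply, h2] at h4
  have h5 : Filter.Tendsto (fun j => ‖synthG hs.le θ x -
      𝓕⁻ (fun η => (wtTrunc d s j η : ℂ) * θ η) x‖ ^ 2) Filter.atTop (nhds 0) := by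
    rw [← ENNReal.tendsto_toReal_zero_iff fun j => ENNReal.pow_ne_top enorm_ne_top] at h4
    simpa using h4
  have h6 : Filter.Tendsto (fun j => 𝓕⁻ (fun η => (wtTrunc d s j η : ℂ) * θ η) x) Filter.atTop
      (nhds (synthG hs.le θ x)) := by
    rw [tendsto_iff_norm_sub_tendsto_zero]
    have := h5.sqrt
    simp only [Real.sqrt_sq (norm_nonneg _), Real.sqrt_zero] at this
    simpa only [norm_sub_rev] using this
  exact (Complex.continuous_re.tendsto _).comp h6

/-- Projected and truncated kernel ridge regression estimators exist. -/
theorem exists_isPTKRR {d : ℕ} (hd : 1 ≤ d) {s L r lam A : ℝ} (hs : 0 < s) (hL : 0 ≤ L)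
    (hr : 0 ≤ r) (hlam : 0 < lam) (hA : 1 ≤ A) (n : ℕ) :
    ∃ fhat : Data d n → E d → ℝ, Measurable (Function.uncurry fhat) ∧
      IsPTKRR s L r lam A fhat := by
  have ht := half_lt_penaltyOrder hd s
  have ht0 : 0 ≤ penaltyOrder d s := le_of_lt (lt_of_le_of_lt (by positivity) ht)
  obtain ⟨R, hRc, hR⟩ := exists_continuous_ridge (H := Lp ℂ 2 (volume : Measure (E d))) n hlam
  obtain ⟨Θ, hΘL, hΘmin, hΘlift, hΘc⟩ := exists_projection_lift (sobolevOp (d := d) hs.le) hL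
  let Φ : Data d n → Lp ℂ 2 (volume : Measure (E d)) := fun D =>
    R (fun i => evalVec (memLp_wt ht) (D i).1, fun i => (D i).2)
  have hΦ : Continuous Φ := hRc.comp ((continuous_pi fun i =>
    (continuous_evalVec _).comp ((continuous_apply i).fst)).prodMk
      (continuous_pi fun i => (continuous_apply i).snd))
  let w : Data d n → Lp ℂ 2 (volume : Measure (E d)) := fun D => Θ (sobolevOp ht0 (Φ D))
  have hw : ∀ ζ, Continuous fun D => (inner ℝ ζ (w D) : ℝ) := fun ζ =>
    (hΘc ζ).comp ((sobolevOp ht0).continuous.comp hΦ)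
  have hridge : ∀ D : Data d n, (∀ i, (D i).1 ∈ cube d) →
      IsRidge (penaltyOrder d s) lam D (realSynth (amp (penaltyOrder d s) (Φ D))) :=
    fun D hD => isRidge_amp ht hlam.le hD (hR _ _)
  have hproj : ∀ D (h : E d → ℝ), h =ᵐ[volume.restrict (cube d)] sobolevOp hs.le (w D) →
      IsBallProjection s L (realSynth (amp (penaltyOrder d s) (Φ D))) h := fun D h hh =>
    isBallProjection_of_forall hs.le hL (sobolevOp_ae_eq ht0 ht (Φ D)).symm (hΘL _)
      (hΘmin _) hh
  rcases lt_or_ge ((d : ℝ) / 2) s with hcase | hcase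
  · refine ⟨fun D x => inner ℝ (evalVec (memLp_wt hcase) x) (w D),
      measurable_inner_evalVec _ hw, fun D hD => ⟨_, hridge D hD, Or.inl ⟨hcase, hproj D _ ?_,
        (continuous_inner_evalVec _ _).continuousOn⟩⟩⟩
    simp_rw [inner_evalVec]
    exact (sobolevOp_ae_eq hs.le hcase (w D)).symm
  rcases hr.eq_or_lt with rfl | hr0
  -- For s ≤ d/2 and r = 0 there is no truncation, and point evaluation is not assumed to be
  -- represented by a vector. A jointly measurable version is the upper limit of dyadic truncations;
  -- the values on the null set of divergence are immaterial.
  · refine ⟨fun D x => (Filter.limsup (fun j : ℕ => ((inner ℝ (evalVec (memLp_wtTrunc hs.le j) x)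
      (w D) : ℝ) : EReal)) Filter.atTop).toReal, ?_, fun D hD => ⟨_, hridge D hD, Or.inr ⟨hcase,
        sobolevOp hs.le (w D), hproj D _ Filter.EventuallyEq.rfl, ?_⟩⟩⟩
    · exact (Measurable.limsup fun j =>
        (measurable_inner_evalVec (memLp_wtTrunc hs.le j) hw).coe_real_ereal).ereal_toReal
    · refine isTruncation_of_ae hs.le hA (hΘlift _) Filter.EventuallyEq.rfl
        (U := synthG hs.le (w D)) ?_ ?_ fun h => absurd h (lt_irrefl _)
      · refine Lp.ext ?_
        filter_upwards [mulOp_coeFn (cutMul d 0) (measurable_cutMul d 0) (abs_cutMul_le d 0)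
          (𝓕 (synthG hs.le (w D)))] with η h
        rw [h, cutMul, zero_mul, cutoff_eq_one (by norm_num), Complex.ofReal_one, one_mul]
      · filter_upwards [ae_restrict_of_ae (ae_tendsto_realSynth_wtTrunc hs (w D))] with x hx
        simp_rw [inner_evalVec]
        exact (congrArg EReal.toReal ((continuous_coe_real_ereal.tendsto _).comp hx).limsup_eq).trans
          (EReal.toReal_coe _)
  · have hm : Measurable fun η => cutMul d r η * wt s η :=
      (measurable_cutMul d r).mul (measurable_wt s)
    have hκ : MemLp (fun η => cutMul d r η * wt s η) 2 :=
      memLp_of_bounded_support hm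
        (fun η => by
          rw [abs_mul]
          exact mul_le_one₀ (abs_cutMul_le d r η) (abs_nonneg _) (abs_wt_le_one hs.le η))
        (R := 1 / r) fun η hη => by rw [cutMul_eq_zero hr0 hη, zero_mul]
    refine ⟨fun D x => inner ℝ (evalVec hκ x) (w D), measurable_inner_evalVec _ hw,
      fun D hD => ⟨_, hridge D hD, Or.inr ⟨hcase, sobolevOp hs.le (w D),
        hproj D _ Filter.EventuallyEq.rfl, ?_⟩⟩⟩
    set γ := mulOp (cutMul d r) (measurable_cutMul d r) (abs_cutMul_le d r)
      (𝓕 (synthG hs.le (w D))) with hγ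
    have hγae : γ =ᵐ[volume] fun η => ((cutMul d r η * wt s η : ℝ) : ℂ) * w D η := by
      filter_upwards [mulOp_coeFn (cutMul d r) (measurable_cutMul d r) (abs_cutMul_le d r)
        (𝓕 (synthG hs.le (w D))), fourier_synthG_ae hs.le (w D)] with η h1 h2
      rw [hγ, h1, h2, amp]
      push_cast
      ring
    refine isTruncation_of_ae hs.le hA (hΘlift _) Filter.EventuallyEq.rfl (U := 𝓕⁻ γ)
      (FourierTransform.fourier_fourierInv_eq γ) ?_
      fun _ => (continuous_inner_evalVec _ _).continuousOn
    have h1 := re_ae_eq_realSynth (G := 𝓕⁻ γ) (by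
      rw [FourierTransform.fourier_fourierInv_eq]; exact hγae) (integrable_real_mul hκ (w D))
    filter_upwards [ae_restrict_of_ae h1] with x hx
    rw [inner_evalVec, hx]
    rfl

/-! ### Consequences of the sampling bound -/

/-- Every subcell of side `1 / (M K)` contains at least the fraction `c₀ / (M K) ^ d` of the sample
points. -/
def Occupied {d n : ℕ} (c₀ : ℝ) (M K : ℕ) (X : Fin n → E d) : Prop :=
  ∀ k : Fin d → Fin M, ∀ l : Fin d → Fin K, c₀ * n / ((M : ℝ) * K) ^ d ≤
    Nat.card {i // X i ∈ fineCell M K k l}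

/-- Integrating the cell bounds gives the L²-estimate. Bounding one cell by the sum over all cells
loses a factor M^d and gives the supremum estimate, which becomes the leverage bound. -/
theorem exists_sampling_bound_amp {d : ℕ} (hd : 1 ≤ d) {t c₀ : ℝ} (ht : (d : ℝ) / 2 < t)
    (hc₀ : 0 < c₀) : ∃ K : ℕ, 1 ≤ K ∧ ∃ C : ℝ, 0 < C ∧ ∀ M : ℕ, 1 ≤ M → ∀ n : ℕ, 1 ≤ n →
    ∀ X : Fin n → E d, Occupied c₀ M K X → ∀ φ : Lp ℂ 2 (volume : Measure (E d)),
    (∫⁻ x in cube d, ENNReal.ofReal (realSynth (amp t φ) x ^ 2) ≤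
      ENNReal.ofReal (C * ((1 / n : ℝ) * ∑ i, realSynth (amp t φ) (X i) ^ 2 +
        (M : ℝ) ^ (-(2 * t)) * ‖φ‖ ^ 2))) ∧
    ∀ x ∈ cube d, realSynth (amp t φ) x ^ 2 ≤ C * (M : ℝ) ^ d *
      ((1 / n : ℝ) * ∑ i, realSynth (amp t φ) (X i) ^ 2 + (M : ℝ) ^ (-(2 * t)) * ‖φ‖ ^ 2) := by
  obtain ⟨K, hK, C, hC, h⟩ := exists_sampling_bound (m := ⌈t⌉₊) hd ht (Nat.le_ceil t) hc₀
  refine ⟨K, hK, C, hC, fun M hM n hn X hX φ => ?_⟩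
  obtain ⟨b, hb, hsum⟩ := h M hM (amp t φ) (aestronglyMeasurable_amp t φ) (energy_amp_lt_top t φ)
    n hn X hX
  have hM0 : (0 : ℝ) < M := by exact_mod_cast hM
  have h0 : 0 ≤ (1 / n : ℝ) * ∑ i, realSynth (amp t φ) (X i) ^ 2 :=
    mul_nonneg (by positivity) (Finset.sum_nonneg fun i _ => sq_nonneg _)
  rw [energy_amp, ← ofReal_norm, ← ENNReal.ofReal_pow (norm_nonneg _), ← ENNReal.ofReal_mul
    (by positivity), ← ENNReal.ofReal_add h0 (by positivity), ← ENNReal.ofReal_mul hC.le] at hsum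
  refine ⟨?_, fun x hx => ?_⟩
  · refine le_trans ?_ hsum
    calc ∫⁻ x in cube d, ENNReal.ofReal (realSynth (amp t φ) x ^ 2)
        ≤ ∫⁻ x in ⋃ k, closedCell (d := d) M k, ENNReal.ofReal (realSynth (amp t φ) x ^ 2) :=
          lintegral_mono_set (cube_subset_iUnion_closedCell hM)
      _ ≤ ∑' k, ∫⁻ x in closedCell (d := d) M k, ENNReal.ofReal (realSynth (amp t φ) x ^ 2) :=
          lintegral_iUnion_le _ _
      _ ≤ ∑' k, b k * ENNReal.ofReal ((M : ℝ)⁻¹ ^ d) := by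
          refine ENNReal.tsum_le_tsum fun k => ?_
          rw [← volume_closedCell hM k, ← setLIntegral_const]
          refine setLIntegral_mono_ae measurable_const.aemeasurable
            (Filter.Eventually.of_forall fun x hx => hb k x hx)
      _ = _ := by rw [tsum_fintype, Finset.mul_sum]; simp_rw [mul_comm]
  · obtain ⟨k, hk⟩ := exists_mem_closedCell hM hx
    have h1 : ENNReal.ofReal ((M : ℝ)⁻¹ ^ d) * ENNReal.ofReal (realSynth (amp t φ) x ^ 2) ≤
        _ := le_trans (mul_le_mul_right ((hb k x hk).trans
          (Finset.single_le_sum (fun _ _ => zero_le) (Finset.mem_univ k))) _) hsum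
    rw [← ENNReal.ofReal_mul (by positivity), ENNReal.ofReal_le_ofReal_iff (by positivity),
      inv_pow, inv_mul_le_iff₀ (by positivity)] at h1
    linarith

/-! ### Low-frequency approximation -/

theorem norm_restrictRe_le {d : ℕ} (G : Lp ℂ 2 (volume : Measure (E d))) :
    ‖restrictRe d G‖ₑ ^ 2 ≤ ‖G‖ₑ ^ 2 := by
  rw [enorm_sq_Lp, enorm_sq_Lp]
  refine le_trans (lintegral_mono_ae ?_) (setLIntegral_le_lintegral (cube d) _)
  filter_upwards [restrictRe_coeFn G] with x hx
  rw [hx]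
  gcongr
  exact enorm_le_iff_norm_le.2 (Complex.abs_re_le_norm _)

theorem enorm_fourier {d : ℕ} (u : Lp ℂ 2 (volume : Measure (E d))) :
    ‖(𝓕 u : Lp ℂ 2 (volume : Measure (E d)))‖ₑ = ‖u‖ₑ := by
  rw [← ofReal_norm, ← ofReal_norm]
  exact congrArg ENNReal.ofReal ((Lp.fourierTransformₗᵢ (E d) ℂ).norm_map u)

theorem enorm_sobolevOp_le {d : ℕ} {s : ℝ} (hs : 0 ≤ s) (φ : Lp ℂ 2 (volume : Measure (E d))) :
    ‖sobolevOp hs φ‖ₑ ^ 2 ≤ ‖φ‖ₑ ^ 2 := by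
  refine (norm_restrictRe_le (synthG hs φ)).trans ?_
  rw [← enorm_fourier, enorm_sq_Lp, lintegral_congr_ae (g := fun η => ‖amp s φ η‖ₑ ^ 2)
    (by filter_upwards [fourier_synthG_ae hs φ] with η h; rw [h])]
  exact (lintegral_sq_le_energy hs (amp s φ)).trans (energy_amp s φ).le

/-- Cut the transform at frequency M: measured in H^t instead of H^s the low part costs M^{2(t-s)},
and the discarded tail has squared L²-norm at most M^{-2s} times that in H^s. This lets a penalty in
H^t serve a function that is only in H^s. -/
theorem exists_lowFreq {d : ℕ} {s t : ℝ} (hs : 0 ≤ s) (hst : s ≤ t) (ht : (d : ℝ) / 2 < t)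
    {M : ℝ} (hM : 1 ≤ M) (φ : Lp ℂ 2 (volume : Measure (E d))) :
    ∃ φ₀ : Lp ℂ 2 (volume : Measure (E d)),
      ‖φ₀‖ ^ 2 ≤ ((1 + (2 * Real.pi) ^ 2) * M ^ 2) ^ (t - s) * ‖φ‖ ^ 2 ∧
      ∫⁻ x in cube d, ‖sobolevOp hs φ x - realSynth (amp t φ₀) x‖ₑ ^ 2 ≤
        ENNReal.ofReal (M ^ (-(2 * s)) * ‖φ‖ ^ 2) := by
  have ht0 : 0 ≤ t := hs.trans hst
  have hM0 : 0 < M := by linarith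
  set γ : E d → ℂ := (Metric.closedBall (0 : E d) M).indicator (amp s φ) with hγ
  have hγm : AEStronglyMeasurable γ :=
    (aestronglyMeasurable_amp s φ).indicator measurableSet_closedBall
  have hγle : ∀ η, ‖γ η‖ ≤ ‖amp s φ η‖ := fun η => norm_indicator_le_norm_self _ _
  have hE : energy t γ ≤ ENNReal.ofReal (((1 + (2 * Real.pi) ^ 2) * M ^ 2) ^ (t - s)) *
      ‖φ‖ₑ ^ 2 := by
    rw [← energy_amp s φ]
    unfold energy
    rw [← lintegral_const_mul' _ _ ENNReal.ofReal_ne_top]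
    refine lintegral_mono fun η => ?_
    rw [← mul_assoc, ← ENNReal.ofReal_mul (by positivity)]
    by_cases h : η ∈ Metric.closedBall (0 : E d) M
    · rw [hγ, indicator_of_mem h]
      refine mul_le_mul_left (ENNReal.ofReal_le_ofReal ?_) _
      have h1 : 0 < 1 + (2 * Real.pi * ‖η‖) ^ 2 := by positivity
      rw [mem_closedBall_zero_iff] at h
      have h2 : 1 + (2 * Real.pi * ‖η‖) ^ 2 ≤ (1 + (2 * Real.pi) ^ 2) * M ^ 2 := by
        rw [mul_pow, add_mul, one_mul]
        have : ‖η‖ ^ 2 ≤ M ^ 2 := by gcongr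
        nlinarith [sq_nonneg (2 * Real.pi)]
      conv_lhs => rw [← sub_add_cancel t s, Real.rpow_add h1]
      gcongr
    · rw [hγ, indicator_of_notMem h]; simp
  have hγ2 : MemLp γ 2 := memLp_of_energy ht0 hγm (hE.trans_lt
    (ENNReal.mul_lt_top ENNReal.ofReal_lt_top (ENNReal.pow_lt_top enorm_lt_top)))
  set G₀ : Lp ℂ 2 (volume : Measure (E d)) := 𝓕⁻ (hγ2.toLp γ) with hG₀
  have hFG : 𝓕 G₀ = hγ2.toLp γ := FourierTransform.fourier_fourierInv_eq _
  have hGn : sobolevNorm t G₀ ^ 2 = energy t γ := by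
    rw [sobolevNorm_sq, hFG]; exact energy_congr hγ2.coeFn_toLp
  have hGfin : sobolevNorm t G₀ < ∞ := by
    by_contra hcon
    rw [not_lt_top_iff.1 hcon] at hGn
    have : energy t γ < ∞ := hE.trans_lt
      (ENNReal.mul_lt_top ENNReal.ofReal_lt_top (ENNReal.pow_lt_top enorm_lt_top))
    rw [← hGn] at this
    simp at this
  obtain ⟨φ₀, hφ₀⟩ := exists_synthG_eq ht0 hGfin
  refine ⟨φ₀, ?_, ?_⟩
  · rw [← hGn, ← hφ₀, sobolevNorm_synthG, ← ofReal_norm, ← ofReal_norm,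
      ← ENNReal.ofReal_pow (norm_nonneg _), ← ENNReal.ofReal_pow (norm_nonneg _),
      ← ENNReal.ofReal_mul (by positivity), ENNReal.ofReal_le_ofReal_iff (by positivity)] at hE
    exact hE
  · have h1 : ∫⁻ x in cube d, ‖sobolevOp hs φ x - realSynth (amp t φ₀) x‖ₑ ^ 2 =
        ‖restrictRe d (synthG hs φ - G₀)‖ₑ ^ 2 := by
      rw [enorm_sq_Lp]
      refine lintegral_congr_ae ?_
      rw [map_sub]
      have h2 := sobolevOp_ae_eq ht0 ht φ₀
      rw [show sobolevOp ht0 φ₀ = restrictRe d (synthG ht0 φ₀) from rfl, hφ₀] at h2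
      filter_upwards [h2, Lp.coeFn_sub (restrictRe d (synthG hs φ)) (restrictRe d G₀)] with x h3 h4
      rw [h4, Pi.sub_apply, h3]
      rfl
    rw [h1]
    refine (norm_restrictRe_le _).trans ?_
    rw [ENNReal.ofReal_mul (by positivity), ENNReal.ofReal_pow (norm_nonneg _), ofReal_norm,
      ← energy_amp s φ, ← enorm_fourier_sub, enorm_sq_Lp]
    refine le_trans (le_of_eq (lintegral_congr_ae ?_)) (lintegral_tail_sq_le hs hM0
      (δ := fun η => amp s φ η - γ η) (fun η => ?_) fun η hη => ?_)
    · filter_upwards [Lp.coeFn_sub (𝓕 (synthG hs φ) : Lp ℂ 2 (volume : Measure (E d)))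
        (𝓕 G₀), fourier_synthG_ae hs φ, hFG.symm ▸ hγ2.coeFn_toLp] with η h3 h4 h5
      rw [h3, Pi.sub_apply, h4, h5]
    · rw [hγ]
      unfold indicator
      split_ifs
      · rw [sub_self, norm_zero]; positivity
      · rw [sub_zero]
    · rw [hγ, indicator_of_mem (by simpa using hη.le), sub_self]

/-! ### The error of ridge regression for a fixed design -/

theorem two_mul_ofReal (x : ℝ) : 2 * ENNReal.ofReal x = ENNReal.ofReal (2 * x) := by
  rw [ENNReal.ofReal_mul (by norm_num), ENNReal.ofReal_ofNat]

theorem ofReal_sub_sq_le (a b c : ℝ) : ENNReal.ofReal ((a - c) ^ 2) ≤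
    2 * ENNReal.ofReal ((a - b) ^ 2) + 2 * ENNReal.ofReal ((b - c) ^ 2) := by
  rw [two_mul_ofReal, two_mul_ofReal, ← ENNReal.ofReal_add (by positivity) (by positivity)]
  refine ENNReal.ofReal_le_ofReal ?_
  nlinarith [sq_nonneg (a - b - (b - c))]

/-- The inverse resolution `n^{1/(2s+d)}`. -/
def resol (d n : ℕ) (s : ℝ) : ℝ := (n : ℝ) ^ (1 / (2 * s + d))

theorem one_le_resol {d n : ℕ} {s : ℝ} (hs : 0 < s) (hn : 1 ≤ n) : 1 ≤ resol d n s :=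
  Real.one_le_rpow (by exact_mod_cast hn) (by positivity)

theorem resol_rpow (d n : ℕ) (s x : ℝ) : resol d n s ^ x = (n : ℝ) ^ (x / (2 * s + d)) := by
  rw [resol, ← Real.rpow_mul (by positivity), one_div_mul_eq_div]

theorem le_ceil_resol (d n : ℕ) (s : ℝ) : resol d n s ≤ ⌈resol d n s⌉₊ := Nat.le_ceil _

theorem ceil_resol_le {d n : ℕ} {s : ℝ} (hs : 0 < s) (hn : 1 ≤ n) :
    (⌈resol d n s⌉₊ : ℝ) ≤ 2 * resol d n s := by
  have h1 := one_le_resol (d := d) hs hn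
  have h2 := Nat.ceil_lt_add_one (show 0 ≤ resol d n s by linarith)
  linarith

theorem one_le_ceil_resol {d n : ℕ} {s : ℝ} (hs : 0 < s) (hn : 1 ≤ n) : 1 ≤ ⌈resol d n s⌉₊ :=
  Nat.one_le_ceil_iff.2 (by linarith [one_le_resol (d := d) hs hn])

-- At resolution M = ⌈N⌉ the choice of lam makes the ridge form dominate the right-hand side of the
-- sampling bound. It therefore controls the leverage, with Λ of order N^d, and the L²-norm of the
-- difference between the estimator and the low-frequency part of f. The residual `ρ` is chosen
-- before the design and the matrix `a` before the noise, so that expectations can be taken in that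
-- order.
set_option maxHeartbeats 1000000 in
theorem exists_ridge_risk_bound {d : ℕ} (hd : 1 ≤ d) {s L κ₁ c₀ : ℝ} (κ₂ : ℝ) (hs : 0 < s)
    (hL : 0 < L) (hκ₁ : 0 < κ₁) (hc₀ : 0 < c₀) :
    ∃ K : ℕ, 1 ≤ K ∧ ∃ C : ℝ, 0 < C ∧ ∀ f ∈ sobolevBall d s L, ∀ n : ℕ, 1 ≤ n →
    ∃ ρ : E d → ℝ, AEMeasurable ρ (volume.restrict (cube d)) ∧
      ∫⁻ x in cube d, ENNReal.ofReal (ρ x ^ 2) ≤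
        ENNReal.ofReal (C * resol d n s ^ (-(2 * s))) ∧
      ∀ lam : ℝ, κ₁ * resol d n s ^ (-(2 * penaltyOrder d s)) ≤ lam →
      lam ≤ κ₂ * resol d n s ^ (-(2 * penaltyOrder d s)) →
      ∀ X : Fin n → E d, (∀ i, X i ∈ cube d) → Occupied c₀ ⌈resol d n s⌉₊ K X →
      ∃ a : Fin n → Fin n → ℝ, (∀ i, a i i ≤ C * resol d n s ^ d) ∧
        (∀ ξ : Fin n → ℝ, 0 ≤ (1 / n : ℝ) ^ 2 * ∑ i, ∑ j, ξ i * ξ j * a i j) ∧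
        ∀ (ξ : Fin n → ℝ) (g : E d → ℝ),
          IsRidge (penaltyOrder d s) lam (fun i => (X i, f (X i) + ξ i)) g →
          ∫⁻ x in cube d, ENNReal.ofReal ((g x - f x) ^ 2) ≤
            ENNReal.ofReal (C * ((1 / n : ℝ) * ∑ i, ρ (X i) ^ 2 +
              (1 / n : ℝ) ^ 2 * ∑ i, ∑ j, ξ i * ξ j * a i j + resol d n s ^ (-(2 * s)))) := by
  have ht := half_lt_penaltyOrder hd s
  have hst := le_penaltyOrder (d := d) s
  set t := penaltyOrder d s with htdef
  have ht0 : 0 ≤ t := hs.le.trans hst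
  obtain ⟨K, hK, Cs, hCs, hS⟩ := exists_sampling_bound_amp hd ht hc₀
  refine ⟨K, hK, ?_⟩
  set T := Cs * (1 + 1 / κ₁) with hT
  have hTpos : 0 < T := by positivity
  set C₁ := ((1 + (2 * Real.pi) ^ 2) * 4) ^ (t - s) with hC₁
  have hC₁pos : 0 < C₁ := by positivity
  set C := 64 * T + 16 * T * (|κ₂| * C₁ * L ^ 2) + 2 * L ^ 2 + T * 2 ^ d with hC
  have hp1 : 0 ≤ 16 * T * (|κ₂| * C₁ * L ^ 2) := by positivity
  have hp2 : 0 < 2 * L ^ 2 := by positivity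
  have hp3 : 0 < T * 2 ^ d := by positivity
  have hCpos : 0 < C := by positivity
  refine ⟨C, hCpos, fun f hf n hn => ?_⟩
  set N := resol d n s with hN
  have hN1 : 1 ≤ N := one_le_resol hs hn
  have hN0 : 0 < N := by linarith
  set M := ⌈N⌉₊ with hMdef
  have hM1 : 1 ≤ M := one_le_ceil_resol hs hn
  have hNM : N ≤ M := le_ceil_resol d n s
  have hMN : (M : ℝ) ≤ 2 * N := ceil_resol_le hs hn
  have hM0 : (0 : ℝ) < M := by linarith
  obtain ⟨φf, hφf, hφn⟩ := exists_cubeNorm_eq hs.le (lt_of_le_of_lt hf ENNReal.ofReal_lt_top)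
  have hφL : ‖φf‖ ≤ L := by
    have : ‖φf‖ₑ ≤ ENNReal.ofReal L := by rw [hφn]; exact hf
    rwa [← ofReal_norm, ENNReal.ofReal_le_ofReal_iff hL.le] at this
  obtain ⟨φ₀, hφ₀, hlow⟩ := exists_lowFreq hs.le hst ht (by exact_mod_cast hM1 : (1 : ℝ) ≤ M) φf
  have hMs : (M : ℝ) ^ (-(2 * s)) ≤ N ^ (-(2 * s)) :=
    Real.rpow_le_rpow_of_nonpos hN0 hNM (by linarith)
  have hg₀ : Continuous (realSynth (amp t φ₀)) := continuous_realSynth (integrable_amp ht φ₀)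
  have hfm : AEMeasurable f (volume.restrict (cube d)) :=
    (Lp.aestronglyMeasurable (sobolevOp hs.le φf)).aemeasurable.congr hφf
  have hρint : ∫⁻ x in cube d, ENNReal.ofReal ((f x - realSynth (amp t φ₀) x) ^ 2) ≤
      ENNReal.ofReal (L ^ 2 * N ^ (-(2 * s))) := by
    refine le_trans (le_of_eq (lintegral_congr_ae ?_)) (hlow.trans (ENNReal.ofReal_le_ofReal ?_))
    · filter_upwards [hφf] with x hx
      rw [hx, ← ofReal_norm, ← ENNReal.ofReal_pow (norm_nonneg _), Real.norm_eq_abs, sq_abs]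
    · rw [mul_comm]
      gcongr
  refine ⟨fun x => f x - realSynth (amp t φ₀) x, hfm.sub hg₀.measurable.aemeasurable, ?_, ?_⟩
  · refine hρint.trans (ENNReal.ofReal_le_ofReal ?_)
    gcongr
    nlinarith
  intro lam hlam₁ hlam₂ X hX hocc
  have hlam : 0 < lam := lt_of_lt_of_le (by positivity) hlam₁
  have hSX := hS M hM1 n hn X hocc
  -- The only use of the lower bound on lam apart from its positivity: too small a penalty would not
  -- control the approximation error at scale 1/M.
  have hMt : (M : ℝ) ^ (-(2 * t)) ≤ 1 / κ₁ * lam := by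
    rw [one_div, ← div_eq_inv_mul, le_div_iff₀ hκ₁, mul_comm]
    refine le_trans (mul_le_mul_of_nonneg_left ?_ hκ₁.le) hlam₁
    exact Real.rpow_le_rpow_of_nonpos hN0 hNM (by linarith)
  have hform : ∀ φ : Lp ℂ 2 (volume : Measure (E d)),
      Cs * ((1 / n : ℝ) * ∑ i, realSynth (amp t φ) (X i) ^ 2 + (M : ℝ) ^ (-(2 * t)) * ‖φ‖ ^ 2) ≤
      T * (lam * ‖φ‖ ^ 2 + (1 / n : ℝ) * ∑ i, realSynth (amp t φ) (X i) ^ 2) := by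
    intro φ
    have h0 : 0 ≤ (1 / n : ℝ) * ∑ i, realSynth (amp t φ) (X i) ^ 2 :=
      mul_nonneg (by positivity) (Finset.sum_nonneg fun i _ => sq_nonneg _)
    have h1 := mul_le_mul_of_nonneg_right hMt (sq_nonneg ‖φ‖)
    have h2 : 0 ≤ lam * ‖φ‖ ^ 2 := by positivity
    have h3 : 0 ≤ 1 / κ₁ * ((1 / n : ℝ) * ∑ i, realSynth (amp t φ) (X i) ^ 2) :=
      mul_nonneg (by positivity) h0
    rw [hT, mul_assoc]
    refine mul_le_mul_of_nonneg_left ?_ hCs.le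
    nlinarith
  have hin : ∀ (φ : Lp ℂ 2 (volume : Measure (E d))) x,
      inner ℝ (evalVec (memLp_wt ht) x) φ = realSynth (amp t φ) x := fun φ x => inner_evalVec _ x φ
  obtain ⟨a, ha, hpsd, herr⟩ := exists_ridge_error_bound (Λ := T * M ^ d) hlam (by positivity)
    (fun i => evalVec (memLp_wt ht) (X i)) (fun i φ => by
      simp_rw [hin]
      have h1 := (hSX φ).2 (X i) (hX i)
      have h2 := mul_le_mul_of_nonneg_right (hform φ) (show (0 : ℝ) ≤ (M : ℝ) ^ d by positivity)
      nlinarith)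
  refine ⟨a, fun i => (ha i).trans ?_, hpsd, fun ξ g hg => ?_⟩
  · have h1 : (M : ℝ) ^ d ≤ 2 ^ d * N ^ d := by rw [← mul_pow]; gcongr
    have h2 : 0 < N ^ d := by positivity
    refine (mul_le_mul_of_nonneg_left h1 hTpos.le).trans ?_
    rw [← mul_assoc]
    exact mul_le_mul_of_nonneg_right (by linarith [mul_pos (show (0 : ℝ) < 64 by norm_num) hTpos])
      h2.le
  obtain ⟨φ, hgφ, hmin⟩ := hg.exists_amp ht hlam.le hX
  set u := φ - φ₀ with hu
  have hy : (fun i => f (X i) + ξ i) = fun i => inner ℝ (evalVec (memLp_wt ht) (X i)) φ₀ +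
      (f (X i) - realSynth (amp t φ₀) (X i)) + ξ i := by
    funext i; rw [hin]; ring
  have herr' := herr φ₀ φ (fun i => f (X i) - realSynth (amp t φ₀) (X i)) ξ (by
    rw [← hy]; exact hmin φ₀)
  simp_rw [hin] at herr'
  set R := (1 / n : ℝ) * ∑ i, (f (X i) - realSynth (amp t φ₀) (X i)) ^ 2 with hR
  set W := (1 / n : ℝ) ^ 2 * ∑ i, ∑ j, ξ i * ξ j * a i j with hW
  have hR0 : 0 ≤ R := mul_nonneg (by positivity) (Finset.sum_nonneg fun i _ => sq_nonneg _)
  have hW0 : 0 ≤ W := hpsd ξ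
  have hNs0 : 0 < N ^ (-(2 * s)) := by positivity
  -- Here the exponents -2t from lam and 2(t - s) from the low-frequency part combine to -2s,
  -- whatever t is.
  have hreg : lam * ‖φ₀‖ ^ 2 ≤ |κ₂| * C₁ * L ^ 2 * N ^ (-(2 * s)) := by
    have h1 : ((1 + (2 * Real.pi) ^ 2) * (M : ℝ) ^ 2) ^ (t - s) ≤ C₁ * N ^ (2 * (t - s)) := by
      rw [Real.rpow_mul hN0.le, Real.rpow_two, hC₁, ← Real.mul_rpow (by positivity) (by positivity)]
      refine Real.rpow_le_rpow (by positivity) ?_ (by linarith)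
      rw [mul_assoc]
      refine mul_le_mul_of_nonneg_left ?_ (by positivity)
      nlinarith
    have h2 : lam ≤ |κ₂| * N ^ (-(2 * t)) := hlam₂.trans
      (mul_le_mul_of_nonneg_right (le_abs_self _) (by positivity))
    have h3 : N ^ (-(2 * t)) * N ^ (2 * (t - s)) = N ^ (-(2 * s)) := by
      rw [← Real.rpow_add hN0]; congr 1; ring
    calc lam * ‖φ₀‖ ^ 2 ≤ (|κ₂| * N ^ (-(2 * t))) * ((C₁ * N ^ (2 * (t - s))) * L ^ 2) := by
          refine mul_le_mul h2 (hφ₀.trans ?_) (by positivity) (by positivity)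
          gcongr
      _ = |κ₂| * C₁ * L ^ 2 * N ^ (-(2 * s)) := by rw [← h3]; ring
  have hu2 : ∫⁻ x in cube d, ENNReal.ofReal (realSynth (amp t u) x ^ 2) ≤
      ENNReal.ofReal (T * (32 * R + 32 * W + 8 * (|κ₂| * C₁ * L ^ 2 * N ^ (-(2 * s))))) := by
    refine (hSX u).1.trans (ENNReal.ofReal_le_ofReal ((hform u).trans ?_))
    refine mul_le_mul_of_nonneg_left (herr'.trans ?_) hTpos.le
    linarith
  have hsub : ∀ x, realSynth (amp t u) x = realSynth (amp t φ) x - realSynth (amp t φ₀) x := by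
    intro x; rw [← hin, ← hin, ← hin, hu, inner_sub_right]
  calc ∫⁻ x in cube d, ENNReal.ofReal ((g x - f x) ^ 2)
      ≤ ∫⁻ x in cube d, (2 * ENNReal.ofReal (realSynth (amp t u) x ^ 2) +
          2 * ENNReal.ofReal ((f x - realSynth (amp t φ₀) x) ^ 2)) := by
        refine setLIntegral_mono_ae' (measurableSet_cube d)
          (Filter.Eventually.of_forall fun x hx => ?_)
        rw [hgφ hx, hsub, ← neg_sq (f x - _), neg_sub]
        exact ofReal_sub_sq_le _ _ _
    _ = 2 * (∫⁻ x in cube d, ENNReal.ofReal (realSynth (amp t u) x ^ 2)) +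
          2 * ∫⁻ x in cube d, ENNReal.ofReal ((f x - realSynth (amp t φ₀) x) ^ 2) := by
        have hm : Measurable fun x => ENNReal.ofReal (realSynth (amp t u) x ^ 2) :=
          ((continuous_realSynth (integrable_amp ht u)).measurable.pow_const 2).ennreal_ofReal
        rw [lintegral_add_left (hm.const_mul 2), lintegral_const_mul' _ _ (by simp),
          lintegral_const_mul' _ _ (by simp)]
    _ ≤ 2 * ENNReal.ofReal (T * (32 * R + 32 * W + 8 * (|κ₂| * C₁ * L ^ 2 * N ^ (-(2 * s))))) +
          2 * ENNReal.ofReal (L ^ 2 * N ^ (-(2 * s))) := by gcongr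
    _ ≤ _ := by
        rw [two_mul_ofReal, two_mul_ofReal, ← ENNReal.ofReal_add (by positivity) (by positivity)]
        refine ENNReal.ofReal_le_ofReal ?_
        have h1 : 0 ≤ (16 * T * (|κ₂| * C₁ * L ^ 2) + 2 * L ^ 2 + T * 2 ^ d) * (R + W) := by
          positivity
        have h2 : 0 ≤ (64 * T + T * 2 ^ d) * N ^ (-(2 * s)) := by positivity
        rw [hC]
        nlinarith

/-! ### The effect of the perturbation -/

/-- The supremum of the squared deviation of `h` from `f x` over the perturbations of `x`. -/
def advSup {d : ℕ} (r : ℝ) (h f : E d → ℝ) (x : E d) : ℝ≥0∞ :=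
  ⨆ x' ∈ cube d ∩ Metric.closedBall x r, ENNReal.ofReal (|h x' - f x| ^ 2)

theorem advSup_zero_le {d : ℕ} (h f : E d → ℝ) (x : E d) :
    advSup 0 h f x ≤ ENNReal.ofReal ((h x - f x) ^ 2) := by
  refine iSup₂_le fun x' hx' => ?_
  have : x' = x := by simpa using hx'.2
  rw [this, sq_abs]

theorem taylorPoly_one {d : ℕ} (γ : E d → ℂ) (x v : E d) :
    taylorPoly γ 1 x v = taylorPoly γ 1 x 0 := by
  simp [taylorPoly, taylorTerm, mono]

theorem ofReal_sub_sq_le_enorm {z w c : ℂ} : ENNReal.ofReal ((z.re - w.re) ^ 2) ≤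
    2 * ‖z - c‖ₑ ^ 2 + 2 * ‖w - c‖ₑ ^ 2 := by
  have h1 : ENNReal.ofReal ((z.re - w.re) ^ 2) ≤ ‖(z - c) + -(w - c)‖ₑ ^ 2 := by
    rw [← ofReal_norm, ← ENNReal.ofReal_pow (norm_nonneg _)]
    refine ENNReal.ofReal_le_ofReal ?_
    rw [← sq_abs, show z - c + -(w - c) = z - w by ring, ← Complex.sub_re]
    gcongr
    exact Complex.abs_re_le_norm _
  refine h1.trans ((enorm_add_sq_le _ _).trans ?_)
  rw [enorm_neg]

/-- With m = 1 the Taylor polynomial is a constant depending on x. Values at x and at the perturbed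
point are both close to it, so the oscillation is controlled by F and separates from the unperturbed
error. -/
theorem lintegral_advSup_le {d : ℕ} {r : ℝ} (hr : 0 ≤ r) {γ δ : E d → ℂ} {F : E d → ℝ≥0∞}
    (hF : Measurable F)
    (hγ : ∀ x v, ‖v‖ ≤ r → ‖𝓕⁻ γ (x + v) - taylorPoly δ 1 x v‖ₑ ^ 2 ≤ F x) {h f : E d → ℝ}
    (hh : EqOn h (realSynth γ) (cube d)) :
    ∫⁻ x in cube d, advSup r h f x ≤ 8 * (∫⁻ x, F x) +
      2 * ∫⁻ x in cube d, ENNReal.ofReal ((realSynth γ x - f x) ^ 2) := by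
  calc ∫⁻ x in cube d, advSup r h f x
      ≤ ∫⁻ x in cube d, (8 * F x + 2 * ENNReal.ofReal ((realSynth γ x - f x) ^ 2)) := by
        refine lintegral_mono fun x => iSup₂_le fun x' hx' => ?_
        rw [hh hx'.1, sq_abs]
        refine (ofReal_sub_sq_le _ (realSynth γ x) _).trans (add_le_add ?_ le_rfl)
        have h1 := hγ x (x' - x) (by simpa [dist_eq_norm] using hx'.2)
        have h2 := hγ x 0 (by simpa using hr)
        rw [taylorPoly_one, add_sub_cancel] at h1
        rw [add_zero] at h2
        refine (mul_le_mul_right (ofReal_sub_sq_le_enorm (c := taylorPoly δ 1 x 0)) 2).trans ?_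
        calc (2 : ℝ≥0∞) * (2 * ‖𝓕⁻ γ x' - taylorPoly δ 1 x 0‖ₑ ^ 2 +
              2 * ‖𝓕⁻ γ x - taylorPoly δ 1 x 0‖ₑ ^ 2) ≤ 2 * (2 * F x + 2 * F x) := by gcongr
          _ = 8 * F x := by ring
    _ = 8 * (∫⁻ x in cube d, F x) +
          2 * ∫⁻ x in cube d, ENNReal.ofReal ((realSynth γ x - f x) ^ 2) := by
        rw [lintegral_add_left (hF.const_mul 8), lintegral_const_mul' _ _ (by simp),
          lintegral_const_mul' _ _ (by simp)]
    _ ≤ _ := by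
        gcongr
        exact Measure.restrict_le_self

/-- The multiplier equals 1 for ‖η‖ ≤ 1/(4πr), so only the tail beyond that frequency is affected.
-/
theorem lintegral_truncation_error_le {d : ℕ} {s r : ℝ} (hs : 0 ≤ s) (hr : 0 < r)
    {G U : Lp ℂ 2 (volume : Measure (E d))}
    (hU : ∀ᵐ η : E d, (𝓕 U : Lp ℂ 2 (volume : Measure (E d))) η =
      (cutoff (r * (2 * Real.pi * ‖η‖)) : ℂ) * (𝓕 G : Lp ℂ 2 (volume : Measure (E d))) η) :
    ∫⁻ x in cube d, ENNReal.ofReal (((U x).re - (G x).re) ^ 2) ≤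
      ENNReal.ofReal ((4 * Real.pi * r) ^ (2 * s)) * sobolevNorm s G ^ 2 := by
  have h1 : ∫⁻ x in cube d, ENNReal.ofReal (((U x).re - (G x).re) ^ 2) ≤ ‖U - G‖ₑ ^ 2 := by
    rw [enorm_sq_Lp]
    refine le_trans (lintegral_mono_ae ?_) (setLIntegral_le_lintegral (cube d) _)
    filter_upwards [ae_restrict_of_ae (Lp.coeFn_sub U G)] with x hx
    rw [hx, Pi.sub_apply, ← ofReal_norm, ← ENNReal.ofReal_pow (norm_nonneg _), ← Complex.sub_re,
      ← sq_abs]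
    refine ENNReal.ofReal_le_ofReal ?_
    gcongr
    exact Complex.abs_re_le_norm _
  refine h1.trans ?_
  rw [← enorm_fourier_sub, enorm_sq_Lp, sobolevNorm_sq]
  have hpos : 0 < 4 * Real.pi * r := by positivity
  have h2 : (4 * Real.pi * r) ^ (2 * s) = (1 / (4 * Real.pi * r)) ^ (-(2 * s)) := by
    rw [one_div, Real.inv_rpow hpos.le, Real.rpow_neg hpos.le, inv_inv]
  rw [h2]
  refine le_trans (le_of_eq (lintegral_congr_ae ?_)) (lintegral_tail_sq_le hs (by positivity)
    (δ := fun η => (cutoff (r * (2 * Real.pi * ‖η‖)) : ℂ) *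
      (𝓕 G : Lp ℂ 2 (volume : Measure (E d))) η - (𝓕 G : Lp ℂ 2 (volume : Measure (E d))) η)
    (fun η => ?_) fun η hη => ?_)
  · filter_upwards [hU, Lp.coeFn_sub (𝓕 U : Lp ℂ 2 (volume : Measure (E d))) (𝓕 G)] with η h3 h4
    rw [h4, Pi.sub_apply, h3]
  · rw [← sub_one_mul, norm_mul, ← Complex.ofReal_one, ← Complex.ofReal_sub, Complex.norm_real]
    refine mul_le_of_le_one_left (norm_nonneg _) ?_
    rw [Real.norm_eq_abs, abs_le]
    constructor <;> linarith [cutoff_nonneg (r * (2 * Real.pi * ‖η‖)),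
      cutoff_le_one (r * (2 * Real.pi * ‖η‖))]
  · rw [cutoff_eq_one, Complex.ofReal_one, one_mul, sub_self]
    rw [abs_of_nonneg (by positivity)]
    rw [lt_div_iff₀ hpos] at hη
    linarith

theorem energy_cutoff_le {d : ℕ} {s r : ℝ} (G : Lp ℂ 2 (volume : Measure (E d))) :
    energy s (fun η => (cutoff (r * (2 * Real.pi * ‖η‖)) : ℂ) *
      (𝓕 G : Lp ℂ 2 (volume : Measure (E d))) η) ≤ sobolevNorm s G ^ 2 := by
  rw [sobolevNorm_sq]
  refine energy_mono fun η => ?_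
  rw [norm_mul, Complex.norm_real, Real.norm_eq_abs, abs_of_nonneg (cutoff_nonneg _)]
  exact mul_le_of_le_one_left (norm_nonneg _) (cutoff_le_one _)

theorem rpow_two_mul_le {s r : ℝ} (hr0 : 0 < r) (hr1 : r ≤ 1) :
    (4 * Real.pi * r) ^ (2 * s) ≤ (4 * Real.pi) ^ (2 * s) * r ^ (2 * min 1 s) := by
  rw [Real.mul_rpow (by positivity) hr0.le]
  refine mul_le_mul_of_nonneg_left ?_ (by positivity)
  exact Real.rpow_le_rpow_of_exponent_ge hr0 hr1 (by linarith [min_le_right 1 s])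

/-- For s > d/2 the projection itself oscillates little. For s ≤ d/2 only its truncation does, by
the low-frequency bound, which needs no lower limit on the smoothness. The projection enters only
through its distance from f, so the perturbation no longer concerns the statistical part. -/
theorem exists_adversarial_bound {d : ℕ} (hd : 1 ≤ d) {s L A : ℝ} (hs : 0 < s) (hA : 1 ≤ A) :
    ∃ C : ℝ, 0 < C ∧ ∀ r : ℝ, 0 ≤ r → r ≤ 1 → ∀ (n : ℕ) (lam : ℝ) (fhat : Data d n → E d → ℝ),
    IsPTKRR s L r lam A fhat → ∀ D : Data d n, (∀ i, (D i).1 ∈ cube d) →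
    ∃ g fbar : E d → ℝ, IsRidge (penaltyOrder d s) lam D g ∧ IsBallProjection s L g fbar ∧
      ∀ f : E d → ℝ, ∫⁻ x in cube d, advSup r (fhat D) f x ≤
        ENNReal.ofReal (C * r ^ (2 * min 1 s)) +
          4 * ∫⁻ x in cube d, ENNReal.ofReal ((fbar x - f x) ^ 2) := by
  obtain ⟨C₁, hC₁, hlow⟩ := exists_low_approx hd 1 hs.le (le_refl (1 : ℝ))
  obtain ⟨C₂, hC₂, hloc⟩ : ∃ C : ℝ, 0 < C ∧ ((d : ℝ) / 2 < s → ∀ h : ℝ, 0 < h → h ≤ 1 →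
      ∀ γ : E d → ℂ, AEStronglyMeasurable γ → energy s γ < ∞ →
      ∃ F : E d → ℝ≥0∞, Measurable F ∧
        ∫⁻ x, F x ≤ ENNReal.ofReal (C * h ^ (2 * min ((1 : ℕ) : ℝ) s)) * energy s γ ∧
        ∀ x v, ‖v‖ ≤ 1 * h →
          ‖𝓕⁻ γ (x + v) - taylorPoly (band (-1) (1 / h) γ) 1 x v‖ₑ ^ 2 ≤ F x) := by
    by_cases hcase : (d : ℝ) / 2 < s
    · obtain ⟨C, hC, h⟩ := exists_local_approx hd 1 hcase (le_refl (1 : ℝ))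
      exact ⟨C, hC, fun _ => h⟩
    · exact ⟨1, one_pos, fun h => absurd h hcase⟩
  simp only [one_mul, Nat.cast_one] at hlow hloc
  set B := (A * L) ^ 2 with hB
  have hB0 : 0 ≤ B := sq_nonneg _
  refine ⟨8 * C₁ * B + 8 * C₂ * L ^ 2 + 4 * (4 * Real.pi) ^ (2 * s) * B + 1, by positivity,
    fun r hr0 hr1 n lam fhat hfhat D hD => ?_⟩
  have hCr : ∀ c : ℝ, c ≤ 8 * C₁ * B + 8 * C₂ * L ^ 2 + 4 * (4 * Real.pi) ^ (2 * s) * B + 1 →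
      ENNReal.ofReal (c * r ^ (2 * min 1 s)) ≤ ENNReal.ofReal
        ((8 * C₁ * B + 8 * C₂ * L ^ 2 + 4 * (4 * Real.pi) ^ (2 * s) * B + 1) *
          r ^ (2 * min 1 s)) := fun c hc =>
    ENNReal.ofReal_le_ofReal (mul_le_mul_of_nonneg_right hc (by positivity))
  have h24 : ∀ x : ℝ≥0∞, 2 * x ≤ 4 * x := fun x => by gcongr; norm_num
  obtain ⟨g, hg, ⟨hcase, hproj, hcont⟩ | ⟨hcase, fbar, hproj, hT⟩⟩ := hfhat D hD
  · refine ⟨g, fhat D, hg, hproj, fun f => ?_⟩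
    -- The local approximation needs a positive scale; at r = 0 the supremum runs over at most one
    -- point.
    rcases hr0.eq_or_lt with rfl | hr
    · refine (lintegral_mono fun x => advSup_zero_le _ _ _).trans (le_add_left ?_)
      exact le_mul_of_one_le_left' (by norm_num)
    obtain ⟨θ, hθ, hθn⟩ := ContinuousSobolev.exists_amp hcase
      (g := fhat D) ⟨hcont, lt_of_le_of_lt hproj.1 ENNReal.ofReal_lt_top⟩
    obtain ⟨F, hFm, hFi, hF⟩ := hloc hcase r hr hr1 _ (aestronglyMeasurable_amp s θ)
      (energy_amp_lt_top s θ)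
    refine (lintegral_advSup_le hr0 hFm hF hθ).trans (add_le_add ?_ ?_)
    · refine le_trans ?_ (hCr (8 * C₂ * L ^ 2) ?_)
      · have h1 : ‖θ‖ₑ ^ 2 ≤ ENNReal.ofReal (L ^ 2) := by
          rw [hθn]
          refine (pow_le_pow_left' hproj.1 2).trans ?_
          rw [← sq_abs, ENNReal.ofReal_pow (abs_nonneg _)]
          gcongr
          exact le_abs_self _
        rw [energy_amp] at hFi
        calc 8 * ∫⁻ x, F x ≤ 8 * (ENNReal.ofReal (C₂ * r ^ (2 * min 1 s)) *
              ENNReal.ofReal (L ^ 2)) := by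
              refine mul_le_mul_right (hFi.trans (mul_le_mul_right h1 _)) _
          _ = _ := by
              rw [← ENNReal.ofReal_ofNat, ← ENNReal.ofReal_mul (by positivity),
                ← ENNReal.ofReal_mul (by norm_num)]
              congr 1; ring
      · have : 0 ≤ 8 * C₁ * B + 4 * (4 * Real.pi) ^ (2 * s) * B + 1 := by positivity
        linarith
    · refine (h24 _).trans (mul_le_mul_right (le_of_eq ?_) _)
      exact setLIntegral_congr_fun (measurableSet_cube d) fun x hx => by simp only [hθ hx]
  · refine ⟨g, fbar, hg, hproj, fun f => ?_⟩
    obtain ⟨G, U, hGf, -, hGn, hU, hUu, hcont⟩ := hT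
    have hGre : fbar =ᵐ[volume.restrict (cube d)] fun x => (G x).re := by
      filter_upwards [hGf] with x hx
      rw [hx, Complex.ofReal_re]
    rcases hr0.eq_or_lt with rfl | hr
    · have hUG : U = G := by
        have h1 : (𝓕 U : Lp ℂ 2 (volume : Measure (E d))) = 𝓕 G := by
          refine Lp.ext ?_
          filter_upwards [hU] with η h
          rw [h, zero_mul, cutoff_eq_one (by norm_num), Complex.ofReal_one, one_mul]
        exact (Lp.fourierTransformₗᵢ (E d) ℂ).injective h1
      refine (lintegral_mono fun x => advSup_zero_le _ _ _).trans (le_add_left ?_)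
      refine le_trans (le_of_eq (lintegral_congr_ae ?_)) (le_mul_of_one_le_left' (by norm_num))
      filter_upwards [hGf, hUu] with x h1 h2
      rw [hUG, h1] at h2
      rw [Complex.ofReal_injective h2]
    have hGL : sobolevNorm s G ^ 2 ≤ ENNReal.ofReal B := by
      have h1 : sobolevNorm s G ≤ ENNReal.ofReal (A * L) := by
        rw [ENNReal.ofReal_mul (by linarith)]
        exact hGn.trans (mul_le_mul_right hproj.1 _)
      refine (pow_le_pow_left' h1 2).trans ?_
      rw [hB, ← sq_abs, ENNReal.ofReal_pow (abs_nonneg _)]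
      gcongr
      exact le_abs_self _
    set γ : E d → ℂ := fun η => (cutoff (r * (2 * Real.pi * ‖η‖)) : ℂ) *
      (𝓕 G : Lp ℂ 2 (volume : Measure (E d))) η with hγ
    have hband : BandLimited (1 / r) γ := by
      refine ⟨(memLp_congr_ae hU).1 (Lp.memLp _), fun η hη => ?_⟩
      have := cutMul_eq_zero hr hη
      rw [cutMul] at this
      rw [hγ]
      simp only [this, Complex.ofReal_zero, zero_mul]
    have hUae : U =ᵐ[volume] 𝓕⁻ γ := re_ae_eq_realSynth hU hband.integrable
    have hEq : EqOn (fhat D) (realSynth γ) (cube d) := by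
      refine eqOn_cube_of_ae ?_ (hcont hr)
        (continuous_realSynth hband.integrable).continuousOn
      filter_upwards [hUu, ae_restrict_of_ae hUae] with x h1 h2
      rw [realSynth, ← h2, h1, Complex.ofReal_re]
    obtain ⟨F, hFm, hFi, hF⟩ := hlow r hr γ hband
    refine (lintegral_advSup_le hr0 hFm hF hEq).trans ?_
    have hFi' : 8 * ∫⁻ x, F x ≤ ENNReal.ofReal (8 * C₁ * B * r ^ (2 * min 1 s)) := by
      calc 8 * ∫⁻ x, F x ≤ 8 * (ENNReal.ofReal (C₁ * r ^ (2 * min 1 s)) *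
            ENNReal.ofReal B) :=
            mul_le_mul_right (hFi.trans (mul_le_mul_right ((energy_cutoff_le G).trans hGL) _)) _
        _ = _ := by
            rw [← ENNReal.ofReal_ofNat, ← ENNReal.ofReal_mul (by positivity),
              ← ENNReal.ofReal_mul (by norm_num)]
            congr 1; ring
    have htr : ∫⁻ x in cube d, ENNReal.ofReal ((realSynth γ x - fbar x) ^ 2) ≤
        ENNReal.ofReal ((4 * Real.pi) ^ (2 * s) * r ^ (2 * min 1 s) * B) := by
      refine le_trans (le_of_eq (lintegral_congr_ae ?_))
        ((lintegral_truncation_error_le hs.le hr hU).trans ?_)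
      · filter_upwards [hGre, ae_restrict_of_ae hUae] with x h1 h2
        rw [h1, h2, realSynth]
      · refine (mul_le_mul' (ENNReal.ofReal_le_ofReal (rpow_two_mul_le hr hr1)) hGL).trans ?_
        rw [← ENNReal.ofReal_mul (by positivity)]
    have hm : AEMeasurable (fun x => 2 * ENNReal.ofReal ((realSynth γ x - fbar x) ^ 2))
        (volume.restrict (cube d)) := by
      have h1 : AEMeasurable fbar (volume.restrict (cube d)) :=
        ((Complex.measurable_re.comp (Lp.stronglyMeasurable G).measurable).aemeasurable).congr hGre.symm
      exact ((((continuous_realSynth hband.integrable).measurable.aemeasurable.sub h1).pow_const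
        2).ennreal_ofReal).const_mul 2
    have hsplit : ∫⁻ x in cube d, ENNReal.ofReal ((realSynth γ x - f x) ^ 2) ≤
        2 * ENNReal.ofReal ((4 * Real.pi) ^ (2 * s) * r ^ (2 * min 1 s) * B) +
        2 * ∫⁻ x in cube d, ENNReal.ofReal ((fbar x - f x) ^ 2) := by
      refine (lintegral_mono fun x => ofReal_sub_sq_le _ (fbar x) _).trans ?_
      rw [lintegral_add_left' hm, lintegral_const_mul' _ _ (by simp),
        lintegral_const_mul' _ _ (by simp)]
      gcongr
    calc 8 * (∫⁻ x, F x) + 2 * ∫⁻ x in cube d, ENNReal.ofReal ((realSynth γ x - f x) ^ 2)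
        ≤ ENNReal.ofReal (8 * C₁ * B * r ^ (2 * min 1 s)) +
          2 * (2 * ENNReal.ofReal ((4 * Real.pi) ^ (2 * s) * r ^ (2 * min 1 s) * B) +
          2 * ∫⁻ x in cube d, ENNReal.ofReal ((fbar x - f x) ^ 2)) :=
          add_le_add hFi' (mul_le_mul_right hsplit _)
      _ = ENNReal.ofReal ((8 * C₁ * B + 4 * (4 * Real.pi) ^ (2 * s) * B) * r ^ (2 * min 1 s)) +
          4 * ∫⁻ x in cube d, ENNReal.ofReal ((fbar x - f x) ^ 2) := by
          rw [mul_add, ← mul_assoc, ← mul_assoc, ← add_assoc, show (2 : ℝ≥0∞) * 2 = 4 by norm_num]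
          congr 1
          rw [← ENNReal.ofReal_ofNat 4, ← ENNReal.ofReal_mul (by norm_num),
            ← ENNReal.ofReal_add (by positivity) (by positivity)]
          congr 1; ring
      _ ≤ _ := by
          refine add_le_add (hCr _ ?_) le_rfl
          have : 0 ≤ 8 * C₂ * L ^ 2 := by positivity
          linarith

/-! ### The laws of the covariates and of the noise -/

theorem IsCovariateDensity.isProbabilityMeasure {d : ℕ} {a b : ℝ} {p : E d → ℝ}
    (hp : IsCovariateDensity a b p) : IsProbabilityMeasure (covariateLaw p) :=
  ⟨by rw [covariateLaw, withDensity_apply _ MeasurableSet.univ, setLIntegral_univ, hp.total]⟩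

theorem covariateLaw_absolutelyContinuous {d : ℕ} (p : E d → ℝ) :
    covariateLaw p ≪ volume.restrict (cube d) := withDensity_absolutelyContinuous _ _

theorem ae_covariateLaw_mem_cube {d : ℕ} (p : E d → ℝ) : ∀ᵐ x ∂(covariateLaw p), x ∈ cube d :=
  (covariateLaw_absolutelyContinuous p).ae_le (ae_restrict_mem (measurableSet_cube d))

theorem IsCovariateDensity.lintegral_le {d : ℕ} {a b : ℝ} {p : E d → ℝ}
    (hp : IsCovariateDensity a b p) (f : E d → ℝ≥0∞) :
    ∫⁻ x, f x ∂(covariateLaw p) ≤ ENNReal.ofReal b * ∫⁻ x in cube d, f x := by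
  have h : covariateLaw p ≤ ENNReal.ofReal b • volume.restrict (cube d) := by
    refine Measure.le_iff.2 fun S hS => ?_
    rw [covariateLaw, withDensity_apply _ hS, Measure.smul_apply, smul_eq_mul,
      ← setLIntegral_const]
    refine lintegral_mono_ae (ae_restrict_of_ae ?_)
    filter_upwards [ae_restrict_mem (measurableSet_cube d)] with x hx
    exact ENNReal.ofReal_le_ofReal (hp.upper x hx)
  refine (lintegral_mono' h le_rfl).trans ?_
  rw [lintegral_smul_measure, smul_eq_mul]

theorem IsCovariateDensity.le_lintegral {d : ℕ} {a b : ℝ} {p : E d → ℝ}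
    (hp : IsCovariateDensity a b p) (f : E d → ℝ≥0∞) :
    ENNReal.ofReal a * ∫⁻ x in cube d, f x ≤ ∫⁻ x, f x ∂(covariateLaw p) := by
  have h : ENNReal.ofReal a • volume.restrict (cube d) ≤ covariateLaw p := by
    refine Measure.le_iff.2 fun S hS => ?_
    rw [covariateLaw, withDensity_apply _ hS, Measure.smul_apply, smul_eq_mul,
      ← setLIntegral_const]
    refine lintegral_mono_ae (ae_restrict_of_ae ?_)
    filter_upwards [ae_restrict_mem (measurableSet_cube d)] with x hx
    exact ENNReal.ofReal_le_ofReal (hp.lower x hx)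
  refine le_trans ?_ (lintegral_mono' h le_rfl)
  rw [lintegral_smul_measure, smul_eq_mul]

/-- Integrate x² ≤ 2(e^x + e^{-x} - 2) at x = t/σ, using the moment generating function at ±1/σ: the
result is at most 4(√e - 1)σ² < 3σ². The sharp constant 1 is not needed. -/
theorem integral_sq_le_of_subGaussian {σ : ℝ≥0} (hσ : 0 < σ) {ν : Measure ℝ}
    (hν : ν ∈ subGaussianLaws σ) : ∫ t, t ^ 2 ∂ν ≤ 3 * (σ : ℝ) ^ 2 := by
  obtain ⟨hprob, -, hsub⟩ := hν
  have hσ' : (0 : ℝ) < σ := hσ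
  have hpt : ∀ t : ℝ, t ^ 2 ≤ 2 * (σ : ℝ) ^ 2 *
      (Real.exp ((σ : ℝ)⁻¹ * t) + Real.exp (-(σ : ℝ)⁻¹ * t) - 2) := by
    have h : ∀ x : ℝ, x ^ 2 ≤ 2 * (Real.exp x + Real.exp (-x) - 2) := by
      have h0 : ∀ x : ℝ, 0 ≤ x → x ^ 2 ≤ 2 * (Real.exp x + Real.exp (-x) - 2) := by
        intro x hx
        have h1 := Real.quadratic_le_exp_of_nonneg hx
        have h2 := Real.add_one_le_exp (-x)
        linarith
      intro x
      rcases le_total 0 x with hx | hx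
      · exact h0 x hx
      · have := h0 (-x) (by linarith)
        rw [neg_neg, neg_sq] at this
        linarith
    intro t
    have h1 := mul_le_mul_of_nonneg_left (h ((σ : ℝ)⁻¹ * t)) (sq_nonneg (σ : ℝ))
    have h2 : (σ : ℝ) ^ 2 * ((σ : ℝ)⁻¹ * t) ^ 2 = t ^ 2 := by field_simp
    rw [h2, ← neg_mul] at h1
    linarith
  have hi1 := hsub.integrable_exp_mul (σ : ℝ)⁻¹
  have hi2 := hsub.integrable_exp_mul (-(σ : ℝ)⁻¹)
  have hm1 := hsub.mgf_le (σ : ℝ)⁻¹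
  have hm2 := hsub.mgf_le (-(σ : ℝ)⁻¹)
  unfold mgf at hm1 hm2
  have he : ((σ ^ 2 : ℝ≥0) : ℝ) * ((σ : ℝ)⁻¹) ^ 2 / 2 = 1 / 2 := by
    push_cast
    field_simp
  rw [neg_sq] at hm2
  rw [he] at hm1 hm2
  have hexp : Real.exp (1 / 2) ≤ 1.7 := by
    have h1 : Real.exp (1 / 2) ^ 2 ≤ 1.7 ^ 2 := by
      rw [← Real.exp_nat_mul]
      norm_num
      linarith [Real.exp_one_lt_d9]
    exact (pow_le_pow_iff_left₀ (Real.exp_pos _).le (by norm_num) two_ne_zero).1 h1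
  have hi12 : Integrable (fun t => Real.exp ((σ : ℝ)⁻¹ * t) + Real.exp (-(σ : ℝ)⁻¹ * t)) ν :=
    hi1.add hi2
  calc ∫ t, t ^ 2 ∂ν ≤ ∫ t, 2 * (σ : ℝ) ^ 2 *
        (Real.exp ((σ : ℝ)⁻¹ * t) + Real.exp (-(σ : ℝ)⁻¹ * t) - 2) ∂ν :=
        integral_mono_of_nonneg (Filter.Eventually.of_forall fun t => sq_nonneg t)
          ((hi12.sub (integrable_const 2)).const_mul _)
          (Filter.Eventually.of_forall hpt)
    _ = 2 * (σ : ℝ) ^ 2 * ((∫ t, Real.exp ((σ : ℝ)⁻¹ * t) ∂ν) +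
          (∫ t, Real.exp (-(σ : ℝ)⁻¹ * t) ∂ν) - 2) := by
        rw [integral_const_mul, integral_sub hi12 (integrable_const 2),
          integral_add hi1 hi2]
        simp
    _ ≤ 2 * (σ : ℝ) ^ 2 * (1.7 + 1.7 - 2) := by gcongr <;> linarith
    _ ≤ 3 * (σ : ℝ) ^ 2 := by nlinarith [sq_nonneg (σ : ℝ)]

theorem integrable_sum_sum_mul {n : ℕ} {ν : Measure ℝ} [IsProbabilityMeasure ν]
    (hν : MemLp (fun t : ℝ => t) 2 ν) (a : Fin n → Fin n → ℝ) :
    Integrable (fun ξ : Fin n → ℝ => ∑ i, ∑ j, ξ i * ξ j * a i j) (Measure.pi fun _ => ν) := by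
  refine integrable_finsetSum _ fun i _ => integrable_finsetSum _ fun j _ => Integrable.mul_const ?_ _
  have h : ∀ i, MemLp (fun ξ : Fin n → ℝ => ξ i) 2 (Measure.pi fun _ => ν) := fun i =>
    hν.comp_measurePreserving (measurePreserving_eval (fun _ : Fin n => ν) i)
  exact MemLp.integrable_mul (h i) (h j)

/-- Independence and centring kill the off-diagonal terms, so only the leverages on the diagonal
matter for the variance. -/
theorem integral_sum_sum_mul {n : ℕ} {ν : Measure ℝ} [IsProbabilityMeasure ν]
    (hν : MemLp (fun t : ℝ => t) 2 ν) (h0 : ∫ t, t ∂ν = 0) (a : Fin n → Fin n → ℝ) :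
    ∫ ξ : Fin n → ℝ, ∑ i, ∑ j, ξ i * ξ j * a i j ∂(Measure.pi fun _ => ν) =
      ∑ i, (∫ t, t ^ 2 ∂ν) * a i i := by
  have h : ∀ i, MemLp (fun ξ : Fin n → ℝ => ξ i) 2 (Measure.pi fun _ => ν) := fun i =>
    hν.comp_measurePreserving (measurePreserving_eval (fun _ : Fin n => ν) i)
  have hint : ∀ i j, Integrable (fun ξ : Fin n → ℝ => ξ i * ξ j * a i j)
      (Measure.pi fun _ => ν) := fun i j => (MemLp.integrable_mul (h i) (h j)).mul_const _
  have hev : ∀ (i : Fin n) (g : ℝ → ℝ), AEStronglyMeasurable g ν →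
      ∫ ξ : Fin n → ℝ, g (ξ i) ∂(Measure.pi fun _ => ν) = ∫ t, g t ∂ν := by
    intro i g hg
    have hmp := measurePreserving_eval (fun _ : Fin n => ν) i
    have h1 := integral_map (μ := Measure.pi fun _ : Fin n => ν) (φ := Function.eval i) (f := g)
      hmp.measurable.aemeasurable (by rw [hmp.map_eq]; exact hg)
    rw [hmp.map_eq] at h1
    exact h1.symm
  rw [integral_finsetSum _ fun i _ => integrable_finsetSum _ fun j _ => hint i j]
  refine Finset.sum_congr rfl fun i _ => ?_
  rw [integral_finsetSum _ fun j _ => hint i j, Finset.sum_eq_single i]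
  · rw [integral_mul_const]
    congr 1
    simp_rw [← sq]
    exact hev i (fun t => t ^ 2) (by fun_prop)
  · intro j _ hj
    have hind : IndepFun (fun ξ : Fin n → ℝ => ξ i) (fun ξ => ξ j) (Measure.pi fun _ => ν) :=
      (iIndepFun_pi (X := fun _ t => t) (μ := fun _ : Fin n => ν)
        fun _ => aemeasurable_id).indepFun hj.symm
    rw [integral_mul_const, hind.integral_fun_mul_eq_mul_integral (h i).aestronglyMeasurable
      (h j).aestronglyMeasurable, hev i (fun t => t) (by fun_prop), h0, zero_mul, zero_mul]
  · simp

/-! ### Occupation numbers -/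

/-- Chernoff's bound for the lower tail. The expectation of e^{-count} is (1 - (1 - e^{-1}) μ(S))^n
≤ e^{-0.6 q n}, since e^{-1} ≤ 0.4, and the factor e^{q n / 2} leaves e^{-q n / 10}. The exponential
majorizes the indicator of having fewer than q n / 2 points in S. -/
theorem lintegral_exp_sub_card_le {α : Type*} [MeasurableSpace α] {μ : Measure α}
    [IsProbabilityMeasure μ] {S : Set α} (hS : MeasurableSet S) {q : ℝ} (hq : q ≤ μ.real S)
    (hq0 : 0 ≤ q) (n : ℕ) :
    ∫⁻ X : Fin n → α, ENNReal.ofReal (Real.exp (q * n / 2 - Nat.card {i // X i ∈ S}))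
      ∂(Measure.pi fun _ => μ) ≤ ENNReal.ofReal (Real.exp (-(q * n / 10))) := by
  classical
  set g : α → ℝ := fun x => 1 - (1 - Real.exp (-1)) * S.indicator 1 x with hg
  have hS1 : Integrable (S.indicator (1 : α → ℝ)) μ := (integrable_const 1).indicator hS
  have hgi : Integrable g μ := (integrable_const 1).sub (hS1.const_mul _)
  have hgint : ∫ x, g x ∂μ = 1 - (1 - Real.exp (-1)) * μ.real S := by
    change ∫ x, (1 - (1 - Real.exp (-1)) * S.indicator 1 x) ∂μ = _
    rw [integral_sub (integrable_const 1) (hS1.const_mul _), integral_const_mul,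
      integral_indicator_one hS]
    simp
  have hcard : ∀ X : Fin n → α, Real.exp (-(Nat.card {i // X i ∈ S} : ℝ)) = ∏ i, g (X i) := by
    intro X
    have h1 : ∀ i, g (X i) = Real.exp (-(if X i ∈ S then 1 else 0)) := by
      intro i
      simp only [hg, indicator_apply, Pi.one_apply]
      split_ifs <;> simp
    simp_rw [h1]
    rw [← Real.exp_sum, Finset.sum_neg_distrib, Finset.sum_boole, Nat.card_eq_fintype_card,
      Fintype.card_subtype]
  have he : Real.exp (-1) ≤ 0.4 := by
    rw [Real.exp_neg, inv_le_comm₀ (Real.exp_pos _) (by norm_num)]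
    linarith [Real.exp_one_gt_d9]
  have hexp : ∀ X : Fin n → α, Real.exp (q * n / 2 - Nat.card {i // X i ∈ S}) =
      Real.exp (q * n / 2) * ∏ i, g (X i) := by
    intro X; rw [← hcard, ← Real.exp_add, sub_eq_add_neg]
  simp_rw [hexp]
  have hI : Integrable (fun X : Fin n → α => Real.exp (q * n / 2) * ∏ i, g (X i))
      (Measure.pi fun _ => μ) :=
    (Integrable.fintype_prod (f := fun _ => g) fun _ => hgi).const_mul _
  rw [← ofReal_integral_eq_lintegral_ofReal hI (Filter.Eventually.of_forall fun X => by
    simp only [Pi.zero_apply]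
    rw [← hcard]; positivity), integral_const_mul, integral_fintype_prod_eq_pow, hgint,
    Fintype.card_fin]
  refine ENNReal.ofReal_le_ofReal ?_
  have hSle : μ.real S ≤ 1 := measureReal_le_one
  have hb : 1 - (1 - Real.exp (-1)) * μ.real S ≤ Real.exp (-(0.6 * q)) := by
    have := Real.add_one_le_exp (-(0.6 * q))
    nlinarith [Real.exp_pos (-1)]
  have hb0 : 0 ≤ 1 - (1 - Real.exp (-1)) * μ.real S := by
    nlinarith [Real.exp_pos (-1), measureReal_nonneg (μ := μ) (s := S)]
  calc Real.exp (q * n / 2) * (1 - (1 - Real.exp (-1)) * μ.real S) ^ n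
      ≤ Real.exp (q * n / 2) * Real.exp (-(0.6 * q)) ^ n := by gcongr
    _ = Real.exp (-(q * n / 10)) := by
        rw [← Real.exp_nat_mul, ← Real.exp_add]
        congr 1; ring

theorem fineCell_eq_box {d M K : ℕ} (hM : 1 ≤ M) (k : Fin d → Fin M) (l : Fin d → Fin K) :
    fineCell M K k l = {x : E d | ∀ i, x i ∈ Ico (((k i : ℝ) + (l i : ℝ) / K) / M)
      (((k i : ℝ) + ((l i : ℝ) + 1) / K) / M)} := by
  have hM' : (0 : ℝ) < M := by exact_mod_cast hM
  ext x
  refine forall_congr' fun i => ?_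
  simp only [mem_Ico, div_le_iff₀ hM', lt_div_iff₀ hM']
  constructor <;> rintro ⟨h1, h2⟩ <;> constructor <;> linarith

theorem volume_fineCell {d M K : ℕ} (hM : 1 ≤ M) (hK : 1 ≤ K) (k : Fin d → Fin M)
    (l : Fin d → Fin K) : volume (fineCell M K k l) = ENNReal.ofReal (1 / ((M : ℝ) * K) ^ d) := by
  have hM' : (0 : ℝ) < M := by exact_mod_cast hM
  have hK' : (0 : ℝ) < K := by exact_mod_cast hK
  rw [fineCell_eq_box hM, volume_box fun i => Ico (((k i : ℝ) + (l i : ℝ) / K) / M)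
      (((k i : ℝ) + ((l i : ℝ) + 1) / K) / M)]
  have : ∀ i, ((k i : ℝ) + ((l i : ℝ) + 1) / K) / M - ((k i : ℝ) + (l i : ℝ) / K) / M =
      1 / ((M : ℝ) * K) := by intro i; field_simp; ring
  simp_rw [Real.volume_Ico, this]
  rw [Finset.prod_const, ← ENNReal.ofReal_pow (by positivity), Finset.card_univ, Fintype.card_fin,
    one_div_pow]

theorem IsCovariateDensity.le_fineCell {d : ℕ} {a b : ℝ} {p : E d → ℝ} (ha : 0 ≤ a)
    (hp : IsCovariateDensity a b p) {M K : ℕ} (hM : 1 ≤ M) (hK : 1 ≤ K) (k : Fin d → Fin M)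
    (l : Fin d → Fin K) : a / ((M : ℝ) * K) ^ d ≤ (covariateLaw p).real (fineCell M K k l) := by
  have := hp.isProbabilityMeasure
  have hm : MeasurableSet (fineCell M K k l) := by
    rw [fineCell_eq_box hM]
    exact measurableSet_coord fun i => measurableSet_Ico
  have hsub : fineCell M K k l ⊆ cube d := fun x hx =>
    closedCell_subset_cube k (mem_closedCell_of_mem_fineCell hM hx)
  have h := hp.le_lintegral ((fineCell M K k l).indicator 1)
  rw [lintegral_indicator_one hm, lintegral_indicator_one hm, Measure.restrict_apply hm,
    inter_eq_left.2 hsub, volume_fineCell hM hK, ← ENNReal.ofReal_mul ha] at h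
  rw [measureReal_def, ← ENNReal.ofReal_le_iff_le_toReal (measure_ne_top _ _)]
  convert h using 2
  ring

/-- The expected penalty for subcells with too few sample points. -/
theorem lintegral_occupation_le {d : ℕ} {a b : ℝ} {p : E d → ℝ} (ha : 0 ≤ a)
    (hp : IsCovariateDensity a b p) {M K : ℕ} (hM : 1 ≤ M) (hK : 1 ≤ K) (n : ℕ) :
    ∃ Q : (Fin n → E d) → ℝ≥0∞, (∀ X, ¬ Occupied (a / 2) M K X → 1 ≤ Q X) ∧
      ∫⁻ X, Q X ∂(Measure.pi fun _ => covariateLaw p) ≤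
        ENNReal.ofReal (((M : ℝ) * K) ^ d *
          Real.exp (-(a / ((M : ℝ) * K) ^ d * n / 10))) := by
  classical
  have := hp.isProbabilityMeasure
  have hm : ∀ k l, MeasurableSet (fineCell (d := d) M K k l) := fun k l => by
    rw [fineCell_eq_box hM]
    exact measurableSet_coord fun i => measurableSet_Ico
  have hmeas : ∀ k l, Measurable fun X : Fin n → E d => ENNReal.ofReal (Real.exp
      (a / ((M : ℝ) * K) ^ d * n / 2 - Nat.card {i // X i ∈ fineCell M K k l})) := by
    intro k l
    have h1 : ∀ X : Fin n → E d, (Nat.card {i // X i ∈ fineCell M K k l} : ℝ) =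
        ∑ i, (fineCell M K k l).indicator (fun _ => (1 : ℝ)) (X i) := by
      intro X
      simp_rw [indicator_apply]
      rw [Finset.sum_boole, Nat.card_eq_fintype_card, Fintype.card_subtype]
    simp_rw [h1]
    have h2 : Measurable fun X : Fin n → E d =>
        ∑ i, (fineCell M K k l).indicator (fun _ => (1 : ℝ)) (X i) :=
      Finset.measurable_sum _ fun i _ =>
        (measurable_const.indicator (hm k l)).comp (measurable_pi_apply i)
    exact (measurable_const.sub h2).exp.ennreal_ofReal
  -- A union bound over the subcells: a subcell with too few points makes its exponential at least
  -- 1.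
  refine ⟨fun X => ∑ k, ∑ l, ENNReal.ofReal (Real.exp
      (a / ((M : ℝ) * K) ^ d * n / 2 - Nat.card {i // X i ∈ fineCell M K k l})), fun X hX => ?_, ?_⟩
  · unfold Occupied at hX
    push Not at hX
    obtain ⟨k, l, hkl⟩ := hX
    refine le_trans ?_ (Finset.single_le_sum (f := fun k => ∑ l, ENNReal.ofReal (Real.exp
      (a / ((M : ℝ) * K) ^ d * n / 2 - Nat.card {i // X i ∈ fineCell M K k l})))
      (fun _ _ => zero_le) (Finset.mem_univ k))
    refine le_trans ?_ (Finset.single_le_sum (f := fun l => ENNReal.ofReal (Real.exp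
      (a / ((M : ℝ) * K) ^ d * n / 2 - Nat.card {i // X i ∈ fineCell M K k l})))
      (fun _ _ => zero_le) (Finset.mem_univ l))
    rw [← ENNReal.ofReal_one]
    refine ENNReal.ofReal_le_ofReal (Real.one_le_exp ?_)
    have : a / 2 * n / ((M : ℝ) * K) ^ d = a / ((M : ℝ) * K) ^ d * n / 2 := by ring
    linarith
  · rw [lintegral_finsetSum _ fun k _ => Finset.measurable_sum _ fun l _ => hmeas k l]
    simp_rw [lintegral_finsetSum _ fun l _ => hmeas _ l]
    calc ∑ k, ∑ l, ∫⁻ X : Fin n → E d, ENNReal.ofReal (Real.exp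
          (a / ((M : ℝ) * K) ^ d * n / 2 - Nat.card {i // X i ∈ fineCell M K k l}))
          ∂(Measure.pi fun _ => covariateLaw p)
        ≤ ∑ _k : Fin d → Fin M, ∑ _l : Fin d → Fin K,
          ENNReal.ofReal (Real.exp (-(a / ((M : ℝ) * K) ^ d * n / 10))) :=
          Finset.sum_le_sum fun k _ => Finset.sum_le_sum fun l _ =>
            lintegral_exp_sub_card_le (hm k l) (hp.le_fineCell ha hM hK k l) (by positivity) n
      _ = _ := by
          simp only [Finset.sum_const, Finset.card_univ, Fintype.card_fun, Fintype.card_fin,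
            nsmul_eq_mul]
          rw [ENNReal.ofReal_mul (by positivity), ← mul_assoc]
          congr 1
          rw [mul_pow, ENNReal.ofReal_mul (by positivity), ← Nat.cast_pow, ← Nat.cast_pow,
            ENNReal.ofReal_natCast, ENNReal.ofReal_natCast]

/-! ### The upper bound -/

theorem resol_rpow_eq {d n : ℕ} {s : ℝ} (hs : 0 < s) :
    resol d n s ^ (2 * s + d) = n := by
  have : 2 * s + (d : ℝ) ≠ 0 := by positivity
  rw [resol_rpow, div_self this, Real.rpow_one]

theorem resol_pow_div {d n : ℕ} {s : ℝ} (hs : 0 < s) (hn : 1 ≤ n) :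
    resol d n s ^ d / n = resol d n s ^ (-(2 * s)) := by
  have h1 : 0 < resol d n s := by linarith [one_le_resol (d := d) hs hn]
  have h2 := resol_rpow_eq (d := d) (n := n) hs
  calc resol d n s ^ d / n = resol d n s ^ (d : ℝ) / resol d n s ^ (2 * s + d) := by
        rw [h2, Real.rpow_natCast]
    _ = _ := by rw [← Real.rpow_sub h1]; congr 1; ring

theorem exists_exp_decay {c s : ℝ} (hc : 0 < c) (hs : 0 < s) (d : ℕ) :
    ∃ C : ℝ, 0 < C ∧ ∀ N : ℝ, 1 ≤ N →
      N ^ d * Real.exp (-(c * N ^ (2 * s))) ≤ C * N ^ (-(2 * s)) := by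
  obtain ⟨j, hj⟩ := exists_nat_ge ((d + 2 * s) / (2 * s))
  rw [div_le_iff₀ (by positivity)] at hj
  refine ⟨j.factorial / c ^ j, by positivity, fun N hN => ?_⟩
  have hN0 : 0 < N := by linarith
  set y := N ^ (2 * s) with hy
  have hy0 : 0 < y := by positivity
  have h1 := Real.pow_div_factorial_le_exp (c * y) (by positivity) j
  have h2 : N ^ d * y ≤ y ^ j := by
    rw [hy, ← Real.rpow_natCast, ← Real.rpow_natCast, ← Real.rpow_add hN0, ← Real.rpow_mul hN0.le]
    exact Real.rpow_le_rpow_of_exponent_le hN (by linarith)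
  rw [Real.exp_neg, Real.rpow_neg hN0.le, ← hy, ← div_eq_mul_inv, ← div_eq_mul_inv,
    div_le_div_iff₀ (Real.exp_pos _) hy0, div_mul_eq_mul_div, le_div_iff₀ (by positivity)]
  rw [mul_pow, div_le_iff₀ (by positivity)] at h1
  calc N ^ d * y * c ^ j ≤ y ^ j * c ^ j := by gcongr
    _ = c ^ j * y ^ j := mul_comm _ _
    _ ≤ _ := h1.trans (le_of_eq (mul_comm _ _))

/-- There are of order N^d subcells, each expecting of order n / N^d = N^{2s} points, so the
probability of failure is at most of order N^d exp(-c N^{2s}), which decays faster than any power of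
N. -/
theorem exists_occupation_bound {d : ℕ} {a s : ℝ} (ha : 0 < a) (hs : 0 < s) {K : ℕ} (hK : 1 ≤ K) :
    ∃ C : ℝ, 0 < C ∧ ∀ n : ℕ, 1 ≤ n →
      ((⌈resol d n s⌉₊ : ℝ) * K) ^ d *
        Real.exp (-(a / ((⌈resol d n s⌉₊ : ℝ) * K) ^ d * n / 10)) ≤
      C * resol d n s ^ (-(2 * s)) := by
  have hK' : (0 : ℝ) < K := by exact_mod_cast hK
  set c := a / (2 * K : ℝ) ^ d / 10 with hc
  obtain ⟨C, hC, h⟩ := exists_exp_decay (c := c) (by positivity) hs d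
  refine ⟨(2 * K : ℝ) ^ d * C, by positivity, fun n hn => ?_⟩
  have hN1 := one_le_resol (d := d) hs hn
  have hN0 : 0 < resol d n s := by linarith
  have hM1 : 1 ≤ ⌈resol d n s⌉₊ := one_le_ceil_resol hs hn
  have hM0 : (0 : ℝ) < ⌈resol d n s⌉₊ := by exact_mod_cast hM1
  have hMK : ((⌈resol d n s⌉₊ : ℝ) * K) ^ d ≤ (2 * K : ℝ) ^ d * resol d n s ^ d := by
    rw [← mul_pow]
    have := ceil_resol_le (d := d) hs hn
    exact pow_le_pow_left₀ (by positivity) (by nlinarith) d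
  have he : c * resol d n s ^ (2 * s) ≤ a / ((⌈resol d n s⌉₊ : ℝ) * K) ^ d * n / 10 := by
    have h1 : resol d n s ^ (2 * s) = n / resol d n s ^ d := by
      rw [eq_div_iff (by positivity), ← Real.rpow_natCast, ← Real.rpow_add hN0, resol_rpow_eq hs]
    calc c * resol d n s ^ (2 * s) = a / ((2 * K : ℝ) ^ d * resol d n s ^ d) * n / 10 := by
          rw [h1, hc]; field_simp
      _ ≤ _ := by gcongr
  calc ((⌈resol d n s⌉₊ : ℝ) * K) ^ d *
        Real.exp (-(a / ((⌈resol d n s⌉₊ : ℝ) * K) ^ d * n / 10))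
      ≤ ((2 * K : ℝ) ^ d * resol d n s ^ d) * Real.exp (-(c * resol d n s ^ (2 * s))) := by
        gcongr
    _ = (2 * K : ℝ) ^ d * (resol d n s ^ d * Real.exp (-(c * resol d n s ^ (2 * s)))) := by ring
    _ ≤ (2 * K : ℝ) ^ d * (C * resol d n s ^ (-(2 * s))) := mul_le_mul_of_nonneg_left (h _ hN1) (by positivity)
    _ = _ := by ring

theorem aemeasurable_of_mem_sobolevBall {d : ℕ} {s L : ℝ} (hs : 0 ≤ s) {f : E d → ℝ}
    (hf : f ∈ sobolevBall d s L) : AEMeasurable f (volume.restrict (cube d)) := by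
  obtain ⟨φ, h, -⟩ := exists_cubeNorm_eq hs (lt_of_le_of_lt hf ENNReal.ofReal_lt_top)
  exact (Lp.aestronglyMeasurable (sobolevOp hs φ)).aemeasurable.congr h

theorem lintegral_sq_le_of_mem_sobolevBall {d : ℕ} {s L : ℝ} (hs : 0 ≤ s) (hL : 0 ≤ L)
    {f : E d → ℝ} (hf : f ∈ sobolevBall d s L) :
    ∫⁻ x in cube d, ENNReal.ofReal (f x ^ 2) ≤ ENNReal.ofReal (L ^ 2) := by
  obtain ⟨φ, h, hn⟩ := exists_cubeNorm_eq hs (lt_of_le_of_lt hf ENNReal.ofReal_lt_top)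
  calc ∫⁻ x in cube d, ENNReal.ofReal (f x ^ 2) = ‖sobolevOp hs φ‖ₑ ^ 2 := by
        rw [enorm_sq_Lp]
        refine lintegral_congr_ae ?_
        filter_upwards [h] with x hx
        rw [hx, ← ofReal_norm, ← ENNReal.ofReal_pow (norm_nonneg _), Real.norm_eq_abs, sq_abs]
    _ ≤ ‖φ‖ₑ ^ 2 := enorm_sobolevOp_le hs φ
    _ ≤ ENNReal.ofReal L ^ 2 := by rw [hn]; exact pow_le_pow_left' hf 2
    _ = _ := (ENNReal.ofReal_pow hL 2).symm

theorem lintegral_ofReal_sub_sq_eq {d : ℕ} (g h : E d → ℝ) :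
    ∫⁻ x in cube d, ENNReal.ofReal ((g x - h x) ^ 2) =
      eLpNorm (g - h) 2 (volume.restrict (cube d)) ^ 2 := by
  rw [eLpNorm_eq_lintegral_rpow_enorm_toReal two_ne_zero (by norm_num), ← ENNReal.rpow_natCast,
    ← ENNReal.rpow_mul]
  norm_num
  refine lintegral_congr fun x => ?_
  rw [← ofReal_norm, ← ENNReal.ofReal_pow (norm_nonneg _), Real.norm_eq_abs, sq_abs]

/-- Since f is itself a competitor, the projection is at least as close to g as f is; the triangle
inequality does the rest. The factor 4, which convexity of the ball would remove, is harmless. -/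
theorem IsBallProjection.lintegral_le {d : ℕ} {s L : ℝ} {g h f : E d → ℝ} (hs : 0 ≤ s)
    (hp : IsBallProjection s L g h) (hg : ContinuousOn g (cube d)) (hf : f ∈ sobolevBall d s L) :
    ∫⁻ x in cube d, ENNReal.ofReal ((h x - f x) ^ 2) ≤
      4 * ∫⁻ x in cube d, ENNReal.ofReal ((g x - f x) ^ 2) := by
  have hgm : AEMeasurable g (volume.restrict (cube d)) := hg.aemeasurable (measurableSet_cube d)
  have hfm := aemeasurable_of_mem_sobolevBall hs hf
  have hm : AEMeasurable (fun x => 2 * ENNReal.ofReal ((g x - f x) ^ 2))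
      (volume.restrict (cube d)) := ((hgm.sub hfm).pow_const 2).ennreal_ofReal.const_mul 2
  have h1 : ∫⁻ x in cube d, ENNReal.ofReal ((h x - g x) ^ 2) ≤
      ∫⁻ x in cube d, ENNReal.ofReal ((g x - f x) ^ 2) := by
    have h2 : ∀ x, (g x - f x) ^ 2 = (f x - g x) ^ 2 := fun x => by ring
    simp_rw [h2, lintegral_ofReal_sub_sq_eq]
    exact pow_le_pow_left' (hp.2 f hf) 2
  calc ∫⁻ x in cube d, ENNReal.ofReal ((h x - f x) ^ 2)
      ≤ ∫⁻ x in cube d, (2 * ENNReal.ofReal ((h x - g x) ^ 2) +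
          2 * ENNReal.ofReal ((g x - f x) ^ 2)) := lintegral_mono fun x => ofReal_sub_sq_le _ _ _
    _ = 2 * (∫⁻ x in cube d, ENNReal.ofReal ((h x - g x) ^ 2)) +
          2 * ∫⁻ x in cube d, ENNReal.ofReal ((g x - f x) ^ 2) := by
        rw [lintegral_add_right' _ hm, lintegral_const_mul' _ _ (by simp),
          lintegral_const_mul' _ _ (by simp)]
    _ ≤ 2 * (∫⁻ x in cube d, ENNReal.ofReal ((g x - f x) ^ 2)) +
          2 * ∫⁻ x in cube d, ENNReal.ofReal ((g x - f x) ^ 2) := by gcongr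
    _ = _ := by ring

theorem lintegral_sub_sq_le_of_mem {d : ℕ} {s L : ℝ} (hs : 0 ≤ s) (hL : 0 ≤ L) {h f : E d → ℝ}
    (hh : h ∈ sobolevBall d s L) (hf : f ∈ sobolevBall d s L) :
    ∫⁻ x in cube d, ENNReal.ofReal ((h x - f x) ^ 2) ≤ ENNReal.ofReal (4 * L ^ 2) := by
  have hm : AEMeasurable (fun x => 2 * ENNReal.ofReal ((0 - f x) ^ 2))
      (volume.restrict (cube d)) :=
    ((aemeasurable_const.sub (aemeasurable_of_mem_sobolevBall hs hf)).pow_const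
      2).ennreal_ofReal.const_mul 2
  refine (lintegral_mono fun x => ofReal_sub_sq_le _ 0 _).trans ?_
  rw [lintegral_add_right' _ hm, lintegral_const_mul' _ _ (by simp),
    lintegral_const_mul' _ _ (by simp)]
  simp only [sub_zero, zero_sub, neg_sq]
  refine (add_le_add (mul_le_mul_right (lintegral_sq_le_of_mem_sobolevBall hs hL hh) 2)
    (mul_le_mul_right (lintegral_sq_le_of_mem_sobolevBall hs hL hf) 2)).trans (le_of_eq ?_)
  rw [two_mul_ofReal, ← ENNReal.ofReal_add (by positivity) (by positivity)]
  congr 1; ring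

/-- The risk as an iterated integral over the design, the noise and the test point. -/
theorem advRisk_le {d n : ℕ} {a b : ℝ} {p : E d → ℝ} (hp : IsCovariateDensity a b p)
    {ν : Measure ℝ} [IsProbabilityMeasure ν] (r : ℝ) (fhat : Data d n → E d → ℝ) (f : E d → ℝ) :
    advRisk p ν r fhat f ≤ ENNReal.ofReal b * ∫⁻ X : Fin n → E d, (∫⁻ ξ : Fin n → ℝ,
      (∫⁻ x in cube d, advSup r (fhat fun i => (X i, f (X i) + ξ i)) f x)
      ∂(Measure.pi fun _ => ν)) ∂(Measure.pi fun _ => covariateLaw p) := by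
  have := hp.isProbabilityMeasure
  unfold advRisk
  -- The supremum over the perturbations is not shown to be measurable. Hence only the half of
  -- Tonelli's theorem that holds for all functions is used, here and again after regrouping the
  -- data into design and noise.
  refine (lintegral_prod_le _).trans ?_
  have hmp := measurePreserving_arrowProdEquivProdArrow (E d) ℝ (Fin n)
    (fun _ => covariateLaw p) (fun _ => ν)
  have h1 := hmp.lintegral_map_equiv (fun z : (Fin n → E d) × (Fin n → ℝ) =>
    ∫⁻ x, advSup r (fhat fun i => (z.1 i, f (z.1 i) + z.2 i)) f x ∂(covariateLaw p))
  refine (le_of_eq h1.symm).trans ((lintegral_prod_le _).trans ?_)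
  rw [← lintegral_const_mul' _ _ ENNReal.ofReal_ne_top]
  refine lintegral_mono fun X => ?_
  rw [← lintegral_const_mul' _ _ ENNReal.ofReal_ne_top]
  exact lintegral_mono fun ξ => hp.lintegral_le _

/-- After averaging, n diagonal terms of size at most 3σ²Λ face the factor n^{-2}, which gives the
variance of order Λ/n. -/
theorem lintegral_noise_le {n : ℕ} (hn : 1 ≤ n) {σ : ℝ≥0} (hσ : 0 < σ) {ν : Measure ℝ}
    (hν : ν ∈ subGaussianLaws σ) {c u Λ : ℝ} (hc : 0 ≤ c) (hu : 0 ≤ u) (hΛ : 0 ≤ Λ)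
    {a : Fin n → Fin n → ℝ} (ha : ∀ i, a i i ≤ Λ)
    (hpsd : ∀ ξ : Fin n → ℝ, 0 ≤ (1 / n : ℝ) ^ 2 * ∑ i, ∑ j, ξ i * ξ j * a i j) :
    ∫⁻ ξ : Fin n → ℝ, ENNReal.ofReal (c * (u + (1 / n : ℝ) ^ 2 * ∑ i, ∑ j, ξ i * ξ j * a i j))
      ∂(Measure.pi fun _ => ν) ≤ ENNReal.ofReal (c * (u + 3 * σ ^ 2 * Λ / n)) := by
  have hsub := hν
  obtain ⟨hprob, h0, hmgf⟩ := hsub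
  have hn0 : (0 : ℝ) < n := by exact_mod_cast hn
  have h2 : MemLp (fun t : ℝ => t) 2 ν := hmgf.memLp 2
  have hI := integrable_sum_sum_mul h2 a
  have hI' : Integrable (fun ξ : Fin n → ℝ =>
      c * (u + (1 / n : ℝ) ^ 2 * ∑ i, ∑ j, ξ i * ξ j * a i j)) (Measure.pi fun _ => ν) :=
    ((integrable_const u).add (hI.const_mul _)).const_mul c
  rw [← ofReal_integral_eq_lintegral_ofReal hI' (Filter.Eventually.of_forall fun ξ =>
    mul_nonneg hc (add_nonneg hu (hpsd ξ))), integral_const_mul,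
    integral_add (integrable_const u) (hI.const_mul _), integral_const_mul,
    integral_sum_sum_mul h2 h0]
  refine ENNReal.ofReal_le_ofReal (mul_le_mul_of_nonneg_left (add_le_add (by simp) ?_) hc)
  have h3 : ∑ i, (∫ t, t ^ 2 ∂ν) * a i i ≤ ∑ _i : Fin n, 3 * (σ : ℝ) ^ 2 * Λ := by
    refine Finset.sum_le_sum fun i _ => ?_
    have h4 : 0 ≤ ∫ t, t ^ 2 ∂ν := integral_nonneg fun t => sq_nonneg t
    exact (mul_le_mul_of_nonneg_left (ha i) h4).trans
      (mul_le_mul_of_nonneg_right (integral_sq_le_of_subGaussian hσ hν) hΛ)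
  rw [Finset.sum_const, Finset.card_univ, Fintype.card_fin, nsmul_eq_mul] at h3
  calc (1 / n : ℝ) ^ 2 * ∑ i, (∫ t, t ^ 2 ∂ν) * a i i
      ≤ (1 / n : ℝ) ^ 2 * (n * (3 * (σ : ℝ) ^ 2 * Λ)) := by gcongr
    _ = 3 * σ ^ 2 * Λ / n := by field_simp

theorem lintegral_design_le {d n : ℕ} (hn : 1 ≤ n) {a b : ℝ} {p : E d → ℝ}
    (hp : IsCovariateDensity a b p) {ρ : E d → ℝ} (hρ : AEMeasurable ρ (volume.restrict (cube d)))
    {c B : ℝ} (hc : 0 ≤ c) (hρB : ∫⁻ x in cube d, ENNReal.ofReal (ρ x ^ 2) ≤ ENNReal.ofReal B) :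
    AEMeasurable (fun X : Fin n → E d => ENNReal.ofReal (c * ((1 / n : ℝ) * ∑ i, ρ (X i) ^ 2)))
      (Measure.pi fun _ => covariateLaw p) ∧
    ∫⁻ X : Fin n → E d, ENNReal.ofReal (c * ((1 / n : ℝ) * ∑ i, ρ (X i) ^ 2))
      ∂(Measure.pi fun _ => covariateLaw p) ≤ ENNReal.ofReal (c * (|b| * B)) := by
  have := hp.isProbabilityMeasure
  have hn0 : (0 : ℝ) < n := by exact_mod_cast hn
  have hρ' : AEMeasurable ρ (covariateLaw p) := hρ.mono_ac (covariateLaw_absolutelyContinuous p)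
  have hmp := fun i => measurePreserving_eval (fun _ : Fin n => covariateLaw p) i
  have hm : ∀ i, AEMeasurable (fun X : Fin n → E d => ρ (X i)) (Measure.pi fun _ => covariateLaw p) :=
    fun i => hρ'.comp_quasiMeasurePreserving (hmp i).quasiMeasurePreserving
  refine ⟨((Finset.aemeasurable_fun_sum _ fun i _ =>
    (hm i).pow_const 2).const_mul _ |>.const_mul c).ennreal_ofReal, ?_⟩
  have h1 : ∀ i, ∫⁻ X : Fin n → E d, ENNReal.ofReal (ρ (X i) ^ 2)
      ∂(Measure.pi fun _ => covariateLaw p) ≤ ENNReal.ofReal (|b| * B) := by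
    intro i
    have h2 := lintegral_map' (μ := Measure.pi fun _ : Fin n => covariateLaw p)
      (g := Function.eval i) (f := fun x => ENNReal.ofReal (ρ x ^ 2))
      (by rw [(hmp i).map_eq]; exact (hρ'.pow_const 2).ennreal_ofReal)
      (hmp i).measurable.aemeasurable
    rw [(hmp i).map_eq] at h2
    refine (le_of_eq h2.symm).trans ((hp.lintegral_le _).trans ?_)
    rw [ENNReal.ofReal_mul (abs_nonneg b)]
    exact mul_le_mul' (ENNReal.ofReal_le_ofReal (le_abs_self b)) hρB
  calc ∫⁻ X : Fin n → E d, ENNReal.ofReal (c * ((1 / n : ℝ) * ∑ i, ρ (X i) ^ 2))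
        ∂(Measure.pi fun _ => covariateLaw p)
      = ∫⁻ X : Fin n → E d, ENNReal.ofReal (c * (1 / n : ℝ)) *
          ∑ i, ENNReal.ofReal (ρ (X i) ^ 2) ∂(Measure.pi fun _ => covariateLaw p) := by
        refine lintegral_congr fun X => ?_
        rw [← mul_assoc, ENNReal.ofReal_mul (by positivity),
          ENNReal.ofReal_sum_of_nonneg fun i _ => sq_nonneg _]
    _ = ENNReal.ofReal (c * (1 / n : ℝ)) * ∑ i, ∫⁻ X : Fin n → E d, ENNReal.ofReal (ρ (X i) ^ 2)
          ∂(Measure.pi fun _ => covariateLaw p) := by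
        rw [lintegral_const_mul' _ _ ENNReal.ofReal_ne_top,
          lintegral_finsetSum' _ fun i _ => ((hm i).pow_const 2).ennreal_ofReal]
    _ ≤ ENNReal.ofReal (c * (1 / n : ℝ)) * ∑ _i : Fin n, ENNReal.ofReal (|b| * B) := by
        gcongr with i _
        exact h1 i
    _ = ENNReal.ofReal (c * (|b| * B)) := by
        rw [Finset.sum_const, Finset.card_univ, Fintype.card_fin, nsmul_eq_mul,
          ← ENNReal.ofReal_natCast, ← ENNReal.ofReal_mul (by positivity) (q := _),
          ← ENNReal.ofReal_mul (by positivity)]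
        congr 1
        field_simp

/-- The risk bound for projected and truncated kernel ridge regression. -/
theorem exists_worstRisk_le {d : ℕ} (hd : 1 ≤ d) {s L a b κ₁ A : ℝ} (κ₂ : ℝ) (hs : 0 < s)
    (hL : 0 < L) (ha : 0 < a) {σ : ℝ≥0} (hσ : 0 < σ) (hκ₁ : 0 < κ₁) (hA : 1 ≤ A) :
    ∃ C : ℝ, 0 < C ∧ ∀ n : ℕ, 1 ≤ n → ∀ r : ℝ, 0 ≤ r → r ≤ 1 → ∀ lam : ℝ,
      κ₁ * resol d n s ^ (-(2 * penaltyOrder d s)) ≤ lam →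
      lam ≤ κ₂ * resol d n s ^ (-(2 * penaltyOrder d s)) →
      ∀ fhat : Data d n → E d → ℝ, IsPTKRR s L r lam A fhat →
      ∀ p : E d → ℝ, IsCovariateDensity a b p →
        worstRisk s L p (subGaussianLaws σ) r fhat ≤ ENNReal.ofReal (C * rate d n s r) := by
  obtain ⟨C₁, hC₁, hadv⟩ := exists_adversarial_bound (L := L) hd hs hA
  obtain ⟨K, hK, C₂, hC₂, hridge⟩ := exists_ridge_risk_bound hd κ₂ hs hL hκ₁ (half_pos ha)
  obtain ⟨C₃, hC₃, hocc⟩ := exists_occupation_bound (d := d) ha hs hK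
  set V := 16 * C₂ * (1 + 3 * (σ : ℝ) ^ 2 * C₂) with hV
  have hV0 : 0 < V := by positivity
  set T := C₁ + V + 16 * C₂ * (|b| * C₂) + 16 * L ^ 2 * C₃ with hT
  have hT0 : 0 < T := by positivity
  refine ⟨(|b| + 1) * T, by positivity, fun n hn r hr0 hr1 lam hlam₁ hlam₂ fhat hfhat p hp =>
    iSup₂_le fun ν hν => iSup₂_le fun f hf => ?_⟩
  have hprobP := hp.isProbabilityMeasure
  have hprob := hν.1
  obtain ⟨ρ, hρm, hρ, hrid⟩ := hridge f hf n hn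
  set N := resol d n s with hN
  have hN1 : 1 ≤ N := one_le_resol hs hn
  have hN0 : 0 < N := by linarith
  have hn0 : (0 : ℝ) < n := by exact_mod_cast hn
  have hM1 : 1 ≤ ⌈N⌉₊ := one_le_ceil_resol hs hn
  set v := N ^ (-(2 * s)) with hv
  have hv0 : 0 < v := by positivity
  obtain ⟨Q, hQ, hQi⟩ := lintegral_occupation_le ha.le hp hM1 hK n
  set w := r ^ (2 * min 1 s) with hw
  have hw0 : 0 ≤ w := by positivity
  have hcube : ∀ᵐ X : Fin n → E d ∂(Measure.pi fun _ => covariateLaw p), ∀ i, X i ∈ cube d := by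
    rw [ae_all_iff]
    intro i
    exact (measurePreserving_eval (fun _ : Fin n =>
      covariateLaw p) i).quasiMeasurePreserving.ae (ae_covariateLaw_mem_cube p)
  have hpt : ∀ X : Fin n → E d, (∀ i, X i ∈ cube d) → ∫⁻ ξ : Fin n → ℝ,
      (∫⁻ x in cube d, advSup r (fhat fun i => (X i, f (X i) + ξ i)) f x)
      ∂(Measure.pi fun _ => ν) ≤ ENNReal.ofReal (C₁ * w) + ENNReal.ofReal (V * v) +
        ENNReal.ofReal (16 * C₂ * ((1 / n : ℝ) * ∑ i, ρ (X i) ^ 2)) +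
        ENNReal.ofReal (16 * L ^ 2) * Q X := by
    intro X hX
    have hR0 : 0 ≤ (1 / n : ℝ) * ∑ i, ρ (X i) ^ 2 :=
      mul_nonneg (by positivity) (Finset.sum_nonneg fun i _ => sq_nonneg _)
    by_cases hO : Occupied (a / 2) ⌈N⌉₊ K X
    · obtain ⟨α, hα, hpsd, hbound⟩ := hrid lam hlam₁ hlam₂ X hX hO
      have h1 : ∀ ξ : Fin n → ℝ,
          ∫⁻ x in cube d, advSup r (fhat fun i => (X i, f (X i) + ξ i)) f x ≤
          ENNReal.ofReal (C₁ * w) + ENNReal.ofReal (16 * C₂ *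
            (((1 / n : ℝ) * ∑ i, ρ (X i) ^ 2 + v) +
              (1 / n : ℝ) ^ 2 * ∑ i, ∑ j, ξ i * ξ j * α i j)) := by
        intro ξ
        obtain ⟨g, fbar, hg, hproj, hle⟩ := hadv r hr0 hr1 n lam fhat hfhat
          (fun i => (X i, f (X i) + ξ i)) hX
        refine (hle f).trans (add_le_add le_rfl ?_)
        have h2 := (hproj.lintegral_le hs.le hg.1.1 hf).trans
          (mul_le_mul_right (hbound ξ g hg) 4)
        refine (mul_le_mul_right h2 4).trans (le_of_eq ?_)
        rw [← mul_assoc, show (4 : ℝ≥0∞) * 4 = ENNReal.ofReal 16 by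
          rw [ENNReal.ofReal_ofNat]; norm_num, ← ENNReal.ofReal_mul (by norm_num)]
        congr 1
        ring
      refine (lintegral_mono h1).trans ?_
      rw [lintegral_add_left measurable_const, lintegral_const, measure_univ, mul_one]
      have h3 := lintegral_noise_le hn hσ hν (c := 16 * C₂) (by positivity)
        (add_nonneg hR0 hv0.le) (show 0 ≤ C₂ * N ^ d by positivity) hα hpsd
      refine (add_le_add le_rfl h3).trans ?_
      rw [add_assoc (ENNReal.ofReal (C₁ * w)), add_assoc (ENNReal.ofReal (C₁ * w))]
      refine add_le_add le_rfl (le_add_right ?_)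
      rw [← ENNReal.ofReal_add (by positivity) (by positivity)]
      refine ENNReal.ofReal_le_ofReal (le_of_eq ?_)
      -- The balance that defines N: leverage of order N^d over n observations is exactly N^{-2s}.
      have h4 : 3 * (σ : ℝ) ^ 2 * (C₂ * N ^ d) / n = 3 * σ ^ 2 * C₂ * v := by
        rw [hv, ← resol_pow_div hs hn]; ring
      rw [h4, hV]
      ring
    -- On a badly distributed design nothing is known about the ridge estimator, but its projection
    -- and f both lie in the Sobolev ball, so their squared distance is at most 4L².
    · have h1 : ∀ ξ : Fin n → ℝ,
          ∫⁻ x in cube d, advSup r (fhat fun i => (X i, f (X i) + ξ i)) f x ≤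
          ENNReal.ofReal (C₁ * w) + ENNReal.ofReal (16 * L ^ 2) := by
        intro ξ
        obtain ⟨g, fbar, hg, hproj, hle⟩ := hadv r hr0 hr1 n lam fhat hfhat
          (fun i => (X i, f (X i) + ξ i)) hX
        refine (hle f).trans (add_le_add le_rfl ?_)
        refine (mul_le_mul_right (lintegral_sub_sq_le_of_mem hs.le hL.le hproj.1 hf) 4).trans
          (le_of_eq ?_)
        rw [← ENNReal.ofReal_ofNat 4, ← ENNReal.ofReal_mul (by norm_num)]
        congr 1; ring
      refine (lintegral_mono h1).trans ?_
      rw [lintegral_const, measure_univ, mul_one]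
      refine add_le_add (le_add_right (le_add_right le_rfl)) ?_
      exact le_mul_of_one_le_right' (hQ X hO)
  obtain ⟨hm, hdes⟩ := lintegral_design_le hn hp hρm (c := 16 * C₂) (by positivity) hρ
  have hmain : ∫⁻ X : Fin n → E d, (∫⁻ ξ : Fin n → ℝ,
      (∫⁻ x in cube d, advSup r (fhat fun i => (X i, f (X i) + ξ i)) f x)
      ∂(Measure.pi fun _ => ν)) ∂(Measure.pi fun _ => covariateLaw p) ≤
      ENNReal.ofReal (T * (w + v)) := by
    calc _ ≤ ∫⁻ X : Fin n → E d, (ENNReal.ofReal (C₁ * w) + ENNReal.ofReal (V * v) +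
          ENNReal.ofReal (16 * C₂ * ((1 / n : ℝ) * ∑ i, ρ (X i) ^ 2)) +
          ENNReal.ofReal (16 * L ^ 2) * Q X) ∂(Measure.pi fun _ => covariateLaw p) :=
          lintegral_mono_ae (by filter_upwards [hcube] with X hX using hpt X hX)
      _ = ENNReal.ofReal (C₁ * w) + ENNReal.ofReal (V * v) +
          (∫⁻ X : Fin n → E d, ENNReal.ofReal (16 * C₂ * ((1 / n : ℝ) * ∑ i, ρ (X i) ^ 2))
            ∂(Measure.pi fun _ => covariateLaw p)) +
          ENNReal.ofReal (16 * L ^ 2) * ∫⁻ X, Q X ∂(Measure.pi fun _ => covariateLaw p) := by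
          rw [lintegral_add_left' (hm.const_add _), lintegral_add_left measurable_const,
            lintegral_const, measure_univ, mul_one, lintegral_const_mul' _ _ ENNReal.ofReal_ne_top]
      _ ≤ ENNReal.ofReal (C₁ * w) + ENNReal.ofReal (V * v) +
          ENNReal.ofReal (16 * C₂ * (|b| * (C₂ * v))) +
          ENNReal.ofReal (16 * L ^ 2) * ENNReal.ofReal (C₃ * v) := by
          gcongr
          exact hQi.trans (ENNReal.ofReal_le_ofReal (hocc n hn))
      _ ≤ ENNReal.ofReal (T * (w + v)) := by
          rw [← ENNReal.ofReal_mul (by positivity), ← ENNReal.ofReal_add (by positivity)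
            (by positivity), ← ENNReal.ofReal_add (by positivity) (by positivity),
            ← ENNReal.ofReal_add (by positivity) (by positivity)]
          refine ENNReal.ofReal_le_ofReal ?_
          have h1 : 0 ≤ C₁ * v := by positivity
          have h2 : 0 ≤ (V + 16 * C₂ * (|b| * C₂) + 16 * L ^ 2 * C₃) * w := by positivity
          rw [hT]
          nlinarith
  refine (advRisk_le hp r fhat f).trans ((mul_le_mul_right hmain _).trans ?_)
  rw [← ENNReal.ofReal_mul' (by positivity)]
  refine ENNReal.ofReal_le_ofReal ?_
  have hrate : rate d n s r = w + v := by
    rw [rate, hv, hN, resol_rpow]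
    congr 2
    ring
  rw [hrate, ← mul_assoc]
  gcongr
  linarith [le_abs_self b]

/-! ### Modulated waves -/

/-- The radius of the frequency ball of the window. -/
def winRadius (d : ℕ) : ℝ := 1 / (7 * d)

/-- The Fourier transform of the window: the indicator of a small ball. -/
def winHat (d : ℕ) : E d → ℂ := (Metric.ball (0 : E d) (winRadius d)).indicator 1

/-- The window, a real function that is bounded below on the cube. -/
def win (d : ℕ) (x : E d) : ℝ := realSynth (winHat d) x

theorem winRadius_pos {d : ℕ} (hd : 1 ≤ d) : 0 < winRadius d := by
  have : (0 : ℝ) < d := by exact_mod_cast hd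
  unfold winRadius; positivity

theorem winRadius_le {d : ℕ} (hd : 1 ≤ d) : winRadius d ≤ 1 / 7 := by
  have : (1 : ℝ) ≤ d := by exact_mod_cast hd
  unfold winRadius
  gcongr
  linarith

theorem memLp_winHat (d : ℕ) (q : ℝ≥0∞) : MemLp (winHat d) q :=
  memLp_indicator_const q measurableSet_ball 1 (Or.inr measure_ball_lt_top.ne)

theorem integrable_winHat (d : ℕ) : Integrable (winHat d) :=
  memLp_one_iff_integrable.1 (memLp_winHat d 1)

theorem continuous_win (d : ℕ) : Continuous (win d) := continuous_realSynth (integrable_winHat d)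

theorem fourierInv_winHat (d : ℕ) (x : E d) : 𝓕⁻ (winHat d) x = (win d x : ℂ) := by
  have h : star (𝓕⁻ (winHat d) x) = 𝓕⁻ (winHat d) x := by
    have hfun : (fun η => star (winHat d (-η))) = winHat d := by
      funext η
      unfold winHat indicator
      by_cases h : η ∈ Metric.ball (0 : E d) (winRadius d)
      · have h' : -η ∈ Metric.ball (0 : E d) (winRadius d) := by simpa using h
        rw [if_pos h, if_pos h']; simp
      · have h' : -η ∉ Metric.ball (0 : E d) (winRadius d) := by simpa using h
        rw [if_neg h, if_neg h']; simp
    rw [star_fourierInv, hfun]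
  exact (Complex.conj_eq_iff_re.1 h).symm

theorem win_eq_integral (d : ℕ) (x : E d) :
    win d x = ∫ η in Metric.ball (0 : E d) (winRadius d), Real.cos (2 * Real.pi * inner ℝ η x) := by
  rw [win, realSynth, fourierInv_eq_mul]
  change RCLike.re (K := ℂ) _ = _
  rw [← integral_re (integrable_cexp_mul (integrable_winHat d) x), ← integral_indicator
    measurableSet_ball]
  congr 1
  funext η
  unfold winHat indicator
  split_ifs
  · rw [Pi.one_apply, mul_one, RCLike.re_to_complex, show (2 * Real.pi * Complex.I *
      (inner ℝ η x : ℝ) : ℂ) = ((2 * Real.pi * inner ℝ η x : ℝ) : ℂ) * Complex.I by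
        push_cast; ring, Complex.exp_ofReal_mul_I_re]
  · simp

/-- The volume of the frequency ball of the window. -/
def winVol (d : ℕ) : ℝ := volume.real (Metric.ball (0 : E d) (winRadius d))

theorem winVol_pos {d : ℕ} (hd : 1 ≤ d) : 0 < winVol d :=
  ENNReal.toReal_pos (Metric.measure_ball_pos volume 0 (winRadius_pos hd)).ne'
    measure_ball_lt_top.ne

theorem abs_win_le (d : ℕ) (x : E d) : |win d x| ≤ winVol d := by
  rw [win_eq_integral, ← Real.norm_eq_abs]
  have := norm_setIntegral_le_of_norm_le_const (μ := volume)
    (s := Metric.ball (0 : E d) (winRadius d))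
    (f := fun η => Real.cos (2 * Real.pi * inner ℝ η x)) (C := 1) measure_ball_lt_top
    fun η _ => by rw [Real.norm_eq_abs]; exact Real.abs_cos_le_one _
  rwa [one_mul] at this

theorem norm_le_sqrt_of_mem_cube {d : ℕ} {x : E d} (hx : x ∈ cube d) : ‖x‖ ≤ Real.sqrt d := by
  rw [EuclideanSpace.norm_eq]
  refine Real.sqrt_le_sqrt ?_
  calc ∑ i, ‖x i‖ ^ 2 ≤ ∑ _i : Fin d, (1 : ℝ) := by
        refine Finset.sum_le_sum fun i _ => ?_
        rw [Real.norm_eq_abs, sq_abs]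
        nlinarith [(hx i).1, (hx i).2]
    _ = d := by simp

/-- For η in the frequency ball and x in the cube |⟨η, x⟩| ≤ √d/(7d) ≤ 1/7, and 2π/7 < 1, so the
cosine in the integral is at least 1/2. This is the reason for the radius 1/(7d). -/
theorem half_winVol_le_win {d : ℕ} (hd : 1 ≤ d) {x : E d} (hx : x ∈ cube d) :
    winVol d / 2 ≤ win d x := by
  have hd' : (1 : ℝ) ≤ d := by exact_mod_cast hd
  have hxn := norm_le_sqrt_of_mem_cube hx
  rw [win_eq_integral, winVol, div_eq_mul_inv, ← smul_eq_mul, ← setIntegral_const]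
  refine setIntegral_mono_on (integrableOn_const measure_ball_lt_top.ne) ?_ measurableSet_ball
    fun η hη => ?_
  · refine Measure.integrableOn_of_bounded (M := 1) measure_ball_lt_top.ne
      (Continuous.aestronglyMeasurable (by fun_prop)) ?_
    exact Filter.Eventually.of_forall fun η => by
      rw [Real.norm_eq_abs]; exact Real.abs_cos_le_one _
  · have h1 : |2 * Real.pi * inner ℝ η x| ≤ 1 := by
      rw [abs_mul, abs_of_pos (by positivity)]
      have h2 : |inner ℝ η x| ≤ winRadius d * Real.sqrt d := by
        refine (abs_real_inner_le_norm η x).trans ?_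
        exact mul_le_mul (mem_ball_zero_iff.1 hη).le hxn (norm_nonneg _) (winRadius_pos hd).le
      have h3 : Real.sqrt d ≤ d := by
        rw [Real.sqrt_le_left (by positivity)]
        nlinarith
      have h4 : winRadius d * Real.sqrt d ≤ 1 / 7 := by
        unfold winRadius
        rw [one_div_mul_eq_div, div_le_div_iff₀ (by positivity) (by norm_num)]
        linarith
      have h5 : Real.pi < 3.15 := Real.pi_lt_d2
      calc 2 * Real.pi * |inner ℝ η x| ≤ 2 * 3.15 * (1 / 7) := by
            gcongr
            exact h2.trans h4
        _ ≤ 1 := by norm_num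
    have h2 := Real.one_sub_sq_div_two_le_cos (x := 2 * Real.pi * inner ℝ η x)
    have h3 : (2 * Real.pi * inner ℝ η x) ^ 2 ≤ 1 := by
      rw [← sq_abs]; exact pow_le_one₀ (abs_nonneg _) h1
    norm_num
    linarith

theorem fourierInv_winHat_sub (d : ℕ) (κ x : E d) :
    𝓕⁻ (fun η => winHat d (η - κ)) x =
      Complex.exp (2 * Real.pi * Complex.I * inner ℝ κ x) * win d x := by
  rw [fourierInv_eq_mul, ← fourierInv_winHat, fourierInv_eq_mul, ← integral_const_mul]
  rw [← integral_sub_right_eq_self (fun η => Complex.exp (2 * Real.pi * Complex.I * inner ℝ κ x) *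
    (Complex.exp (2 * Real.pi * Complex.I * inner ℝ η x) * winHat d η)) κ]
  refine integral_congr_ae (Filter.Eventually.of_forall fun η => ?_)
  simp only
  rw [← mul_assoc, ← Complex.exp_add]
  congr 2
  rw [inner_sub_left]
  push_cast
  ring

/-- The superposition of the waves with frequencies `κ i` and amplitudes `c i`. -/
def waves {d : ℕ} {ι : Type*} [Fintype ι] (κ : ι → E d) (c : ι → ℝ) (x : E d) : ℝ :=
  (∑ i, c i * Real.cos (2 * Real.pi * inner ℝ (κ i) x)) * win d x

theorem continuous_waves {d : ℕ} {ι : Type*} [Fintype ι] (κ : ι → E d) (c : ι → ℝ) :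
    Continuous (waves κ c) := by
  unfold waves
  have := continuous_win d
  fun_prop

/-- The Fourier transform whose synthesis is `waves κ c`. -/
def wavesHat {d : ℕ} {ι : Type*} [Fintype ι] (κ : ι → E d) (c : ι → ℝ) (η : E d) : ℂ :=
  ∑ i, (c i : ℂ) * winHat d (η - κ i)

theorem memLp_wavesHat {d : ℕ} {ι : Type*} [Fintype ι] (κ : ι → E d) (c : ι → ℝ) (q : ℝ≥0∞) :
    MemLp (wavesHat κ c) q :=
  memLp_finsetSum _ fun i _ => ((memLp_winHat d q).comp_measurePreserving
    (measurePreserving_sub_right volume (κ i))).const_mul _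

theorem realSynth_wavesHat {d : ℕ} {ι : Type*} [Fintype ι] (κ : ι → E d) (c : ι → ℝ) (x : E d) :
    realSynth (wavesHat κ c) x = waves κ c x := by
  have hi : ∀ i, Integrable fun η => winHat d (η - κ i) := fun i =>
    (integrable_winHat d).comp_sub_right (κ i)
  have h : 𝓕⁻ (wavesHat κ c) x = ∑ i, (c i : ℂ) *
      (Complex.exp (2 * Real.pi * Complex.I * inner ℝ (κ i) x) * win d x) := by
    rw [fourierInv_eq_mul]
    simp_rw [← fourierInv_winHat_sub, fourierInv_eq_mul, ← integral_const_mul]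
    rw [← integral_finsetSum _ fun i _ => (integrable_cexp_mul (hi i) x).const_mul _]
    refine integral_congr_ae (Filter.Eventually.of_forall fun η => ?_)
    simp only [wavesHat, Finset.mul_sum]
    exact Finset.sum_congr rfl fun i _ => by ring
  rw [realSynth, h, waves, Complex.re_sum, Finset.sum_mul]
  refine Finset.sum_congr rfl fun i _ => ?_
  rw [Complex.re_ofReal_mul, Complex.re_mul_ofReal, show (2 * Real.pi * Complex.I *
      (inner ℝ (κ i) x : ℝ) : ℂ) = ((2 * Real.pi * inner ℝ (κ i) x : ℝ) : ℂ) * Complex.I by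
        push_cast; ring, Complex.exp_ofReal_mul_I_re]
  ring

/-- The frequencies are at distance at least 1 and the balls have radius at most 1/7. At most one
summand is nonzero at any η, and the square of the sum has no cross terms. -/
theorem enorm_wavesHat_sq_le {d : ℕ} (hd : 1 ≤ d) {ι : Type*} [Fintype ι] {κ : ι → E d}
    (hκ : ∀ i j, i ≠ j → 1 ≤ ‖κ i - κ j‖) (c : ι → ℝ) (η : E d) :
    ‖wavesHat κ c η‖ₑ ^ 2 ≤ ∑ i, ENNReal.ofReal (c i ^ 2) *
      (Metric.ball (κ i) (winRadius d)).indicator 1 η := by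
  classical
  have hball : ∀ i, η - κ i ∈ Metric.ball (0 : E d) (winRadius d) ↔
      η ∈ Metric.ball (κ i) (winRadius d) := fun i => by
    rw [mem_ball_zero_iff, Metric.mem_ball, dist_eq_norm]
  by_cases h : ∃ i, η ∈ Metric.ball (κ i) (winRadius d)
  · obtain ⟨i, hi⟩ := h
    have hj : ∀ j, j ≠ i → η ∉ Metric.ball (κ j) (winRadius d) := by
      intro j hji hj
      have h1 := hκ i j hji.symm
      have h2 := winRadius_le hd
      rw [Metric.mem_ball, dist_eq_norm] at hi hj
      have h3 : ‖κ i - κ j‖ ≤ ‖η - κ j‖ + ‖η - κ i‖ := by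
        rw [← sub_sub_sub_cancel_left (κ j) (κ i) η]
        exact norm_sub_le _ _
      linarith
    rw [wavesHat, Finset.sum_eq_single i]
    · refine le_trans (le_of_eq ?_) (Finset.single_le_sum (f := fun i => ENNReal.ofReal (c i ^ 2) *
        (Metric.ball (κ i) (winRadius d)).indicator 1 η) (fun _ _ => zero_le) (Finset.mem_univ i))
      rw [winHat, indicator_of_mem ((hball i).2 hi), indicator_of_mem hi, Pi.one_apply,
        Pi.one_apply, mul_one, mul_one, ← ofReal_norm, ← ENNReal.ofReal_pow (norm_nonneg _),
        Complex.norm_real, Real.norm_eq_abs, sq_abs]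
    · intro j _ hji
      rw [winHat, indicator_of_notMem (fun h => hj j hji ((hball j).1 h)), mul_zero]
    · simp
  · push Not at h
    have : wavesHat κ c η = 0 := by
      refine Finset.sum_eq_zero fun i _ => ?_
      rw [winHat, indicator_of_notMem (fun h' => h i ((hball i).1 h')), mul_zero]
    rw [this]
    simp

/-- The waves are extended to the whole space by their own formula. On each frequency ball the
weight is at most of order R^{2s}, which handles every real s ≥ 0 without derivatives or cut-offs in
space. -/
theorem cubeNorm_waves_le {d : ℕ} (hd : 1 ≤ d) {s : ℝ} (hs : 0 ≤ s) {ι : Type*} [Fintype ι]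
    {κ : ι → E d} (hκ : ∀ i j, i ≠ j → 1 ≤ ‖κ i - κ j‖) {R : ℝ} (hR1 : 1 ≤ R)
    (hR : ∀ i, ‖κ i‖ ≤ R) (c : ι → ℝ) :
    cubeNorm s (waves κ c) ^ 2 ≤
      ENNReal.ofReal ((1 + (4 * Real.pi) ^ 2) ^ s * winVol d * (R ^ (2 * s) * ∑ i, c i ^ 2)) := by
  have h2 := memLp_wavesHat κ c 2
  set G : Lp ℂ 2 (volume : Measure (E d)) := 𝓕⁻ (h2.toLp _) with hG
  have hFG : 𝓕 G = h2.toLp _ := FourierTransform.fourier_fourierInv_eq _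
  have hFae : (𝓕 G : Lp ℂ 2 (volume : Measure (E d))) =ᵐ[volume] wavesHat κ c := by
    rw [hFG]; exact h2.coeFn_toLp
  have hGae := re_ae_eq_realSynth hFae (memLp_one_iff_integrable.1 (memLp_wavesHat κ c 1))
  have h1 : cubeNorm s (waves κ c) ≤ sobolevNorm s G := by
    refine cubeNorm_re_le ?_
    filter_upwards [ae_restrict_of_ae hGae] with x hx
    rw [← realSynth_wavesHat, hx, realSynth]
  refine (pow_le_pow_left' h1 2).trans ?_
  rw [sobolevNorm_sq, energy_congr hFae]
  have hm : ∀ i, Measurable fun η : E d => ENNReal.ofReal (c i ^ 2) *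
      (Metric.ball (κ i) (winRadius d)).indicator 1 η := fun i =>
    (measurable_one.indicator measurableSet_ball).const_mul _
  have hwt : ∀ i, ∀ η ∈ Metric.ball (κ i) (winRadius d),
      (1 + (2 * Real.pi * ‖η‖) ^ 2) ^ s ≤ (1 + (4 * Real.pi) ^ 2) ^ s * R ^ (2 * s) := by
    intro i η hη
    rw [Real.rpow_mul (by linarith), Real.rpow_two, ← Real.mul_rpow (by positivity) (by positivity)]
    refine Real.rpow_le_rpow (by positivity) ?_ hs
    have h3 : ‖η‖ ≤ 2 * R := by
      rw [Metric.mem_ball, dist_eq_norm] at hη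
      have h4 := norm_le_norm_add_norm_sub (κ i) η
      rw [norm_sub_rev] at h4
      linarith [hR i, winRadius_le hd]
    have h5 : (2 * Real.pi * ‖η‖) ^ 2 ≤ (2 * Real.pi * (2 * R)) ^ 2 := by gcongr
    nlinarith
  calc energy s (wavesHat κ c)
      ≤ ∫⁻ η, ∑ i, ENNReal.ofReal ((1 + (4 * Real.pi) ^ 2) ^ s * R ^ (2 * s)) *
          (ENNReal.ofReal (c i ^ 2) * (Metric.ball (κ i) (winRadius d)).indicator 1 η) := by
        refine lintegral_mono fun η => ?_
        refine (mul_le_mul_right (enorm_wavesHat_sq_le hd hκ c η) _).trans ?_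
        rw [Finset.mul_sum]
        refine Finset.sum_le_sum fun i _ => ?_
        by_cases hη : η ∈ Metric.ball (κ i) (winRadius d)
        · exact mul_le_mul_left (ENNReal.ofReal_le_ofReal (hwt i η hη)) _
        · rw [indicator_of_notMem hη]; simp
    _ = ∑ i, ENNReal.ofReal ((1 + (4 * Real.pi) ^ 2) ^ s * R ^ (2 * s)) *
          (ENNReal.ofReal (c i ^ 2) * ENNReal.ofReal (winVol d)) := by
        rw [lintegral_finsetSum _ fun i _ => (hm i).const_mul _]
        refine Finset.sum_congr rfl fun i _ => ?_
        rw [lintegral_const_mul _ (hm i), lintegral_const_mul _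
          (measurable_one.indicator measurableSet_ball), lintegral_indicator_one measurableSet_ball,
          winVol, measureReal_def, ENNReal.ofReal_toReal measure_ball_lt_top.ne]
        congr 2
        simp [Measure.addHaar_ball_center]
    _ = _ := by
        have h0 : 0 ≤ winVol d := measureReal_nonneg
        rw [← Finset.mul_sum, ← Finset.sum_mul, ← ENNReal.ofReal_sum_of_nonneg
          fun i _ => sq_nonneg _, ← ENNReal.ofReal_mul (Finset.sum_nonneg fun i _ => sq_nonneg _),
          ← ENNReal.ofReal_mul (by positivity)]
        congr 1; ring

/-! ### The lower bound for the effect of the perturbation -/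

theorem measurable_dataOf {d n : ℕ} {f : E d → ℝ} (hf : Measurable f) :
    Measurable (dataOf (n := n) f) := by
  unfold dataOf
  fun_prop

/-- The points of the cube that stay in the cube under translation by `v`. -/
def overlap {d : ℕ} (v : E d) : Set (E d) := cube d ∩ (· + v) ⁻¹' cube d

theorem measurableSet_overlap {d : ℕ} (v : E d) : MeasurableSet (overlap v) :=
  (measurableSet_cube d).inter (measurable_add_const v (measurableSet_cube d))

theorem overlap_zero (d : ℕ) : overlap (0 : E d) = cube d := by
  simp [overlap]

/-- The supremum is bounded below by the value at the fixed translate x + v, which is admissible on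
the overlap. A fixed translate keeps the integrand measurable, so Tonelli's theorem applies as an
equality. -/
theorem lintegral_le_advRisk {d n : ℕ} {a b r : ℝ} {p : E d → ℝ} (hp : IsCovariateDensity a b p)
    {ν : Measure ℝ} [IsProbabilityMeasure ν] {fhat : Data d n → E d → ℝ}
    (hfhat : Measurable (Function.uncurry fhat)) {f : E d → ℝ} (hf : Measurable f) {v : E d}
    (hv : ‖v‖ ≤ r) :
    ∫⁻ ω, (ENNReal.ofReal a * ∫⁻ x in overlap v,
      ENNReal.ofReal ((fhat (dataOf f ω) (x + v) - f x) ^ 2))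
      ∂(Measure.pi fun _ : Fin n => (covariateLaw p).prod ν) ≤ advRisk p ν r fhat f := by
  have := hp.isProbabilityMeasure
  have hm : Measurable fun z : (Fin n → E d × ℝ) × E d =>
      ENNReal.ofReal ((fhat (dataOf f z.1) (z.2 + v) - f z.2) ^ 2) := by
    have h1 : Measurable fun z : (Fin n → E d × ℝ) × E d => fhat (dataOf f z.1) (z.2 + v) :=
      hfhat.comp (((measurable_dataOf hf).comp measurable_fst).prodMk
        (measurable_snd.add_const v))
    exact ((h1.sub (hf.comp measurable_snd)).pow_const 2).ennreal_ofReal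
  have hS : MeasurableSet {z : (Fin n → E d × ℝ) × E d | z.2 ∈ overlap v} :=
    measurable_snd (measurableSet_overlap v)
  unfold advRisk
  calc _ ≤ ∫⁻ ω, (∫⁻ x, {z : (Fin n → E d × ℝ) × E d | z.2 ∈ overlap v}.indicator (fun z =>
          ENNReal.ofReal ((fhat (dataOf f z.1) (z.2 + v) - f z.2) ^ 2)) (ω, x)
          ∂(covariateLaw p)) ∂(Measure.pi fun _ : Fin n => (covariateLaw p).prod ν) := by
        refine lintegral_mono fun ω => le_trans (mul_le_mul_right ?_ _) (hp.le_lintegral _)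
        rw [← lintegral_indicator (measurableSet_cube d), ← lintegral_indicator
          (measurableSet_overlap v)]
        refine lintegral_mono fun x => ?_
        by_cases hx : x ∈ overlap v
        · rw [indicator_of_mem hx, indicator_of_mem hx.1, indicator_of_mem (by exact hx)]
        · rw [indicator_of_notMem hx]; exact zero_le
    _ = _ := (lintegral_prod _ (hm.indicator hS).aemeasurable).symm
    _ ≤ _ := by
        refine lintegral_mono fun z => ?_
        by_cases hz : z.2 ∈ overlap v
        · rw [indicator_of_mem (by exact hz), ← sq_abs]
          exact le_iSup₂ (f := fun x' (_ : x' ∈ cube d ∩ Metric.closedBall z.2 r) =>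
            ENNReal.ofReal (|fhat (dataOf f z.1) x' - f z.2| ^ 2)) (z.2 + v)
            ⟨hz.2, by simpa [dist_eq_norm] using hv⟩
        · rw [indicator_of_notMem (by exact hz)]; exact zero_le

/-- An integral over a set is at least the integral over a translate of a subset. -/
theorem lintegral_comp_add_le {d : ℕ} {S T : Set (E d)} (hS : MeasurableSet S)
    (hT : MeasurableSet T) {v : E d} (h : ∀ x ∈ S, x + v ∈ T) (g : E d → ℝ≥0∞) :
    ∫⁻ x in S, g (x + v) ≤ ∫⁻ x in T, g x := by
  rw [← lintegral_indicator hS, ← lintegral_indicator hT,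
    ← lintegral_add_right_eq_self (T.indicator g) v]
  refine lintegral_mono fun x => ?_
  by_cases hx : x ∈ S
  · rw [indicator_of_mem hx, indicator_of_mem (h x hx)]
  · rw [indicator_of_notMem hx]; exact zero_le

/-- The oscillation of the regression function at the scale of the perturbation bounds the
adversarial risk from below. -/
theorem lintegral_shift_le_advRisk {d n : ℕ} {a b r : ℝ} {p : E d → ℝ}
    (hp : IsCovariateDensity a b p) {ν : Measure ℝ} [IsProbabilityMeasure ν]
    {fhat : Data d n → E d → ℝ} (hfhat : Measurable (Function.uncurry fhat)) {f : E d → ℝ}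
    (hf : Measurable f) {v : E d} (hv : ‖v‖ ≤ r) :
    ENNReal.ofReal a * ∫⁻ x in overlap v, ENNReal.ofReal ((f x - f (x + v)) ^ 2) ≤
      4 * advRisk p ν r fhat f := by
  have := hp.isProbabilityMeasure
  have h1 := lintegral_le_advRisk hp (ν := ν) hfhat hf hv
  have h2 := lintegral_le_advRisk hp (ν := ν) hfhat hf (v := 0)
    (by simpa using (norm_nonneg v).trans hv)
  have hmD : Measurable fun z : (Fin n → E d × ℝ) × E d =>
      ENNReal.ofReal ((fhat (dataOf f z.1) (z.2 + 0) - f z.2) ^ 2) := by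
    have h1 : Measurable fun z : (Fin n → E d × ℝ) × E d => fhat (dataOf f z.1) (z.2 + 0) :=
      hfhat.comp (((measurable_dataOf hf).comp measurable_fst).prodMk
        (measurable_snd.add_const 0))
    exact ((h1.sub (hf.comp measurable_snd)).pow_const 2).ennreal_ofReal
  -- One value of the estimator, at x + v, is compared with f(x), the test point x being moved by v,
  -- and with f(x + v), the test point being left unmoved. The two errors together bound f(x) - f(x
  -- + v).
  have key : ∀ ω : Fin n → E d × ℝ,
      ENNReal.ofReal a * ∫⁻ x in overlap v, ENNReal.ofReal ((f x - f (x + v)) ^ 2) ≤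
      2 * (ENNReal.ofReal a * ∫⁻ x in overlap v,
        ENNReal.ofReal ((fhat (dataOf f ω) (x + v) - f x) ^ 2)) +
      2 * (ENNReal.ofReal a * ∫⁻ x in overlap 0,
        ENNReal.ofReal ((fhat (dataOf f ω) (x + 0) - f x) ^ 2)) := by
    intro ω
    have hm : Measurable fun x : E d =>
        ENNReal.ofReal ((fhat (dataOf f ω) (x + 0) - f x) ^ 2) :=
      hmD.comp (measurable_const.prodMk measurable_id)
    have h3 := lintegral_comp_add_le (measurableSet_overlap v) (measurableSet_overlap 0)
      (v := v) (fun x hx => by rw [overlap_zero]; exact hx.2)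
      (fun x => ENNReal.ofReal ((fhat (dataOf f ω) (x + 0) - f x) ^ 2))
    calc _ ≤ ENNReal.ofReal a * ∫⁻ x in overlap v,
          (2 * ENNReal.ofReal ((fhat (dataOf f ω) (x + v) - f x) ^ 2) +
          2 * ENNReal.ofReal ((fhat (dataOf f ω) (x + v + 0) - f (x + v)) ^ 2)) := by
          gcongr with x
          have h5 := ofReal_sub_sq_le (f x) (fhat (dataOf f ω) (x + v)) (f (x + v))
          rw [add_zero, ← neg_sub (f x), neg_sq]
          exact h5
      _ = 2 * (ENNReal.ofReal a * ∫⁻ x in overlap v,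
            ENNReal.ofReal ((fhat (dataOf f ω) (x + v) - f x) ^ 2)) +
          2 * (ENNReal.ofReal a * ∫⁻ x in overlap v,
            ENNReal.ofReal ((fhat (dataOf f ω) (x + v + 0) - f (x + v)) ^ 2)) := by
          have hm' : Measurable fun x : E d =>
              2 * ENNReal.ofReal ((fhat (dataOf f ω) (x + v + 0) - f (x + v)) ^ 2) :=
            (hm.comp (measurable_add_const v)).const_mul 2
          rw [lintegral_add_right _ hm', lintegral_const_mul' _ _ (by simp), lintegral_const_mul' _ _ (by simp)]
          ring
      _ ≤ _ := by gcongr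
  calc _ = ∫⁻ _ω : Fin n → E d × ℝ, ENNReal.ofReal a *
        (∫⁻ x in overlap v, ENNReal.ofReal ((f x - f (x + v)) ^ 2))
        ∂(Measure.pi fun _ : Fin n => (covariateLaw p).prod ν) := by
        rw [lintegral_const, measure_univ, mul_one]
    _ ≤ _ := lintegral_mono key
    _ = 2 * (∫⁻ ω, (ENNReal.ofReal a * ∫⁻ x in overlap v,
          ENNReal.ofReal ((fhat (dataOf f ω) (x + v) - f x) ^ 2))
          ∂(Measure.pi fun _ : Fin n => (covariateLaw p).prod ν)) +
        2 * (∫⁻ ω, (ENNReal.ofReal a * ∫⁻ x in overlap 0,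
          ENNReal.ofReal ((fhat (dataOf f ω) (x + 0) - f x) ^ 2))
          ∂(Measure.pi fun _ : Fin n => (covariateLaw p).prod ν)) := by
        have hm' : Measurable fun ω : Fin n → E d × ℝ => 2 * (ENNReal.ofReal a *
            ∫⁻ x in overlap 0, ENNReal.ofReal ((fhat (dataOf f ω) (x + 0) - f x) ^ 2)) :=
          (hmD.lintegral_prod_right'.const_mul _).const_mul 2
        exact (lintegral_add_right _ hm').trans (congrArg₂ (· + ·)
          (lintegral_const_mul' _ _ (by simp)) (lintegral_const_mul' _ _ (by simp)))
    _ ≤ 2 * advRisk p ν r fhat f + 2 * advRisk p ν r fhat f := by gcongr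
    _ = _ := by ring

/-- The first coordinate vector, scaled by `u`. -/
def axis {d : ℕ} (hd : 1 ≤ d) (u : ℝ) : E d := EuclideanSpace.single ⟨0, hd⟩ u

theorem norm_axis {d : ℕ} (hd : 1 ≤ d) (u : ℝ) : ‖axis hd u‖ = |u| := by
  simp [axis]

theorem axis_add {d : ℕ} (hd : 1 ≤ d) (u w : ℝ) : axis hd (u + w) = axis hd u + axis hd w := by
  ext i
  by_cases hi : i = ⟨0, hd⟩ <;> simp [axis, hi]

theorem inner_axis {d : ℕ} (hd : 1 ≤ d) (u : ℝ) (x : E d) :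
    inner ℝ (axis hd u) x = u * x ⟨0, hd⟩ := by
  simp [axis, EuclideanSpace.inner_single_left]

/-- The part of the cube where the first coordinate is at most `u`. -/
def slab {d : ℕ} (hd : 1 ≤ d) (u : ℝ) : Set (E d) := cube d ∩ {x | x ⟨0, hd⟩ ≤ u}

theorem measurableSet_slab {d : ℕ} (hd : 1 ≤ d) (u : ℝ) : MeasurableSet (slab hd u) :=
  (measurableSet_cube d).inter (measurableSet_le (by fun_prop) measurable_const)

theorem add_axis_mem_slab {d : ℕ} (hd : 1 ≤ d) {u w t : ℝ} (hw : 0 ≤ w) (huw : u + w ≤ t)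
    (ht : t ≤ 1) {x : E d} (hx : x ∈ slab hd u) : x + axis hd w ∈ slab hd t := by
  have hx0 : x ⟨0, hd⟩ ≤ u := hx.2
  have h0 : (x + axis hd w) ⟨0, hd⟩ = x ⟨0, hd⟩ + w := by simp [axis]
  refine ⟨fun i => ?_, ?_⟩
  · by_cases hi : i = ⟨0, hd⟩
    · rw [hi, h0]
      exact ⟨by linarith [(hx.1 ⟨0, hd⟩).1], by linarith⟩
    · have : (x + axis hd w) i = x i := by simp [axis, hi]
      rw [this]; exact hx.1 i
  · change (x + axis hd w) ⟨0, hd⟩ ≤ t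
    rw [h0]; linarith

theorem volume_slab {d : ℕ} (hd : 1 ≤ d) {u : ℝ} (hu1 : u ≤ 1) :
    volume (slab hd u) = ENNReal.ofReal u := by
  have h : slab hd u = {x : E d | ∀ i, x i ∈ Icc (0 : ℝ) (if i = ⟨0, hd⟩ then u else 1)} := by
    ext x
    refine ⟨fun hx i => ?_, fun hx => ⟨fun i => ?_, ?_⟩⟩
    · split_ifs with hi
      · rw [hi]; exact ⟨(hx.1 _).1, hx.2⟩
      · exact hx.1 i
    · refine ⟨(hx i).1, (hx i).2.trans ?_⟩
      split_ifs <;> linarith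
    · have := (hx ⟨0, hd⟩).2
      rwa [if_pos rfl] at this
  rw [h, volume_box fun i => Icc (0 : ℝ) (if i = ⟨0, hd⟩ then u else 1)]
  simp only [Real.volume_Icc, sub_zero]
  rw [Finset.prod_eq_single ⟨0, hd⟩ (fun i _ hi => by rw [if_neg hi]; simp) (by simp), if_pos rfl]

/-- Translation by a quarter period turns cos² into sin². Two translates of the slab of width 1/4
fit into the slab of width 1/2, and their integrands add up to 1. -/
theorem lintegral_cos_sq_ge {d : ℕ} (hd : 1 ≤ d) {k : ℕ} (hk : 1 ≤ k) :
    ENNReal.ofReal (1 / 8) ≤ ∫⁻ x in slab hd (1 / 2),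
      ENNReal.ofReal (Real.cos (2 * Real.pi * (k * x ⟨0, hd⟩)) ^ 2) := by
  have hk' : (1 : ℝ) ≤ k := by exact_mod_cast hk
  set g : E d → ℝ≥0∞ := fun x =>
    ENNReal.ofReal (Real.cos (2 * Real.pi * (k * x ⟨0, hd⟩)) ^ 2) with hg
  have hgm : Measurable g := by rw [hg]; fun_prop
  have hw : (1 : ℝ) / (4 * k) ≤ 1 / 4 := by
    rw [div_le_div_iff₀ (by positivity) (by norm_num)]; linarith
  have h1 := lintegral_comp_add_le (measurableSet_slab hd (1 / 4)) (measurableSet_slab hd (1 / 2))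
    (v := 0) (fun x hx => ⟨by simpa using hx.1, by
      have : x ⟨0, hd⟩ ≤ 1 / 4 := hx.2
      change (x + 0) ⟨0, hd⟩ ≤ 1 / 2
      rw [add_zero]; linarith⟩) g
  have h2 := lintegral_comp_add_le (measurableSet_slab hd (1 / 4)) (measurableSet_slab hd (1 / 2))
    (v := axis hd (1 / (4 * k)))
    (fun x hx => add_axis_mem_slab hd (by positivity) (by linarith) (by norm_num) hx) g
  have h3 : ENNReal.ofReal (1 / 4) ≤ 2 * ∫⁻ x in slab hd (1 / 2), g x := by
    calc ENNReal.ofReal (1 / 4) = ∫⁻ x in slab hd (1 / 4), 1 := by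
          rw [setLIntegral_one, volume_slab hd (by norm_num)]
      _ = ∫⁻ x in slab hd (1 / 4), (g (x + 0) + g (x + axis hd (1 / (4 * k)))) := by
          refine lintegral_congr fun x => ?_
          have h0 : (x + axis hd (1 / (4 * k))) ⟨0, hd⟩ = x ⟨0, hd⟩ + 1 / (4 * k) := by
            simp [axis]
          have h4 : 2 * Real.pi * (k * (x ⟨0, hd⟩ + 1 / (4 * k))) =
              2 * Real.pi * (k * x ⟨0, hd⟩) + Real.pi / 2 := by
            field_simp; ring
          rw [hg]
          simp only [add_zero]
          rw [h0, h4, Real.cos_add_pi_div_two, neg_sq, ← ENNReal.ofReal_add (sq_nonneg _)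
            (sq_nonneg _), Real.cos_sq_add_sin_sq, ENNReal.ofReal_one]
      _ = (∫⁻ x in slab hd (1 / 4), g (x + 0)) +
            ∫⁻ x in slab hd (1 / 4), g (x + axis hd (1 / (4 * k))) :=
          lintegral_add_left (hgm.comp (measurable_add_const 0)) _
      _ ≤ _ := by rw [two_mul]; exact add_le_add h1 h2
  refine (ENNReal.mul_le_mul_iff_right (a := 2) (by simp) (by simp)).1 (le_trans ?_ h3)
  rw [two_mul_ofReal]
  norm_num

/-- A wave of frequency `k` oscillates at all scales down to `1/(2kN)`. -/
theorem lintegral_shift_wave_ge {d : ℕ} (hd : 1 ≤ d) {k N : ℕ} (hk : 1 ≤ k) (hN : 1 ≤ N) (γ : ℝ) :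
    ENNReal.ofReal (γ ^ 2 * winVol d ^ 2 / (8 * N ^ 2)) ≤
      ∫⁻ x in overlap (axis hd (1 / (2 * k * N))), ENNReal.ofReal
        ((waves (fun _ : Unit => axis hd k) (fun _ => γ) x -
          waves (fun _ : Unit => axis hd k) (fun _ => γ) (x + axis hd (1 / (2 * k * N)))) ^ 2) := by
  have hk' : (1 : ℝ) ≤ k := by exact_mod_cast hk
  have hN' : (1 : ℝ) ≤ N := by exact_mod_cast hN
  set u : ℝ := 1 / (2 * k * N) with hu
  have hu0 : 0 ≤ u := by positivity
  have hNu : N * u = 1 / (2 * k) := by rw [hu]; field_simp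
  have hNu2 : N * u ≤ 1 / 2 := by
    rw [hNu, div_le_div_iff₀ (by positivity) (by norm_num)]; linarith
  set f := waves (fun _ : Unit => axis hd (k : ℝ)) (fun _ => γ) with hf
  have hfc : Continuous f := continuous_waves _ _
  have hfx : ∀ x, f x = γ * Real.cos (2 * Real.pi * (k * x ⟨0, hd⟩)) * win d x := by
    intro x
    simp [hf, waves, inner_axis]
  set I := ∫⁻ x in overlap (axis hd u), ENNReal.ofReal ((f x - f (x + axis hd u)) ^ 2) with hI
  have hstep : ∀ j ∈ Finset.range N, ∫⁻ x in slab hd (1 / 2), ENNReal.ofReal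
      ((f (x + axis hd (j * u)) - f (x + axis hd ((j + 1 : ℕ) * u))) ^ 2) ≤ I := by
    intro j hj
    have hj' : ((j + 1 : ℕ) : ℝ) ≤ N := by exact_mod_cast Finset.mem_range.1 hj
    have hj2 : ((j + 1 : ℕ) : ℝ) * u ≤ 1 / 2 :=
      (mul_le_mul_of_nonneg_right hj' hu0).trans hNu2
    have hadd : ∀ x, x + axis hd ((j + 1 : ℕ) * u) = x + axis hd (j * u) + axis hd u := by
      intro x
      rw [add_assoc, ← axis_add]
      congr 2; push_cast; ring
    simp_rw [hadd]
    push_cast at hj2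
    refine lintegral_comp_add_le (measurableSet_slab hd (1 / 2))
      (measurableSet_overlap (axis hd u)) (fun x hx => ⟨?_, ?_⟩)
      (fun x => ENNReal.ofReal ((f x - f (x + axis hd u)) ^ 2))
    · exact (add_axis_mem_slab hd (t := 1) (by positivity) (by linarith) le_rfl hx).1
    · change x + axis hd (j * u) + axis hd u ∈ cube d
      rw [← hadd]
      refine (add_axis_mem_slab hd (t := 1) (by positivity) ?_ le_rfl hx).1
      push_cast; linarith
  -- The shift by N u is a chain of N shifts by u, each contributing at most `I` by translation.
  -- Cauchy–Schwarz over the chain gives the loss N² in total.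
  have htel : ∀ x, (f x - f (x + axis hd (N * u))) ^ 2 ≤ N * ∑ j ∈ Finset.range N,
      (f (x + axis hd (j * u)) - f (x + axis hd ((j + 1 : ℕ) * u))) ^ 2 := by
    intro x
    have h1 := Finset.sum_range_sub' (fun j : ℕ => f (x + axis hd (j * u))) N
    have h0 : x + axis hd ((0 : ℕ) * u) = x := by simp [axis]
    rw [h0] at h1
    rw [← h1]
    have h2 := sq_sum_le_card_mul_sum_sq (s := Finset.range N)
      (f := fun j : ℕ => f (x + axis hd (j * u)) - f (x + axis hd ((j + 1 : ℕ) * u)))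
    rwa [Finset.card_range] at h2
  -- The total shift N u = 1/(2k) is half a period, which reverses the sign of the cosine. The
  -- difference therefore contains the sum of two window values, each at least `winVol d / 2`.
  have hlow : ∀ x ∈ slab hd (1 / 2), γ ^ 2 * winVol d ^ 2 *
      Real.cos (2 * Real.pi * (k * x ⟨0, hd⟩)) ^ 2 ≤ (f x - f (x + axis hd (N * u))) ^ 2 := by
    intro x hx
    have h1 : x + axis hd (N * u) ∈ cube d :=
      (add_axis_mem_slab hd (t := 1) (by positivity) (by linarith) le_rfl hx).1
    have h2 := half_winVol_le_win hd hx.1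
    have h3 := half_winVol_le_win hd h1
    have h4 := winVol_pos hd
    have h0 : (x + axis hd (N * u)) ⟨0, hd⟩ = x ⟨0, hd⟩ + N * u := by simp [axis]
    have h5 : 2 * Real.pi * (k * (x ⟨0, hd⟩ + N * u)) =
        2 * Real.pi * (k * x ⟨0, hd⟩) + Real.pi := by
      rw [hNu]; field_simp
    have h6 : f x - f (x + axis hd (N * u)) = γ * Real.cos (2 * Real.pi * (k * x ⟨0, hd⟩)) *
        (win d x + win d (x + axis hd (N * u))) := by
      rw [hfx, hfx, h0, h5, Real.cos_add_pi]; ring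
    rw [h6, mul_pow, mul_pow]
    have h7 : winVol d ^ 2 ≤ (win d x + win d (x + axis hd (N * u))) ^ 2 := by
      apply pow_le_pow_left₀ h4.le; linarith
    calc _ = γ ^ 2 * Real.cos (2 * Real.pi * (k * x ⟨0, hd⟩)) ^ 2 * winVol d ^ 2 := by ring
      _ ≤ _ := by gcongr
  have hsum : ENNReal.ofReal (γ ^ 2 * winVol d ^ 2) * ENNReal.ofReal (1 / 8) ≤
      ENNReal.ofReal (N ^ 2) * I := by
    calc _ ≤ ENNReal.ofReal (γ ^ 2 * winVol d ^ 2) * ∫⁻ x in slab hd (1 / 2),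
          ENNReal.ofReal (Real.cos (2 * Real.pi * (k * x ⟨0, hd⟩)) ^ 2) :=
          mul_le_mul_right (lintegral_cos_sq_ge hd hk) _
      _ = ∫⁻ x in slab hd (1 / 2), ENNReal.ofReal (γ ^ 2 * winVol d ^ 2 *
          Real.cos (2 * Real.pi * (k * x ⟨0, hd⟩)) ^ 2) := by
          rw [← lintegral_const_mul' _ _ (by simp)]
          refine lintegral_congr fun x => ?_
          rw [← ENNReal.ofReal_mul (by positivity)]
      _ ≤ ∫⁻ x in slab hd (1 / 2), ENNReal.ofReal N * ∑ j ∈ Finset.range N, ENNReal.ofReal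
          ((f (x + axis hd (j * u)) - f (x + axis hd ((j + 1 : ℕ) * u))) ^ 2) := by
          refine setLIntegral_mono' (measurableSet_slab hd _) fun x hx => ?_
          rw [← ENNReal.ofReal_sum_of_nonneg fun j _ => sq_nonneg _,
            ← ENNReal.ofReal_mul (by positivity)]
          exact ENNReal.ofReal_le_ofReal ((hlow x hx).trans (htel x))
      _ = ENNReal.ofReal N * ∑ j ∈ Finset.range N, ∫⁻ x in slab hd (1 / 2), ENNReal.ofReal
          ((f (x + axis hd (j * u)) - f (x + axis hd ((j + 1 : ℕ) * u))) ^ 2) := by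
          rw [lintegral_const_mul' _ _ (by simp), lintegral_finsetSum _ fun j _ => ?_]
          have := hfc.measurable
          fun_prop
      _ ≤ ENNReal.ofReal N * ∑ j ∈ Finset.range N, I := by
          gcongr with j hj
          exact hstep j hj
      _ = _ := by
          rw [Finset.sum_const, Finset.card_range, nsmul_eq_mul, ← mul_assoc,
            ← ENNReal.ofReal_natCast, ← ENNReal.ofReal_mul (by positivity), sq]
  rw [← ENNReal.ofReal_mul (by positivity)] at hsum
  refine (ENNReal.mul_le_mul_iff_right (a := ENNReal.ofReal (N ^ 2))
    (ENNReal.ofReal_pos.2 (by positivity)).ne' (by simp)).1 (le_trans (le_of_eq ?_) hsum)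
  rw [← ENNReal.ofReal_mul (by positivity)]
  congr 1
  field_simp

theorem mem_sobolevBall_of_sq_le {d : ℕ} {s L : ℝ} (hL : 0 ≤ L) {f : E d → ℝ}
    (h : cubeNorm s f ^ 2 ≤ ENNReal.ofReal (L ^ 2)) : f ∈ sobolevBall d s L := by
  rw [ENNReal.ofReal_pow hL] at h
  exact (ENNReal.pow_le_pow_left_iff two_ne_zero).1 h

theorem exists_steps_le_advRisk {d : ℕ} (hd : 1 ≤ d) {s L a : ℝ} (hs : 0 < s) (hL : 0 < L)
    (ha : 0 < a) : ∃ c : ℝ, 0 < c ∧ ∀ (k N : ℕ) (r b : ℝ), 1 ≤ k → 1 ≤ N → 1 / (2 * k * N) ≤ r →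
      ∃ f ∈ sobolevBall d s L, ∀ p, IsCovariateDensity a b p → ∀ ν : Measure ℝ,
        IsProbabilityMeasure ν → ∀ (n : ℕ) (fhat : Data d n → E d → ℝ),
        Measurable (Function.uncurry fhat) →
        ENNReal.ofReal (c * ((k : ℝ) ^ (-(2 * s)) / N ^ 2)) ≤ advRisk p ν r fhat f := by
  have hw := winVol_pos hd
  set C₀ := (1 + (4 * Real.pi) ^ 2) ^ s * winVol d with hC₀
  have hC : 0 < C₀ := by positivity
  refine ⟨a * (L ^ 2 / C₀) * winVol d ^ 2 / 32, by positivity, fun k N r b hk hN hr => ?_⟩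
  have hk' : (1 : ℝ) ≤ k := by exact_mod_cast hk
  have hk0 : (0 : ℝ) < k := by linarith
  have hN' : (1 : ℝ) ≤ N := by exact_mod_cast hN
  -- The largest amplitude permitted by the norm estimate: C₀ k^{2s} γ² = L².
  set γ : ℝ := L / Real.sqrt C₀ * (k : ℝ) ^ (-s) with hγ
  have hγ2 : γ ^ 2 = L ^ 2 / C₀ * (k : ℝ) ^ (-(2 * s)) := by
    rw [hγ, mul_pow, div_pow, Real.sq_sqrt hC.le, ← Real.rpow_natCast ((k : ℝ) ^ (-s)),
      ← Real.rpow_mul hk0.le]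
    congr 2; push_cast; ring
  refine ⟨waves (fun _ : Unit => axis hd k) (fun _ => γ), ?_, fun p hp ν hν n fhat hfhat => ?_⟩
  · refine mem_sobolevBall_of_sq_le hL.le ?_
    refine (cubeNorm_waves_le hd hs.le (fun i j hij => (hij rfl).elim) hk'
      (fun _ => by rw [norm_axis, abs_of_pos hk0]) _).trans (ENNReal.ofReal_le_ofReal ?_)
    rw [← hC₀, Finset.univ_unique, Finset.sum_singleton, hγ2, Real.rpow_neg hk0.le]
    have : 0 < (k : ℝ) ^ (2 * s) := by positivity
    apply le_of_eq
    field_simp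
  · have h1 := lintegral_shift_wave_ge hd hk hN γ
    have h2 := lintegral_shift_le_advRisk hp (ν := ν) (r := r) hfhat
      (continuous_waves (fun _ : Unit => axis hd (k : ℝ)) (fun _ => γ)).measurable
      (v := axis hd (1 / (2 * k * N))) (by
        rw [norm_axis, abs_of_pos (by positivity)]; exact hr)
    have h3 := (mul_le_mul_right h1 (ENNReal.ofReal a)).trans h2
    rw [← ENNReal.ofReal_mul ha.le] at h3
    refine (ENNReal.mul_le_mul_iff_right (a := 4) (by simp) (by simp)).1 (le_trans ?_ h3)
    rw [← ENNReal.ofReal_ofNat 4, ← ENNReal.ofReal_mul (by norm_num)]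
    refine ENNReal.ofReal_le_ofReal (le_of_eq ?_)
    rw [hγ2]
    field_simp
    ring

theorem exists_half_inv_ceil {r : ℝ} (hr0 : 0 < r) (hr1 : r ≤ 1) :
    ∃ k : ℕ, 1 ≤ k ∧ 1 / (2 * (k : ℝ)) ≤ r ∧ (k : ℝ) ≤ 2 / r := by
  refine ⟨⌈1 / (2 * r)⌉₊, Nat.ceil_pos.2 (by positivity), ?_, ?_⟩
  · have h := Nat.le_ceil (1 / (2 * r))
    have h0 : (0 : ℝ) < ⌈1 / (2 * r)⌉₊ := lt_of_lt_of_le (by positivity) h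
    rw [div_le_iff₀ (by positivity)] at h ⊢
    linarith
  · have h := (Nat.ceil_lt_add_one (a := 1 / (2 * r)) (by positivity)).le
    refine h.trans ?_
    rw [le_div_iff₀ hr0, add_mul, div_mul_eq_mul_div, one_mul]
    have : r / (2 * r) = 1 / 2 := by field_simp
    linarith

/-- The lower bound of the order `r^{2 min(1,s)}` for the adversarial risk. -/
theorem exists_perturbation_le_advRisk {d : ℕ} (hd : 1 ≤ d) {s L a : ℝ} (hs : 0 < s) (hL : 0 < L)
    (ha : 0 < a) : ∃ c : ℝ, 0 < c ∧ ∀ (r b : ℝ), 0 ≤ r → r ≤ 1 →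
      ∀ p, IsCovariateDensity a b p → ∀ ν : Measure ℝ,
        IsProbabilityMeasure ν → ∀ (n : ℕ) (fhat : Data d n → E d → ℝ),
        Measurable (Function.uncurry fhat) →
        ENNReal.ofReal (c * r ^ (2 * min 1 s)) ≤ ⨆ f ∈ sobolevBall d s L, advRisk p ν r fhat f := by
  obtain ⟨c, hc, h⟩ := exists_steps_le_advRisk hd hs hL ha
  refine ⟨c * min (1 / 4) (2 ^ (-(2 * s))), by positivity, fun r b hr0 hr1 p hp ν hν n fhat hm => ?_⟩
  rcases hr0.eq_or_lt with rfl | hr0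
  · rw [Real.zero_rpow (by positivity)]
    simp
  obtain ⟨k, hk1, hkr, hk2⟩ := exists_half_inv_ceil hr0 hr1
  have hk0 : (0 : ℝ) < k := by exact_mod_cast hk1
  -- For s ≥ 1 the wave of frequency 1 is best: a shift of order r changes it by order r. For s ≤ 1
  -- a wave of frequency of order 1/r and amplitude of order r^s is reversed by a single half-period
  -- shift.
  rcases le_total 1 s with h1s | hs1
  · obtain ⟨f, hf, hf2⟩ := h 1 k r b le_rfl hk1 (by simpa using hkr)
    refine le_trans ?_ ((hf2 p hp ν hν n fhat hm).trans (le_iSup₂ (f := fun f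
      (_ : f ∈ sobolevBall d s L) => advRisk p ν r fhat f) f hf))
    refine ENNReal.ofReal_le_ofReal ?_
    rw [min_eq_left h1s, mul_assoc]
    refine mul_le_mul_of_nonneg_left ?_ hc.le
    rw [mul_one, Real.rpow_two, Nat.cast_one, Real.one_rpow]
    calc min (1 / 4) (2 ^ (-(2 * s))) * r ^ 2 ≤ 1 / 4 * r ^ 2 := by
          gcongr
          exact min_le_left _ _
      _ = 1 / (2 / r) ^ 2 := by field_simp; norm_num
      _ ≤ _ := by gcongr
  · obtain ⟨f, hf, hf2⟩ := h k 1 r b hk1 le_rfl (by simpa using hkr)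
    refine le_trans ?_ ((hf2 p hp ν hν n fhat hm).trans (le_iSup₂ (f := fun f
      (_ : f ∈ sobolevBall d s L) => advRisk p ν r fhat f) f hf))
    refine ENNReal.ofReal_le_ofReal ?_
    rw [min_eq_right hs1, mul_assoc]
    refine mul_le_mul_of_nonneg_left ?_ hc.le
    rw [Nat.cast_one, one_pow, div_one]
    calc min (1 / 4) (2 ^ (-(2 * s))) * r ^ (2 * s) ≤ 2 ^ (-(2 * s)) * r ^ (2 * s) := by
          gcongr
          exact min_le_right _ _
      _ = (2 / r) ^ (-(2 * s)) := by
          rw [Real.div_rpow (by norm_num) hr0.le, Real.rpow_neg hr0.le, div_inv_eq_mul]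
      _ ≤ _ := Real.rpow_le_rpow_of_nonpos hk0 hk2 (by linarith)

/-! ### Testing two Gaussian shifts -/

theorem lintegral_pi_prod {ι : Type*} [Fintype ι] {X : ι → Type*} [∀ i, MeasurableSpace (X i)]
    (μ : ∀ i, Measure (X i)) [∀ i, IsProbabilityMeasure (μ i)] {g : ∀ i, X i → ℝ≥0∞}
    (hg : ∀ i, Measurable (g i)) :
    ∫⁻ x, ∏ i, g i (x i) ∂(Measure.pi μ) = ∏ i, ∫⁻ x, g i x ∂(μ i) := by
  have h := lintegral_prod_eq_prod_lintegral_of_indepFun (μ := Measure.pi μ) Finset.univ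
    (fun i x => g i (x i)) (iIndepFun_pi fun i => (hg i).aemeasurable)
    fun i => (hg i).comp (measurable_pi_apply i)
  refine h.trans (Finset.prod_congr rfl fun i _ => ?_)
  exact (measurePreserving_eval μ i).lintegral_comp (hg i)

theorem gaussianReal_eq_withDensity (θ : ℝ) {v : ℝ≥0} (hv : v ≠ 0) :
    gaussianReal θ v = (gaussianReal 0 v).withDensity
      fun x => ENNReal.ofReal (Real.exp ((θ * x - θ ^ 2 / 2) / v)) := by
  have hv' : (v : ℝ) ≠ 0 := by exact_mod_cast hv
  rw [gaussianReal_of_var_ne_zero θ hv, gaussianReal_of_var_ne_zero 0 hv,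
    ← withDensity_mul _ (measurable_gaussianPDF 0 v) (by fun_prop)]
  congr 1
  funext x
  rw [Pi.mul_apply, gaussianPDF, gaussianPDF, ← ENNReal.ofReal_mul (gaussianPDFReal_nonneg _ _ _),
    gaussianPDFReal, gaussianPDFReal, mul_assoc (√(2 * Real.pi * v))⁻¹, ← Real.exp_add]
  congr 3
  field_simp
  ring

/-- The likelihood ratio of the Gaussian product measure shifted by `θ`. -/
def shiftDensity {n : ℕ} (v : ℝ≥0) (θ ξ : Fin n → ℝ) : ℝ :=
  Real.exp (∑ i, (θ i * ξ i - θ i ^ 2 / 2) / v)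

theorem shiftDensity_pos {n : ℕ} (v : ℝ≥0) (θ ξ : Fin n → ℝ) : 0 < shiftDensity v θ ξ :=
  Real.exp_pos _

theorem measurable_shiftDensity {n : ℕ} (v : ℝ≥0) (θ : Fin n → ℝ) :
    Measurable (shiftDensity v θ) := by
  unfold shiftDensity
  fun_prop

theorem map_shift_pi_gaussian {n : ℕ} (θ : Fin n → ℝ) {v : ℝ≥0} (hv : v ≠ 0) :
    (Measure.pi fun _ : Fin n => gaussianReal 0 v).map (fun ξ => θ + ξ) =
      (Measure.pi fun _ => gaussianReal 0 v).withDensity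
        fun ξ => ENNReal.ofReal (shiftDensity v θ ξ) := by
  have h1 : (Measure.pi fun _ : Fin n => gaussianReal 0 v).map (fun ξ => θ + ξ) =
      Measure.pi fun i => gaussianReal (θ i) v := by
    have h := Measure.pi_map_pi (μ := fun _ : Fin n => gaussianReal 0 v)
      (f := fun i x => θ i + x) (hμ := fun i => by
        rw [gaussianReal_map_const_add]; infer_instance) fun i => by fun_prop
    simp_rw [gaussianReal_map_const_add, zero_add] at h
    exact h
  rw [h1]
  refine Measure.pi_eq fun s hs => ?_
  rw [withDensity_apply _ (MeasurableSet.univ_pi hs), ← lintegral_indicator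
    (MeasurableSet.univ_pi hs)]
  have h2 : ∀ i, gaussianReal (θ i) v (s i) = ∫⁻ x, (s i).indicator (fun x =>
      ENNReal.ofReal (Real.exp ((θ i * x - θ i ^ 2 / 2) / v))) x ∂(gaussianReal 0 v) := fun i => by
    rw [gaussianReal_eq_withDensity _ hv, withDensity_apply _ (hs i), lintegral_indicator (hs i)]
  simp_rw [h2]
  rw [← lintegral_pi_prod _ fun i => Measurable.indicator (by fun_prop) (hs i)]
  refine lintegral_congr fun ξ => ?_
  by_cases hξ : ξ ∈ Set.univ.pi s
  · rw [indicator_of_mem hξ, shiftDensity, Real.exp_sum, ENNReal.ofReal_prod_of_nonneg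
      fun i _ => (Real.exp_pos _).le]
    exact Finset.prod_congr rfl fun i _ => (indicator_of_mem (hξ i (mem_univ i))
      fun x => ENNReal.ofReal (Real.exp ((θ i * x - θ i ^ 2 / 2) / v))).symm
  · rw [indicator_of_notMem hξ]
    obtain ⟨i, hi⟩ : ∃ i, ξ i ∉ s i := by simpa [Set.mem_pi] using hξ
    exact (Finset.prod_eq_zero (Finset.mem_univ i) (indicator_of_notMem hi _)).symm

theorem lintegral_shift_pi_gaussian {n : ℕ} (θ : Fin n → ℝ) {v : ℝ≥0} (hv : v ≠ 0)
    {F : (Fin n → ℝ) → ℝ≥0∞} (hF : Measurable F) :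
    ∫⁻ ξ, F (θ + ξ) ∂(Measure.pi fun _ => gaussianReal 0 v) =
      ∫⁻ ξ, ENNReal.ofReal (shiftDensity v θ ξ) * F ξ ∂(Measure.pi fun _ => gaussianReal 0 v) := by
  rw [← lintegral_map hF (measurable_const_add θ), map_shift_pi_gaussian θ hv,
    lintegral_withDensity_eq_lintegral_mul _ (measurable_shiftDensity v θ).ennreal_ofReal hF]
  rfl

/-- The inverse likelihood ratio is, up to this constant, the likelihood ratio of the opposite
shift, which integrates to 1. -/
theorem lintegral_inv_shiftDensity {n : ℕ} (θ : Fin n → ℝ) {v : ℝ≥0} (hv : v ≠ 0) :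
    ∫⁻ ξ, ENNReal.ofReal (shiftDensity v θ ξ)⁻¹ ∂(Measure.pi fun _ => gaussianReal 0 v) =
      ENNReal.ofReal (Real.exp (∑ i, θ i ^ 2 / v)) := by
  have h := lintegral_shift_pi_gaussian (-θ) hv (F := fun _ => 1) measurable_const
  rw [lintegral_const, measure_univ, mul_one] at h
  have h2 : ∀ ξ, ENNReal.ofReal (shiftDensity v θ ξ)⁻¹ = ENNReal.ofReal
      (Real.exp (∑ i, θ i ^ 2 / v)) * (ENNReal.ofReal (shiftDensity v (-θ) ξ) * 1) := by
    intro ξ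
    rw [mul_one, ← ENNReal.ofReal_mul (Real.exp_pos _).le, shiftDensity, shiftDensity,
      ← Real.exp_neg, ← Real.exp_add, ← Finset.sum_neg_distrib, ← Finset.sum_add_distrib]
    congr 2
    refine Finset.sum_congr rfl fun i _ => ?_
    rw [Pi.neg_apply]
    ring
  simp_rw [h2]
  rw [lintegral_const_mul' _ _ ENNReal.ofReal_ne_top, ← h, mul_one]

/-- An estimator of the sign of `±g` from a Gaussian vector errs if the means are close. -/
theorem two_point_lower_bound {n : ℕ} {v : ℝ≥0} (hv : v ≠ 0) {c : (Fin n → ℝ) → ℝ}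
    (hc : Measurable c) (g : ℝ) (y₁ y₂ : Fin n → ℝ) :
    ENNReal.ofReal (4 * g ^ 2 / (1 + Real.exp (∑ i, (y₁ i - y₂ i) ^ 2 / v))) ≤
      (∫⁻ ξ, ENNReal.ofReal ((c (y₁ + ξ) - g) ^ 2) ∂(Measure.pi fun _ => gaussianReal 0 v)) +
      ∫⁻ ξ, ENNReal.ofReal ((c (y₂ + ξ) + g) ^ 2) ∂(Measure.pi fun _ => gaussianReal 0 v) := by
  set G := Measure.pi fun _ : Fin n => gaussianReal 0 v with hG
  set θ := y₁ - y₂ with hθ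
  set T := Real.exp (∑ i, θ i ^ 2 / v) with hT
  have hT0 : 0 < T := Real.exp_pos _
  have hcm : Measurable fun ξ => c (y₂ + ξ) := hc.comp (measurable_const_add y₂)
  have h1 : ∫⁻ ξ, ENNReal.ofReal ((c (y₁ + ξ) - g) ^ 2) ∂G =
      ∫⁻ ξ, ENNReal.ofReal (shiftDensity v θ ξ) * ENNReal.ofReal ((c (y₂ + ξ) - g) ^ 2) ∂G := by
    rw [← lintegral_shift_pi_gaussian θ hv ((hcm.sub_const g).pow_const 2).ennreal_ofReal]
    refine lintegral_congr fun ξ => ?_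
    rw [← add_assoc, hθ, add_sub_cancel]
  have hρ := measurable_shiftDensity v θ
  -- Minus the slope at t = T of the convex function 4g²/(1 + t). Jensen's inequality is carried out
  -- with the tangent at T, the mean of the inverse likelihood ratio: D times that ratio is added to
  -- both sides, integrated, and cancelled.
  set D : ℝ := 4 * g ^ 2 / (1 + T) ^ 2 with hD
  have hD0 : 0 ≤ D := by positivity
  have key : ∀ ξ, ENNReal.ofReal (4 * g ^ 2 / (1 + T) + D * T) ≤
      (ENNReal.ofReal (shiftDensity v θ ξ) * ENNReal.ofReal ((c (y₂ + ξ) - g) ^ 2) +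
        ENNReal.ofReal ((c (y₂ + ξ) + g) ^ 2)) +
      ENNReal.ofReal D * ENNReal.ofReal (shiftDensity v θ ξ)⁻¹ := by
    intro ξ
    have hp := shiftDensity_pos v θ ξ
    set ρ := shiftDensity v θ ξ
    set z := c (y₂ + ξ)
    rw [← ENNReal.ofReal_mul hp.le, ← ENNReal.ofReal_add (by positivity) (by positivity),
      ← ENNReal.ofReal_mul hD0, ← ENNReal.ofReal_add (by positivity) (by positivity)]
    refine ENNReal.ofReal_le_ofReal ?_
    -- The left-hand side is the minimum over z, attained at z = (ρ - 1) g / (ρ + 1).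
    have h2 : 4 * g ^ 2 / (1 + ρ⁻¹) ≤ ρ * (z - g) ^ 2 + (z + g) ^ 2 := by
      have : 1 + ρ⁻¹ = (1 + ρ) / ρ := by field_simp; ring
      rw [this, div_div_eq_mul_div, div_le_iff₀ (by positivity)]
      nlinarith [sq_nonneg ((ρ + 1) * z - (ρ - 1) * g)]
    have hi : 0 < ρ⁻¹ := inv_pos.2 hp
    have h3 : 4 * g ^ 2 / (1 + T) + D * T ≤ 4 * g ^ 2 / (1 + ρ⁻¹) + D * ρ⁻¹ := by
      set t := ρ⁻¹
      have h4 : 1 / (1 + T) + 1 / (1 + T) ^ 2 * T ≤ 1 / (1 + t) + 1 / (1 + T) ^ 2 * t := by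
        rw [← sub_nonneg]
        have : 1 / (1 + t) + 1 / (1 + T) ^ 2 * t - (1 / (1 + T) + 1 / (1 + T) ^ 2 * T) =
            (t - T) ^ 2 / ((1 + t) * (1 + T) ^ 2) := by
          field_simp; ring
        rw [this]; positivity
      have h5 := mul_le_mul_of_nonneg_left h4 (by positivity : 0 ≤ 4 * g ^ 2)
      have h6 : ∀ w u : ℝ, 4 * g ^ 2 / (1 + w) + D * u =
          4 * g ^ 2 * (1 / (1 + w) + 1 / (1 + T) ^ 2 * u) := fun w u => by rw [hD]; ring
      rw [h6, h6]
      exact h5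
    linarith
  have hint := lintegral_mono (μ := G) key
  have hm₁ : Measurable fun ξ => ENNReal.ofReal D * ENNReal.ofReal (shiftDensity v θ ξ)⁻¹ :=
    hρ.inv.ennreal_ofReal.const_mul _
  have hm₂ : Measurable fun ξ => ENNReal.ofReal ((c (y₂ + ξ) + g) ^ 2) :=
    ((hcm.add_const g).pow_const 2).ennreal_ofReal
  rw [lintegral_const, measure_univ, mul_one, lintegral_add_right _ hm₁,
    lintegral_add_right _ hm₂, lintegral_const_mul' _ _ ENNReal.ofReal_ne_top,
    lintegral_inv_shiftDensity θ hv, ← h1, ← hT, ENNReal.ofReal_add (by positivity) (by positivity),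
    ← ENNReal.ofReal_mul hD0] at hint
  exact (ENNReal.add_le_add_iff_right ENNReal.ofReal_ne_top).1 hint

/-! ### Fourier coefficients on the cube -/

theorem integral_cexp_int {m : ℤ} (hm : m ≠ 0) :
    ∫ x in Icc (0 : ℝ) 1, Complex.exp (2 * Real.pi * Complex.I * m * x) = 0 := by
  have hm' : (2 * Real.pi * Complex.I * m : ℂ) ≠ 0 :=
    mul_ne_zero Complex.two_pi_I_ne_zero (by exact_mod_cast hm)
  rw [integral_Icc_eq_integral_Ioc, ← intervalIntegral.integral_of_le zero_le_one,
    integral_exp_mul_complex hm']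
  have h : Complex.exp (2 * Real.pi * Complex.I * m * (1 : ℝ)) = 1 := by
    rw [← Complex.exp_int_mul_two_pi_mul_I m]
    congr 1; push_cast; ring
  rw [h]; simp

theorem integral_cube_cos {d : ℕ} {m : E d} (hint : ∀ i, ∃ z : ℤ, m i = z) (hm : m ≠ 0) :
    ∫ x in cube d, Real.cos (2 * Real.pi * inner ℝ m x) = 0 := by
  choose z hz using hint
  obtain ⟨i, hi⟩ : ∃ i, z i ≠ 0 := by
    by_contra! h
    exact hm (by ext i; rw [hz, h]; simp)
  have hcont : Continuous fun x : E d => Complex.exp (2 * Real.pi * Complex.I * inner ℝ m x) := by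
    fun_prop
  have hre : ∀ x : E d, Real.cos (2 * Real.pi * inner ℝ m x) =
      RCLike.re (Complex.exp (2 * Real.pi * Complex.I * (inner ℝ m x : ℝ))) := fun x => by
    rw [RCLike.re_to_complex, show (2 * Real.pi * Complex.I * (inner ℝ m x : ℝ) : ℂ) =
      ((2 * Real.pi * inner ℝ m x : ℝ) : ℂ) * Complex.I by push_cast; ring,
      Complex.exp_ofReal_mul_I_re]
  simp_rw [hre]
  rw [integral_re (hcont.continuousOn.integrableOn_compact (isCompact_cube d))]
  have hmp := (EuclideanSpace.volume_preserving_symm_measurableEquiv_toLp (Fin d)).symm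
  have hpre : (MeasurableEquiv.toLp 2 (Fin d → ℝ)) ⁻¹' (cube d) =
      Set.univ.pi fun _ => Icc (0 : ℝ) 1 := by
    ext x; simp [cube, Pi.le_def, forall_and]
  have h1 := hmp.setIntegral_preimage_emb (MeasurableEquiv.measurableEmbedding _)
    (fun x => Complex.exp (2 * Real.pi * Complex.I * (inner ℝ m x : ℝ))) (cube d)
  rw [MeasurableEquiv.symm_symm] at h1
  rw [← h1, hpre, volume_pi, Measure.restrict_pi_pi]
  have h2 : ∀ y : Fin d → ℝ, Complex.exp (2 * Real.pi * Complex.I *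
      (inner ℝ m ((MeasurableEquiv.toLp 2 (Fin d → ℝ)) y) : ℝ)) =
      ∏ k, Complex.exp (2 * Real.pi * Complex.I * z k * y k) := by
    intro y
    rw [← Complex.exp_sum]
    congr 1
    rw [PiLp.inner_apply]
    push_cast
    rw [Finset.mul_sum]
    refine Finset.sum_congr rfl fun k _ => ?_
    simp [hz]
    ring
  simp_rw [h2]
  rw [integral_fintype_prod_eq_prod (fun k (t : ℝ) =>
    Complex.exp (2 * Real.pi * Complex.I * z k * t)), Finset.prod_eq_zero (Finset.mem_univ i)
    (integral_cexp_int hi)]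
  rfl

/-- The frequency of the wave with index `j`: a vector of positive integers. -/
def freq {d K : ℕ} (j : Fin d → Fin K) : E d := WithLp.toLp 2 fun i => ((j i : ℕ) : ℝ) + 1

theorem freq_apply {d K : ℕ} (j : Fin d → Fin K) (i : Fin d) : freq j i = (j i : ℕ) + 1 := rfl

/-- The wave with index `j`. -/
def cosine {d K : ℕ} (j : Fin d → Fin K) (x : E d) : ℝ :=
  Real.cos (2 * Real.pi * inner ℝ (freq j) x)

theorem continuous_cosine {d K : ℕ} (j : Fin d → Fin K) : Continuous (cosine j) := by
  unfold cosine; fun_prop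

theorem abs_cosine_le {d K : ℕ} (j : Fin d → Fin K) (x : E d) : |cosine j x| ≤ 1 :=
  Real.abs_cos_le_one _

theorem exists_ne_of_ne {d K : ℕ} {j l : Fin d → Fin K} (h : j ≠ l) :
    ∃ i, ((j i : ℕ) : ℤ) - (l i : ℕ) ≠ 0 := by
  obtain ⟨i, hi⟩ := Function.ne_iff.1 h
  exact ⟨i, fun h0 => hi (Fin.ext (by omega))⟩

/-- By the product formula only the difference and the sum of the frequencies matter. The sum is
never zero because the coordinates of `freq` start at 1, and the difference is zero only on the
diagonal. -/
theorem integral_cosine_mul {d K : ℕ} (hd : 1 ≤ d) (j l : Fin d → Fin K) :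
    ∫ x in cube d, cosine j x * cosine l x = if j = l then 1 / 2 else 0 := by
  have hprod : ∀ x, cosine j x * cosine l x =
      1 / 2 * Real.cos (2 * Real.pi * inner ℝ (freq j - freq l) x) +
      1 / 2 * Real.cos (2 * Real.pi * inner ℝ (freq j + freq l) x) := by
    intro x
    rw [cosine, cosine, inner_sub_left, inner_add_left, mul_sub, mul_add, Real.cos_sub,
      Real.cos_add]
    ring
  have hi : ∀ m : E d, IntegrableOn (fun x => 1 / 2 * Real.cos (2 * Real.pi * inner ℝ m x))
      (cube d) := fun m =>
    Continuous.continuousOn (by fun_prop) |>.integrableOn_compact (isCompact_cube d)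
  simp_rw [hprod]
  rw [integral_add (hi _) (hi _), integral_const_mul, integral_const_mul,
    integral_cube_cos (m := freq j + freq l) (fun i => ⟨(j i : ℕ) + 1 + ((l i : ℕ) + 1), by
      rw [PiLp.add_apply, freq_apply, freq_apply]; push_cast; ring⟩) ?_, mul_zero, add_zero]
  · split_ifs with h
    · rw [h, sub_self]
      simp [measureReal_def]
    · rw [integral_cube_cos (m := freq j - freq l) (fun i => ⟨(j i : ℕ) - (l i : ℕ), by
        rw [PiLp.sub_apply, freq_apply, freq_apply]; push_cast; ring⟩) ?_, mul_zero]
      intro h0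
      obtain ⟨i, hi⟩ := exists_ne_of_ne h
      have := congrFun (congrArg WithLp.ofLp h0) i
      rw [PiLp.sub_apply, freq_apply, freq_apply] at this
      apply hi
      have h3 : ((j i : ℕ) : ℝ) - (l i : ℕ) = 0 := by simpa using this
      exact_mod_cast h3
  · intro h0
    have := congrFun (congrArg WithLp.ofLp h0) ⟨0, hd⟩
    rw [PiLp.add_apply, freq_apply, freq_apply] at this
    have h3 : ((j ⟨0, hd⟩ : ℕ) : ℝ) + 1 + ((l ⟨0, hd⟩ : ℕ) + 1) = 0 := by simpa using this
    have h4 : (0 : ℝ) ≤ (j ⟨0, hd⟩ : ℕ) := Nat.cast_nonneg _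
    have h5 : (0 : ℝ) ≤ (l ⟨0, hd⟩ : ℕ) := Nat.cast_nonneg _
    linarith

/-- Bessel's inequality for the waves. -/
theorem bessel_cosine {d K : ℕ} (hd : 1 ≤ d) {u : E d → ℝ}
    (hu : MemLp u 2 (volume.restrict (cube d))) :
    1 / 2 * ∑ j : Fin d → Fin K, (2 * ∫ x in cube d, u x * cosine j x) ^ 2 ≤
      ∫ x in cube d, u x ^ 2 := by
  set e : (Fin d → Fin K) → ℝ := fun j => 2 * ∫ x in cube d, u x * cosine j x with he
  have hc : ∀ j : Fin d → Fin K, MemLp (cosine j) 2 (volume.restrict (cube d)) := fun j =>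
    memLp_of_continuous_cube (continuous_cosine j).continuousOn
  have hi1 : ∀ j : Fin d → Fin K, Integrable (fun x => 2 * e j * (u x * cosine j x))
      (volume.restrict (cube d)) := fun j => (hu.integrable_mul (hc j)).const_mul _
  have hi2 : ∀ j l : Fin d → Fin K, Integrable (fun x => e j * e l * (cosine j x * cosine l x))
      (volume.restrict (cube d)) := fun j l => ((hc j).integrable_mul (hc l)).const_mul _
  have hsq : ∀ x, (u x - ∑ j, e j * cosine j x) ^ 2 = u x ^ 2 -
      (∑ j, 2 * e j * (u x * cosine j x)) + ∑ j, ∑ l, e j * e l * (cosine j x * cosine l x) := by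
    intro x
    have h1 : ∑ j, 2 * e j * (u x * cosine j x) = 2 * u x * ∑ j, e j * cosine j x := by
      rw [Finset.mul_sum]; exact Finset.sum_congr rfl fun j _ => by ring
    have h2 : ∑ j, ∑ l, e j * e l * (cosine j x * cosine l x) =
        (∑ j, e j * cosine j x) * ∑ l, e l * cosine l x := by
      rw [Finset.sum_mul_sum]
      exact Finset.sum_congr rfl fun j _ => Finset.sum_congr rfl fun l _ => by ring
    rw [h1, h2]; ring
  have h0 : 0 ≤ ∫ x in cube d, (u x - ∑ j, e j * cosine j x) ^ 2 :=
    integral_nonneg fun x => sq_nonneg _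
  have hi3 : Integrable (fun x => u x ^ 2 - ∑ j, 2 * e j * (u x * cosine j x))
      (volume.restrict (cube d)) :=
    hu.integrable_sq.sub (integrable_finsetSum _ fun j _ => hi1 j)
  simp_rw [hsq] at h0
  rw [integral_add hi3 (integrable_finsetSum _ fun j _ => integrable_finsetSum _ fun l _ => hi2 j l),
    integral_sub hu.integrable_sq (integrable_finsetSum _ fun j _ => hi1 j),
    integral_finsetSum _ fun j _ => hi1 j,
    integral_finsetSum _ fun j _ => integrable_finsetSum _ fun l _ => hi2 j l] at h0
  have h3 : ∀ j, ∫ x in cube d, 2 * e j * (u x * cosine j x) = e j ^ 2 := fun j => by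
    rw [integral_const_mul, he]; ring
  have h4 : ∀ j, ∫ x in cube d, ∑ l, e j * e l * (cosine j x * cosine l x) = 1 / 2 * e j ^ 2 := by
    intro j
    rw [integral_finsetSum _ fun l _ => hi2 j l]
    simp_rw [integral_const_mul, integral_cosine_mul hd]
    simp
    ring
  simp_rw [h3, h4] at h0
  rw [← Finset.mul_sum] at h0
  linarith

/-- The Fourier coefficient of `g` relative to the window. -/
def windowCoeff {d K : ℕ} (g : E d → ℝ) (j : Fin d → Fin K) : ℝ :=
  2 * ∫ x in cube d, g x / win d x * cosine j x

/-- Divided by the window, the error becomes the difference of g / win and a trigonometric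
polynomial. The window is at least `winVol d / 2` on the cube, which costs 1/4, and Bessel's
inequality with ‖cosine‖² = 1/2 supplies the other factor 1/2. -/
theorem sum_windowCoeff_le {d K : ℕ} (hd : 1 ≤ d) {g : E d → ℝ} (hg : Measurable g)
    (θ : (Fin d → Fin K) → ℝ) :
    ENNReal.ofReal (winVol d ^ 2 / 8) *
      ∑ j, ENNReal.ofReal ((windowCoeff g j - θ j) ^ 2) ≤
      ∫⁻ x in cube d, ENNReal.ofReal ((g x - waves freq θ x) ^ 2) := by
  have hV := winVol_pos hd
  set u : E d → ℝ := fun x => g x / win d x - ∑ j, θ j * cosine j x with hu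
  have hum : Measurable u := by
    have h1 := (continuous_win d).measurable
    have h2 : Measurable fun x : E d => ∑ j, θ j * cosine (K := K) j x :=
      (continuous_finsetSum _ fun j _ => (continuous_cosine j).const_mul _).measurable
    exact (hg.div h1).sub h2
  have hle : ENNReal.ofReal (winVol d ^ 2 / 4) * ∫⁻ x in cube d, ENNReal.ofReal (u x ^ 2) ≤
      ∫⁻ x in cube d, ENNReal.ofReal ((g x - waves freq θ x) ^ 2) := by
    rw [← lintegral_const_mul' _ _ ENNReal.ofReal_ne_top]
    refine setLIntegral_mono' (measurableSet_cube d) fun x hx => ?_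
    rw [← ENNReal.ofReal_mul (by positivity)]
    refine ENNReal.ofReal_le_ofReal ?_
    have hw := half_winVol_le_win hd hx
    have hw0 : 0 < win d x := by linarith
    have h1 : g x - waves freq θ x = win d x * u x := by
      have h2 : g x / win d x * win d x = g x := div_mul_cancel₀ _ hw0.ne'
      rw [hu, waves]
      simp only [cosine]
      linear_combination -h2
    rw [h1, mul_pow]
    have h2 : winVol d ^ 2 / 4 ≤ win d x ^ 2 := by nlinarith
    gcongr
  by_cases hL : MemLp u 2 (volume.restrict (cube d))
  · refine le_trans ?_ hle
    have hc : ∀ j : Fin d → Fin K, MemLp (cosine j) 2 (volume.restrict (cube d)) := fun j =>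
      memLp_of_continuous_cube (continuous_cosine j).continuousOn
    have hcoef : ∀ j, 2 * ∫ x in cube d, u x * cosine j x = windowCoeff g j - θ j := by
      intro j
      have hi : ∀ l, Integrable (fun x => θ l * (cosine l x * cosine j x))
          (volume.restrict (cube d)) := fun l => ((hc l).integrable_mul (hc j)).const_mul _
      have h1 : ∀ x, g x / win d x * cosine j x =
          u x * cosine j x + ∑ l, θ l * (cosine l x * cosine j x) := by
        intro x
        have : ∑ l, θ l * (cosine l x * cosine j x) = (∑ l, θ l * cosine l x) * cosine j x := by
          rw [Finset.sum_mul]; exact Finset.sum_congr rfl fun l _ => by ring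
        rw [this, hu]; ring
      have hi0 : Integrable (fun x => u x * cosine j x) (volume.restrict (cube d)) :=
        hL.integrable_mul (hc j)
      rw [windowCoeff]
      simp_rw [h1]
      rw [integral_add hi0 (integrable_finsetSum _ fun l _ => hi l),
        integral_finsetSum _ fun l _ => hi l]
      simp_rw [integral_const_mul, integral_cosine_mul hd]
      simp
      ring
    have hb := bessel_cosine (K := K) hd hL
    simp_rw [hcoef] at hb
    rw [← ofReal_integral_eq_lintegral_ofReal hL.integrable_sq
      (Filter.Eventually.of_forall fun x => sq_nonneg _), ← ENNReal.ofReal_sum_of_nonneg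
      fun j _ => sq_nonneg _, ← ENNReal.ofReal_mul (by positivity),
      ← ENNReal.ofReal_mul (by positivity)]
    refine ENNReal.ofReal_le_ofReal ?_
    calc _ = winVol d ^ 2 / 4 * (1 / 2 * ∑ j, (windowCoeff g j - θ j) ^ 2) := by ring
      _ ≤ _ := by gcongr
  -- If the error is not square integrable the right-hand side is infinite, and the default values
  -- of the coefficients play no role.
  · have htop : ∫⁻ x in cube d, ENNReal.ofReal (u x ^ 2) = ∞ := by
      by_contra h
      refine hL ((memLp_two_iff_integrable_sq hum.aestronglyMeasurable).2
        ⟨(hum.pow_const 2).aestronglyMeasurable, ?_⟩)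
      rw [hasFiniteIntegral_iff_ofReal (Filter.Eventually.of_forall fun x => sq_nonneg _)]
      exact lt_top_iff_ne_top.2 h
    rw [htop, ENNReal.mul_top (ENNReal.ofReal_pos.2 (by positivity)).ne'] at hle
    exact le_top.trans hle

theorem measurable_windowCoeff {d n K : ℕ} {fhat : Data d n → E d → ℝ}
    (hfhat : Measurable (Function.uncurry fhat)) (j : Fin d → Fin K) :
    Measurable fun D => windowCoeff (fhat D) j := by
  have h1 : Measurable fun z : Data d n × E d => fhat z.1 z.2 / win d z.2 * cosine j z.2 :=
    (hfhat.div ((continuous_win d).measurable.comp measurable_snd)).mul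
      ((continuous_cosine j).measurable.comp measurable_snd)
  exact (h1.stronglyMeasurable.integral_prod_right'
    (ν := volume.restrict (cube d))).measurable.const_mul 2

/-! ### The lower bound for the estimation error -/

theorem lintegral_arrowProd {d n : ℕ} (P : Measure (E d)) (ν : Measure ℝ)
    [IsProbabilityMeasure P] [IsProbabilityMeasure ν] {F : (Fin n → E d × ℝ) → ℝ≥0∞}
    (hF : Measurable F) :
    ∫⁻ ω, F ω ∂(Measure.pi fun _ : Fin n => P.prod ν) = ∫⁻ X : Fin n → E d,
      (∫⁻ ξ : Fin n → ℝ, F (fun i => (X i, ξ i)) ∂(Measure.pi fun _ => ν))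
      ∂(Measure.pi fun _ => P) := by
  have hmp := measurePreserving_arrowProdEquivProdArrow (E d) ℝ (Fin n) (fun _ => P) (fun _ => ν)
  have hm : Measurable fun z : (Fin n → E d) × (Fin n → ℝ) => F fun i => (z.1 i, z.2 i) :=
    hF.comp (by fun_prop)
  have h1 := hmp.lintegral_map_equiv (fun z : (Fin n → E d) × (Fin n → ℝ) =>
    F fun i => (z.1 i, z.2 i))
  exact h1.symm.trans (lintegral_prod _ hm.aemeasurable)

/-- The two-point bound for regression functions that differ by at most `δ` on the cube. -/
theorem two_point_regression {d n : ℕ} {a b : ℝ} {p : E d → ℝ} (hp : IsCovariateDensity a b p)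
    {v : ℝ≥0} (hv : v ≠ 0) {f₁ f₂ : E d → ℝ} (hf₁ : Measurable f₁) (hf₂ : Measurable f₂) {δ : ℝ}
    (hδ : ∀ x ∈ cube d, (f₁ x - f₂ x) ^ 2 ≤ δ) {c : Data d n → ℝ} (hc : Measurable c) (g : ℝ) :
    ENNReal.ofReal (4 * g ^ 2 / (1 + Real.exp (n * δ / v))) ≤
      (∫⁻ ω, ENNReal.ofReal ((c (dataOf f₁ ω) - g) ^ 2)
        ∂(Measure.pi fun _ : Fin n => (covariateLaw p).prod (gaussianReal 0 v))) +
      ∫⁻ ω, ENNReal.ofReal ((c (dataOf f₂ ω) + g) ^ 2)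
        ∂(Measure.pi fun _ : Fin n => (covariateLaw p).prod (gaussianReal 0 v)) := by
  have := hp.isProbabilityMeasure
  have hm₁ : Measurable fun ω : Fin n → E d × ℝ => ENNReal.ofReal ((c (dataOf f₁ ω) - g) ^ 2) :=
    (((hc.comp (measurable_dataOf hf₁)).sub_const g).pow_const 2).ennreal_ofReal
  have hm₂ : Measurable fun ω : Fin n → E d × ℝ => ENNReal.ofReal ((c (dataOf f₂ ω) + g) ^ 2) :=
    (((hc.comp (measurable_dataOf hf₂)).add_const g).pow_const 2).ennreal_ofReal
  have hm : Measurable fun ω : Fin n → E d × ℝ => ENNReal.ofReal ((c (dataOf f₁ ω) - g) ^ 2) +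
      ENNReal.ofReal ((c (dataOf f₂ ω) + g) ^ 2) := hm₁.add hm₂
  rw [← lintegral_add_left hm₁, lintegral_arrowProd _ _ hm]
  have hcube : ∀ᵐ X : Fin n → E d ∂(Measure.pi fun _ => covariateLaw p), ∀ i, X i ∈ cube d := by
    rw [ae_all_iff]
    intro i
    exact (measurePreserving_eval (fun _ : Fin n =>
      covariateLaw p) i).quasiMeasurePreserving.ae (ae_covariateLaw_mem_cube p)
  calc ENNReal.ofReal (4 * g ^ 2 / (1 + Real.exp (n * δ / v)))
      = ∫⁻ _X : Fin n → E d, ENNReal.ofReal (4 * g ^ 2 / (1 + Real.exp (n * δ / v)))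
          ∂(Measure.pi fun _ => covariateLaw p) := by
        rw [lintegral_const, measure_univ, mul_one]
    _ ≤ _ := by
        -- Given the design, the responses form a Gaussian vector whose mean is the vector of values
        -- of the regression function.
        refine lintegral_mono_ae ?_
        filter_upwards [hcube] with X hX
        have hcX : Measurable fun y : Fin n → ℝ => c fun i => (X i, y i) := hc.comp (by fun_prop)
        have h := two_point_lower_bound hv hcX g (fun i => f₁ (X i)) (fun i => f₂ (X i))
        refine le_trans (ENNReal.ofReal_le_ofReal ?_) (h.trans (le_lintegral_add _ _))
        have hsum : ∑ i, (f₁ (X i) - f₂ (X i)) ^ 2 / (v : ℝ) ≤ n * δ / v := by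
          rw [← Finset.sum_div]
          gcongr
          calc _ ≤ ∑ _i : Fin n, δ := Finset.sum_le_sum fun i _ => hδ _ (hX i)
            _ = _ := by simp
        gcongr

/-- The sign of a Boolean. -/
def boolSign (β : Bool) : ℝ := if β then 1 else -1

theorem boolSign_not (β : Bool) : boolSign (!β) = -boolSign β := by
  cases β <;> simp [boolSign]

theorem boolSign_sq (β : Bool) : boolSign β ^ 2 = 1 := by
  cases β <;> simp [boolSign]

/-- The involution that flips the sign with index `j`. -/
def flipAt {ι : Type*} [DecidableEq ι] (j : ι) : Equiv.Perm (ι → Bool) :=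
  Function.Involutive.toPerm (fun τ => Function.update τ j (!(τ j))) fun τ => by simp

theorem flipAt_apply {ι : Type*} [DecidableEq ι] (j : ι) (τ : ι → Bool) :
    flipAt j τ = Function.update τ j (!(τ j)) := rfl

/-- Assouad's lemma for Gaussian regression. -/
theorem assouad_regression {d n : ℕ} {a b : ℝ} {p : E d → ℝ} (hp : IsCovariateDensity a b p)
    {v : ℝ≥0} (hv : v ≠ 0) {ι : Type*} [Fintype ι] [DecidableEq ι] {f : (ι → Bool) → E d → ℝ}
    (hf : ∀ τ, Measurable (f τ)) {δ : ℝ}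
    (hδ : ∀ τ j, ∀ x ∈ cube d, (f τ x - f (flipAt j τ) x) ^ 2 ≤ δ) {c : ι → Data d n → ℝ}
    (hc : ∀ j, Measurable (c j)) (g : ℝ) :
    ∃ τ, ENNReal.ofReal (Fintype.card ι * (2 * g ^ 2 / (1 + Real.exp (n * δ / v)))) ≤
      ∫⁻ ω, ∑ j, ENNReal.ofReal ((c j (dataOf (f τ) ω) - g * boolSign (τ j)) ^ 2)
        ∂(Measure.pi fun _ : Fin n => (covariateLaw p).prod (gaussianReal 0 v)) := by
  set μ := Measure.pi fun _ : Fin n => (covariateLaw p).prod (gaussianReal 0 v) with hμ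
  set A : (ι → Bool) → ι → ℝ≥0∞ := fun τ j =>
    ∫⁻ ω, ENNReal.ofReal ((c j (dataOf (f τ) ω) - g * boolSign (τ j)) ^ 2) ∂μ with hA
  set B : ℝ := 2 * g ^ 2 / (1 + Real.exp (n * δ / v)) with hB
  have hB0 : 0 ≤ B := by positivity
  have hpair : ∀ τ j, ENNReal.ofReal (2 * B) ≤ A τ j + A (flipAt j τ) j := by
    intro τ j
    have h := two_point_regression hp hv (hf τ) (hf (flipAt j τ)) (hδ τ j) (hc j)
      (g * boolSign (τ j))
    rw [mul_pow, boolSign_sq, mul_one, ← hμ] at h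
    have h2 : ∀ ω, (c j (dataOf (f (flipAt j τ)) ω) + g * boolSign (τ j)) ^ 2 =
        (c j (dataOf (f (flipAt j τ)) ω) - g * boolSign (flipAt j τ j)) ^ 2 := fun ω => by
      rw [flipAt_apply, Function.update_self, boolSign_not]; ring
    simp_rw [h2] at h
    refine le_trans (le_of_eq ?_) h
    congr 1
    rw [hB]; ring
  -- Flipping the j-th sign permutes the sign patterns, so the sum over τ of the paired errors is
  -- twice the sum of the errors. On average over τ every coordinate errs by B, and some τ does at
  -- least as badly as the average.
  have hsum : ∀ j, ∑ _τ : ι → Bool, ENNReal.ofReal B ≤ ∑ τ, A τ j := by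
    intro j
    have h1 : ∑ _τ : ι → Bool, ENNReal.ofReal (2 * B) ≤ ∑ τ, (A τ j + A (flipAt j τ) j) :=
      Finset.sum_le_sum fun τ _ => hpair τ j
    rw [Finset.sum_add_distrib, Equiv.sum_comp (flipAt j) (fun τ => A τ j), ← two_mul] at h1
    simp_rw [← two_mul_ofReal] at h1
    rw [← Finset.mul_sum] at h1
    exact (ENNReal.mul_le_mul_iff_right (by simp) (by simp)).1 h1
  have hswap : ∑ _τ : ι → Bool, ∑ _j : ι, ENNReal.ofReal B ≤ ∑ τ, ∑ j, A τ j := by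
    rw [Finset.sum_comm, Finset.sum_comm (f := A)]
    exact Finset.sum_le_sum fun j _ => hsum j
  obtain ⟨τ, hτ⟩ : ∃ τ, ∑ _j : ι, ENNReal.ofReal B ≤ ∑ j, A τ j := by
    by_contra! h
    exact (ENNReal.sum_lt_sum_of_nonempty Finset.univ_nonempty fun τ _ => h τ).not_ge hswap
  refine ⟨τ, ?_⟩
  rw [lintegral_finsetSum]
  · refine le_trans (le_of_eq ?_) hτ
    rw [Finset.sum_const, Finset.card_univ, nsmul_eq_mul, ENNReal.ofReal_mul (by positivity),
      ENNReal.ofReal_natCast]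
  · intro j _
    exact ((((hc j).comp (measurable_dataOf (hf τ))).sub_const _).pow_const 2).ennreal_ofReal

theorem norm_freq_le {d K : ℕ} (j : Fin d → Fin K) : ‖freq j‖ ≤ d * K := by
  have h1 : ∀ i, ‖freq j i‖ ^ 2 ≤ (K : ℝ) ^ 2 := fun i => by
    have h2 : ((j i : ℕ) : ℝ) + 1 ≤ K := by exact_mod_cast (j i).2
    rw [freq_apply, Real.norm_eq_abs, abs_of_nonneg (by positivity)]
    gcongr
  rw [EuclideanSpace.norm_eq]
  refine Real.sqrt_le_iff.2 ⟨by positivity, ?_⟩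
  calc ∑ i, ‖freq j i‖ ^ 2 ≤ ∑ _i : Fin d, (K : ℝ) ^ 2 := Finset.sum_le_sum fun i _ => h1 i
    _ = d * (K : ℝ) ^ 2 := by simp
    _ ≤ _ := by
        rw [mul_pow]
        gcongr
        exact_mod_cast Nat.le_self_pow two_ne_zero d

theorem one_le_norm_freq_sub {d K : ℕ} {j l : Fin d → Fin K} (h : j ≠ l) :
    1 ≤ ‖freq j - freq l‖ := by
  obtain ⟨i, hi⟩ := exists_ne_of_ne h
  refine le_trans ?_ (PiLp.norm_apply_le (freq j - freq l) i)
  rw [PiLp.sub_apply, freq_apply, freq_apply, Real.norm_eq_abs]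
  have h2 : ((j i : ℕ) : ℝ) + 1 - ((l i : ℕ) + 1) = ((((j i : ℕ) : ℤ) - (l i : ℕ) : ℤ) : ℝ) := by
    push_cast; ring
  rw [h2, ← Int.cast_abs]
  exact_mod_cast Int.one_le_abs hi

/-- The lower bound of the order `n^{-2s/(2s+d)}` for the risk with Gaussian noise. -/
theorem exists_estimation_le_advRisk {d : ℕ} (hd : 1 ≤ d) {s L a : ℝ} (hs : 0 < s) (hL : 0 < L)
    (ha : 0 < a) {v : ℝ≥0} (hv : v ≠ 0) : ∃ c : ℝ, 0 < c ∧ ∀ (n : ℕ) (r b : ℝ), 1 ≤ n → 0 ≤ r →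
      ∀ p, IsCovariateDensity a b p → ∀ fhat : Data d n → E d → ℝ,
        Measurable (Function.uncurry fhat) →
        ENNReal.ofReal (c * resol d n s ^ (-(2 * s))) ≤
          ⨆ f ∈ sobolevBall d s L, advRisk p (gaussianReal 0 v) r fhat f := by
  have hw := winVol_pos hd
  have hd0 : (1 : ℝ) ≤ d := by exact_mod_cast hd
  have hd1 : (0 : ℝ) < d := by linarith
  have hv0 : (0 : ℝ) < v := by exact_mod_cast pos_iff_ne_zero.2 hv
  set C₀ := (1 + (4 * Real.pi) ^ 2) ^ s * winVol d with hC₀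
  have hC : 0 < C₀ := by positivity
  set c₀ := L ^ 2 / (C₀ * (d : ℝ) ^ (2 * s)) with hc₀
  have hc₀0 : 0 < c₀ := by positivity
  set T := 1 + Real.exp (4 * c₀ * winVol d ^ 2 / v) with hT
  have hT0 : 0 < T := by positivity
  refine ⟨a * (winVol d ^ 2 / 8) * (2 * c₀ / T) * 2 ^ (-(2 * s)), by positivity,
    fun n r b hn hr p hp fhat hfhat => ?_⟩
  have := hp.isProbabilityMeasure
  set K := ⌈resol d n s⌉₊ with hK
  have hN1 := one_le_resol (d := d) hs hn
  have hK1 : 1 ≤ K := one_le_ceil_resol hs hn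
  have hK1' : (1 : ℝ) ≤ K := by exact_mod_cast hK1
  have hK0 : (0 : ℝ) < K := by linarith
  -- There are K^d waves of frequency at most dK, and this amplitude makes the bound for the squared
  -- norm equal to L².
  set γ : ℝ := Real.sqrt (c₀ * (K : ℝ) ^ (-(2 * s + d))) with hγ
  have hγ2 : γ ^ 2 = c₀ * (K : ℝ) ^ (-(2 * s + d)) := Real.sq_sqrt (by positivity)
  have hKsplit : (K : ℝ) ^ (-(2 * s + d)) = ((K : ℝ) ^ (2 * s))⁻¹ * ((K : ℝ) ^ d)⁻¹ := by
    rw [Real.rpow_neg hK0.le, Real.rpow_add hK0, Real.rpow_natCast, mul_inv]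
  set θ : ((Fin d → Fin K) → Bool) → (Fin d → Fin K) → ℝ := fun τ j => γ * boolSign (τ j) with hθ
  have hcard : Fintype.card (Fin d → Fin K) = K ^ d := by simp
  have hmem : ∀ τ, waves freq (θ τ) ∈ sobolevBall d s L := by
    intro τ
    refine mem_sobolevBall_of_sq_le hL.le ((cubeNorm_waves_le hd hs.le
      (fun j l h => one_le_norm_freq_sub h) (R := d * K) (by nlinarith)
      norm_freq_le _).trans (ENNReal.ofReal_le_ofReal (le_of_eq ?_)))
    have h1 : ∑ j, θ τ j ^ 2 = K ^ d * γ ^ 2 := by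
      simp_rw [hθ, mul_pow, boolSign_sq, mul_one]
      rw [Finset.sum_const, Finset.card_univ, hcard, nsmul_eq_mul]
      push_cast; ring
    rw [← hC₀, h1, hγ2, hKsplit, Real.mul_rpow hd1.le hK0.le, hc₀]
    have h2 : 0 < (K : ℝ) ^ (2 * s) := by positivity
    have h3 : 0 < (d : ℝ) ^ (2 * s) := by positivity
    field_simp
  have hδ : ∀ τ j, ∀ x ∈ cube d, (waves freq (θ τ) x - waves freq (θ (flipAt j τ)) x) ^ 2 ≤
      4 * γ ^ 2 * winVol d ^ 2 := by
    intro τ j x _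
    have h1 : waves freq (θ τ) x - waves freq (θ (flipAt j τ)) x =
        2 * γ * boolSign (τ j) * cosine j x * win d x := by
      rw [waves, waves, ← sub_mul, ← Finset.sum_sub_distrib, Finset.sum_eq_single j]
      · simp only [hθ, flipAt_apply, Function.update_self, boolSign_not, cosine]
        ring
      · intro l _ hl
        simp only [hθ, flipAt_apply, Function.update_of_ne hl]
        ring
      · simp
    have h2 : cosine j x ^ 2 ≤ 1 := by
      rw [← sq_abs]; exact pow_le_one₀ (abs_nonneg _) (abs_cosine_le j x)
    have h3 : win d x ^ 2 ≤ winVol d ^ 2 := by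
      rw [← sq_abs]; exact pow_le_pow_left₀ (abs_nonneg _) (abs_win_le d x) 2
    calc _ = 4 * γ ^ 2 * (cosine j x ^ 2 * win d x ^ 2) := by
          rw [h1, mul_pow, mul_pow, mul_pow, mul_pow, boolSign_sq]; ring
      _ ≤ 4 * γ ^ 2 * (1 * winVol d ^ 2) := by gcongr
      _ = _ := by ring
  obtain ⟨τ, hτ⟩ := assouad_regression hp hv (f := fun τ => waves freq (θ τ))
    (fun τ => (continuous_waves _ _).measurable) hδ
    (c := fun j D => windowCoeff (fhat D) j) (fun j => measurable_windowCoeff hfhat j) γ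
  refine le_trans ?_ (le_iSup₂ (f := fun f (_ : f ∈ sobolevBall d s L) =>
    advRisk p (gaussianReal 0 v) r fhat f) (waves freq (θ τ)) (hmem τ))
  have hrisk := lintegral_le_advRisk hp (ν := gaussianReal 0 v) (r := r) hfhat
    (continuous_waves freq (θ τ)).measurable (v := 0) (by simpa using hr)
  refine le_trans ?_ hrisk
  have hB : c₀ * 2 ^ (-(2 * s)) * resol d n s ^ (-(2 * s)) * (2 / T) ≤
      Fintype.card (Fin d → Fin K) *
        (2 * γ ^ 2 / (1 + Real.exp (n * (4 * γ ^ 2 * winVol d ^ 2) / v))) := by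
    -- With K ≥ N and N^{2s+d} = n, flipping one sign changes the mean vector by a bounded amount,
    -- so the likelihood ratios stay under control.
    have hnγ : n * γ ^ 2 ≤ c₀ := by
      have h1 : (n : ℝ) ≤ (K : ℝ) ^ (2 * s + d) := by
        rw [← resol_rpow_eq (d := d) (n := n) hs]
        exact Real.rpow_le_rpow (by linarith) (le_ceil_resol d n s) (by positivity)
      rw [hγ2, Real.rpow_neg hK0.le]
      have h2 : 0 < (K : ℝ) ^ (2 * s + d) := by positivity
      calc n * (c₀ * ((K : ℝ) ^ (2 * s + d))⁻¹) ≤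
            (K : ℝ) ^ (2 * s + d) * (c₀ * ((K : ℝ) ^ (2 * s + d))⁻¹) := by gcongr
        _ = c₀ := by field_simp
    have hexp : 1 + Real.exp (n * (4 * γ ^ 2 * winVol d ^ 2) / v) ≤ T := by
      rw [hT]
      gcongr 1 + Real.exp (?_ / _)
      calc n * (4 * γ ^ 2 * winVol d ^ 2) = 4 * (n * γ ^ 2) * winVol d ^ 2 := by ring
        _ ≤ _ := by gcongr
    have hKs : 2 ^ (-(2 * s)) * resol d n s ^ (-(2 * s)) ≤ ((K : ℝ) ^ (2 * s))⁻¹ := by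
      rw [← Real.mul_rpow (by norm_num) (by linarith), ← Real.rpow_neg hK0.le]
      exact Real.rpow_le_rpow_of_nonpos hK0 (ceil_resol_le hs hn) (by linarith)
    rw [hcard]
    calc _ = c₀ * (2 ^ (-(2 * s)) * resol d n s ^ (-(2 * s))) * (2 / T) := by ring
      _ ≤ c₀ * ((K : ℝ) ^ (2 * s))⁻¹ * (2 / T) := by gcongr
      _ = ((K ^ d : ℕ) : ℝ) * (2 * γ ^ 2 / T) := by
          rw [hγ2, hKsplit]
          push_cast
          field_simp
      _ ≤ _ := by gcongr
  calc ENNReal.ofReal (a * (winVol d ^ 2 / 8) * (2 * c₀ / T) * 2 ^ (-(2 * s)) *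
        resol d n s ^ (-(2 * s)))
      = ENNReal.ofReal (a * (winVol d ^ 2 / 8)) *
          ENNReal.ofReal (c₀ * 2 ^ (-(2 * s)) * resol d n s ^ (-(2 * s)) * (2 / T)) := by
        rw [← ENNReal.ofReal_mul (by positivity)]
        congr 1; ring
    _ ≤ ENNReal.ofReal (a * (winVol d ^ 2 / 8)) * ∫⁻ ω, ∑ j, ENNReal.ofReal
          ((windowCoeff (fhat (dataOf (waves freq (θ τ)) ω)) j - θ τ j) ^ 2)
          ∂(Measure.pi fun _ : Fin n => (covariateLaw p).prod (gaussianReal 0 v)) :=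
        mul_le_mul_right ((ENNReal.ofReal_le_ofReal hB).trans hτ) _
    _ ≤ _ := by
        rw [← lintegral_const_mul' _ _ ENNReal.ofReal_ne_top]
        refine lintegral_mono fun ω => ?_
        rw [ENNReal.ofReal_mul ha.le, mul_assoc, overlap_zero]
        refine mul_le_mul_right ?_ _
        simp only [add_zero]
        exact sum_windowCoeff_le hd (hfhat.comp measurable_prodMk_left) (θ τ)

/-! ### The minimax rate -/

theorem gaussianReal_mem_subGaussianLaws (σ : ℝ≥0) :
    gaussianReal 0 (σ ^ 2) ∈ subGaussianLaws σ := by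
  refine ⟨inferInstance, integral_id_gaussianReal, ⟨integrable_exp_mul_gaussianReal, fun t => ?_⟩⟩
  rw [mgf_fun_id_gaussianReal]
  simp

theorem minimaxRisk_mono {d n : ℕ} {s L r : ℝ} {p : E d → ℝ} {N₁ N₂ : Set (Measure ℝ)}
    (h : N₁ ⊆ N₂) : minimaxRisk n s L p N₁ r ≤ minimaxRisk n s L p N₂ r :=
  iInf₂_mono fun _ _ => biSup_mono fun _ hν => h hν

theorem rate_eq (d n : ℕ) (s r : ℝ) :
    rate d n s r = r ^ (2 * min 1 s) + resol d n s ^ (-(2 * s)) := by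
  rw [rate, resol_rpow, neg_div]

/-- The minimax risk with Gaussian noise is at least of the order of the rate. -/
theorem exists_le_minimaxRisk_gaussian {d : ℕ} (hd : 1 ≤ d) {s L a : ℝ} (hs : 0 < s) (hL : 0 < L)
    (ha : 0 < a) {v : ℝ≥0} (hv : v ≠ 0) : ∃ c : ℝ, 0 < c ∧ ∀ (b : ℝ) (p : E d → ℝ),
      IsCovariateDensity a b p → ∀ n : ℕ, 1 ≤ n → ∀ r : ℝ, 0 ≤ r → r ≤ 1 →
        ENNReal.ofReal (c * rate d n s r) ≤ minimaxRisk n s L p {gaussianReal 0 v} r := by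
  obtain ⟨c₁, hc₁, h₁⟩ := exists_perturbation_le_advRisk hd hs hL ha
  obtain ⟨c₂, hc₂, h₂⟩ := exists_estimation_le_advRisk hd hs hL ha hv
  refine ⟨min c₁ c₂ / 2, by positivity, fun b p hp n hn r hr0 hr1 => le_iInf₂ fun fhat hfhat => ?_⟩
  have h3 : worstRisk s L p {gaussianReal 0 v} r fhat =
      ⨆ f ∈ sobolevBall d s L, advRisk p (gaussianReal 0 v) r fhat f := by
    rw [worstRisk, iSup_singleton]
  rw [h3, rate_eq]
  have hx : 0 ≤ r ^ (2 * min 1 s) := by positivity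
  have hN : 0 ≤ resol d n s := by linarith [one_le_resol (d := d) hs hn]
  have hy : 0 ≤ resol d n s ^ (-(2 * s)) := by positivity
  have hA := h₁ r b hr0 hr1 p hp (gaussianReal 0 v) inferInstance n fhat hfhat
  have hB := h₂ n r b hn hr0 p hp fhat hfhat
  -- The larger of the two terms is at least half of their sum, so the two lower bounds need not
  -- hold for the same regression function.
  rcases le_total (r ^ (2 * min 1 s)) (resol d n s ^ (-(2 * s))) with h | h
  · refine le_trans (ENNReal.ofReal_le_ofReal ?_) hB
    calc _ ≤ min c₁ c₂ / 2 * (resol d n s ^ (-(2 * s)) + resol d n s ^ (-(2 * s))) := by gcongr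
      _ = min c₁ c₂ * resol d n s ^ (-(2 * s)) := by ring
      _ ≤ _ := mul_le_mul_of_nonneg_right (min_le_right _ _) hy
  · refine le_trans (ENNReal.ofReal_le_ofReal ?_) hA
    calc _ ≤ min c₁ c₂ / 2 * (r ^ (2 * min 1 s) + r ^ (2 * min 1 s)) := by gcongr
      _ = min c₁ c₂ * r ^ (2 * min 1 s) := by ring
      _ ≤ _ := mul_le_mul_of_nonneg_right (min_le_left _ _) hx

/-- Projected and truncated kernel ridge regression estimators exist and attain the rate. -/
theorem exists_isPTKRR_worstRisk_le {d : ℕ} (hd : 1 ≤ d) {s L a : ℝ} (b : ℝ) {κ₁ A : ℝ} (κ₂ : ℝ)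
    (hs : 0 < s) (hL : 0 < L) (ha : 0 < a) {σ : ℝ≥0} (hσ : 0 < σ) (hκ₁ : 0 < κ₁) (hA : 1 ≤ A) :
    ∃ C : ℝ, 0 < C ∧
      ∀ n : ℕ, 1 ≤ n → ∀ r : ℝ, 0 ≤ r → r ≤ 1 → ∀ lam : ℝ,
        κ₁ * (n : ℝ) ^ (-(2 * penaltyOrder d s / (2 * s + d))) ≤ lam →
        lam ≤ κ₂ * (n : ℝ) ^ (-(2 * penaltyOrder d s / (2 * s + d))) →
        (∃ fhat : Data d n → E d → ℝ,
          Measurable (Function.uncurry fhat) ∧ IsPTKRR s L r lam A fhat) ∧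
        ∀ fhat : Data d n → E d → ℝ,
          Measurable (Function.uncurry fhat) → IsPTKRR s L r lam A fhat →
          ∀ p : E d → ℝ, IsCovariateDensity a b p →
            worstRisk s L p (subGaussianLaws σ) r fhat ≤ ENNReal.ofReal (C * rate d n s r) := by
  obtain ⟨C, hC, h⟩ := exists_worstRisk_le (b := b) hd κ₂ hs hL ha hσ hκ₁ hA
  refine ⟨C, hC, fun n hn r hr0 hr1 lam h1 h2 => ⟨?_, fun fhat _ hfhat p hp => ?_⟩⟩
  · have hn0 : (0 : ℝ) < n := by exact_mod_cast hn
    exact exists_isPTKRR hd hs hL.le hr0 (lt_of_lt_of_le (by positivity) h1) hA n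
  · rw [← neg_div, ← resol_rpow] at h1 h2
    exact h n hn r hr0 hr1 lam h1 h2 fhat hfhat p hp

end AdvReg

end

/-! ### Conclusion: the minimax rate and its attainment -/

theorem theorem3p3 (d : ℕ) (hd : 1 ≤ d) (s L a b : ℝ) (hs : 0 < s) (hL : 0 < L) (ha : 0 < a)
    (σ : ℝ≥0) (hσ : 0 < σ) :
    -- the minimax risk is of the order of the rate, and the lower bound holds already for
    -- Gaussian noise of variance `σ²`
    (∃ c C : ℝ, 0 < c ∧ 0 < C ∧
      ∀ p : AdvReg.E d → ℝ, AdvReg.IsCovariateDensity a b p →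
      ∀ n : ℕ, 1 ≤ n → ∀ r : ℝ, 0 ≤ r → r ≤ 1 →
        ENNReal.ofReal (c * AdvReg.rate d n s r) ≤
          AdvReg.minimaxRisk n s L p (AdvReg.subGaussianLaws σ) r ∧
        AdvReg.minimaxRisk n s L p (AdvReg.subGaussianLaws σ) r ≤
          ENNReal.ofReal (C * AdvReg.rate d n s r) ∧
        ENNReal.ofReal (c * AdvReg.rate d n s r) ≤
          AdvReg.minimaxRisk n s L p {gaussianReal 0 (σ ^ 2)} r) ∧
    -- projected and truncated kernel ridge regression estimators exist and attain the rate
    (∀ κ₁ κ₂ A : ℝ, 0 < κ₁ → 1 ≤ A → ∃ C : ℝ, 0 < C ∧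
      ∀ n : ℕ, 1 ≤ n → ∀ r : ℝ, 0 ≤ r → r ≤ 1 → ∀ lam : ℝ,
        κ₁ * (n : ℝ) ^ (-(2 * AdvReg.penaltyOrder d s / (2 * s + d))) ≤ lam →
        lam ≤ κ₂ * (n : ℝ) ^ (-(2 * AdvReg.penaltyOrder d s / (2 * s + d))) →
        (∃ fhat : AdvReg.Data d n → AdvReg.E d → ℝ,
          Measurable (Function.uncurry fhat) ∧ AdvReg.IsPTKRR s L r lam A fhat) ∧
        ∀ fhat : AdvReg.Data d n → AdvReg.E d → ℝ,
          Measurable (Function.uncurry fhat) → AdvReg.IsPTKRR s L r lam A fhat →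
          ∀ p : AdvReg.E d → ℝ, AdvReg.IsCovariateDensity a b p →
            AdvReg.worstRisk s L p (AdvReg.subGaussianLaws σ) r fhat ≤
              ENNReal.ofReal (C * AdvReg.rate d n s r)) := by
  refine ⟨?_, fun κ₁ κ₂ A hκ₁ hA =>
    AdvReg.exists_isPTKRR_worstRisk_le hd b κ₂ hs hL ha hσ hκ₁ hA⟩
  obtain ⟨c, hc, hlow⟩ := AdvReg.exists_le_minimaxRisk_gaussian (v := σ ^ 2) hd hs hL ha
    (pow_ne_zero 2 hσ.ne')
  -- For the minimax upper bound one estimator suffices: lam exactly n^{-2t/(2s+d)} and an extension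
  -- of least norm.
  obtain ⟨C, hC, hup⟩ := AdvReg.exists_isPTKRR_worstRisk_le (κ₁ := 1) (A := 1) hd b 1 hs hL ha hσ
    one_pos le_rfl
  refine ⟨c, C, hc, hC, fun p hp n hn r hr0 hr1 => ?_⟩
  have hgauss := hlow b p hp n hn r hr0 hr1
  refine ⟨hgauss.trans (AdvReg.minimaxRisk_mono
    (singleton_subset_iff.2 (AdvReg.gaussianReal_mem_subGaussianLaws σ))), ?_, hgauss⟩
  obtain ⟨⟨fhat, hm, hfhat⟩, hle⟩ := hup n hn r hr0 hr1 _ (one_mul _).le (one_mul _).ge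
  exact (iInf₂_le fhat hm).trans (hle fhat hm hfhat p hp)
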